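/- **Conventions.** Let $d\ge 2$, let $w_n$ be the $n\times n$ anti-diagonal identity matrix, and $\xi(s)=\pi^{-s/2}\Gamma(s/2)\zeta(s)$. Vectors are row vectors. *Eisenstein series.* For $G=SL(d,\mathbb R)$, or for $G=SO(d,d,\mathbb R)=\{g\in SL(2d,\mathbb R): g\,w_{2d}\,g^t=w_{2d}\}$, every $g\in G$ has a unique Iwasawa decomposition $g=n\,\mathrm{diag}(a_1,a_2,\dots)\,k$ with all factors in $G$, $n$ unit upper triangular, $a_i>0$, $k$ orthogonal; write $a_i(g)$ for the $a_i$. For $\operatorname{Re}s$ large define $$E^{SL(d)}_{\beta_i;s}(g)=\sum_{\gamma\in (P_{\beta_i}\cap SL(d,\mathbb Z))\backslash SL(d,\mathbb Z)}\bigl(a_1\cdots a_{d-i}\bigr)(\gamma g)^{2s},\qquad E^{SO(d,d)}_{\alpha_1;s}(g)=\sum_{\gamma\in(P_{\alpha_1}\cap\Gamma)\backslash\Gamma}a_1(\gamma g)^{2s},$$ where $P_{\beta_i}\subset SL(d)$ is the block upper triangular subgroup with diagonal blocks of sizes $d-i,\,i$; $\Gamma=SO(d,d,\mathbb R)\cap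 SL(2d,\mathbb Z)$; and $P_{\alpha_1}\subset SO(d,d)$ is the block upper triangular subgroup with diagonal blocks of sizes $1,2d-2,1$. Let $\pi:Spin(d,d,\mathbb R)\to SO(d,d,\mathbb R)$ be the covering map. $E^{Spin(d,d)}_{\alpha_1;s}(g)$ is the sum of $a_1(\pi(\gamma g))^{2s}$ over $\gamma\in(\pi^{-1}(P_{\alpha_1})\cap \pi^{-1}(\Gamma))\backslash\pi^{-1}(\Gamma)$. Finally, for $\tau=\tau_1+i\tau_2\in\mathbb H$, $E_s(\tau)=\frac1{2\zeta(2s)}\sum_{(m,n)\in\mathbb Z^2\setminus 0}\frac{\tau_2^s}{|n\tau+m|^{2s}}$ for $\operatorname{Re}s$ large, continued meromorphically in $s$. *Modular integral.* For a real $d\times d$ matrix $X$ with positive definite symmetric part put $$\mathcal G(\tau,X)=\sum_{m,n}e^{-\pi\tau_2^{-1}(m+n\tau)X(m+n\bar\tau)^t},\qquad I(s,X)=\int_{SL(2,\mathbb Z)\backslash\mathbb H}E_s(\tau)\,\mathcal G(\tau,X)\,\frac{d\tau_1d\tau_2}{\tau_2^2},$$ the sum being over pairs of linearly independent $m,n\in\mathbb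 Z^d$. **Proposition.** Let $e\in GL(d,\mathbb R)$ with $\det e>0$, let $B$ be a real antisymmetric $d\times d$ matrix, $e'=(\det e)^{-1/d}e\in SL(d,\mathbb R)$, and $$h=\begin{pmatrix}I&Bw_d\\0&I\end{pmatrix}\begin{pmatrix}e&0\\0&w_d(e^t)^{-1}w_d\end{pmatrix}\in SO(d,d,\mathbb R).$$ Let $E^{D_d}_{\alpha_1;s}(h)$ denote $E^{SO(d,d)}_{\alpha_1;s}(h)$, or $E^{Spin(d,d)}_{\alpha_1;s}(h')$ for any $h'\in Spin(d,d,\mathbb R)$ with $\pi(h')=h$. Then there is $\sigma$ depending only on $d$ such that for $\operatorname{Re}s>\sigma$ the series $E_s(\tau)$, the three Eisenstein series below, the sum $\mathcal G$ and the integral $I$ converge absolutely, and $$I(s,ee^t+B)=\frac{2}{\det e}\,\xi(2s+d-2)\,E^{D_d}_{\alpha_1;s+\frac d2-1}(h)-2(\det e)^{\frac{2s-2}d}\,\xi(2s+d-2)\,E^{SL(d)}_{\beta_{d-1};s+\frac d2-1}(e')-2(\det e)^{-\frac{2s}d}\,\xi(2s-1)\,E^{SL(d)}_{\beta_1;s}(e').$$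 All the Eisenstein series, and $I(s,ee^t+B)$, continue meromorphically to $s\in\mathbb C$, and the identity holds as an identity of meromorphic functions on $\mathbb C$. Moreover, at every $s_0$ at which $E_s(\tau)$ is holomorphic in $s$ for all $\tau$, the integral defining $I(s_0,ee^t+B)$ converges absolutely and equals the limit of the right-hand side as $s\to s_0$. This includes $s_0=0$, where $E_0(\tau)=1$; for $d\ge4$ the functions $s\mapsto E^{D_d}_{\alpha_1;s}(h)$ and $s\mapsto E^{SL(d)}_{\beta_{d-1};s}(e')$ are holomorphic at $s=\frac d2-1$ and $$\frac{2}{\det e}\,\xi(d-2)\,E^{D_d}_{\alpha_1;\frac d2-1}(h)=\int_{SL(2,\mathbb Z)\backslash\mathbb H}\mathcal G(\tau,ee^t+B)\frac{d\tau_1d\tau_2}{\tau_2^2}+2(\det e)^{-\frac2d}\,\xi(d-2)\,E^{SL(d)}_{\beta_{d-1};\frac d2-1}(e')+2\,\xi(2).$$ -/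

import Mathlib

namespace ThetaLift

open Matrix MeasureTheory UpperHalfPlane CliffordAlgebra

/-! ### Iwasawa decomposition and maximal parabolic Eisenstein series -/

/-- The group `SL(N, ℝ)`. -/
abbrev SLR (N : ℕ) : Type := Matrix.SpecialLinearGroup (Fin N) ℝ

/-- The discrete subgroup `SL(N, ℤ)` of `SL(N, ℝ)`. -/
noncomputable def SLZ (N : ℕ) : Subgroup (SLR N) :=
  (Matrix.SpecialLinearGroup.map (Int.castRingHom ℝ)).range

/-- The subgroup of block upper triangular matrices in `SL(N, ℝ)`, where `b k` is the number of
the block to which the index `k` belongs. -/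
noncomputable def blockUpper (N : ℕ) (b : Fin N → ℕ) : Subgroup (SLR N) where
  carrier := {p | BlockTriangular (p : Matrix (Fin N) (Fin N) ℝ) b}
  one_mem' := by
    simpa using (blockTriangular_one : BlockTriangular (1 : Matrix (Fin N) (Fin N) ℝ) b)
  mul_mem' := by
    intro p q hp hq
    simpa using BlockTriangular.mul hp hq
  inv_mem' := by
    intro p hp
    have hdet : IsUnit (p : Matrix (Fin N) (Fin N) ℝ).det := by simp
    let := Matrix.invertibleOfIsUnitDet _ hdet
    have h := blockTriangular_inv_of_blockTriangular
      (M := (p : Matrix (Fin N) (Fin N) ℝ)) (b := b) hp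
    have h' : ((p⁻¹ : SLR N) : Matrix (Fin N) (Fin N) ℝ) = (p : Matrix (Fin N) (Fin N) ℝ)⁻¹ := by
      rw [Matrix.SpecialLinearGroup.coe_inv, Matrix.inv_def]
      simp
    show BlockTriangular ((p⁻¹ : SLR N) : Matrix (Fin N) (Fin N) ℝ) b
    rw [h']
    exact h

/-- `g = n * diag(a) * k` is an Iwasawa decomposition inside the group `G ⊆ SL(N, ℝ)`:
`n ∈ G` is unit upper triangular, `diag(a) ∈ G` has positive entries, and `k ∈ G` is orthogonal. -/
def IsIwasawa {N : ℕ} (G : Subgroup (SLR N)) (g : SLR N) (a : Fin N → ℝ) : Prop :=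
  ∃ n ∈ G, ∃ t ∈ G, ∃ k ∈ G,
    BlockTriangular (n : Matrix (Fin N) (Fin N) ℝ) id ∧
    (∀ i, (n : Matrix (Fin N) (Fin N) ℝ) i i = 1) ∧
    (∀ i, 0 < a i) ∧ (t : Matrix (Fin N) (Fin N) ℝ) = diagonal a ∧
    (k : Matrix (Fin N) (Fin N) ℝ) * (k : Matrix (Fin N) (Fin N) ℝ)ᵀ = 1 ∧
    g = n * t * k

/-- The diagonal of the `A`-factor in the (unique) Iwasawa decomposition of `g` in `G`. -/
noncomputable def iwasawaA {N : ℕ} (G : Subgroup (SLR N)) (g : SLR N) : Fin N → ℝ :=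
  Classical.epsilon (IsIwasawa G g)

/-- `exp (ω (H g))` for the weight `ω = ε₁ + ⋯ + ε_j`, that is the product `a₁ ⋯ a_j` of the first
`j` entries of the Iwasawa `A`-factor of `g`. -/
noncomputable def expWeight {N : ℕ} (G : Subgroup (SLR N)) (j : ℕ) (g : SLR N) : ℝ :=
  ∏ k : Fin N with k.val < j, iwasawaA G g k

section Series

variable {G : Type*} [Group G]

/-- The coset space `(P ∩ Γ) \ Γ`. -/
abbrev LeftCosets (Γ P : Subgroup G) : Type _ :=
  Quotient (QuotientGroup.rightRel (P.subgroupOf Γ))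

/-- The term of the Eisenstein series indexed by a coset in `(P ∩ Γ) \ Γ`. It is evaluated on a
representative; the functions `χ` used below are left invariant under `P ∩ Γ`. -/
noncomputable def eisTerm (Γ P : Subgroup G) (χ : G → ℝ) (s : ℂ) (g : G)
    (q : LeftCosets Γ P) : ℂ :=
  ((χ ((q.out : Γ) * g) : ℝ) : ℂ) ^ (2 * s)

end Series

/-! ### The series for `SL(d)` -/

/-- The parabolic `P_{β_i}` of `SL(d)`: block upper triangular with diagonal blocks of sizes
`d - i` and `i`. It is the stabilizer of the span of the last `i` coordinate row vectors. -/
noncomputable def parabolicSL (d i : ℕ) : Subgroup (SLR d) :=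
  blockUpper d fun k => if k.val < d - i then 0 else 1

/-- Terms of the Eisenstein series of `SL(d)` for the node `β_i`; the fundamental weight of the
node, with the above parabolic, is `ε₁ + ⋯ + ε_{d-i}`. -/
noncomputable def eisSLTerm (d i : ℕ) (s : ℂ) (g : SLR d) :
    LeftCosets (SLZ d) (parabolicSL d i) → ℂ :=
  eisTerm (SLZ d) (parabolicSL d i) (expWeight ⊤ (d - i)) s g

/-- The series defining `E^{SL(d)}_{β_i;s}(g)` for `Re s` large. -/
noncomputable def eisSLSeries (d i : ℕ) (s : ℂ) (g : SLR d) : ℂ :=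
  ∑' q, eisSLTerm d i s g q

/-! ### The series for `SO(d,d)` -/

/-- The anti-diagonal identity matrix. -/
def antidiag (n : ℕ) : Matrix (Fin n) (Fin n) ℝ := fun i j => if j = i.rev then 1 else 0

lemma antidiag_mul_self (n : ℕ) : antidiag n * antidiag n = 1 := by
  ext i j
  simp only [antidiag, Matrix.mul_apply, ite_mul, one_mul, zero_mul, Matrix.one_apply]
  rw [Finset.sum_ite_eq']
  simp [eq_comm]

lemma antidiag_transpose (n : ℕ) : (antidiag n)ᵀ = antidiag n := by
  ext i j
  simp only [antidiag, Matrix.transpose_apply]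
  congr 1
  rw [eq_iff_iff]
  constructor <;> rintro rfl <;> simp

/-- `SO(d,d,ℝ) = {g ∈ SL(2d,ℝ) : g w gᵗ = w}`, with `w` the anti-diagonal identity matrix. -/
noncomputable def SODD (d : ℕ) : Subgroup (SLR (d + d)) where
  carrier := {g | (g : Matrix (Fin (d + d)) (Fin (d + d)) ℝ) * antidiag (d + d) *
    (g : Matrix (Fin (d + d)) (Fin (d + d)) ℝ)ᵀ = antidiag (d + d)}
  one_mem' := by simp
  mul_mem' := by
    intro p q hp hq
    simp only [Set.mem_ofPred_eq, Matrix.SpecialLinearGroup.coe_mul, Matrix.transpose_mul] at *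
    calc _ = (p : Matrix (Fin (d + d)) (Fin (d + d)) ℝ) *
        ((q : Matrix (Fin (d + d)) (Fin (d + d)) ℝ) * antidiag (d + d) *
        (q : Matrix (Fin (d + d)) (Fin (d + d)) ℝ)ᵀ) *
        (p : Matrix (Fin (d + d)) (Fin (d + d)) ℝ)ᵀ := by simp only [Matrix.mul_assoc]
      _ = _ := by rw [hq, hp]
  inv_mem' := by
    intro p hp
    simp only [Set.mem_ofPred_eq] at *
    have h1 : ((p⁻¹ : SLR (d + d)) : Matrix (Fin (d + d)) (Fin (d + d)) ℝ) *
        (p : Matrix (Fin (d + d)) (Fin (d + d)) ℝ) = 1 := by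
      rw [← Matrix.SpecialLinearGroup.coe_mul]; simp
    have h2 : (p : Matrix (Fin (d + d)) (Fin (d + d)) ℝ)ᵀ *
        ((p⁻¹ : SLR (d + d)) : Matrix (Fin (d + d)) (Fin (d + d)) ℝ)ᵀ = 1 := by
      rw [← Matrix.transpose_mul, h1, Matrix.transpose_one]
    generalize ((p⁻¹ : SLR (d + d)) : Matrix (Fin (d + d)) (Fin (d + d)) ℝ) = r at *
    generalize (p : Matrix (Fin (d + d)) (Fin (d + d)) ℝ) = m at *
    calc r * antidiag (d + d) * rᵀ = r * (m * antidiag (d + d) * mᵀ) * rᵀ := by rw [hp]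
      _ = (r * m) * antidiag (d + d) * (mᵀ * rᵀ) := by simp only [Matrix.mul_assoc]
      _ = _ := by rw [h1, h2]; simp

/-- `SO(d,d,ℤ) = SO(d,d,ℝ) ∩ SL(2d,ℤ)`. -/
noncomputable def SODDZ (d : ℕ) : Subgroup (SODD d) := (SLZ (d + d)).subgroupOf (SODD d)

/-- The parabolic `P_{α₁}` of `SO(d,d)`: block upper triangular with diagonal blocks of sizes
`1`, `2d - 2`, `1`. -/
noncomputable def parabolicSO (d : ℕ) : Subgroup (SODD d) :=
  (blockUpper (d + d) fun k =>
    if k.val = 0 then 0 else if k.val + 1 = d + d then 2 else 1).subgroupOf (SODD d)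

/-- `exp (ω₁ (H g))` on `SO(d,d,ℝ)`, with `ω₁ = ε₁` the fundamental weight of the vector node. -/
noncomputable def expWeightSO (d : ℕ) (g : SODD d) : ℝ := expWeight (SODD d) 1 (g : SLR (d + d))

/-- Terms of the Eisenstein series of `SO(d,d)` for the vector node `α₁`. -/
noncomputable def eisSOTerm (d : ℕ) (s : ℂ) (g : SODD d) :
    LeftCosets (SODDZ d) (parabolicSO d) → ℂ :=
  eisTerm (SODDZ d) (parabolicSO d) (expWeightSO d) s g

/-- The series defining `E^{SO(d,d)}_{α₁;s}(g)` for `Re s` large. -/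
noncomputable def eisSOSeries (d : ℕ) (s : ℂ) (g : SODD d) : ℂ :=
  ∑' q, eisSOTerm d s g q

/-! ### The series for `Spin(d,d)` -/

/-- The split quadratic form `v ↦ v w vᵗ` on `ℝ^{2d}`. -/
noncomputable def splitForm (d : ℕ) : QuadraticForm ℝ (Fin (d + d) → ℝ) :=
  (antidiag (d + d)).toQuadraticForm'

/-- The group `Spin(d,d,ℝ)`. -/
abbrev SpinDD (d : ℕ) : Type := spinGroup (splitForm d)

lemma splitForm_apply (d : ℕ) (v : Fin (d + d) → ℝ) :
    splitForm d v = v ⬝ᵥ (antidiag (d + d) *ᵥ v) := by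
  simp [splitForm, Matrix.toQuadraticForm', Matrix.toLinearMap₂'_apply']

lemma polar_splitForm (d : ℕ) (v u : Fin (d + d) → ℝ) :
    QuadraticMap.polar (splitForm d) v u = 2 * (v ⬝ᵥ (antidiag (d + d) *ᵥ u)) := by
  have h : u ⬝ᵥ (antidiag (d + d) *ᵥ v) = v ⬝ᵥ (antidiag (d + d) *ᵥ u) := by
    rw [Matrix.dotProduct_mulVec, ← Matrix.mulVec_transpose, antidiag_transpose, dotProduct_comm]
  simp only [QuadraticMap.polar, splitForm_apply, Matrix.mulVec_add, dotProduct_add,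
    add_dotProduct, h]
  ring

lemma iota_injective (d : ℕ) : Function.Injective (ι (splitForm d)) := by
  intro v u h
  have hs : ∀ z, antidiag (d + d) *ᵥ z = 0 → z = 0 := by
    intro z hz
    have := congrArg (fun y => antidiag (d + d) *ᵥ y) hz
    simpa [Matrix.mulVec_mulVec, antidiag_mul_self] using this
  rw [← sub_eq_zero]
  apply hs
  ext i
  have h0 : ι (splitForm d) (v - u) = 0 := by rw [map_sub, h, sub_self]
  have h1 := ι_mul_ι_add_swap (Q := splitForm d) (Pi.single i 1) (v - u)
  rw [h0, mul_zero, zero_mul, add_zero] at h1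
  have h2 := (map_eq_zero_iff (algebraMap ℝ (CliffordAlgebra (splitForm d)))
    (FaithfulSMul.algebraMap_injective _ _)).1 h1.symm
  rw [polar_splitForm] at h2
  simpa using h2

/-- The matrix `m` describes the conjugation action of the Clifford element `x` on vectors:
`x v x⁻¹ = m v`. -/
def Covers (d : ℕ) (x : CliffordAlgebra (splitForm d))
    (m : Matrix (Fin (d + d)) (Fin (d + d)) ℝ) : Prop :=
  ∀ v, x * ι (splitForm d) v = ι (splitForm d) (m *ᵥ v) * x

lemma Covers.mul {d : ℕ} {x y : CliffordAlgebra (splitForm d)}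
    {m n : Matrix (Fin (d + d)) (Fin (d + d)) ℝ} (hx : Covers d x m) (hy : Covers d y n) :
    Covers d (x * y) (m * n) := by
  intro v
  rw [mul_assoc, hy, ← mul_assoc, hx, mul_assoc, Matrix.mulVec_mulVec]

lemma Covers.unique {d : ℕ} {x : CliffordAlgebra (splitForm d)} (hu : IsUnit x)
    {m n : Matrix (Fin (d + d)) (Fin (d + d)) ℝ} (hm : Covers d x m) (hn : Covers d x n) :
    m = n := by
  refine Matrix.toLin'.injective (LinearMap.ext fun v => ?_)
  apply iota_injective d
  simp only [Matrix.toLin'_apply]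
  exact hu.mul_left_injective ((hm v).symm.trans (hn v))

lemma covers_vector (d : ℕ) (x : (CliffordAlgebra (splitForm d))ˣ) (a : Fin (d + d) → ℝ)
    (ha : ι (splitForm d) a = x) : ∃ m, Covers d x m ∧ m.det = -1 := by
  set w := antidiag (d + d) with hw
  have hq : splitForm d a ≠ 0 := by
    intro h
    have h1 := ι_sq_scalar (splitForm d) a
    rw [h, map_zero, ha] at h1
    exact (x * x).ne_zero ((Units.val_mul x x).trans h1)
  set c : ℝ := 2 / splitForm d a with hc
  refine ⟨-(1 + Matrix.replicateCol Unit a * Matrix.replicateRow Unit (-(c • (w *ᵥ a)))), ?_, ?_⟩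
  · intro v
    have hv : (-(1 + Matrix.replicateCol Unit a *
        Matrix.replicateRow Unit (-(c • (w *ᵥ a))))) *ᵥ v = (c * (a ⬝ᵥ (w *ᵥ v))) • a - v := by
      have h3 : a ⬝ᵥ (w *ᵥ v) = (w *ᵥ a) ⬝ᵥ v := by
        rw [Matrix.dotProduct_mulVec, ← Matrix.mulVec_transpose, hw, antidiag_transpose]
      rw [Matrix.neg_mulVec, Matrix.add_mulVec, Matrix.one_mulVec, ← Matrix.mulVec_mulVec, h3]
      have h6 : Matrix.replicateCol Unit a *ᵥ
          (Matrix.replicateRow Unit (-(c • (w *ᵥ a))) *ᵥ v) = -((c * ((w *ᵥ a) ⬝ᵥ v)) • a) := by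
        have h7 : Matrix.replicateRow Unit (-(c • (w *ᵥ a))) *ᵥ v =
            fun _ => -(c * ((w *ᵥ a) ⬝ᵥ v)) := by
          ext u
          show (-(c • (w *ᵥ a))) ⬝ᵥ v = _
          rw [neg_dotProduct, smul_dotProduct, smul_eq_mul]
        rw [h7]
        ext i
        simp [Matrix.mulVec, dotProduct, mul_comm]
      rw [h6]
      abel
    rw [hv, ← ha, map_sub, map_smul, sub_mul, smul_mul_assoc, ι_sq_scalar]
    have h1 := ι_mul_ι_add_swap (Q := splitForm d) a v
    rw [polar_splitForm, ← hw] at h1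
    rw [eq_sub_iff_add_eq, h1, Algebra.smul_def, ← map_mul]
    congr 1
    rw [hc]
    field_simp
  · rw [Matrix.det_neg, Matrix.det_one_add_replicateCol_mul_replicateRow]
    have h4 : (w *ᵥ a) ⬝ᵥ a = splitForm d a := by rw [splitForm_apply, dotProduct_comm]
    have h5 : Even (Fintype.card (Fin (d + d))) := by simp
    rw [h5.neg_one_pow, neg_dotProduct, smul_dotProduct, h4, hc, smul_eq_mul,
      div_mul_cancel₀ _ hq]
    norm_num

lemma covers_lipschitz (d : ℕ) (x : (CliffordAlgebra (splitForm d))ˣ)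
    (hx : x ∈ lipschitzGroup (splitForm d)) :
    ∃ m, Covers d x m ∧
      ((m.det = 1 ∧ (x : CliffordAlgebra (splitForm d)) ∈ evenOdd (splitForm d) 0) ∨
       (m.det = -1 ∧ (x : CliffordAlgebra (splitForm d)) ∈ evenOdd (splitForm d) 1)) := by
  unfold lipschitzGroup at hx
  induction hx using Subgroup.closure_induction'' with
  | mem x hx =>
    obtain ⟨a, ha⟩ := hx
    obtain ⟨m, h1, h2⟩ := covers_vector d x a ha
    exact ⟨m, h1, Or.inr ⟨h2, ha ▸ ι_mem_evenOdd_one _ a⟩⟩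
  | inv_mem x hx =>
    obtain ⟨a, ha⟩ := hx
    obtain ⟨b, hb⟩ : ∃ b, ι (splitForm d) b = (x⁻¹ : (CliffordAlgebra (splitForm d))ˣ) := by
      have hq : splitForm d a ≠ 0 := by
        intro h
        have h1 := ι_sq_scalar (splitForm d) a
        rw [h, map_zero, ha] at h1
        exact (x * x).ne_zero ((Units.val_mul x x).trans h1)
      refine ⟨(splitForm d a)⁻¹ • a, ?_⟩
      have h3 : ι (splitForm d) ((splitForm d a)⁻¹ • a) *
          (x : CliffordAlgebra (splitForm d)) = 1 := by
        rw [← ha, map_smul, smul_mul_assoc, ι_sq_scalar, Algebra.smul_def, ← map_mul,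
          inv_mul_cancel₀ hq, map_one]
      exact (Units.inv_eq_of_mul_eq_one_left h3).symm
    obtain ⟨m, h1, h2⟩ := covers_vector d x⁻¹ b hb
    exact ⟨m, h1, Or.inr ⟨h2, hb ▸ ι_mem_evenOdd_one _ b⟩⟩
  | one =>
    exact ⟨1, fun v => by simp, Or.inl ⟨by simp, by
      simpa using SetLike.GradedOne.one_mem (A := evenOdd (splitForm d))⟩⟩
  | mul y z _ _ hy hz =>
    obtain ⟨m, hm, hm'⟩ := hy
    obtain ⟨n, hn, hn'⟩ := hz
    refine ⟨m * n, by simpa using hm.mul hn, ?_⟩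
    rw [Matrix.det_mul, Units.val_mul]
    rcases hm' with ⟨h1, h2⟩ | ⟨h1, h2⟩ <;> rcases hn' with ⟨h3, h4⟩ | ⟨h3, h4⟩
    · exact Or.inl ⟨by rw [h1, h3]; norm_num, by simpa using SetLike.mul_mem_graded h2 h4⟩
    · exact Or.inr ⟨by rw [h1, h3]; norm_num, by simpa using SetLike.mul_mem_graded h2 h4⟩
    · exact Or.inr ⟨by rw [h1, h3]; norm_num, by simpa using SetLike.mul_mem_graded h2 h4⟩
    · exact Or.inl ⟨by rw [h1, h3]; norm_num, by
        have := SetLike.mul_mem_graded h2 h4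
        rwa [show (1 : ZMod 2) + 1 = 0 from rfl] at this⟩

lemma isUnit_spin (d : ℕ) (x : SpinDD d) : IsUnit (x : CliffordAlgebra (splitForm d)) :=
  ⟨spinGroup.toUnits x, rfl⟩

lemma exists_cover (d : ℕ) (x : SpinDD d) :
    ∃ g : SLR (d + d), g ∈ SODD d ∧ Covers d x (g : Matrix (Fin (d + d)) (Fin (d + d)) ℝ) := by
  obtain ⟨m, hm, h⟩ := covers_lipschitz d (spinGroup.toUnits x)
    (spinGroup.units_mem_lipschitzGroup (x := spinGroup.toUnits x) x.2)
  change Covers d (x : CliffordAlgebra (splitForm d)) m at hm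
  have hdet : m.det = 1 := by
    rcases h with h | ⟨_, h⟩
    · exact h.1
    · exfalso
      have h0 : (x : CliffordAlgebra (splitForm d)) ∈ evenOdd (splitForm d) 0 :=
        spinGroup.mem_even x.2
      have h1 := (Submodule.disjoint_def.1 (evenOdd_isCompl (splitForm d)).disjoint) _ h0 h
      exact (isUnit_spin d x).ne_zero h1
  have hQ : ∀ v, splitForm d (m *ᵥ v) = splitForm d v := by
    intro v
    apply FaithfulSMul.algebraMap_injective ℝ (CliffordAlgebra (splitForm d))
    apply (isUnit_spin d x).mul_left_injective
    show algebraMap _ _ (splitForm d (m *ᵥ v)) * (x : CliffordAlgebra (splitForm d)) =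
      algebraMap _ _ (splitForm d v) * (x : CliffordAlgebra (splitForm d))
    rw [← ι_sq_scalar, ← ι_sq_scalar, mul_assoc, ← hm, ← mul_assoc, ← hm, mul_assoc, ι_sq_scalar,
      Algebra.commutes]
  have hP : mᵀ * antidiag (d + d) * m = antidiag (d + d) := by
    ext i j
    have h1 : QuadraticMap.polar (splitForm d) (m *ᵥ Pi.single i 1) (m *ᵥ Pi.single j 1) =
        QuadraticMap.polar (splitForm d) (Pi.single i 1) (Pi.single j 1) := by
      simp only [QuadraticMap.polar, ← Matrix.mulVec_add, hQ]
    rw [polar_splitForm, polar_splitForm] at h1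
    have h2 := mul_left_cancel₀ two_ne_zero h1
    have h3 : ∀ A : Matrix (Fin (d + d)) (Fin (d + d)) ℝ,
        A i j = Pi.single i 1 ⬝ᵥ (A *ᵥ Pi.single j 1) := by
      intro A; simp
    rw [h3 (mᵀ * antidiag (d + d) * m), h3 (antidiag (d + d)), ← h2, ← Matrix.mulVec_mulVec, ← Matrix.mulVec_mulVec,
      Matrix.dotProduct_mulVec _ mᵀ, Matrix.vecMul_transpose]
  refine ⟨⟨m, hdet⟩, ?_, hm⟩
  show m * antidiag (d + d) * mᵀ = antidiag (d + d)
  set w := antidiag (d + d) with hw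
  have hww : w * w = 1 := antidiag_mul_self _
  have h1 : (w * mᵀ * w) * m = 1 := by
    calc (w * mᵀ * w) * m = w * (mᵀ * w * m) := by simp only [Matrix.mul_assoc]
      _ = 1 := by rw [hP, hww]
  have h2 : m * (w * mᵀ * w) = 1 := mul_eq_one_comm.1 h1
  calc m * w * mᵀ = m * w * mᵀ * (w * w) := by rw [hww, Matrix.mul_one]
    _ = (m * (w * mᵀ * w)) * w := by simp only [Matrix.mul_assoc]
    _ = w := by rw [h2, Matrix.one_mul]

/-- The covering homomorphism `Spin(d,d,ℝ) → SO(d,d,ℝ)`, given by the conjugation action on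
vectors (see `spinCover_spec`). -/
noncomputable def spinCover (d : ℕ) : SpinDD d →* SODD d where
  toFun x := ⟨(exists_cover d x).choose, (exists_cover d x).choose_spec.1⟩
  map_one' := by
    apply Subtype.ext
    apply Subtype.ext
    refine Covers.unique (isUnit_spin d 1) (exists_cover d 1).choose_spec.2 ?_
    intro v
    simp
  map_mul' x y := by
    apply Subtype.ext
    apply Subtype.ext
    refine Covers.unique (isUnit_spin d (x * y)) (exists_cover d (x * y)).choose_spec.2 ?_
    simpa using (exists_cover d x).choose_spec.2.mul (exists_cover d y).choose_spec.2

lemma spinCover_spec (d : ℕ) (x : SpinDD d) (v : Fin (d + d) → ℝ) :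
    (x : CliffordAlgebra (splitForm d)) * ι (splitForm d) v =
      ι (splitForm d) ((((spinCover d x : SODD d) : SLR (d + d)) :
        Matrix (Fin (d + d)) (Fin (d + d)) ℝ) *ᵥ v) * x :=
  (exists_cover d x).choose_spec.2 v

/-- `Spin(d,d,ℤ)`, the preimage of `SO(d,d,ℤ)` under the covering map. -/
noncomputable def SpinDDZ (d : ℕ) : Subgroup (SpinDD d) := (SODDZ d).comap (spinCover d)

/-- The parabolic `P_{α₁}` of `Spin(d,d)`. -/
noncomputable def parabolicSpin (d : ℕ) : Subgroup (SpinDD d) :=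
  (parabolicSO d).comap (spinCover d)

/-- Terms of the Eisenstein series of `Spin(d,d)` for the vector node `α₁`. The weight `ω₁` and
the function `H` factor through the covering map. -/
noncomputable def eisSpinTerm (d : ℕ) (s : ℂ) (g : SpinDD d) :
    LeftCosets (SpinDDZ d) (parabolicSpin d) → ℂ :=
  eisTerm (SpinDDZ d) (parabolicSpin d) (fun x => expWeightSO d (spinCover d x)) s g

/-- The series defining `E^{Spin(d,d)}_{α₁;s}(g)` for `Re s` large. -/
noncomputable def eisSpinSeries (d : ℕ) (s : ℂ) (g : SpinDD d) : ℂ :=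
  ∑' q, eisSpinTerm d s g q

/-! ### Meromorphic continuation -/

/-- `f`, which matters only for `Re s` large, has a meromorphic continuation to `ℂ`. -/
def HasMeroCont (f : ℂ → ℂ) : Prop :=
  ∃ F : ℂ → ℂ, MeromorphicNFOn F Set.univ ∧ ∃ σ : ℝ, ∀ s : ℂ, σ < s.re → F s = f s

open Classical in
/-- The meromorphic continuation of `f` to `ℂ` from a right half plane. Normal form makes it
unique: removable singularities are removed, and the value at a pole is `0`. -/
noncomputable def meroCont (f : ℂ → ℂ) : ℂ → ℂ :=
  if h : HasMeroCont f then h.choose else f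

/-! ### The modular integral -/

/-- Terms of the lattice sum defining the nonholomorphic Eisenstein series of `SL(2)`. -/
noncomputable def eisSL2Term (s : ℂ) (τ : ℍ) (p : {p : ℤ × ℤ // p ≠ 0}) : ℂ :=
  (τ.im : ℂ) ^ s / ((‖(p.1.2 : ℂ) * (τ : ℂ) + (p.1.1 : ℂ)‖ : ℝ) : ℂ) ^ (2 * s)

/-- `E_s(τ) = (2 ζ(2s))⁻¹ ∑_{(m,n) ≠ 0} τ₂^s / |nτ + m|^{2s}`, for `Re s` large. -/
noncomputable def eisSL2Series (s : ℂ) (τ : ℍ) : ℂ :=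
  (2 * riemannZeta (2 * s))⁻¹ * ∑' p, eisSL2Term s τ p

/-- The Eisenstein series `E_s(τ)` of `SL(2)`, meromorphically continued in `s`. -/
noncomputable def eisSL2 (s : ℂ) (τ : ℍ) : ℂ := meroCont (fun z => eisSL2Series z τ) s

/-- The integral `2 × d` matrices of rank `2`; the rows of `M` are `m = M 0` and `n = M 1`. -/
abbrev RankTwo (d : ℕ) : Type :=
  {M : Matrix (Fin 2) (Fin d) ℤ // (M.map (Int.cast : ℤ → ℚ)).rank = 2}

/-- `exp(-π τ₂⁻¹ (m + nτ) X (m + n τ̄)ᵗ)`. -/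
noncomputable def latticeTerm {d : ℕ} (X : Matrix (Fin d) (Fin d) ℝ) (τ : ℍ) (M : RankTwo d) : ℂ :=
  Complex.exp (-(Real.pi : ℂ) * (τ.im : ℂ)⁻¹ *
    ((fun i => (M.1 0 i : ℂ) + (M.1 1 i : ℂ) * (τ : ℂ)) ⬝ᵥ
      (X.map (Complex.ofReal) *ᵥ
        fun i => (M.1 0 i : ℂ) + (M.1 1 i : ℂ) * (starRingEnd ℂ) (τ : ℂ))))

/-- The rank-two lattice sum `𝒢(τ, X)`. -/
noncomputable def latticeSum {d : ℕ} (X : Matrix (Fin d) (Fin d) ℝ) (τ : ℍ) : ℂ :=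
  ∑' M : RankTwo d, latticeTerm X τ M

/-- `∫_{SL(2,ℤ)\ℍ} E(τ) 𝒢(τ, X) dτ₁ dτ₂ / τ₂²`, as an integral over the standard fundamental domain;
the volume on `ℍ` is the invariant measure. -/
noncomputable def modularIntegral {d : ℕ} (E : ℍ → ℂ) (X : Matrix (Fin d) (Fin d) ℝ) : ℂ :=
  ∫ τ in ModularGroup.fd, E τ * latticeSum X τ

/-! ### The group elements `e'` and `h`, and the right hand side -/

/-- The unimodular matrix `e' = (det e)^{-1/d} e`. -/
noncomputable def unimodular {d : ℕ} (e : Matrix (Fin d) (Fin d) ℝ) (he : 0 < e.det) : SLR d :=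
  ⟨(e.det ^ (-(1 / (d : ℝ)))) • e, by
    rw [Matrix.det_smul, Fintype.card_fin]
    rcases Nat.eq_zero_or_pos d with rfl | hd
    · simp
    · have hd' : (d : ℝ) ≠ 0 := by positivity
      rw [← Real.rpow_natCast, ← Real.rpow_mul he.le]
      rw [show -(1 / (d : ℝ)) * (d : ℝ) = -1 by field_simp]
      rw [Real.rpow_neg_one, inv_mul_cancel₀ he.ne']⟩

/-- The matrix `[I, B w; 0, I] [e, 0; 0, ẽ]` with `ẽ = w (eᵗ)⁻¹ w`. -/
noncomputable def hMatrix {d : ℕ} (e B : Matrix (Fin d) (Fin d) ℝ) :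
    Matrix (Fin (d + d)) (Fin (d + d)) ℝ :=
  Matrix.reindex finSumFinEquiv finSumFinEquiv
    (Matrix.fromBlocks 1 (B * antidiag d) 0 1 *
      Matrix.fromBlocks e 0 0 (antidiag d * (eᵀ)⁻¹ * antidiag d))

lemma antidiag_add (d : ℕ) : antidiag (d + d) = Matrix.reindex finSumFinEquiv finSumFinEquiv
    (Matrix.fromBlocks 0 (antidiag d) (antidiag d) 0) := by
  rw [← Equiv.symm_apply_eq]
  ext i j
  rcases i with i | i <;> rcases j with j | j <;>
    simp only [antidiag, Matrix.reindex_symm, Matrix.reindex_apply, Equiv.symm_symm,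
      Matrix.submatrix_apply, finSumFinEquiv_apply_left, finSumFinEquiv_apply_right,
      Matrix.fromBlocks_apply₁₁, Matrix.fromBlocks_apply₁₂, Matrix.fromBlocks_apply₂₁,
      Matrix.fromBlocks_apply₂₂, Matrix.zero_apply, Fin.ext_iff, Fin.val_rev, Fin.val_castAdd,
      Fin.val_natAdd, ite_eq_right_iff, one_ne_zero, imp_false]
  · omega
  · congr 1
    rw [eq_iff_iff]
    omega
  · congr 1
    rw [eq_iff_iff]
    omega
  · omega

lemma hMatrix_det {d : ℕ} (e B : Matrix (Fin d) (Fin d) ℝ) (he : 0 < e.det) :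
    (hMatrix e B).det = 1 := by
  have hw : (antidiag d).det * (antidiag d).det = 1 := by
    rw [← Matrix.det_mul, antidiag_mul_self, Matrix.det_one]
  rw [hMatrix, Matrix.det_reindex_self, Matrix.det_mul, Matrix.det_fromBlocks_zero₂₁,
    Matrix.det_fromBlocks_zero₂₁, Matrix.det_mul, Matrix.det_mul, Matrix.det_nonsing_inv,
    Matrix.det_transpose, Ring.inverse_eq_inv', Matrix.det_one]
  calc _ = (e.det * e.det⁻¹) * ((antidiag d).det * (antidiag d).det) := by ring
    _ = 1 := by rw [hw, mul_inv_cancel₀ he.ne', one_mul]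

lemma hMatrix_mem {d : ℕ} (e B : Matrix (Fin d) (Fin d) ℝ) (he : 0 < e.det) (hB : Bᵀ = -B) :
    hMatrix e B * antidiag (d + d) * (hMatrix e B)ᵀ = antidiag (d + d) := by
  have hu : IsUnit e.det := he.ne'.isUnit
  set w := antidiag d with hw
  have hww : w * w = 1 := antidiag_mul_self _
  have hwt : wᵀ = w := antidiag_transpose _
  have h1 : e * w * (w * (eᵀ)⁻¹ * w)ᵀ = w := by
    rw [Matrix.transpose_mul, Matrix.transpose_mul, hwt, Matrix.transpose_nonsing_inv,
      Matrix.transpose_transpose]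
    calc e * w * (w * (e⁻¹ * w)) = e * (w * w) * e⁻¹ * w := by simp only [Matrix.mul_assoc]
      _ = w := by rw [hww, Matrix.mul_one, Matrix.mul_nonsing_inv _ hu, Matrix.one_mul]
  have h2 : (w * (eᵀ)⁻¹ * w) * w * eᵀ = w := by
    calc (w * (eᵀ)⁻¹ * w) * w * eᵀ = w * ((eᵀ)⁻¹ * (w * w) * eᵀ) := by
          simp only [Matrix.mul_assoc]
      _ = w := by
          rw [hww, Matrix.mul_one, Matrix.nonsing_inv_mul _ (by rwa [Matrix.det_transpose]),
            Matrix.mul_one]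
  have key : ∀ M N : Matrix (Fin d ⊕ Fin d) (Fin d ⊕ Fin d) ℝ,
      Matrix.fromBlocks 0 w w 0 = N → M * N * Mᵀ = N →
      Matrix.reindex finSumFinEquiv finSumFinEquiv M * antidiag (d + d) *
        (Matrix.reindex finSumFinEquiv finSumFinEquiv M)ᵀ = antidiag (d + d) := by
    intro M N hN h
    rw [antidiag_add, ← hw, hN]
    simp only [Matrix.reindex_apply, Matrix.transpose_submatrix, Matrix.submatrix_mul_equiv, h]
  refine key _ _ rfl ?_
  rw [Matrix.transpose_mul]
  have h3 : Matrix.fromBlocks e 0 0 (w * (eᵀ)⁻¹ * w) * Matrix.fromBlocks 0 w w 0 *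
      (Matrix.fromBlocks e 0 0 (w * (eᵀ)⁻¹ * w))ᵀ = Matrix.fromBlocks 0 w w 0 := by
    rw [Matrix.fromBlocks_transpose, Matrix.fromBlocks_multiply, Matrix.fromBlocks_multiply]
    simp only [Matrix.zero_mul, Matrix.mul_zero, zero_add, add_zero, Matrix.transpose_zero]
    rw [h1, h2]
  have h4 : Matrix.fromBlocks 1 (B * w) 0 1 * Matrix.fromBlocks 0 w w 0 *
      (Matrix.fromBlocks 1 (B * w) 0 1)ᵀ = Matrix.fromBlocks 0 w w 0 := by
    rw [Matrix.fromBlocks_transpose, Matrix.fromBlocks_multiply, Matrix.fromBlocks_multiply]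
    simp only [Matrix.zero_mul, Matrix.mul_zero, zero_add, add_zero, Matrix.transpose_zero,
      Matrix.one_mul, Matrix.mul_one, Matrix.transpose_one, Matrix.transpose_mul, hwt, hB]
    rw [Matrix.mul_assoc B, hww, ← Matrix.mul_assoc w, hww]
    simp
  calc _ = Matrix.fromBlocks 1 (B * w) 0 1 *
        (Matrix.fromBlocks e 0 0 (w * (eᵀ)⁻¹ * w) * Matrix.fromBlocks 0 w w 0 *
        (Matrix.fromBlocks e 0 0 (w * (eᵀ)⁻¹ * w))ᵀ) *
        (Matrix.fromBlocks 1 (B * w) 0 1)ᵀ := by simp only [← hw, Matrix.mul_assoc]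
    _ = _ := by rw [h3, h4]

/-- The element `h = [I, B w; 0, I] [e, 0; 0, ẽ]` of `SO(d,d,ℝ)`, with `B` antisymmetric. Writing
`e = r^{1/2} e'` with `det e' = 1`, the second factor is `[r^{1/2} e', 0; 0, r^{-1/2} ẽ']`. -/
noncomputable def hElt {d : ℕ} (e : Matrix (Fin d) (Fin d) ℝ) (he : 0 < e.det)
    (B : Matrix (Fin d) (Fin d) ℝ) (hB : Bᵀ = -B) : SODD d :=
  ⟨⟨hMatrix e B, hMatrix_det e B he⟩, hMatrix_mem e B he hB⟩

/-- The right hand side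
`2 D⁻¹ ξ(2s+d-2) E₀(s+d/2-1) - 2 D^{(2s-2)/d} ξ(2s+d-2) E₁(s+d/2-1) - 2 D^{-2s/d} ξ(2s-1) E₂(s)`,
with `ξ(s) = π^{-s/2} Γ(s/2) ζ(s)`. -/
noncomputable def liftRHS (d : ℕ) (D : ℝ) (E₀ E₁ E₂ : ℂ → ℂ) (s : ℂ) : ℂ :=
  2 * (D : ℂ)⁻¹ * completedRiemannZeta (2 * s + d - 2) * E₀ (s + d / 2 - 1)
    - 2 * (D : ℂ) ^ ((2 * s - 2) / d) * completedRiemannZeta (2 * s + d - 2) * E₁ (s + d / 2 - 1)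
    - 2 * (D : ℂ) ^ (-(2 * s / d)) * completedRiemannZeta (2 * s - 1) * E₂ s

end ThetaLift

open ThetaLift Filter Topology

/-! The proof is the Rankin–Selberg (orbit) method. For `Re s` large, `2 E_s` is the sum over
SL(2,ℤ) of the translates of τ₂^s cut off to the strip −1/2 < τ₁ ≤ 1/2 (`tsum_indicator_strip`).
Since 𝒢 is modular invariant (`latticeSum_smul`), the integral unfolds to that of τ₂^{s−2} 𝒢 over
the strip (`integral_eq_tsum_integral`).

Write 𝒢 as the sum over all pairs (m, n) with n ≠ 0 minus the sum over those with m parallel to n.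
In the full sum, Poisson summation in m (`hasSum_poisson`, `hasSum_pairTerm_dual`) introduces a dual
vector k and the factor |det e|⁻¹ τ₂^{d/2} exp(−π τ₂ Q(n,k)) exp(2πi (k·n) τ₁), where Q(n,k) = |n
e|² + |(k − B n) e⁻ᵗ|². Integration over τ₁ forces k·n = 0, and integration over τ₂ gives π^{−s'}
Γ(s') Q^{−s'} with s' = s + d/2 − 1. The pairs with k·n = 0 are the isotropic vectors of ℤ^{2d}, and
Q is their squared length after h⁻¹ (`qf_hElt_inv`). The sum over all of them is a multiple of the
vector Eisenstein series; the part n = 0, which has to be removed, is the Epstein zeta function of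
the dual lattice, that is the β_{d−1} series. The parallel pairs (j v, c v), v primitive, are the
same computation in dimension one and give ξ(2s−1) times the β_1 series. The result is
`modularIntegral_eq`.

Eisenstein series become lattice sums because cosets correspond to pairs ±v of primitive (isotropic)
vectors, the Iwasawa weight being the inverse length of v (`hasSum_leftCosets`, `expWeight_one`,
`expWeight_pred`). This needs transitivity of the arithmetic group up to sign, which is the
Euclidean algorithm (`exists_vecMul_eq_single`, `spinRel_transitive`). In the orthogonal case its
elementary moves are lifted to the Clifford algebra, so that SO(d,d) and Spin(d,d) are served by one
argument (`hasSum_eisTerm_vector`).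

For the continuation, Epstein zeta functions are Mellin transforms of theta functions with a
functional equation. E_s(τ) is a binary Epstein zeta function whose entire part grows at most like a
power of τ₂ in the fundamental domain, while 𝒢 is integrable there against every power of τ₂
(`integrableOn_fd_latticeNorm`). Hence I is meromorphic, and holomorphic wherever E_s is. The
continuation of the vector series is obtained by solving the identity for it (`vectorCont`,
`continues_vectorCont`), and the identity theorem extends the equation to ℂ. At s = 0 both E_s and
the β_1 series take the value 1, and ξ(−1) = ξ(2). -/

set_option linter.unusedSectionVars false

namespace ThetaLift

open Matrix MeasureTheory Set Filter Topology

/-! ### Integral vectors and quadratic forms -/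

section Lattice

variable {ι κ : Type*}

/-- The real vector underlying an integral vector. -/
def toR (v : ι → ℤ) : ι → ℝ := fun i => v i

@[simp] lemma toR_apply (v : ι → ℤ) (i : ι) : toR v i = v i := rfl

@[simp] lemma toR_zero : toR (0 : ι → ℤ) = 0 := by ext; simp

lemma toR_add (v w : ι → ℤ) : toR (v + w) = toR v + toR w := by ext; simp

lemma toR_neg (v : ι → ℤ) : toR (-v) = -toR v := by ext; simp

lemma toR_smul (c : ℤ) (v : ι → ℤ) : toR (c • v) = (c : ℝ) • toR v := by ext; simp

lemma toR_injective : Function.Injective (toR : (ι → ℤ) → ι → ℝ) := by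
  intro v w h
  ext i
  have := congrFun h i
  simpa using this

lemma toR_eq_zero {v : ι → ℤ} : toR v = 0 ↔ v = 0 :=
  ⟨fun h => toR_injective (h.trans toR_zero.symm), fun h => by rw [h, toR_zero]⟩

variable [Fintype ι] [Fintype κ]

/-- The quadratic form `v ↦ |v e|²`. -/
def qf (e : Matrix ι κ ℝ) (v : ι → ℝ) : ℝ := (v ᵥ* e) ⬝ᵥ (v ᵥ* e)

lemma qf_nonneg (e : Matrix ι κ ℝ) (v : ι → ℝ) : 0 ≤ qf e v :=
  Finset.sum_nonneg fun _ _ => mul_self_nonneg _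

@[simp] lemma qf_zero (e : Matrix ι κ ℝ) : qf e 0 = 0 := by simp [qf]

lemma qf_neg (e : Matrix ι κ ℝ) (v : ι → ℝ) : qf e (-v) = qf e v := by simp [qf, neg_vecMul]

lemma qf_smul (e : Matrix ι κ ℝ) (c : ℝ) (v : ι → ℝ) : qf e (c • v) = c ^ 2 * qf e v := by
  simp only [qf, smul_vecMul, smul_dotProduct, dotProduct_smul, smul_eq_mul]; ring

lemma qf_smul_left (e : Matrix ι κ ℝ) (c : ℝ) (v : ι → ℝ) : qf (c • e) v = c ^ 2 * qf e v := by
  simp only [qf, vecMul_smul, smul_dotProduct, dotProduct_smul, smul_eq_mul]; ring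

/-- In each coordinate the right side minus the left side is the square of v + 2w. -/
lemma qf_le_two_mul (e : Matrix ι κ ℝ) (v w : ι → ℝ) :
    qf e v ≤ 2 * qf e (v + w) + 2 * qf e w := by
  simp only [qf, add_vecMul, dotProduct, Pi.add_apply, Finset.mul_sum, ← Finset.sum_add_distrib]
  exact Finset.sum_le_sum fun i _ => by nlinarith [sq_nonneg ((v ᵥ* e) i + 2 * (w ᵥ* e) i)]

lemma continuous_qf (e : Matrix ι κ ℝ) : Continuous (qf e) := by
  unfold qf
  fun_prop

/-! ### Coercivity of the form and convergence of lattice sums -/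

variable [DecidableEq ι]

lemma qf_pos {e : Matrix ι ι ℝ} (he : e.det ≠ 0) {v : ι → ℝ} (hv : v ≠ 0) : 0 < qf e v := by
  refine lt_of_le_of_ne (qf_nonneg e v) fun h => hv ?_
  exact eq_zero_of_vecMul_eq_zero he (dotProduct_self_eq_zero.1 h.symm)

lemma qf_toR_pos {e : Matrix ι ι ℝ} (he : e.det ≠ 0) {v : ι → ℤ} (hv : v ≠ 0) :
    0 < qf e (toR v) := qf_pos he fun h => hv (toR_eq_zero.1 h)

/-- Right multiplication by `e⁻¹` is bounded; the norm is the sup norm, which is at most the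
Euclidean length. -/
lemma exists_le_qf {e : Matrix ι ι ℝ} (he : e.det ≠ 0) :
    ∃ c > 0, ∀ v, c * ‖v‖ ^ 2 ≤ qf e v := by
  obtain ⟨C, hC⟩ := (LinearMap.toContinuousLinearMap (Matrix.vecMulLinear e⁻¹)).isBoundedLinearMap.bound
  refine ⟨(C ^ 2)⁻¹, by have := hC.1; positivity, fun v => ?_⟩
  have h1 : ‖v‖ ≤ C * ‖v ᵥ* e‖ := by
    have := hC.2 (v ᵥ* e)
    simpa [Matrix.vecMulLinear, Matrix.mul_nonsing_inv _ he.isUnit] using this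
  have h2 : ‖v ᵥ* e‖ ^ 2 ≤ qf e v := by
    have : ‖v ᵥ* e‖ ≤ √(qf e v) := by
      refine (pi_norm_le_iff_of_nonneg (Real.sqrt_nonneg _)).2 fun i => ?_
      rw [Real.norm_eq_abs]
      apply Real.abs_le_sqrt
      rw [sq]
      exact Finset.single_le_sum (f := fun i => (v ᵥ* e) i * (v ᵥ* e) i)
        (fun _ _ => mul_self_nonneg _) (Finset.mem_univ i)
    calc _ ≤ √(qf e v) ^ 2 := by gcongr
      _ = _ := Real.sq_sqrt (qf_nonneg e v)
  have hC0 := hC.1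
  calc (C ^ 2)⁻¹ * ‖v‖ ^ 2 ≤ (C ^ 2)⁻¹ * (C * ‖v ᵥ* e‖) ^ 2 := by gcongr
    _ = ‖v ᵥ* e‖ ^ 2 := by field_simp
    _ ≤ _ := h2

/-- The integral vectors form the lattice spanned by the standard basis, of rank `Fintype.card ι`;
the coordinate equivalence carries the known lattice sum back to functions `ι → ℤ`. -/
lemma summable_norm_toR_rpow {r : ℝ} (hr : Fintype.card ι < r) :
    Summable fun v : ι → ℤ => ‖toR v‖ ^ (-r) := by
  let b := Pi.basisFun ℝ ι
  let L := Submodule.span ℤ (Set.range b)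
  let E := (b.restrictScalars ℤ).equivFun
  have hrank : Module.finrank ℤ L = Fintype.card ι :=
    Module.finrank_eq_card_basis (b.restrictScalars ℤ)
  have h := ZLattice.summable_norm_rpow L (-r) (by rw [hrank]; linarith)
  have h2 := h.comp_injective E.symm.injective
  refine h2.congr fun v => ?_
  have h3 : ((E.symm v : L) : ι → ℝ) = toR v := by
    ext i
    classical
    simp [E, Module.Basis.equivFun_symm_apply, b, Pi.single_apply]
  show ‖((E.symm v : L) : ι → ℝ)‖ ^ (-r) = _
  rw [h3]

/-- Raise `x / R ≤ exp (x / R)` to the power `R`. Trading exponential decay for a power lets theta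
functions be bounded by zeta values at real points. -/
lemma exp_neg_le_rpow {R x : ℝ} (hR : 0 < R) (hx : 0 < x) :
    Real.exp (-x) ≤ R ^ R * x ^ (-R) := by
  have h1 : x / R ≤ Real.exp (x / R) := by linarith [Real.add_one_le_exp (x / R)]
  have h2 : (x / R) ^ R ≤ Real.exp x := by
    calc (x / R) ^ R ≤ Real.exp (x / R) ^ R := Real.rpow_le_rpow (by positivity) h1 hR.le
      _ = Real.exp x := by rw [← Real.exp_mul]; congr 1; field_simp
  rw [Real.div_rpow hx.le hR.le, div_le_iff₀ (by positivity)] at h2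
  rw [Real.exp_neg, Real.rpow_neg hx.le, ← div_eq_mul_inv, inv_le_comm₀ (Real.exp_pos _)
    (by positivity), inv_div, div_le_iff₀ (by positivity)]
  exact h2

lemma summable_qf_rpow {e : Matrix ι ι ℝ} (he : e.det ≠ 0) {r : ℝ} (hr : Fintype.card ι < 2 * r) :
    Summable fun v : ι → ℤ => qf e (toR v) ^ (-r) := by
  obtain ⟨c, hc, h⟩ := exists_le_qf he
  have hr0 : 0 < r := by
    have : (0 : ℝ) ≤ Fintype.card ι := by positivity
    linarith
  refine Summable.of_nonneg_of_le (fun v => Real.rpow_nonneg (qf_nonneg _ _) _) (fun v => ?_)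
    ((summable_norm_toR_rpow hr).mul_left (c ^ (-r)))
  rcases eq_or_ne v 0 with rfl | hv
  -- `0 ^ (-r) = 0` for `r ≠ 0`: under this convention the zero vector drops out of all the power
  -- sums, which therefore run over all of `ι → ℤ`.
  · simp only [toR_zero, qf_zero, norm_zero]
    rw [Real.zero_rpow (by linarith)]
    positivity
  · have hn : 0 < ‖toR v‖ := norm_pos_iff.2 fun h => hv (toR_eq_zero.1 h)
    calc qf e (toR v) ^ (-r) ≤ (c * ‖toR v‖ ^ 2) ^ (-r) :=
          Real.rpow_le_rpow_of_nonpos (by positivity) (h _) (by linarith)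
      _ = c ^ (-r) * ‖toR v‖ ^ (-(2 * r)) := by
          rw [Real.mul_rpow hc.le (by positivity), ← Real.rpow_natCast, ← Real.rpow_mul hn.le]
          congr 2
          push_cast
          ring

lemma exp_neg_qf_le {e : Matrix ι ι ℝ} (he : e.det ≠ 0) {a R : ℝ} (ha : 0 < a) (hR : 0 < R)
    {v : ι → ℤ} (hv : v ≠ 0) :
    Real.exp (-(a * qf e (toR v))) ≤ R ^ R * a ^ (-R) * qf e (toR v) ^ (-R) := by
  have h := qf_toR_pos he hv
  refine (exp_neg_le_rpow hR (mul_pos ha h)).trans (le_of_eq ?_)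
  rw [Real.mul_rpow ha.le h.le, mul_assoc]

lemma summable_exp_neg_qf {e : Matrix ι ι ℝ} (he : e.det ≠ 0) {a : ℝ} (ha : 0 < a) :
    Summable fun v : ι → ℤ => Real.exp (-(a * qf e (toR v))) := by
  set R : ℝ := Fintype.card ι + 1 with hR
  have hR0 : 0 < R := by positivity
  -- The power bound vanishes at `v = 0`, where the exponential is 1; the indicator makes up for it.
  have hs : Summable fun v : ι → ℤ =>
      R ^ R * a ^ (-R) * qf e (toR v) ^ (-R) + (if v = 0 then 1 else 0) :=
    ((summable_qf_rpow he (by rw [hR]; have : (0 : ℝ) ≤ Fintype.card ι := by positivity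
                              linarith)).mul_left _).add
      (summable_of_ne_finset_zero (s := {0}) fun v hv => by simpa using hv)
  refine Summable.of_nonneg_of_le (fun v => (Real.exp_pos _).le) (fun v => ?_) hs
  rcases eq_or_ne v 0 with rfl | hv
  · simp [Real.zero_rpow (neg_ne_zero.2 hR0.ne')]
  · simpa [hv] using exp_neg_qf_le he ha hR0 hv

/-- Giving up half of the exponent makes the decay in `v` uniform for `x` in bounded sets. -/
lemma exp_neg_qf_add_le (e : Matrix ι κ ℝ) {a : ℝ} (ha : 0 < a) (x v : ι → ℝ) :
    Real.exp (-(a * qf e (x + v))) ≤ Real.exp (a * qf e x) * Real.exp (-(a / 2 * qf e v)) := by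
  rw [← Real.exp_add]
  gcongr
  have := qf_le_two_mul e v x
  rw [add_comm v x] at this
  nlinarith

/-! ### Poisson summation for Gaussians -/

/-- The Gaussian `exp(-π |x e|² + 2πi b·x)`. -/
noncomputable def gaussian (e : Matrix ι ι ℝ) (b x : ι → ℝ) : ℂ :=
  Complex.exp (-(Real.pi * qf e x : ℝ) + 2 * Real.pi * Complex.I * (b ⬝ᵥ x : ℝ))

lemma norm_gaussian (e : Matrix ι ι ℝ) (b x : ι → ℝ) :
    ‖gaussian e b x‖ = Real.exp (-(Real.pi * qf e x)) := by
  rw [gaussian, Complex.norm_exp]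
  simp [Complex.mul_re]

lemma continuous_gaussian (e : Matrix ι ι ℝ) (b : ι → ℝ) : Continuous (gaussian e b) := by
  have := continuous_qf e
  unfold gaussian
  fun_prop

lemma summable_gaussian {e : Matrix ι ι ℝ} (he : e.det ≠ 0) (b x : ι → ℝ) :
    Summable fun m : ι → ℤ => gaussian e b (x + toR m) := by
  refine Summable.of_norm_bounded ((summable_exp_neg_qf he (by positivity :
    0 < Real.pi / 2)).mul_left (Real.exp (Real.pi * qf e x))) fun m => ?_
  rw [norm_gaussian]
  exact exp_neg_qf_add_le e Real.pi_pos x (toR m)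

/-- The substitution y = x e reduces everything to the standard Gaussian; the linear parameter moves
by the inverse transpose. -/
lemma gaussian_eq_comp {e : Matrix ι ι ℝ} (he : e.det ≠ 0) (b : ι → ℝ) :
    gaussian e b = (fun y : ι → ℝ => Complex.exp (-(Real.pi : ℂ) * ∑ i, (y i : ℂ) ^ 2 +
      ∑ i, (2 * Real.pi * Complex.I * ((b ᵥ* (e⁻¹)ᵀ) i : ℝ)) * y i)) ∘ Matrix.toLin' eᵀ := by
  ext x
  have h1 : b ⬝ᵥ x = (b ᵥ* (e⁻¹)ᵀ) ⬝ᵥ (x ᵥ* e) := by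
    rw [Matrix.vecMul_transpose, dotProduct_comm (e⁻¹ *ᵥ b), Matrix.dotProduct_mulVec,
      Matrix.vecMul_vecMul, Matrix.mul_nonsing_inv _ he.isUnit, Matrix.vecMul_one, dotProduct_comm]
  simp only [gaussian, Function.comp, Matrix.toLin'_apply, Matrix.mulVec_transpose, h1, qf]
  congr 1
  simp only [dotProduct]
  push_cast
  rw [neg_mul, Finset.mul_sum (s := Finset.univ) (a := 2 * (Real.pi : ℂ) * Complex.I)]
  congr 1
  · simp [sq]
  · exact Finset.sum_congr rfl fun i _ => by ring

lemma map_volume_toLin' {e : Matrix ι ι ℝ} (he : e.det ≠ 0) :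
    Measure.map (Matrix.toLin' eᵀ) volume = ENNReal.ofReal |e.det|⁻¹ • volume := by
  rw [Real.map_matrix_volume_pi_eq_smul_volume_pi (by rwa [Matrix.det_transpose]),
    Matrix.det_transpose, abs_inv]

lemma integrable_gaussian {e : Matrix ι ι ℝ} (he : e.det ≠ 0) (b : ι → ℝ) :
    Integrable (gaussian e b) := by
  rw [gaussian_eq_comp he]
  have hm : AEMeasurable (Matrix.toLin' eᵀ) (volume : Measure (ι → ℝ)) :=
    (LinearMap.continuous_of_finiteDimensional _).measurable.aemeasurable
  refine Integrable.comp_aemeasurable ?_ hm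
  rw [map_volume_toLin' he]
  refine Integrable.smul_measure ?_ ENNReal.ofReal_ne_top
  exact GaussianFourier.integrable_cexp_neg_mul_sum_add (by simpa using Real.pi_pos) _

lemma integral_gaussian {e : Matrix ι ι ℝ} (he : e.det ≠ 0) (b : ι → ℝ) :
    ∫ x, gaussian e b x = (|e.det|⁻¹ : ℝ) * Complex.exp (-(Real.pi * qf (e⁻¹)ᵀ b : ℝ)) := by
  have hm : AEMeasurable (Matrix.toLin' eᵀ) (volume : Measure (ι → ℝ)) :=
    (LinearMap.continuous_of_finiteDimensional _).measurable.aemeasurable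
  rw [gaussian_eq_comp he]
  simp only [Function.comp_def]
  rw [← MeasureTheory.integral_map (φ := Matrix.toLin' eᵀ) hm (f := fun y : ι → ℝ => Complex.exp
    (-(Real.pi : ℂ) * ∑ i, (y i : ℂ) ^ 2 +
      ∑ i, (2 * Real.pi * Complex.I * ((b ᵥ* (e⁻¹)ᵀ) i : ℝ)) * y i))
    (Continuous.aestronglyMeasurable (by fun_prop)), map_volume_toLin' he, integral_smul_measure,
    GaussianFourier.integral_cexp_neg_mul_sum_add (by simpa using Real.pi_pos)]
  have hpi : (Real.pi : ℂ) ≠ 0 := by exact_mod_cast Real.pi_ne_zero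
  rw [div_self hpi, Complex.one_cpow, one_mul, ENNReal.toReal_ofReal (by positivity),
    Complex.real_smul]
  congr 2
  simp only [qf, dotProduct]
  push_cast
  rw [Finset.mul_sum, Finset.sum_div, ← Finset.sum_neg_distrib]
  refine Finset.sum_congr rfl fun i _ => ?_
  field_simp
  rw [Complex.I_sq]
  ring

/-- Integration of the periodization over a unit box. -/
lemma integral_box_tsum {h : (ι → ℝ) → ℂ} (hh : Integrable h) (a : ι → ℝ) :
    ∫ x in {x : ι → ℝ | ∀ i, x i ∈ Ioc (a i) (a i + 1)}, ∑' m : ι → ℤ, h (x + toR m) =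
      ∫ x, h x := by
  set box := {x : ι → ℝ | ∀ i, x i ∈ Ioc (a i) (a i + 1)} with hbox
  have hbm : MeasurableSet box := by
    have : box = Set.pi univ fun i => Ioc (a i) (a i + 1) := by ext; simp [hbox]
    rw [this]
    exact MeasurableSet.univ_pi fun i => measurableSet_Ioc
  let S : (ι → ℤ) → Set (ι → ℝ) := fun m => (fun x => x - toR m) ⁻¹' box
  have hSm : ∀ m, MeasurableSet (S m) := fun m => hbm.preimage (by fun_prop)
  have hdisj : Pairwise (Function.onFun Disjoint S) := by
    intro m n hmn
    refine Set.disjoint_left.2 fun x hx hy => hmn ?_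
    ext i
    have h1 := hx i
    have h2 := hy i
    simp only [Pi.sub_apply, toR_apply, mem_Ioc] at h1 h2
    have h3 : (m i : ℝ) < n i + 1 := by linarith
    have h4 : (n i : ℝ) < m i + 1 := by linarith
    have h5 : m i < n i + 1 := by exact_mod_cast h3
    have h6 : n i < m i + 1 := by exact_mod_cast h4
    omega
  have hU : ⋃ m, S m = univ := by
    -- With half-open boxes (a, a+1], the integer translate containing x has index ⌈x − a⌉ − 1.
    refine eq_univ_of_forall fun x => mem_iUnion.2 ⟨fun i => ⌈x i - a i⌉ - 1, fun i => ?_⟩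
    simp only [Pi.sub_apply, toR_apply, mem_Ioc]
    push_cast
    constructor <;> linarith [Int.ceil_lt_add_one (x i - a i), Int.le_ceil (x i - a i)]
  have htr : ∀ {E : Type} [NormedAddCommGroup E] [NormedSpace ℝ E] (f : (ι → ℝ) → E) (m : ι → ℤ),
      ∫ x in S m, f x = ∫ x in box, f (x + toR m) := by
    intro E _ _ f m
    have := (measurePreserving_sub_right (volume : Measure (ι → ℝ)) (toR m)).setIntegral_preimage_emb
      (MeasurableEquiv.subRight (toR m)).measurableEmbedding (fun x => f (x + toR m)) box
    simpa using this
  have h1 := hasSum_integral_iUnion hSm hdisj (f := h) (μ := volume) hh.integrableOn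
  have h2 := hasSum_integral_iUnion hSm hdisj (f := fun x => ‖h x‖) (μ := volume)
    hh.norm.integrableOn
  rw [hU, setIntegral_univ] at h1
  simp only [htr] at h1 h2
  rw [← h1.tsum_eq]
  exact (integral_tsum_of_summable_integral_norm (F := fun (m : ι → ℤ) x => h (x + toR m))
    (fun m => (hh.comp_add_right (toR m)).integrableOn) h2.summable).symm

lemma mFourier_coe (k : ι → ℤ) (x : ι → ℝ) :
    UnitAddTorus.mFourier k (fun i => (x i : AddCircle (1 : ℝ))) =
      Complex.exp (2 * Real.pi * Complex.I * (toR k ⬝ᵥ x : ℝ)) := by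
  simp only [UnitAddTorus.mFourier, ContinuousMap.coe_mk, fourier_coe_apply, ← Complex.exp_sum,
    dotProduct]
  congr 1
  push_cast
  rw [Finset.mul_sum]
  exact Finset.sum_congr rfl fun i _ => by simp; ring

/-- Weierstrass test on the open sublevel set `qf e x < qf e x₀ + 1`, on which the terms have a
common summable majorant. -/
lemma continuous_tsum_gaussian {e : Matrix ι ι ℝ} (he : e.det ≠ 0) (b : ι → ℝ) :
    Continuous fun x => ∑' m : ι → ℤ, gaussian e b (x + toR m) := by
  rw [continuous_iff_continuousAt]
  intro x₀
  have hopen : IsOpen {x | qf e x < qf e x₀ + 1} := isOpen_lt (continuous_qf e) continuous_const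
  have hmem : x₀ ∈ {x | qf e x < qf e x₀ + 1} := by simp
  refine ContinuousOn.continuousAt (s := {x | qf e x < qf e x₀ + 1}) ?_ (hopen.mem_nhds hmem)
  refine continuousOn_tsum (u := fun m => Real.exp (Real.pi * (qf e x₀ + 1)) *
    Real.exp (-(Real.pi / 2 * qf e (toR m)))) (fun m => Continuous.continuousOn ?_)
    ((summable_exp_neg_qf he (by positivity)).mul_left _) fun m x hx => ?_
  · exact (continuous_gaussian e b).comp (by fun_prop)
  · rw [norm_gaussian]
    refine (exp_neg_qf_add_le e Real.pi_pos x (toR m)).trans ?_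
    gcongr
    exact (show qf e x < qf e x₀ + 1 from hx).le

/-- Poisson summation for Gaussians on `ℤ^ι`. -/
theorem hasSum_poisson {e : Matrix ι ι ℝ} (he : e.det ≠ 0) (b x : ι → ℝ) :
    HasSum (fun k : ι → ℤ => (|e.det|⁻¹ : ℝ) *
      Complex.exp (-(Real.pi * qf (e⁻¹)ᵀ (toR k - b) : ℝ)) *
        Complex.exp (2 * Real.pi * Complex.I * (toR k ⬝ᵥ x : ℝ)))
      (∑' m : ι → ℤ, gaussian e b (x + toR m)) := by
  set f : (ι → ℝ) → ℂ := fun x => ∑' m : ι → ℤ, gaussian e b (x + toR m) with hf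
  let p : (ι → ℝ) → UnitAddTorus ι := fun x i => (x i : AddCircle (1 : ℝ))
  have hper : ∀ x (m : ι → ℤ), f (x + toR m) = f x := by
    intro x m
    simp only [hf]
    rw [← (Equiv.addLeft m).tsum_eq fun n : ι → ℤ => gaussian e b (x + toR n)]
    refine tsum_congr fun n => ?_
    simp [toR_add, add_assoc]
  have hp : ∀ x y, p x = p y → f x = f y := by
    intro x y hxy
    have h1 : ∀ i, ∃ m : ℤ, x i = y i + m := by
      intro i
      have h2 : ((x i - y i : ℝ) : AddCircle (1 : ℝ)) = 0 := by
        have := congrFun hxy i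
        simp only [p] at this
        rw [AddCircle.coe_sub, this, sub_self]
      obtain ⟨m, hm⟩ := (AddCircle.coe_eq_zero_iff 1).1 h2
      refine ⟨m, ?_⟩
      simp only [zsmul_eq_mul, mul_one] at hm
      linarith
    choose m hm using h1
    rw [show x = y + toR m from funext hm, hper]
  -- The map ℝ^ι → (ℝ/ℤ)^ι is a quotient map, so the periodic function descends to a continuous
  -- function on the torus.
  have hq : IsQuotientMap p := by
    have hopen : IsOpenMap p := IsOpenMap.piMap (f := fun (_ : ι) (t : ℝ) => (t : AddCircle (1 : ℝ)))
      (fun _ => QuotientAddGroup.isOpenMap_coe) (by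
        refine Filter.Eventually.of_forall fun _ => ?_
        exact QuotientAddGroup.mk_surjective)
    have hsurj : Function.Surjective p := by
      intro t
      choose x hx using fun i => QuotientAddGroup.mk_surjective (t i)
      exact ⟨x, funext hx⟩
    refine hopen.isQuotientMap ?_ hsurj
    exact continuous_pi fun i => (AddCircle.continuous_mk' 1).comp (continuous_apply i)
  let F : C(UnitAddTorus ι, ℂ) := ⟨fun t => f (Function.surjInv hq.surjective t), by
    rw [hq.continuous_iff]
    refine (continuous_tsum_gaussian he b).congr fun x => ?_
    exact hp _ _ (Function.surjInv_eq hq.surjective (p x)).symm⟩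
  have hF : ∀ x, F (p x) = f x := fun x => hp _ _ (Function.surjInv_eq hq.surjective (p x))
  -- Multiplication by the character of frequency −k only shifts the parameter `b`, so each Fourier
  -- coefficient unfolds to a known Gaussian integral.
  have hmul : ∀ (k : ι → ℤ) (x : ι → ℝ), Complex.exp (2 * Real.pi * Complex.I * (toR (-k) ⬝ᵥ x : ℝ)) *
      gaussian e b x = gaussian e (b - toR k) x := by
    intro k x
    rw [gaussian, gaussian, ← Complex.exp_add, toR_neg, neg_dotProduct, sub_dotProduct]
    congr 1
    push_cast
    ring
  have hcoeff : ∀ k : ι → ℤ, UnitAddTorus.mFourierCoeff F k = (|e.det|⁻¹ : ℝ) *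
      Complex.exp (-(Real.pi * qf (e⁻¹)ᵀ (toR k - b) : ℝ)) := by
    intro k
    rw [UnitAddTorus.mFourierCoeff_eq_integral F k 0, ← neg_sub b, qf_neg, ← integral_gaussian he,
      ← integral_box_tsum (integrable_gaussian he (b - toR k)) 0]
    refine integral_congr_ae (Filter.Eventually.of_forall fun x => ?_)
    show UnitAddTorus.mFourier (-k) (p x) • F (p x) = _
    rw [hF, mFourier_coe, hf, smul_eq_mul, ← tsum_mul_left]
    refine tsum_congr fun m => ?_
    rw [← hmul k (x + toR m)]
    congr 1
    rw [dotProduct_add]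
    have : (toR (-k) ⬝ᵥ toR m : ℝ) = ((-k ⬝ᵥ m : ℤ) : ℝ) := by simp [dotProduct]
    rw [this]
    push_cast
    rw [mul_add, Complex.exp_add]
    have h2 := Complex.exp_int_mul_two_pi_mul_I (-k ⬝ᵥ m)
    rw [mul_comm] at h2
    rw [h2, mul_one]
  -- In absolute value the coefficients are a shifted Gaussian over the dual form, so the Fourier
  -- series converges at every point to the function.
  have hsum : Summable (UnitAddTorus.mFourierCoeff F) := by
    have he' : ((e⁻¹)ᵀ).det ≠ 0 := by
      rw [Matrix.det_transpose]
      exact (Matrix.isUnit_nonsing_inv_det _ he.isUnit).ne_zero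
    refine Summable.of_norm ?_
    refine ((summable_gaussian he' 0 (-b)).norm.mul_left |e.det|⁻¹).congr fun k => ?_
    rw [hcoeff, norm_gaussian, norm_mul, Complex.norm_exp, neg_add_eq_sub, Complex.norm_real]
    simp
  have h := UnitAddTorus.hasSum_mFourier_series_apply_of_summable hsum (p x)
  rw [hF] at h
  refine h.congr_fun fun k => ?_
  rw [hcoeff, smul_eq_mul, mFourier_coe]

end Lattice

end ThetaLift

namespace ThetaLift

open Matrix MeasureTheory Set Filter Topology

/-! ### Epstein zeta functions -/

section Epstein

variable {ι : Type*} [Fintype ι] [DecidableEq ι]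

lemma det_inv_transpose_ne_zero {e : Matrix ι ι ℝ} (he : e.det ≠ 0) : ((e⁻¹)ᵀ).det ≠ 0 := by
  rw [Matrix.det_transpose]
  exact (Matrix.isUnit_nonsing_inv_det _ he.isUnit).ne_zero

/-- The theta function `∑_{v ∈ ℤ^ι} exp(-π t |v e|²)`. -/
noncomputable def theta (e : Matrix ι ι ℝ) (t : ℝ) : ℝ :=
  ∑' v : ι → ℤ, Real.exp (-(Real.pi * t * qf e (toR v)))

lemma summable_theta {e : Matrix ι ι ℝ} (he : e.det ≠ 0) {t : ℝ} (ht : 0 < t) :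
    Summable fun v : ι → ℤ => Real.exp (-(Real.pi * t * qf e (toR v))) :=
  summable_exp_neg_qf he (by positivity)

lemma hasSum_theta_sub_one {e : Matrix ι ι ℝ} (he : e.det ≠ 0) {t : ℝ} (ht : 0 < t) :
    HasSum (fun v : ι → ℤ => if v = 0 then 0 else Real.exp (-(Real.pi * t * qf e (toR v))))
      (theta e t - 1) := by
  have h := (summable_theta he ht).hasSum
  have h0 : HasSum (fun v : ι → ℤ => if v = 0 then (1 : ℝ) else 0) 1 := hasSum_ite_eq 0 1
  refine (h.sub h0).congr_fun fun v => ?_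
  split_ifs with hv
  · simp [hv]
  · simp

/-- The zeta function `∑_{v ≠ 0} |v e|^{-2R}` for real `R`. -/
noncomputable def epsteinReal (e : Matrix ι ι ℝ) (R : ℝ) : ℝ :=
  ∑' v : ι → ℤ, qf e (toR v) ^ (-R)

lemma epsteinReal_nonneg (e : Matrix ι ι ℝ) (R : ℝ) : 0 ≤ epsteinReal e R :=
  tsum_nonneg fun _ => Real.rpow_nonneg (qf_nonneg _ _) _

lemma theta_sub_one_nonneg {e : Matrix ι ι ℝ} (he : e.det ≠ 0) {t : ℝ} (ht : 0 < t) :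
    0 ≤ theta e t - 1 :=
  (hasSum_theta_sub_one he ht).nonneg fun v => by split_ifs <;> positivity

/-- The exponential is replaced by a power term by term. The bound holds for every t > 0 and sees
`e` only through one zeta value, so it can be made uniform in a family of lattices. -/
lemma theta_sub_one_le {e : Matrix ι ι ℝ} (he : e.det ≠ 0) {R : ℝ}
    (hR : Fintype.card ι < 2 * R) {t : ℝ} (ht : 0 < t) :
    theta e t - 1 ≤ R ^ R * Real.pi ^ (-R) * epsteinReal e R * t ^ (-R) := by
  have hR0 : 0 < R := by
    have : (0 : ℝ) ≤ Fintype.card ι := by positivity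
    linarith
  have h2 := ((summable_qf_rpow he hR).hasSum.mul_left (R ^ R * (Real.pi * t) ^ (-R)))
  refine (hasSum_le (fun v => ?_) (hasSum_theta_sub_one he ht) h2).trans (le_of_eq ?_)
  · split_ifs with hv
    · have := qf_nonneg e (toR v)
      positivity
    · exact exp_neg_qf_le he (by positivity) hR0 hv
  · rw [epsteinReal, Real.mul_rpow Real.pi_pos.le ht.le]
    ring

/-- Poisson summation at the origin with b = 0, for the matrix t^{−1/2} e. -/
lemma theta_one_div {e : Matrix ι ι ℝ} (he : e.det ≠ 0) {t : ℝ} (ht : 0 < t) :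
    theta e (1 / t) = |e.det|⁻¹ * t ^ ((Fintype.card ι : ℝ) / 2) * theta (e⁻¹)ᵀ t := by
  set c : ℝ := (√t)⁻¹ with hc
  have hst : 0 < √t := Real.sqrt_pos.2 ht
  have hc0 : 0 < c := by positivity
  have hcsq : c ^ 2 = 1 / t := by rw [hc, inv_pow, Real.sq_sqrt ht.le, one_div]
  have hdet : (c • e).det = c ^ Fintype.card ι * e.det := Matrix.det_smul _ _
  have hne : (c • e).det ≠ 0 := by rw [hdet]; positivity
  have hinv : ((c • e)⁻¹)ᵀ = √t • (e⁻¹)ᵀ := by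
    have : Invertible c := invertibleOfNonzero hc0.ne'
    rw [Matrix.inv_smul _ _ he.isUnit, Matrix.transpose_smul, invOf_eq_inv, hc, inv_inv]
  have h := hasSum_poisson hne 0 0
  have h1 : (∑' m : ι → ℤ, gaussian (c • e) 0 (0 + toR m)) = (theta e (1 / t) : ℝ) := by
    rw [theta, Complex.ofReal_tsum]
    refine tsum_congr fun m => ?_
    rw [gaussian, qf_smul_left, hcsq]
    push_cast
    simp
    ring_nf
  have h2 : HasSum (fun k : ι → ℤ => (((|e.det|⁻¹ * t ^ ((Fintype.card ι : ℝ) / 2)) *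
      Real.exp (-(Real.pi * t * qf (e⁻¹)ᵀ (toR k))) : ℝ) : ℂ)) ((theta e (1 / t) : ℝ) : ℂ) := by
    rw [← h1]
    refine h.congr_fun fun k => ?_
    have h3 : |(c • e).det|⁻¹ = |e.det|⁻¹ * t ^ ((Fintype.card ι : ℝ) / 2) := by
      rw [hdet, abs_mul, abs_of_pos (by positivity), mul_inv, mul_comm]
      congr 1
      rw [hc, inv_pow, inv_inv, Real.sqrt_eq_rpow, ← Real.rpow_natCast, ← Real.rpow_mul ht.le]
      congr 1
      ring
    rw [hinv, qf_smul_left, Real.sq_sqrt ht.le, h3, sub_zero, dotProduct_zero, ← mul_assoc]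
    push_cast
    simp
  rw [Complex.hasSum_ofReal] at h2
  rw [← h2.tsum_eq, tsum_mul_left, theta]

lemma continuousOn_theta {e : Matrix ι ι ℝ} (he : e.det ≠ 0) : ContinuousOn (theta e) (Ioi 0) := by
  intro t₀ ht₀
  have ht₀' : (0 : ℝ) < t₀ := ht₀
  refine ContinuousAt.continuousWithinAt (ContinuousOn.continuousAt (s := Ioi (t₀ / 2)) ?_
    (Ioi_mem_nhds (by linarith)))
  refine continuousOn_tsum (u := fun v : ι → ℤ => Real.exp (-(Real.pi * (t₀ / 2) * qf e (toR v))))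
    (fun v => Continuous.continuousOn (by fun_prop)) (summable_theta he (by linarith))
    fun v t ht => ?_
  rw [Real.norm_eq_abs, Real.abs_exp]
  have := qf_nonneg e (toR v)
  have ht' : t₀ / 2 < t := ht
  gcongr

lemma theta_sub_one_isBigO {e : Matrix ι ι ℝ} (he : e.det ≠ 0) (r : ℝ) :
    (fun t => (theta e t : ℂ) - 1) =O[atTop] fun t : ℝ => t ^ r := by
  set R : ℝ := max (Fintype.card ι + 1) (-r) with hR
  have hR1 : (Fintype.card ι : ℝ) + 1 ≤ R := le_max_left _ _
  have hR2 : -r ≤ R := le_max_right _ _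
  have hcard : (0 : ℝ) ≤ Fintype.card ι := by positivity
  refine Asymptotics.IsBigO.of_bound (R ^ R * Real.pi ^ (-R) * epsteinReal e R) ?_
  filter_upwards [eventually_ge_atTop 1] with t ht
  have ht0 : 0 < t := by linarith
  rw [← Complex.ofReal_one, ← Complex.ofReal_sub, Complex.norm_real, Real.norm_eq_abs,
    abs_of_nonneg (theta_sub_one_nonneg he ht0), Real.norm_eq_abs,
    abs_of_nonneg (Real.rpow_nonneg ht0.le _)]
  refine (theta_sub_one_le he (R := R) (by linarith) ht0).trans ?_
  have := epsteinReal_nonneg e R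
  have hR0 : 0 ≤ R := by linarith
  gcongr
  linarith

/-- The pair of theta functions attached to `e` and its dual. -/
noncomputable def thetaPair [Nonempty ι] (e : Matrix ι ι ℝ) (he : e.det ≠ 0) : WeakFEPair ℂ where
  f t := theta e t
  g t := theta (e⁻¹)ᵀ t
  k := (Fintype.card ι : ℝ) / 2
  ε := (|e.det|⁻¹ : ℝ)
  f₀ := 1
  g₀ := 1
  hf_int := (Complex.continuous_ofReal.comp_continuousOn
    (continuousOn_theta he)).locallyIntegrableOn measurableSet_Ioi
  hg_int := (Complex.continuous_ofReal.comp_continuousOn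
    (continuousOn_theta (det_inv_transpose_ne_zero he))).locallyIntegrableOn measurableSet_Ioi
  hk := by have := Fintype.card_pos (α := ι); positivity
  hε := by
    rw [Complex.ofReal_ne_zero]
    positivity
  h_feq := by
    intro x hx
    rw [theta_one_div he hx, smul_eq_mul]
    push_cast
    ring
  hf_top := theta_sub_one_isBigO he
  hg_top := theta_sub_one_isBigO (det_inv_transpose_ne_zero he)

variable [Nonempty ι]

/-- The completed Epstein zeta function, continued to `ℂ`. -/
noncomputable def epsteinLambda (e : Matrix ι ι ℝ) (he : e.det ≠ 0) : ℂ → ℂ := (thetaPair e he).Λ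

/-- Mellin transform of theta − 1, term by term. The zero vector has no effect on either side,
because `0 ^ (-s) = 0` when `s ≠ 0`. -/
lemma hasSum_epsteinLambda {e : Matrix ι ι ℝ} (he : e.det ≠ 0) {s : ℂ}
    (hs : Fintype.card ι < 2 * s.re) :
    HasSum (fun v : ι → ℤ => (Real.pi : ℂ) ^ (-s) * Complex.Gamma s *
      ((qf e (toR v) : ℝ) : ℂ) ^ (-s)) (epsteinLambda e he s) := by
  have hcard : (0 : ℝ) ≤ Fintype.card ι := by positivity
  have hs0 : 0 < s.re := by linarith
  have hm := ((thetaPair e he).hasMellin (s := s) (by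
    show (Fintype.card ι : ℝ) / 2 < s.re
    linarith)).2
  rw [epsteinLambda, ← hm]
  have := hasSum_mellin_pi_mul₀ (a := fun _ : ι → ℤ => (1 : ℂ)) (p := fun v => qf e (toR v))
    (F := fun t => (thetaPair e he).f t - (thetaPair e he).f₀) (s := s)
    (fun v => qf_nonneg _ _) hs0 (fun t ht => ?_) ?_
  · refine this.congr_fun fun v => ?_
    rw [Complex.cpow_neg (qf e (toR v) : ℂ) s, mul_one, div_eq_mul_inv]
  · have h := (Complex.hasSum_ofReal.2 (hasSum_theta_sub_one he ht))
    have h' : ((theta e t - 1 : ℝ) : ℂ) = (thetaPair e he).f t - (thetaPair e he).f₀ := by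
      simp [thetaPair]
    rw [← h']
    refine h.congr_fun fun v => ?_
    by_cases hv : v = 0
    · simp [hv]
    · rw [if_neg (qf_toR_pos he hv).ne', if_neg hv, one_mul]
      congr 2
      ring
  · refine (summable_qf_rpow he hs).congr fun v => ?_
    rw [norm_one, Real.rpow_neg (qf_nonneg _ _), one_div]

/-- The entire part of the completed Epstein zeta function. -/
noncomputable def epsteinLambda₀ (e : Matrix ι ι ℝ) (he : e.det ≠ 0) : ℂ → ℂ := (thetaPair e he).Λ₀

lemma differentiable_epsteinLambda₀ {e : Matrix ι ι ℝ} (he : e.det ≠ 0) :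
    Differentiable ℂ (epsteinLambda₀ e he) := (thetaPair e he).differentiable_Λ₀

lemma epsteinLambda_eq {e : Matrix ι ι ℝ} (he : e.det ≠ 0) (s : ℂ) :
    epsteinLambda e he s = epsteinLambda₀ e he s - 1 / s -
      (|e.det|⁻¹ : ℝ) / ((Fintype.card ι : ℂ) / 2 - s) := by
  rw [epsteinLambda, epsteinLambda₀, WeakFEPair.Λ]
  simp [thetaPair]

/-- A bound for the entire part by the values of the zeta function at a real point. -/
lemma norm_epsteinLambda₀_le {e : Matrix ι ι ℝ} (he : e.det ≠ 0) {R : ℝ}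
    (hR : Fintype.card ι < 2 * R) {s : ℂ} (h1 : s.re + 1 ≤ R)
    (h2 : (Fintype.card ι : ℝ) / 2 + 1 ≤ R + s.re) :
    ‖epsteinLambda₀ e he s‖ ≤ R ^ R * Real.pi ^ (-R) *
      (epsteinReal e R + |e.det|⁻¹ * epsteinReal (e⁻¹)ᵀ R) := by
  have he' := det_inv_transpose_ne_zero he
  set C := R ^ R * Real.pi ^ (-R) with hC
  have hcard : (0 : ℝ) ≤ Fintype.card ι := by positivity
  have hR0 : 0 < R := by linarith
  have hC0 : 0 ≤ C := by positivity
  have hA := epsteinReal_nonneg e R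
  have hB := epsteinReal_nonneg (e⁻¹)ᵀ R
  set A := C * epsteinReal e R
  set B := C * (|e.det|⁻¹ * epsteinReal (e⁻¹)ᵀ R)
  have hA0 : 0 ≤ A := by positivity
  have hB0 : 0 ≤ B := by positivity
  -- A majorant of the Mellin integrand. On t > 1 the hypothesis Re s + 1 ≤ R leaves at most t^{−2}.
  -- On t < 1 the functional equation passes to the dual theta function at 1/t, and the second
  -- hypothesis makes the resulting exponent of t nonnegative. The integral of `G` is exactly B + A.
  let G : ℝ → ℝ := fun t => if t ≤ 1 then B else A * t ^ (-2 : ℝ)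
  have hGint1 : IntegrableOn G (Ioc 0 1) := by
    refine (integrableOn_const (C := B) (by simp)).congr_fun (fun t ht => ?_) measurableSet_Ioc
    simp [G, ht.2]
  have hGint2 : IntegrableOn G (Ioi 1) := by
    have h0 : IntegrableOn (fun t : ℝ => A * t ^ (-2 : ℝ)) (Ioi 1) :=
      (integrableOn_Ioi_rpow_of_lt (by norm_num : (-2 : ℝ) < -1) one_pos).const_mul A
    refine h0.congr_fun (fun t ht => ?_) measurableSet_Ioi
    simp [G, not_le.2 (show (1 : ℝ) < t from ht)]
  have hGval : ∫ t in Ioi 0, G t = B + A := by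
    rw [← Ioc_union_Ioi_eq_Ioi zero_le_one, setIntegral_union (by
      rw [Set.disjoint_left]; intro t ht ht'; exact absurd ht.2 (not_le.2 ht')) measurableSet_Ioi hGint1 hGint2]
    congr 1
    · rw [setIntegral_congr_fun (g := fun _ => B) measurableSet_Ioc (fun t ht => by simp [G, ht.2])]
      simp
    · rw [setIntegral_congr_fun (g := fun t => A * t ^ (-2 : ℝ)) measurableSet_Ioi (fun t ht => by
        simp [G, not_le.2 (show (1 : ℝ) < t from ht)]), integral_const_mul,
        integral_Ioi_rpow_of_lt (by norm_num) one_pos]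
      norm_num
  have hGint : IntegrableOn G (Ioi 0) := by
    rw [← Ioc_union_Ioi_eq_Ioi zero_le_one]
    exact hGint1.union hGint2
  rw [epsteinLambda₀, WeakFEPair.Λ₀, mellin, hC]
  refine (norm_integral_le_of_norm_le hGint ?_).trans (le_of_eq ?_)
  swap
  · rw [hGval]
    show C * _ + C * _ = _
    ring
  refine (ae_restrict_iff' measurableSet_Ioi).2 (Eventually.of_forall fun t ht => ?_)
  have ht0 : (0 : ℝ) < t := ht
  rw [norm_smul, Complex.norm_cpow_eq_rpow_re_of_pos ht0, Complex.sub_re, Complex.one_re]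
  simp only [WeakFEPair.f_modif, Pi.add_apply, indicator, mem_Ioi, mem_Ioo, G]
  rcases lt_trichotomy t 1 with h | h | h
  · rw [if_neg (by linarith), if_pos ⟨ht0, h⟩, zero_add, if_pos h.le]
    have hf : theta e t = |e.det|⁻¹ * t ^ (-((Fintype.card ι : ℝ) / 2)) * theta (e⁻¹)ᵀ (1 / t) := by
      have := theta_one_div he (show 0 < 1 / t by positivity)
      rw [one_div_one_div] at this
      rw [this, one_div, Real.inv_rpow ht0.le, Real.rpow_neg ht0.le]
    have hle := theta_sub_one_le he' hR (show 0 < 1 / t by positivity)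
    have hnn := theta_sub_one_nonneg he' (show 0 < 1 / t by positivity)
    have : (thetaPair e he).f t - ((thetaPair e he).ε * ((t ^ (-(thetaPair e he).k) : ℝ) : ℂ)) •
        (thetaPair e he).g₀ = ((|e.det|⁻¹ * t ^ (-((Fintype.card ι : ℝ) / 2)) *
          (theta (e⁻¹)ᵀ (1 / t) - 1) : ℝ) : ℂ) := by
      simp only [thetaPair, smul_eq_mul, mul_one]
      rw [hf]
      push_cast
      ring
    rw [this, Complex.norm_real, Real.norm_eq_abs, abs_of_nonneg (by positivity)]
    calc _ ≤ t ^ (s.re - 1) * (|e.det|⁻¹ * t ^ (-((Fintype.card ι : ℝ) / 2)) *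
          (C * epsteinReal (e⁻¹)ᵀ R * (1 / t) ^ (-R))) := by gcongr
      _ = B * (t ^ (s.re - 1) * t ^ (-((Fintype.card ι : ℝ) / 2)) * t ^ R) := by
          rw [one_div, Real.inv_rpow ht0.le, Real.rpow_neg ht0.le R, inv_inv]; ring
      _ = B * t ^ (s.re - 1 + -((Fintype.card ι : ℝ) / 2) + R) := by
          rw [Real.rpow_add ht0, Real.rpow_add ht0]
      _ ≤ B * 1 := by
          gcongr
          exact Real.rpow_le_one ht0.le h.le (by linarith)
      _ = B := mul_one B
  · subst h
    simp
    exact hB0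
  · rw [if_pos h, if_neg (by intro hh; linarith [hh.2]), add_zero, if_neg (by linarith)]
    have hle := theta_sub_one_le he hR ht0
    have hnn := theta_sub_one_nonneg he ht0
    have : (thetaPair e he).f t - (thetaPair e he).f₀ = ((theta e t - 1 : ℝ) : ℂ) := by
      simp [thetaPair]
    rw [this, Complex.norm_real, Real.norm_eq_abs, abs_of_nonneg hnn]
    calc _ ≤ t ^ (s.re - 1) * (C * epsteinReal e R * t ^ (-R)) := by gcongr
      _ = A * t ^ (s.re - 1 + -R) := by rw [Real.rpow_add ht0]; ring
      _ ≤ _ := by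
        gcongr
        · exact h.le
        · linarith

end Epstein

end ThetaLift

namespace ThetaLift

open Matrix MeasureTheory Set Filter Topology

/-! ### Meromorphic continuation -/

section MeroCont

/-- Identity theorem: the difference has order ⊤ at σ + 1, and on a connected set a meromorphic
function of order ⊤ at one point has order ⊤ everywhere. -/
lemma eventuallyEq_nhdsNE_of_eq_halfPlane {f g : ℂ → ℂ} (hf : MeromorphicOn f univ)
    (hg : MeromorphicOn g univ) {σ : ℝ} (h : ∀ s : ℂ, σ < s.re → f s = g s) (z : ℂ) :
    f =ᶠ[𝓝[≠] z] g := by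
  have hs : MeromorphicOn (f - g) univ := hf.sub hg
  have h0 : meromorphicOrderAt (f - g) ((σ + 1 : ℝ) : ℂ) = ⊤ := by
    rw [meromorphicOrderAt_eq_top_iff]
    have hopen : IsOpen {s : ℂ | σ < s.re} := isOpen_lt continuous_const Complex.continuous_re
    have hmem : ((σ + 1 : ℝ) : ℂ) ∈ {s : ℂ | σ < s.re} := by simp
    filter_upwards [nhdsWithin_le_nhds (hopen.mem_nhds hmem)] with s hs
    simp [h s hs]
  have h1 : meromorphicOrderAt (f - g) z = ⊤ := by
    by_contra hne
    have := (hs.exists_meromorphicOrderAt_ne_top_iff_forall isConnected_univ).1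
      ⟨⟨z, mem_univ z⟩, hne⟩ ⟨((σ + 1 : ℝ) : ℂ), mem_univ _⟩
    exact this h0
  rw [meromorphicOrderAt_eq_top_iff] at h1
  filter_upwards [h1] with s hs
  exact sub_eq_zero.1 hs

lemma eventuallyEq_codiscrete_of_eq_halfPlane {f g : ℂ → ℂ} (hf : MeromorphicOn f univ)
    (hg : MeromorphicOn g univ) {σ : ℝ} (h : ∀ s : ℂ, σ < s.re → f s = g s) :
    f =ᶠ[codiscrete ℂ] g := by
  refine mem_codiscreteWithin_iff_forall_mem_nhdsNE.2 fun z _ => ?_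
  filter_upwards [eventuallyEq_nhdsNE_of_eq_halfPlane hf hg h z] with s hs using Or.inl hs

/-- A function meromorphic on `ℂ` and analytic on a right half plane gives the meromorphic
continuation of its restriction to the half plane. -/
structure Continues (F f : ℂ → ℂ) (σ : ℝ) : Prop where
  mero : MeromorphicOn F univ
  analyticAt : ∀ s : ℂ, σ < s.re → AnalyticAt ℂ F s
  eq : ∀ s : ℂ, σ < s.re → F s = f s

namespace Continues

variable {F f : ℂ → ℂ} {σ : ℝ}

lemma nf_eq (h : Continues F f σ) {s : ℂ} (hs : AnalyticAt ℂ F s) :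
    toMeromorphicNFOn F univ s = F s := by
  rw [toMeromorphicNFOn_eq_toMeromorphicNFAt h.mero (mem_univ s),
    toMeromorphicNFAt_eq_self.2 hs.meromorphicNFAt]

lemma hasMeroCont (h : Continues F f σ) : HasMeroCont f :=
  ⟨toMeromorphicNFOn F univ, meromorphicNFOn_toMeromorphicNFOn F univ, σ, fun s hs => by
    rw [h.nf_eq (h.analyticAt s hs), h.eq s hs]⟩

lemma meroCont_nf (h : Continues F f σ) : MeromorphicNFOn (meroCont f) univ := by
  rw [meroCont, dif_pos h.hasMeroCont]
  exact h.hasMeroCont.choose_spec.1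

lemma eventuallyEq_nhdsNE (h : Continues F f σ) (z : ℂ) : meroCont f =ᶠ[𝓝[≠] z] F := by
  have h1 := h.meroCont_nf
  -- The half plane belonging to the chosen continuation is not specified, so the comparison takes
  -- place on the smaller of the two.
  obtain ⟨σ', h2⟩ : ∃ σ' : ℝ, ∀ s : ℂ, σ' < s.re → meroCont f s = f s := by
    rw [meroCont, dif_pos h.hasMeroCont]
    exact h.hasMeroCont.choose_spec.2
  refine eventuallyEq_nhdsNE_of_eq_halfPlane h1.meromorphicOn h.mero (σ := max σ σ')
    (fun s hs => ?_) z
  rw [h2 s ((le_max_right _ _).trans_lt hs), h.eq s ((le_max_left _ _).trans_lt hs)]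

/-- Normal form repairs removable singularities: the value of `F` at `z` plays no role, only its
agreement near `z` with some analytic `G`. This is what gives the correct values at s = 0, where the
explicit quotients have poles in numerator and denominator. -/
lemma eventuallyEq_nhds (h : Continues F f σ) {G : ℂ → ℂ} {z : ℂ} (hG : AnalyticAt ℂ G z)
    (hFG : F =ᶠ[𝓝[≠] z] G) : meroCont f =ᶠ[𝓝 z] G :=
  (MeromorphicNFAt.eventuallyEq_nhdsNE_iff_eventuallyEq_nhds (h.meroCont_nf (mem_univ z))
    hG.meromorphicNFAt).1 ((h.eventuallyEq_nhdsNE z).trans hFG)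

lemma analyticAt_meroCont (h : Continues F f σ) {G : ℂ → ℂ} {z : ℂ} (hG : AnalyticAt ℂ G z)
    (hFG : F =ᶠ[𝓝[≠] z] G) : AnalyticAt ℂ (meroCont f) z :=
  hG.congr (h.eventuallyEq_nhds hG hFG).symm

lemma meroCont_eq (h : Continues F f σ) {z : ℂ} (hF : AnalyticAt ℂ F z) : meroCont f z = F z :=
  (h.eventuallyEq_nhds hF EventuallyEq.rfl).eq_of_nhds

lemma meroCont_eq_self (h : Continues F f σ) {z : ℂ} (hz : σ < z.re) : meroCont f z = f z := by
  rw [h.meroCont_eq (h.analyticAt z hz), h.eq z hz]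

end Continues

end MeroCont

/-! ### Holomorphic dependence of integrals on a parameter -/

/-- Cauchy's estimate on circles of radius r/4 around points of the half ball bounds the derivative
by g/(r/4), so a bound on `F` alone justifies differentiation under the integral. -/
lemma differentiableAt_integral_of_bound {α : Type*} [MeasurableSpace α] {μ : Measure α}
    {F : ℂ → α → ℂ} {g : α → ℝ} {s₀ : ℂ} {r : ℝ} (hr : 0 < r)
    (hm : ∀ s ∈ Metric.ball s₀ r, AEStronglyMeasurable (F s) μ) (hg : Integrable g μ)
    (hd : ∀ᵐ a ∂μ, DifferentiableOn ℂ (fun s => F s a) (Metric.ball s₀ r) ∧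
      ∀ s ∈ Metric.ball s₀ r, ‖F s a‖ ≤ g a) :
    DifferentiableAt ℂ (fun s => ∫ a, F s a ∂μ) s₀ := by
  have hs₀ : s₀ ∈ Metric.ball s₀ r := Metric.mem_ball_self hr
  have hda : ∀ᵐ a ∂μ, ∀ s ∈ Metric.ball s₀ r, HasDerivAt (fun s => F s a) (deriv (fun s => F s a) s) s := by
    filter_upwards [hd] with a ha s hs
    exact ((ha.1 s hs).differentiableAt (Metric.isOpen_ball.mem_nhds hs)).hasDerivAt
  refine (hasDerivAt_integral_of_dominated_loc_of_deriv_le (F := F)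
    (F' := fun s a => deriv (fun s => F s a) s) (s := Metric.ball s₀ (r / 2))
    (bound := fun a => g a / (r / 4)) (Metric.ball_mem_nhds s₀ (by linarith)) ?_ ?_ ?_ ?_ ?_ ?_).2.differentiableAt
  · filter_upwards [Metric.ball_mem_nhds s₀ hr] with s hs using hm s hs
  · refine hg.mono' (hm s₀ hs₀) ?_
    filter_upwards [hd] with a ha using ha.2 s₀ hs₀
  -- The derivative is measurable in the parameter as the limit of difference quotients along s₀ +
  -- r/(n+2), points which stay in the open ball.
  · have hseq : ∀ n : ℕ, s₀ + ((r / (n + 2) : ℝ) : ℂ) ∈ Metric.ball s₀ r := by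
      intro n
      rw [Metric.mem_ball, dist_eq_norm, add_sub_cancel_left, Complex.norm_real, Real.norm_eq_abs,
        abs_of_pos (by positivity)]
      exact div_lt_self hr (by linarith [(Nat.cast_nonneg n : (0 : ℝ) ≤ n)])
    refine aestronglyMeasurable_of_tendsto_ae (u := atTop) (f := fun (n : ℕ) a =>
      (((r / (n + 2) : ℝ) : ℂ))⁻¹ • (F (s₀ + ((r / (n + 2) : ℝ) : ℂ)) a - F s₀ a)) (fun n => ?_) ?_
    · exact ((hm _ (hseq n)).sub (hm _ hs₀)).const_smul (((r / (n + 2) : ℝ) : ℂ))⁻¹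
    · filter_upwards [hda] with a ha
      have h1 := (hasDerivAt_iff_tendsto_slope_zero.1 (ha s₀ hs₀))
      refine h1.comp (tendsto_nhdsWithin_iff.2 ⟨?_, Eventually.of_forall fun n => ?_⟩)
      · rw [← Complex.ofReal_zero]
        refine (Complex.continuous_ofReal.tendsto 0).comp ?_
        refine Tendsto.div_atTop tendsto_const_nhds ?_
        exact tendsto_atTop_add_const_right _ _ tendsto_natCast_atTop_atTop
      · simp only [mem_compl_iff, mem_singleton_iff, Complex.ofReal_eq_zero]
        positivity
  · filter_upwards [hd] with a ha s hs
    have hsub : Metric.closedBall s (r / 4) ⊆ Metric.ball s₀ r := by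
      intro z hz
      rw [Metric.mem_closedBall] at hz
      rw [Metric.mem_ball] at hs ⊢
      linarith [dist_triangle z s s₀]
    refine Complex.norm_deriv_le_of_forall_mem_sphere_norm_le (by linarith) ?_ fun z hz =>
      ha.2 z (hsub (Metric.sphere_subset_closedBall hz))
    refine DifferentiableOn.diffContOnCl (ha.1.mono ?_)
    rw [closure_ball _ (by linarith : r / 4 ≠ 0)]
    exact hsub
  · exact hg.div_const _
  · filter_upwards [hda] with a ha s hs
    exact ha s (Metric.ball_subset_ball (by linarith) hs)

lemma analyticAt_integral_of_bound {α : Type*} [MeasurableSpace α] {μ : Measure α}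
    {F : ℂ → α → ℂ} {g : α → ℝ} {s₀ : ℂ} {r : ℝ} (hr : 0 < r)
    (hm : ∀ s ∈ Metric.ball s₀ r, AEStronglyMeasurable (F s) μ) (hg : Integrable g μ)
    (hd : ∀ᵐ a ∂μ, DifferentiableOn ℂ (fun s => F s a) (Metric.ball s₀ r) ∧
      ∀ s ∈ Metric.ball s₀ r, ‖F s a‖ ≤ g a) :
    AnalyticAt ℂ (fun s => ∫ a, F s a ∂μ) s₀ := by
  refine DifferentiableOn.analyticAt (s := Metric.ball s₀ (r / 2)) (fun s hs => ?_)
    (Metric.ball_mem_nhds s₀ (by linarith))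
  refine (differentiableAt_integral_of_bound (s₀ := s) (r := r / 2) (by linarith) (fun z hz => hm z ?_)
    hg ?_).differentiableWithinAt
  · rw [Metric.mem_ball] at *
    linarith [dist_triangle z s s₀]
  · have hsub : Metric.ball s (r / 2) ⊆ Metric.ball s₀ r := by
      intro z hz
      rw [Metric.mem_ball] at *
      linarith [dist_triangle z s s₀]
    filter_upwards [hd] with a ha
    exact ⟨ha.1.mono hsub, fun z hz => ha.2 z (hsub hz)⟩

/-! ### The completed zeta functions -/

lemma completedZeta_ne_zero {s : ℂ} (hs : 1 < s.re) : completedRiemannZeta s ≠ 0 := by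
  intro h
  have hs0 : s ≠ 0 := by rintro rfl; simp at hs; linarith
  have h1 := riemannZeta_def_of_ne_zero hs0
  rw [h, zero_div] at h1
  exact riemannZeta_ne_zero_of_one_le_re hs.le h1

lemma analyticAt_completedZeta {s : ℂ} (hs : s ≠ 0) (hs' : s ≠ 1) :
    AnalyticAt ℂ completedRiemannZeta s := by
  have : completedRiemannZeta = fun s => completedRiemannZeta₀ s - 1 / s - 1 / (1 - s) :=
    funext completedRiemannZeta_eq
  rw [this]
  have h1 : (1 : ℂ) - s ≠ 0 := sub_ne_zero.2 hs'.symm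
  have h0 : AnalyticAt ℂ completedRiemannZeta₀ s := differentiable_completedZeta₀.analyticAt s
  fun_prop (disch := assumption)

lemma meromorphicAt_completedZeta (s : ℂ) : MeromorphicAt completedRiemannZeta s := by
  have : completedRiemannZeta = fun s => completedRiemannZeta₀ s - 1 / s - 1 / (1 - s) :=
    funext completedRiemannZeta_eq
  rw [this]
  have h0 : MeromorphicAt completedRiemannZeta₀ s :=
    (differentiable_completedZeta₀.analyticAt s).meromorphicAt
  fun_prop

section EpsteinEisenstein

variable {ι : Type*} [Fintype ι] [DecidableEq ι] [Nonempty ι] {e : Matrix ι ι ℝ}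

lemma analyticAt_epsteinLambda (he : e.det ≠ 0) {s : ℂ} (hs : s ≠ 0)
    (hs' : s ≠ (Fintype.card ι : ℂ) / 2) : AnalyticAt ℂ (epsteinLambda e he) s := by
  rw [funext (epsteinLambda_eq he)]
  have h1 : (Fintype.card ι : ℂ) / 2 - s ≠ 0 := sub_ne_zero.2 hs'.symm
  have h0 : AnalyticAt ℂ (epsteinLambda₀ e he) s := (differentiable_epsteinLambda₀ he).analyticAt s
  fun_prop (disch := assumption)

lemma meromorphicAt_epsteinLambda (he : e.det ≠ 0) (s : ℂ) :
    MeromorphicAt (epsteinLambda e he) s := by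
  rw [funext (epsteinLambda_eq he)]
  have h0 : MeromorphicAt (epsteinLambda₀ e he) s :=
    ((differentiable_epsteinLambda₀ he).analyticAt s).meromorphicAt
  fun_prop

/-- The normalized zeta function `(2 ζ(2s))⁻¹ ∑_{v ≠ 0} |v e|^{-2s}`, continued to `ℂ`. -/
noncomputable def epsteinEis (e : Matrix ι ι ℝ) (he : e.det ≠ 0) (s : ℂ) : ℂ :=
  epsteinLambda e he s / (2 * completedRiemannZeta (2 * s))

lemma meromorphicAt_completedZeta_two_mul (s : ℂ) :
    MeromorphicAt (fun s => completedRiemannZeta (2 * s)) s :=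
  (meromorphicAt_completedZeta (2 * s)).comp_analyticAt (f := completedRiemannZeta) (by fun_prop)

lemma meromorphicOn_epsteinEis (he : e.det ≠ 0) : MeromorphicOn (epsteinEis e he) univ := by
  intro s _
  have h1 := meromorphicAt_epsteinLambda he s
  have h2 := meromorphicAt_completedZeta_two_mul s
  unfold epsteinEis
  fun_prop

lemma analyticAt_epsteinEis (he : e.det ≠ 0) {s : ℂ} (hs : s ≠ 0) (h2 : s ≠ 1 / 2)
    (hs' : s ≠ (Fintype.card ι : ℂ) / 2) (hz : completedRiemannZeta (2 * s) ≠ 0) :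
    AnalyticAt ℂ (epsteinEis e he) s := by
  have h1 := analyticAt_epsteinLambda he hs hs'
  have h3 : AnalyticAt ℂ (fun s => completedRiemannZeta (2 * s)) s := by
    refine AnalyticAt.fun_comp (analyticAt_completedZeta ?_ ?_) (by fun_prop)
    · simpa using hs
    · intro h
      exact h2 (by linear_combination h / 2)
  exact h1.div (analyticAt_const.mul h3) (mul_ne_zero two_ne_zero hz)

lemma analyticAt_epsteinEis_of_re (he : e.det ≠ 0) {s : ℂ} (hs : (1 : ℝ) / 2 < s.re)
    (hs' : s ≠ (Fintype.card ι : ℂ) / 2) : AnalyticAt ℂ (epsteinEis e he) s := by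
  refine analyticAt_epsteinEis he ?_ ?_ hs' (completedZeta_ne_zero ?_)
  · rintro rfl; simp at hs; linarith
  · rintro rfl; norm_num at hs
  · simp; linarith

/-- Near `0` the normalized zeta function is analytic, with value `1` at `0`. -/
lemma exists_analytic_epsteinEis_zero (he : e.det ≠ 0) :
    ∃ G : ℂ → ℂ, AnalyticAt ℂ G 0 ∧ G 0 = 1 ∧ epsteinEis e he =ᶠ[𝓝[≠] 0] G := by
  have hc : (Fintype.card ι : ℂ) / 2 ≠ 0 := by simp
  -- `N` and `M` are s Λ(s) and 2s ξ(2s) with the simple poles at 0 cancelled. Both equal −1 at 0,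
  -- so their quotient tends to 1.
  let N : ℂ → ℂ := fun s => s * epsteinLambda₀ e he s - 1 -
    s * ((|e.det|⁻¹ : ℝ) / ((Fintype.card ι : ℂ) / 2 - s))
  let M : ℂ → ℂ := fun s => 2 * s * completedRiemannZeta₀ (2 * s) - 1 - 2 * s * (1 / (1 - 2 * s))
  have h0 : AnalyticAt ℂ (epsteinLambda₀ e he) 0 := (differentiable_epsteinLambda₀ he).analyticAt 0
  have h1 : AnalyticAt ℂ (fun s => completedRiemannZeta₀ (2 * s)) 0 :=
    (differentiable_completedZeta₀.comp (by fun_prop : Differentiable ℂ fun s : ℂ => 2 * s)).analyticAt 0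
  have hN : AnalyticAt ℂ N 0 := by
    have : (Fintype.card ι : ℂ) / 2 - 0 ≠ 0 := by simp
    fun_prop (disch := assumption)
  have hM : AnalyticAt ℂ M 0 := by
    have : (1 : ℂ) - 2 * 0 ≠ 0 := by simp
    fun_prop (disch := assumption)
  have hM0 : M 0 = -1 := by simp [M]
  refine ⟨fun s => N s / M s, hN.div hM (by rw [hM0]; norm_num), ?_, ?_⟩
  · show N 0 / M 0 = 1
    rw [hM0]; simp [N]
  · filter_upwards [self_mem_nhdsWithin] with s hs
    have hs' : s ≠ 0 := hs
    have h3 : N s = s * epsteinLambda e he s := by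
      simp only [N]
      rw [epsteinLambda_eq]
      field_simp
    have h4 : M s = s * (2 * completedRiemannZeta (2 * s)) := by
      simp only [M]
      rw [completedRiemannZeta_eq]
      generalize (1 : ℂ) / (1 - 2 * s) = u
      field_simp
    rw [epsteinEis, h3, h4, mul_div_mul_left _ _ hs']

/-- In the domain of convergence. -/
lemma hasSum_epsteinEis (he : e.det ≠ 0) {s : ℂ} (hs : Fintype.card ι < 2 * s.re)
    (hs1 : 1 < 2 * s.re) :
    HasSum (fun v : ι → ℤ => (2 * riemannZeta (2 * s))⁻¹ * ((qf e (toR v) : ℝ) : ℂ) ^ (-s))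
      (epsteinEis e he s) := by
  have h := (hasSum_epsteinLambda he hs).div_const (2 * completedRiemannZeta (2 * s))
  have hs0 : 2 * s ≠ 0 := by
    intro h0
    have := congrArg Complex.re h0
    simp at this
    linarith
  have hG : Complex.Gammaℝ (2 * s) ≠ 0 := Complex.Gammaℝ_ne_zero_of_re_pos (by simp; linarith)
  have hx : completedRiemannZeta (2 * s) =
      (Real.pi : ℂ) ^ (-s) * Complex.Gamma s * riemannZeta (2 * s) := by
    rw [riemannZeta_def_of_ne_zero hs0, mul_div_assoc', eq_div_iff hG, Complex.Gammaℝ_def,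
      show -(2 * s) / 2 = -s by ring, show 2 * s / 2 = s by ring]
    ring
  have hG' : (Real.pi : ℂ) ^ (-s) * Complex.Gamma s ≠ 0 := by
    rw [Complex.Gammaℝ_def, show -(2 * s) / 2 = -s by ring, show 2 * s / 2 = s by ring] at hG
    exact hG
  refine h.congr_fun fun v => ?_
  rw [hx]
  generalize (Real.pi : ℂ) ^ (-s) * Complex.Gamma s = u at *
  rw [show 2 * (u * riemannZeta (2 * s)) = u * (2 * riemannZeta (2 * s)) by ring,
    mul_div_mul_left _ _ hG', div_eq_inv_mul]

end EpsteinEisenstein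

end ThetaLift

namespace ThetaLift

open Matrix MeasureTheory Set Filter Topology UpperHalfPlane

/-! ### The Eisenstein series of `SL(2)` -/

section SLTwo

/-- The matrix with `|(m, n) e|² = |m + n τ|² / τ₂`. -/
noncomputable def tauMat (τ : ℍ) : Matrix (Fin 2) (Fin 2) ℝ :=
  !![(√τ.im)⁻¹, 0; τ.re * (√τ.im)⁻¹, √τ.im]

lemma sqrt_im_ne_zero (τ : ℍ) : √τ.im ≠ 0 := (Real.sqrt_pos.2 τ.im_pos).ne'

lemma tauMat_det (τ : ℍ) : (tauMat τ).det = 1 := by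
  simp [tauMat, Matrix.det_fin_two, sqrt_im_ne_zero]

lemma tauMat_det_ne (τ : ℍ) : (tauMat τ).det ≠ 0 := by simp [tauMat_det]

lemma qf_tauMat (τ : ℍ) (v : Fin 2 → ℝ) :
    qf (tauMat τ) v = ((v 0 + v 1 * τ.re) ^ 2 + (v 1 * τ.im) ^ 2) / τ.im := by
  have h := sqrt_im_ne_zero τ
  have h2 : √τ.im ^ 2 = τ.im := Real.sq_sqrt τ.im_pos.le
  have h3 := τ.im_ne_zero
  simp only [qf, tauMat, dotProduct, vecMul, Fin.sum_univ_two, Matrix.of_apply, Matrix.cons_val_zero,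
    Matrix.cons_val_one, Matrix.cons_val']
  simp
  generalize √τ.im = u at *
  rw [← h2]
  field_simp

lemma tauMat_dual (τ : ℍ) :
    ((tauMat τ)⁻¹)ᵀ = !![√τ.im, -(τ.re * (√τ.im)⁻¹); 0, (√τ.im)⁻¹] := by
  rw [Matrix.inv_def, tauMat_det, Ring.inverse_one, one_smul, tauMat, Matrix.adjugate_fin_two_of]
  ext i j
  fin_cases i <;> fin_cases j <;> simp

/-- For a 2 × 2 matrix of determinant one, passing to the inverse transpose is a quarter turn of the
lattice; the dual zeta values are therefore the original ones. -/
lemma qf_tauMat_dual (τ : ℍ) (v : Fin 2 → ℝ) :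
    qf ((tauMat τ)⁻¹)ᵀ v = qf (tauMat τ) ![v 1, -v 0] := by
  have h := sqrt_im_ne_zero τ
  have h2 : √τ.im ^ 2 = τ.im := Real.sq_sqrt τ.im_pos.le
  have h3 := τ.im_ne_zero
  rw [qf_tauMat, tauMat_dual]
  simp only [qf, dotProduct, vecMul, Fin.sum_univ_two, Matrix.of_apply, Matrix.cons_val_zero,
    Matrix.cons_val_one, Matrix.cons_val']
  simp
  generalize √τ.im = u at *
  rw [← h2]
  field_simp
  ring

/-- On the fundamental domain |τ| ≥ 1 and |τ₁| ≤ 1/2, so |m + nτ|² ≥ m² − |mn| + n² ≥ (m² + n²)/2.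
This reduces all forms to the standard one at the cost of a factor τ₂. -/
lemma le_qf_tauMat {τ : ℍ} (hτ : τ ∈ ModularGroup.fd) (v : Fin 2 → ℝ) :
    (2 * τ.im)⁻¹ * qf (1 : Matrix (Fin 2) (Fin 2) ℝ) v ≤ qf (tauMat τ) v := by
  obtain ⟨h1, h2⟩ := hτ
  have hy := τ.im_pos
  rw [qf_tauMat, le_div_iff₀ hy]
  have hq : qf (1 : Matrix (Fin 2) (Fin 2) ℝ) v = v 0 ^ 2 + v 1 ^ 2 := by
    simp [qf, dotProduct, sq]
  have h3 : (2 * τ.im)⁻¹ * qf (1 : Matrix (Fin 2) (Fin 2) ℝ) v * τ.im = (v 0 ^ 2 + v 1 ^ 2) / 2 := by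
    rw [hq]; field_simp
  rw [h3]
  have h4 : 1 ≤ τ.re ^ 2 + τ.im ^ 2 := by
    have : Complex.normSq τ = τ.re * τ.re + τ.im * τ.im := Complex.normSq_apply _
    nlinarith
  have h5 := abs_le.1 h2
  rcases le_total 0 (v 0 * v 1) with h | h
  · nlinarith [sq_nonneg (v 0 - v 1), sq_nonneg (v 1), mul_nonneg h (by linarith [h5.1] : 0 ≤ τ.re + 1 / 2),
      mul_nonneg (sq_nonneg (v 1)) (by linarith : 0 ≤ τ.re ^ 2 + τ.im ^ 2 - 1)]
  · nlinarith [sq_nonneg (v 0 + v 1), sq_nonneg (v 1), mul_nonneg (neg_nonneg.2 h) (by linarith [h5.2] : 0 ≤ 1 / 2 - τ.re),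
      mul_nonneg (sq_nonneg (v 1)) (by linarith : 0 ≤ τ.re ^ 2 + τ.im ^ 2 - 1)]

lemma half_le_im_of_mem_fd {τ : ℍ} (hτ : τ ∈ ModularGroup.fd) : 1 / 2 ≤ τ.im := by
  have := ModularGroup.three_le_four_mul_im_sq_of_mem_fd hτ
  have := τ.im_pos
  nlinarith

lemma epsteinReal_tauMat_le {τ : ℍ} (hτ : τ ∈ ModularGroup.fd) {R : ℝ} (hR : 1 < R) :
    epsteinReal (tauMat τ) R ≤ (2 * τ.im) ^ R * epsteinReal (1 : Matrix (Fin 2) (Fin 2) ℝ) R := by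
  have hy := τ.im_pos
  have h1 : ((1 : Matrix (Fin 2) (Fin 2) ℝ)).det ≠ 0 := by simp
  have hR' : (Fintype.card (Fin 2) : ℝ) < 2 * R := by simp; linarith
  rw [epsteinReal, epsteinReal, ← tsum_mul_left]
  refine Summable.tsum_le_tsum (fun v => ?_) (summable_qf_rpow (tauMat_det_ne τ) hR')
    ((summable_qf_rpow h1 hR').mul_left _)
  rcases eq_or_ne v 0 with rfl | hv
  · simp [Real.zero_rpow (by linarith : -R ≠ 0)]
  · have hp := qf_toR_pos h1 hv
    calc _ ≤ ((2 * τ.im)⁻¹ * qf (1 : Matrix (Fin 2) (Fin 2) ℝ) (toR v)) ^ (-R) :=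
          Real.rpow_le_rpow_of_nonpos (by positivity) (le_qf_tauMat hτ _) (by linarith)
      _ = _ := by
          rw [Real.mul_rpow (by positivity) hp.le, Real.rpow_neg (by positivity),
            Real.inv_rpow (by positivity), inv_inv]

lemma epsteinReal_tauMat_dual (τ : ℍ) (R : ℝ) :
    epsteinReal ((tauMat τ)⁻¹)ᵀ R = epsteinReal (tauMat τ) R := by
  let E : (Fin 2 → ℤ) ≃ (Fin 2 → ℤ) :=
    { toFun := fun v => ![v 1, -v 0]
      invFun := fun v => ![-v 1, v 0]
      left_inv := fun v => by ext i; fin_cases i <;> simp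
      right_inv := fun v => by ext i; fin_cases i <;> simp }
  rw [epsteinReal, epsteinReal, ← E.tsum_eq fun v => qf (tauMat τ) (toR v) ^ (-R)]
  refine tsum_congr fun v => ?_
  rw [qf_tauMat_dual]
  congr 2
  ext i; fin_cases i <;> simp [E]

lemma eisSL2Term_eq {s : ℂ} (τ : ℍ) (p : {p : ℤ × ℤ // p ≠ 0}) :
    eisSL2Term s τ p = ((qf (tauMat τ) (toR ![p.1.1, p.1.2]) : ℝ) : ℂ) ^ (-s) := by
  have hy := τ.im_pos
  have hv : (![p.1.1, p.1.2] : Fin 2 → ℤ) ≠ 0 := by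
    intro h
    apply p.2
    have h0 := congrFun h 0
    have h1 := congrFun h 1
    simp at h0 h1
    exact Prod.ext h0 h1
  have hq := qf_toR_pos (tauMat_det_ne τ) hv
  have hn : ‖(p.1.2 : ℂ) * (τ : ℂ) + (p.1.1 : ℂ)‖ ^ 2 = τ.im * qf (tauMat τ) (toR ![p.1.1, p.1.2]) := by
    rw [qf_tauMat, mul_div_cancel₀ _ hy.ne', ← Complex.normSq_eq_norm_sq, Complex.normSq_apply]
    simp
    ring
  have hn0 : 0 < ‖(p.1.2 : ℂ) * (τ : ℂ) + (p.1.1 : ℂ)‖ := by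
    have : 0 < ‖(p.1.2 : ℂ) * (τ : ℂ) + (p.1.1 : ℂ)‖ ^ 2 := by rw [hn]; positivity
    exact lt_of_le_of_ne (norm_nonneg _) fun h => by simp [← h] at this
  rw [eisSL2Term]
  have h2 : ((‖(p.1.2 : ℂ) * (τ : ℂ) + (p.1.1 : ℂ)‖ : ℝ) : ℂ) ^ (2 * s) =
      ((τ.im : ℝ) : ℂ) ^ s * ((qf (tauMat τ) (toR ![p.1.1, p.1.2]) : ℝ) : ℂ) ^ s := by
    rw [← Complex.mul_cpow_ofReal_nonneg hy.le hq.le, ← Complex.ofReal_mul, ← hn, Complex.ofReal_pow,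
      ← Complex.cpow_ofNat_mul' (n := 2) (by
        rw [Complex.arg_ofReal_of_nonneg hn0.le]; simpa using Real.pi_pos) (by
        rw [Complex.arg_ofReal_of_nonneg hn0.le]; simpa using Real.pi_pos.le)]
  have hys : ((τ.im : ℝ) : ℂ) ^ s ≠ 0 := by
    rw [Ne, Complex.cpow_eq_zero_iff]
    simp [hy.ne']
  rw [h2, Complex.cpow_neg, div_mul_eq_div_div, div_self hys, one_div]

/-- Nonzero pairs as nonzero vectors. -/
def pairEquiv : {p : ℤ × ℤ // p ≠ 0} ≃ {v : Fin 2 → ℤ // v ≠ 0} :=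
  (finTwoArrowEquiv ℤ).symm.subtypeEquiv fun p => by
    rw [not_iff_not]
    constructor
    · rintro rfl; ext i; fin_cases i <;> simp
    · intro h
      have h0 := congrFun h 0
      have h1 := congrFun h 1
      simp at h0 h1
      exact Prod.ext h0 h1

lemma zero_cpow_neg_qf {ι : Type*} [Fintype ι] (e : Matrix ι ι ℝ) {s : ℂ} (hs : s ≠ 0) :
    ((qf e (toR (0 : ι → ℤ)) : ℝ) : ℂ) ^ (-s) = 0 := by
  rw [toR_zero, qf_zero, Complex.ofReal_zero, Complex.zero_cpow (neg_ne_zero.2 hs)]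

lemma hasSum_eisSL2Term {s : ℂ} (hs : 1 < s.re) (τ : ℍ) :
    HasSum (eisSL2Term s τ)
      (2 * riemannZeta (2 * s) * epsteinEis (tauMat τ) (tauMat_det_ne τ) s) := by
  have hs0 : s ≠ 0 := by rintro rfl; simp at hs; linarith
  have hz : 2 * riemannZeta (2 * s) ≠ 0 := mul_ne_zero two_ne_zero
    (riemannZeta_ne_zero_of_one_le_re (by simp; linarith))
  have h := (hasSum_epsteinEis (tauMat_det_ne τ) (s := s) (by simp; linarith)
    (by linarith)).mul_left (2 * riemannZeta (2 * s))
  simp only [mul_inv_cancel_left₀ hz] at h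
  rw [← pairEquiv.symm.hasSum_iff]
  rw [← hasSum_subtype_iff_of_support_subset (s := {v : Fin 2 → ℤ | v ≠ 0})] at h
  · refine h.congr_fun fun v => ?_
    rw [Function.comp, eisSL2Term_eq]
    congr 4
    ext i
    fin_cases i <;> simp [pairEquiv]
  · intro v hv h0
    rw [Function.mem_support] at hv
    rw [h0] at hv
    exact hv (zero_cpow_neg_qf _ hs0)

lemma eisSL2Series_eq {s : ℂ} (hs : 1 < s.re) (τ : ℍ) :
    eisSL2Series s τ = epsteinEis (tauMat τ) (tauMat_det_ne τ) s := by
  have hz : 2 * riemannZeta (2 * s) ≠ 0 := mul_ne_zero two_ne_zero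
    (riemannZeta_ne_zero_of_one_le_re (by simp; linarith))
  rw [eisSL2Series, (hasSum_eisSL2Term hs τ).tsum_eq, inv_mul_cancel_left₀ hz]

lemma continues_eisSL2 (τ : ℍ) :
    Continues (epsteinEis (tauMat τ) (tauMat_det_ne τ)) (fun s => eisSL2Series s τ) 1 where
  mero := meromorphicOn_epsteinEis _
  analyticAt s hs := analyticAt_epsteinEis_of_re _ (by linarith) (by
    rintro rfl
    norm_num at hs)
  eq s hs := (eisSL2Series_eq hs τ).symm

/-- Points at which the formula for the continued Eisenstein series has no vanishing denominator. -/
def goodPoints : Set ℂ := {s | s ≠ 0 ∧ s ≠ 1 / 2 ∧ s ≠ 1 ∧ completedRiemannZeta (2 * s) ≠ 0}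

lemma analyticAt_epsteinEis_tauMat {s : ℂ} (hs : s ∈ goodPoints) (τ : ℍ) :
    AnalyticAt ℂ (epsteinEis (tauMat τ) (tauMat_det_ne τ)) s :=
  analyticAt_epsteinEis _ hs.1 hs.2.1 (by simpa using hs.2.2.1) hs.2.2.2

lemma eisSL2_eq {s : ℂ} (hs : s ∈ goodPoints) (τ : ℍ) :
    eisSL2 s τ = epsteinEis (tauMat τ) (tauMat_det_ne τ) s :=
  (continues_eisSL2 τ).meroCont_eq (analyticAt_epsteinEis_tauMat hs τ)

lemma analyticAt_eisSL2 {s : ℂ} (hs : s ∈ goodPoints) (τ : ℍ) :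
    AnalyticAt ℂ (fun z => eisSL2 z τ) s :=
  (continues_eisSL2 τ).analyticAt_meroCont (analyticAt_epsteinEis_tauMat hs τ) EventuallyEq.rfl

lemma eisSL2_zero (τ : ℍ) : AnalyticAt ℂ (fun z => eisSL2 z τ) 0 ∧ eisSL2 0 τ = 1 := by
  obtain ⟨G, hG, h0, h⟩ := exists_analytic_epsteinEis_zero (tauMat_det_ne τ)
  exact ⟨(continues_eisSL2 τ).analyticAt_meroCont hG h,
    ((continues_eisSL2 τ).eventuallyEq_nhds hG h).eq_of_nhds.trans h0⟩

lemma mem_goodPoints_of_re {s : ℂ} (hs : 1 < s.re) : s ∈ goodPoints := by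
  refine ⟨?_, ?_, ?_, completedZeta_ne_zero (by simp; linarith)⟩ <;> rintro rfl <;> norm_num at hs

/-- ξ(2z) is meromorphic on ℂ and does not vanish for Re z > 1, hence is not identically zero and
has isolated zeros. -/
lemma eventually_mem_goodPoints (s : ℂ) : ∀ᶠ z in 𝓝[≠] s, z ∈ goodPoints := by
  have hm : MeromorphicOn (fun z => completedRiemannZeta (2 * z)) univ :=
    fun z _ => meromorphicAt_completedZeta_two_mul z
  have hz : ∀ᶠ z in 𝓝[≠] s, completedRiemannZeta (2 * z) ≠ 0 := by
    rcases (hm s (mem_univ s)).eventually_eq_zero_or_eventually_ne_zero with h | h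
    · exfalso
      have h1 : meromorphicOrderAt (fun z => completedRiemannZeta (2 * z)) s = ⊤ :=
        meromorphicOrderAt_eq_top_iff.2 h
      have h2 : meromorphicOrderAt (fun z => completedRiemannZeta (2 * z)) 2 ≠ ⊤ := by
        intro h3
        rw [meromorphicOrderAt_eq_top_iff] at h3
        have hopen : IsOpen {z : ℂ | 1 < z.re} := isOpen_lt continuous_const Complex.continuous_re
        have h4 : ∀ᶠ z in 𝓝[≠] (2 : ℂ), z ∈ {z : ℂ | 1 < z.re} :=
          nhdsWithin_le_nhds (hopen.mem_nhds (by simp))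
        obtain ⟨z, hz1, hz2⟩ := (h3.and h4).exists
        exact (mem_goodPoints_of_re hz2).2.2.2 hz1
      exact (hm.exists_meromorphicOrderAt_ne_top_iff_forall isConnected_univ).1
        ⟨⟨2, mem_univ _⟩, h2⟩ ⟨s, mem_univ s⟩ h1
    · exact h
  have hne : ∀ c : ℂ, ∀ᶠ z in 𝓝[≠] s, z ≠ c := by
    intro c
    rcases eq_or_ne s c with rfl | h
    · exact self_mem_nhdsWithin
    · exact nhdsWithin_le_nhds (isOpen_ne.mem_nhds h)
  filter_upwards [hz, hne 0, hne (1 / 2), hne 1] with z h1 h2 h3 h4 using ⟨h2, h3, h4, h1⟩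

/-! ### Growth at the cusp and measurability -/

lemma exists_bound_epsteinLambda₀_tauMat {K : Set ℂ} (hK : IsCompact K) (R₀ : ℝ) :
    ∃ R ≥ R₀, 0 ≤ R ∧ ∃ C : ℝ, ∀ s ∈ K, ∀ τ ∈ ModularGroup.fd,
      ‖epsteinLambda₀ (tauMat τ) (tauMat_det_ne τ) s‖ ≤ C * τ.im ^ R := by
  obtain ⟨A, hA⟩ := (hK.image Complex.continuous_re).isBounded.exists_norm_le
  have hA' : ∀ s ∈ K, |s.re| ≤ A := fun s hs => by
    simpa using hA _ ⟨s, hs, rfl⟩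
  -- With |Re s| ≤ A on K, R ≥ A + 2 gives both Re s + 1 ≤ R and 2 ≤ R + Re s, and R ≥ 2 gives
  -- convergence.
  set R := max R₀ (max (A + 2) 2) with hR
  have hR1 : A + 2 ≤ R := (le_max_left _ _).trans (le_max_right _ _)
  have hR2 : 2 ≤ R := (le_max_right _ _).trans (le_max_right _ _)
  set Z := epsteinReal (1 : Matrix (Fin 2) (Fin 2) ℝ) R with hZ
  refine ⟨R, le_max_left _ _, by linarith, R ^ R * Real.pi ^ (-R) * (2 * (2 ^ R * Z)),
    fun s hs τ hτ => ?_⟩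
  have hre := abs_le.1 (hA' s hs)
  refine (norm_epsteinLambda₀_le (tauMat_det_ne τ) (R := R) (by simp; linarith) (by linarith)
    (by simp; linarith)).trans ?_
  rw [epsteinReal_tauMat_dual, tauMat_det, abs_one, inv_one, one_mul, ← two_mul]
  have h1 := epsteinReal_tauMat_le hτ (show 1 < R by linarith)
  rw [Real.mul_rpow (by norm_num) τ.im_pos.le] at h1
  calc _ ≤ R ^ R * Real.pi ^ (-R) * (2 * (2 ^ R * τ.im ^ R * Z)) := by gcongr
    _ = _ := by ring

/-- Polynomial growth at the cusp, uniformly in `s` in compact sets. -/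
lemma exists_bound_epsteinEis_tauMat {K : Set ℂ} (hK : IsCompact K) (hK' : K ⊆ goodPoints) (R₀ : ℝ) :
    ∃ R ≥ R₀, ∃ C : ℝ, ∀ s ∈ K, ∀ τ ∈ ModularGroup.fd,
      ‖epsteinEis (tauMat τ) (tauMat_det_ne τ) s‖ ≤ C * τ.im ^ R := by
  obtain ⟨R, hR, hR0, C0, hC0⟩ := exists_bound_epsteinLambda₀_tauMat hK R₀
  have hcont : ContinuousOn (fun s : ℂ => ‖(2 * completedRiemannZeta (2 * s))⁻¹‖) K := by
    intro s hs
    obtain ⟨h1, h2, h3, h4⟩ := hK' hs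
    have h5 : ContinuousAt completedRiemannZeta (2 * s) :=
      (analyticAt_completedZeta (by simpa using h1) (fun h => h2 (by linear_combination h / 2))).continuousAt
    have h6 : ContinuousAt (fun s : ℂ => completedRiemannZeta (2 * s)) s :=
      ContinuousAt.comp (f := fun s : ℂ => 2 * s) h5 (by fun_prop)
    exact ((continuousAt_const.mul h6).inv₀ (mul_ne_zero two_ne_zero h4)).norm.continuousWithinAt
  have hcont2 : ContinuousOn (fun s : ℂ => ‖1 / s‖ + ‖1 / (1 - s)‖) K := by
    intro s hs
    obtain ⟨h1, h2, h3, h4⟩ := hK' hs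
    have h5 : 1 - s ≠ 0 := sub_ne_zero.2 h3.symm
    refine ContinuousAt.continuousWithinAt ?_
    fun_prop (disch := assumption)
  obtain ⟨C1, hC1⟩ := hK.exists_bound_of_continuousOn hcont
  obtain ⟨C2, hC2⟩ := hK.exists_bound_of_continuousOn hcont2
  refine ⟨R, hR, C1 * (C0 + C2 * 2 ^ R), fun s hs τ hτ => ?_⟩
  have hy := τ.im_pos
  have hy2 := half_le_im_of_mem_fd hτ
  have h1 := hC0 s hs τ hτ
  -- τ₂ ≥ 1/2 on the fundamental domain; this absorbs the polar terms, constant in τ, into the power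
  -- of τ₂.
  have h2 : 1 ≤ 2 ^ R * τ.im ^ R := by
    rw [← Real.mul_rpow (by norm_num) hy.le]
    exact Real.one_le_rpow (by linarith) hR0
  have hC20 := hC2 s hs
  rw [Real.norm_eq_abs, abs_of_nonneg (by positivity)] at hC20
  have hC10 := hC1 s hs
  rw [norm_norm] at hC10
  have h3 : ‖epsteinLambda (tauMat τ) (tauMat_det_ne τ) s‖ ≤ (C0 + C2 * 2 ^ R) * τ.im ^ R := by
    rw [epsteinLambda_eq, tauMat_det]
    simp only [abs_one, inv_one, Complex.ofReal_one, Fintype.card_fin, Nat.cast_ofNat]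
    rw [div_self (two_ne_zero : (2 : ℂ) ≠ 0)]
    calc _ ≤ ‖epsteinLambda₀ (tauMat τ) (tauMat_det_ne τ) s‖ + ‖1 / s‖ + ‖1 / (1 - s)‖ :=
          (norm_sub_le _ _).trans (by gcongr; exact norm_sub_le _ _)
      _ ≤ C0 * τ.im ^ R + C2 * 1 := by linarith
      _ ≤ C0 * τ.im ^ R + C2 * (2 ^ R * τ.im ^ R) := by
          have : 0 ≤ C2 := le_trans (by positivity) hC20
          gcongr
      _ = _ := by ring
  rw [epsteinEis, div_eq_mul_inv, norm_mul]
  calc _ ≤ ((C0 + C2 * 2 ^ R) * τ.im ^ R) * C1 :=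
          mul_le_mul h3 hC10 (norm_nonneg _) ((norm_nonneg _).trans h3)
    _ = _ := by ring

/-- Rewriting the sum in `ENNReal` makes a countable sum of measurable functions measurable without
any question of convergence, also for t ≤ 0. -/
lemma measurable_theta_tauMat : Measurable fun p : ℍ × ℝ => theta (tauMat p.1) p.2 := by
  have h : ∀ p : ℍ × ℝ, theta (tauMat p.1) p.2 =
      (∑' v : Fin 2 → ℤ, ENNReal.ofReal (Real.exp (-(Real.pi * p.2 * qf (tauMat p.1) (toR v))))).toReal := by
    intro p
    rw [ENNReal.tsum_toReal_eq (fun _ => ENNReal.ofReal_ne_top), theta]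
    exact tsum_congr fun v => (ENNReal.toReal_ofReal (Real.exp_pos _).le).symm
  simp only [h, qf_tauMat]
  have h1 : Measurable (UpperHalfPlane.im) := UpperHalfPlane.continuous_im.measurable
  have h2 : Measurable (UpperHalfPlane.re) := UpperHalfPlane.continuous_re.measurable
  refine (Measurable.tsum fun v => ?_).ennreal_toReal
  fun_prop

lemma measurable_epsteinLambda₀_tauMat (s : ℂ) :
    StronglyMeasurable fun τ : ℍ => epsteinLambda₀ (tauMat τ) (tauMat_det_ne τ) s := by
  have h1 : Measurable fun p : ℍ × ℝ => ((theta (tauMat p.1) p.2 : ℝ) : ℂ) :=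
    Complex.measurable_ofReal.comp measurable_theta_tauMat
  let F : ℍ × ℝ → ℂ := fun p => (p.2 : ℂ) ^ (s - 1) *
    ((if 1 < p.2 then ((theta (tauMat p.1) p.2 : ℝ) : ℂ) - 1 else 0) +
      (if 0 < p.2 ∧ p.2 < 1 then ((theta (tauMat p.1) p.2 : ℝ) : ℂ) - ((p.2 ^ (-1 : ℝ) : ℝ) : ℂ) else 0))
  have hF : Measurable F := by
    refine Measurable.mul ?_ (Measurable.add (Measurable.ite ?_ (by fun_prop) (by fun_prop))
      (Measurable.ite ?_ (by fun_prop) (by fun_prop)))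
    · fun_prop
    · exact measurableSet_lt measurable_const measurable_snd
    · exact (measurableSet_lt measurable_const measurable_snd).inter
        (measurableSet_lt measurable_snd measurable_const)
  have h2 := hF.stronglyMeasurable.integral_prod_right' (ν := volume.restrict (Ioi (0 : ℝ)))
  convert h2 using 2 with τ
  rw [epsteinLambda₀, WeakFEPair.Λ₀, mellin]
  congr 1
  ext t
  simp only [F, WeakFEPair.f_modif, thetaPair, Pi.add_apply, indicator, mem_Ioi, mem_Ioo, smul_eq_mul,
    tauMat_det, mul_one, abs_one, inv_one, Complex.ofReal_one, one_mul, Fintype.card_fin,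
    Nat.cast_ofNat]
  rw [div_self (two_ne_zero : (2 : ℝ) ≠ 0)]

lemma measurable_epsteinEis_tauMat (s : ℂ) :
    StronglyMeasurable fun τ : ℍ => epsteinEis (tauMat τ) (tauMat_det_ne τ) s := by
  have h := measurable_epsteinLambda₀_tauMat s
  simp only [epsteinEis, epsteinLambda_eq, tauMat_det]
  exact ((h.sub stronglyMeasurable_const).sub stronglyMeasurable_const).div stronglyMeasurable_const

end SLTwo

end ThetaLift

namespace ThetaLift

open Matrix MeasureTheory Set Filter Topology UpperHalfPlane

/-! ### Primitive vectors -/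

section Primitive

variable {ι : Type*} [Fintype ι]

/-- An integral vector is primitive if its entries have greatest common divisor `1`. -/
def IsPrim (v : ι → ℤ) : Prop := Finset.univ.gcd v = 1

lemma gcd_smul (c : ℤ) (v : ι → ℤ) : Finset.univ.gcd (c • v) = normalize c * Finset.univ.gcd v :=
  Finset.gcd_mul_left

lemma gcd_nonneg (v : ι → ℤ) : 0 ≤ Finset.univ.gcd v := by
  rw [← Finset.normalize_gcd, ← Int.abs_eq_normalize]
  exact abs_nonneg _

lemma IsPrim.ne_zero {v : ι → ℤ} (hv : IsPrim v) : v ≠ 0 := by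
  rintro rfl
  have : Finset.univ.gcd (0 : ι → ℤ) = 0 := Finset.gcd_eq_zero_iff.2 fun _ _ => rfl
  rw [IsPrim, this] at hv
  exact zero_ne_one hv

lemma IsPrim.neg {v : ι → ℤ} (hv : IsPrim v) : IsPrim (-v) := by
  have := gcd_smul (-1) v
  rw [neg_one_smul] at this
  rw [IsPrim, this, hv, mul_one, Int.normalize_of_nonpos (by norm_num), neg_neg]

lemma exists_eq_smul_prim {v : ι → ℤ} (hv : v ≠ 0) :
    ∃ (n : ℕ) (w : ι → ℤ), IsPrim w ∧ v = ((n : ℤ) + 1) • w := by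
  obtain ⟨i, hi⟩ := Function.ne_iff.1 hv
  obtain ⟨w, hw, hw1⟩ := Finset.extract_gcd (s := Finset.univ) v ⟨i, Finset.mem_univ i⟩
  have hg : Finset.univ.gcd v ≠ 0 := by
    intro h
    exact hi (Finset.gcd_eq_zero_iff.1 h i (Finset.mem_univ i))
  have hg0 := gcd_nonneg v
  refine ⟨(Finset.univ.gcd v - 1).toNat, w, hw1, ?_⟩
  rw [Int.toNat_of_nonneg (by omega), sub_add_cancel]
  ext j
  exact hw j (Finset.mem_univ j)

lemma smul_prim_injective {n m : ℕ} {v w : ι → ℤ} (hv : IsPrim v) (hw : IsPrim w)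
    (h : ((n : ℤ) + 1) • v = ((m : ℤ) + 1) • w) : n = m ∧ v = w := by
  have h1 := gcd_smul ((n : ℤ) + 1) v
  have h2 := gcd_smul ((m : ℤ) + 1) w
  rw [hv, mul_one, Int.normalize_of_nonneg (by positivity)] at h1
  rw [hw, mul_one, Int.normalize_of_nonneg (by positivity)] at h2
  have h3 : (n : ℤ) + 1 = m + 1 := by rw [← h1, ← h2, h]
  have h4 : n = m := by omega
  subst h4
  refine ⟨rfl, ?_⟩
  ext i
  have := congrFun h i
  simp only [Pi.smul_apply, smul_eq_mul] at this
  exact mul_left_cancel₀ (by positivity) this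

/-- A nonzero integral vector is uniquely a positive multiple of a primitive one. -/
noncomputable def primEquiv : ℕ × {v : ι → ℤ // IsPrim v} ≃ {v : ι → ℤ // v ≠ 0} :=
  Equiv.ofBijective (fun p => ⟨((p.1 : ℤ) + 1) • p.2.1, by
    have := p.2.2.ne_zero
    refine smul_ne_zero (by positivity) this⟩) (by
    constructor
    · rintro ⟨n, v, hv⟩ ⟨m, w, hw⟩ h
      obtain ⟨h1, h2⟩ := smul_prim_injective hv hw (Subtype.ext_iff.1 h)
      subst h1; subst h2; rfl
    · rintro ⟨v, hv⟩
      obtain ⟨n, w, hw, h⟩ := exists_eq_smul_prim hv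
      exact ⟨(n, ⟨w, hw⟩), Subtype.ext h.symm⟩)

lemma primEquiv_apply (p : ℕ × {v : ι → ℤ // IsPrim v}) :
    (primEquiv p : ι → ℤ) = ((p.1 : ℤ) + 1) • p.2.1 := rfl

/-- Sort the nonzero vectors by their content n + 1; homogeneity of degree −z turns the sum into a
product. Stated for general `f`, so that it applies also to sums restricted to the isotropic cone.
-/
lemma tsum_eq_zeta_mul_tsum_prim {z : ℂ} (hz : 1 < z.re) {f : (ι → ℤ) → ℂ} (hf0 : f 0 = 0)
    (hf : ∀ (n : ℕ) (v : ι → ℤ), f (((n : ℤ) + 1) • v) = ((n : ℂ) + 1) ^ (-z) * f v)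
    (hs : Summable f) :
    ∑' v, f v = riemannZeta z * ∑' v : {v : ι → ℤ // IsPrim v}, f v := by
  have hsupp : Function.support f ⊆ {v | v ≠ 0} := by
    intro v hv h0
    rw [h0] at hv
    exact hv hf0
  have h1 : ∑' v, f v = ∑' v : {v : ι → ℤ | v ≠ 0}, f v :=
    (tsum_subtype_eq_of_support_subset hsupp).symm
  have h3 : ∀ p : ℕ × {v : ι → ℤ // IsPrim v}, f (primEquiv p : ι → ℤ) =
      ((p.1 : ℂ) + 1) ^ (-z) * f p.2 := fun p => by rw [primEquiv_apply, hf]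
  have h1' : ∑' v : {v : ι → ℤ // v ≠ 0}, f v =
      ∑' p : ℕ × {v : ι → ℤ // IsPrim v}, f (primEquiv p : {v : ι → ℤ // v ≠ 0}) :=
    (primEquiv.tsum_eq fun v : {v : ι → ℤ // v ≠ 0} => f v).symm
  refine h1.trans (h1'.trans ?_)
  simp only [h3]
  have h4 : Summable fun v : {v : ι → ℤ // IsPrim v} => f v :=
    hs.comp_injective Subtype.val_injective
  have h5 : Summable fun n : ℕ => ((n : ℂ) + 1) ^ (-z) := by
    have := (Complex.summable_one_div_nat_cpow.2 hz)
    rw [← summable_nat_add_iff 1] at this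
    refine this.congr fun n => ?_
    push_cast
    rw [Complex.cpow_neg, one_div]
  have h6 : riemannZeta z = ∑' n : ℕ, ((n : ℂ) + 1) ^ (-z) := by
    rw [zeta_eq_tsum_one_div_nat_add_one_cpow hz]
    refine tsum_congr fun n => ?_
    rw [Complex.cpow_neg, one_div]
  rw [h6]
  exact (tsum_mul_tsum_of_summable_norm h5.norm h4.norm).symm

lemma isPrim_fin_two {v : Fin 2 → ℤ} : IsPrim v ↔ IsCoprime (v 0) (v 1) := by
  constructor
  · intro h
    rw [Int.isCoprime_iff_gcd_eq_one]
    have h1 : ((Int.gcd (v 0) (v 1) : ℕ) : ℤ) ∣ Finset.univ.gcd v := by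
      refine Finset.dvd_gcd fun i _ => ?_
      fin_cases i
      · exact Int.gcd_dvd_left ..
      · exact Int.gcd_dvd_right ..
    rw [h] at h1
    exact Nat.dvd_one.1 (by exact_mod_cast h1)
  · intro h
    have h1 := h.isUnit_of_dvd' (Finset.gcd_dvd (Finset.mem_univ 0))
      (Finset.gcd_dvd (Finset.mem_univ 1))
    rw [IsPrim, ← Finset.normalize_gcd, normalize_eq_one]
    exact h1

lemma cpow_neg_qf_smul {κ : Type*} [Fintype κ] (e : Matrix ι κ ℝ) (s : ℂ) (n : ℕ) (v : ι → ℤ) :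
    ((qf e (toR (((n : ℤ) + 1) • v)) : ℝ) : ℂ) ^ (-s) =
      ((n : ℂ) + 1) ^ (-(2 * s)) * ((qf e (toR v) : ℝ) : ℂ) ^ (-s) := by
  have hn : (0 : ℝ) ≤ (n : ℝ) + 1 := by positivity
  rw [toR_smul, qf_smul, Complex.ofReal_mul, Complex.mul_cpow_ofReal_nonneg (by positivity) (qf_nonneg _ _)]
  congr 1
  push_cast
  rw [show ((n : ℂ) + 1) = (((n : ℝ) + 1 : ℝ) : ℂ) by push_cast; ring, ← mul_neg,
    ← Complex.cpow_ofNat_mul' (n := 2) (by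
      rw [Complex.arg_ofReal_of_nonneg hn]; simpa using Real.pi_pos) (by
      rw [Complex.arg_ofReal_of_nonneg hn]; simpa using Real.pi_pos.le)]

end Primitive

/-! ### The invariant measure on the upper half plane -/

section Measure

open scoped NNReal MatrixGroups

lemma measurableEmbedding_reIm : MeasurableEmbedding fun τ : ℍ => (τ.re, τ.im) :=
  Complex.measurableEquivRealProd.measurableEmbedding.comp measurableEmbedding_coe

lemma map_reIm_volume :
    Measure.map (fun τ : ℍ => (τ.re, τ.im)) volume =
      (volume.restrict {p : ℝ × ℝ | 0 < p.2}).withDensity fun p => (((‖p.2‖₊ ^ 2)⁻¹ : ℝ≥0) : ENNReal) := by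
  ext A hA
  have hpos : MeasurableSet {p : ℝ × ℝ | 0 < p.2} := measurableSet_lt measurable_const measurable_snd
  rw [measurableEmbedding_reIm.map_apply, volume_eq_lintegral, withDensity_apply _ hA,
    Measure.restrict_restrict hA]
  have himg : UpperHalfPlane.coe '' ((fun τ : ℍ => (τ.re, τ.im)) ⁻¹' A) =
      Complex.measurableEquivRealProd ⁻¹' (A ∩ {p : ℝ × ℝ | 0 < p.2}) := by
    ext z
    constructor
    · rintro ⟨τ, h, rfl⟩
      exact ⟨h, τ.im_pos⟩
    · rintro ⟨h1, h2⟩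
      exact ⟨⟨z, h2⟩, h1, rfl⟩
  rw [himg, ← Complex.volume_preserving_equiv_real_prod.setLIntegral_comp_preimage_emb
    Complex.measurableEquivRealProd.measurableEmbedding]
  refine lintegral_congr fun z => ?_
  simp [Complex.measurableEquivRealProd_apply]

lemma integral_comp_reIm (A : Set (ℝ × ℝ)) (hA : MeasurableSet A) (f : ℝ × ℝ → ℂ) :
    ∫ τ in (fun τ : ℍ => (τ.re, τ.im)) ⁻¹' A, f (τ.re, τ.im) =
      ∫ p in A ∩ {p : ℝ × ℝ | 0 < p.2}, ((p.2 ^ 2)⁻¹ : ℝ) • f p := by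
  rw [← Measure.restrict_restrict hA, ← measurableEmbedding_reIm.setIntegral_map, map_reIm_volume,
    restrict_withDensity hA, integral_withDensity_eq_integral_smul (by fun_prop)]
  refine integral_congr_ae (Eventually.of_forall fun p => ?_)
  simp [NNReal.smul_def]

lemma integrableOn_comp_reIm {A : Set (ℝ × ℝ)} (hA : MeasurableSet A) {f : ℝ × ℝ → ℂ} :
    IntegrableOn (fun τ : ℍ => f (τ.re, τ.im)) ((fun τ : ℍ => (τ.re, τ.im)) ⁻¹' A) ↔
      IntegrableOn (fun p => ((p.2 ^ 2)⁻¹ : ℝ) • f p) (A ∩ {p : ℝ × ℝ | 0 < p.2}) := by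
  have h := measurableEmbedding_reIm.integrableOn_map_iff (f := f) (μ := volume) (s := A)
  rw [show (fun τ : ℍ => f (τ.re, τ.im)) = f ∘ fun τ : ℍ => (τ.re, τ.im) from rfl, ← h,
    map_reIm_volume, IntegrableOn, restrict_withDensity hA,
    integrable_withDensity_iff_integrable_smul (by fun_prop), IntegrableOn,
    Measure.restrict_restrict hA]
  simp [NNReal.smul_def]

lemma volume_preimage_reIm_null {A : Set (ℝ × ℝ)} (hA : volume A = 0) :
    volume ((fun τ : ℍ => (τ.re, τ.im)) ⁻¹' A) = 0 := by
  rw [← measurableEmbedding_reIm.map_apply, map_reIm_volume]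
  exact ((withDensity_absolutelyContinuous _ _).trans Measure.absolutelyContinuous_restrict) hA

lemma volume_vertical_line (c : ℝ) : volume {p : ℝ × ℝ | p.1 = c} = 0 := by
  have : {p : ℝ × ℝ | p.1 = c} = {c} ×ˢ univ := by ext; simp
  rw [this, Measure.volume_eq_prod, Measure.prod_prod]
  simp

lemma volume_re_eq (c : ℝ) : volume {τ : ℍ | τ.re = c} = 0 :=
  volume_preimage_reIm_null (volume_vertical_line c)

/-- The boundary lies on two vertical lines and the unit circle. -/
lemma volume_fd_diff_fdo : volume (ModularGroup.fd \ ModularGroup.fdo) = 0 := by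
  have hc : volume {p : ℝ × ℝ | p.1 ^ 2 + p.2 ^ 2 = 1} = 0 := by
    have hm : MeasurableSet {p : ℝ × ℝ | p.1 ^ 2 + p.2 ^ 2 = 1} :=
      measurableSet_eq_fun (by fun_prop) measurable_const
    rw [Measure.volume_eq_prod, Measure.measure_prod_null hm]
    refine Eventually.of_forall fun x => ?_
    refine measure_mono_null (t := {√(1 - x ^ 2), -√(1 - x ^ 2)}) (fun y hy => ?_)
      (Set.Finite.measure_zero (by simp) _)
    have hy' : x ^ 2 + y ^ 2 = 1 := hy
    have h2 : √(1 - x ^ 2) = |y| := by rw [← Real.sqrt_sq_eq_abs]; congr 1; linarith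
    rw [h2]
    rcases abs_choice y with h | h <;> simp [h]
  refine measure_mono_null (t := ({τ : ℍ | τ.re = 1 / 2} ∪ {τ : ℍ | τ.re = -(1 / 2)}) ∪
    (fun τ : ℍ => (τ.re, τ.im)) ⁻¹' {p : ℝ × ℝ | p.1 ^ 2 + p.2 ^ 2 = 1}) ?_
    (measure_union_null (measure_union_null (volume_re_eq _) (volume_re_eq _))
      (volume_preimage_reIm_null hc))
  rintro τ ⟨⟨h1, h2⟩, h3⟩
  by_contra hn
  simp only [mem_union, not_or, mem_ofPred_eq, mem_preimage] at hn
  refine h3 ⟨lt_of_le_of_ne h1 fun h => hn.2 ?_, lt_of_le_of_ne h2 fun h => ?_⟩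
  · rw [h, Complex.normSq_apply]
    simp [sq]
  · rcases abs_eq (by norm_num : (0 : ℝ) ≤ 1 / 2) |>.1 h with h | h
    · exact hn.1.1 h
    · exact hn.1.2 h

lemma measurableSet_fd : MeasurableSet ModularGroup.fd := ModularGroup.isClosed_fd.measurableSet

instance : Countable SL(2, ℤ) :=
  Function.Injective.countable (f := fun (g : SL(2, ℤ)) (i j : Fin 2) =>
    (g : Matrix (Fin 2) (Fin 2) ℤ) i j) fun _ _ hgh => Subtype.ext hgh

/-! ### Translates of the fundamental domain -/

lemma measurePreserving_sl_smul (γ : SL(2, ℤ)) :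
    MeasurePreserving (fun τ : ℍ => γ • τ) volume volume :=
  measurePreserving_smul (γ : GL (Fin 2) ℝ) (volume : Measure ℍ)

lemma measurableEmbedding_sl_smul (γ : SL(2, ℤ)) : MeasurableEmbedding fun τ : ℍ => γ • τ :=
  measurableEmbedding_const_smul (γ : GL (Fin 2) ℝ)

/-- The translate `γ • fd`. -/
def tile (γ : SL(2, ℤ)) : Set ℍ := {τ | γ⁻¹ • τ ∈ ModularGroup.fd}

lemma measurableSet_tile (γ : SL(2, ℤ)) : MeasurableSet (tile γ) :=
  (measurePreserving_sl_smul γ⁻¹).measurable measurableSet_fd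

lemma preimage_tile (γ : SL(2, ℤ)) : (fun τ : ℍ => γ • τ) ⁻¹' tile γ = ModularGroup.fd := by
  ext τ
  simp [tile]

lemma ae_exists_smul_mem_fdo :
    ∀ᵐ τ : ℍ, ∃ γ : SL(2, ℤ), γ • τ ∈ ModularGroup.fdo := by
  have h : ∀ᵐ τ : ℍ, ∀ γ : SL(2, ℤ), γ • τ ∉ ModularGroup.fd \ ModularGroup.fdo := by
    rw [ae_all_iff]
    intro γ
    rw [ae_iff]
    simp only [not_not]
    exact (measurePreserving_sl_smul γ).quasiMeasurePreserving.preimage_null volume_fd_diff_fdo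
  filter_upwards [h] with τ hτ
  obtain ⟨γ, hγ⟩ := ModularGroup.exists_smul_mem_fd τ
  refine ⟨γ, ?_⟩
  by_contra hn
  exact hτ γ ⟨hγ, hn⟩

lemma sl_ne_neg (γ : SL(2, ℤ)) : γ ≠ -γ := by
  intro h
  have h1 : ∀ i j, (γ : Matrix (Fin 2) (Fin 2) ℤ) i j = 0 := by
    intro i j
    have := congrArg (fun g : SL(2, ℤ) => (g : Matrix (Fin 2) (Fin 2) ℤ) i j) h
    simp at this
    omega
  have := γ.det_coe
  rw [Matrix.det_fin_two, h1, h1, h1] at this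
  simp at this

/-- Off the null set of points with a translate on the boundary, τ lies in exactly two tiles, those
of some γ and of −γ, since −1 acts trivially. -/
lemma ae_tsum_indicator_tile {E : Type*} [AddCommMonoid E] [TopologicalSpace E] [T2Space E]
    (ψ : ℍ → E) :
    ∀ᵐ τ : ℍ, ∑' γ, (tile γ).indicator ψ τ = 2 • ψ τ := by
  filter_upwards [ae_exists_smul_mem_fdo] with τ ⟨γ₀, h0⟩
  have hmem : ∀ γ, τ ∈ tile γ ↔ γ ∈ ({γ₀⁻¹, -γ₀⁻¹} : Finset SL(2, ℤ)) := by
    intro γ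
    simp only [tile, mem_ofPred_eq, Finset.mem_insert, Finset.mem_singleton]
    constructor
    · intro h
      have h1 : (γ⁻¹ * γ₀⁻¹) • (γ₀ • τ) ∈ ModularGroup.fd := by
        rw [mul_smul, inv_smul_smul]; exact h
      rcases ModularGroup.eq_one_or_neg_one_of_mem_fdo_mem_fd h0 h1 with h2 | h2
      · left
        rw [inv_mul_eq_one] at h2
        exact h2
      · right
        have : γ * (γ⁻¹ * γ₀⁻¹) = γ * -1 := by rw [h2]
        rw [mul_inv_cancel_left, mul_neg, mul_one] at this
        rw [this, neg_neg]
    · rintro (rfl | rfl)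
      · rw [inv_inv]; exact ModularGroup.fdo_subset_fd h0
      · have : (-γ₀⁻¹)⁻¹ = -γ₀ := by
          rw [inv_eq_iff_mul_eq_one]; simp
        rw [this, ModularGroup.SL_neg_smul]
        exact ModularGroup.fdo_subset_fd h0
  rw [tsum_eq_sum (s := {γ₀⁻¹, -γ₀⁻¹}) (fun γ hγ => indicator_of_notMem (fun h => hγ ((hmem γ).1 h)) _),
    Finset.sum_pair (sl_ne_neg _), indicator_of_mem ((hmem _).2 (by simp)),
    indicator_of_mem ((hmem _).2 (by simp)), two_nsmul]

/-- Unfolding: summing the translates of `ψ` over `SL(2, ℤ)` and integrating over the fundamental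
domain gives twice the integral of `ψ`. -/
lemma tsum_lintegral_fd (ψ : ℍ → ENNReal) (hψ : Measurable ψ) :
    ∑' γ : SL(2, ℤ), ∫⁻ τ in ModularGroup.fd, ψ (γ • τ) = 2 * ∫⁻ τ, ψ τ := by
  have h1 : ∀ γ : SL(2, ℤ), ∫⁻ τ in ModularGroup.fd, ψ (γ • τ) = ∫⁻ τ, (tile γ).indicator ψ τ := by
    intro γ
    rw [lintegral_indicator (measurableSet_tile γ), ← preimage_tile γ]
    exact (measurePreserving_sl_smul γ).setLIntegral_comp_preimage_emb (measurableEmbedding_sl_smul γ) ψ _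
  simp only [h1]
  rw [← lintegral_tsum fun γ => (hψ.indicator (measurableSet_tile γ)).aemeasurable,
    ← lintegral_const_mul _ hψ]
  refine lintegral_congr_ae ?_
  filter_upwards [ae_tsum_indicator_tile ψ] with τ hτ
  rw [hτ, nsmul_eq_mul]
  rfl

/-- The version for nonnegative functions, applied to the norm of ψ, supplies the finiteness
required to exchange sum and integral. -/
lemma integral_fd_tsum (ψ : ℍ → ℂ) (hψ : StronglyMeasurable ψ) (hi : Integrable ψ) :
    ∫ τ in ModularGroup.fd, ∑' γ : SL(2, ℤ), ψ (γ • τ) = 2 * ∫ τ, ψ τ := by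
  have hfin : 2 * ∫⁻ τ, ‖ψ τ‖ₑ ≠ ⊤ := ENNReal.mul_ne_top (by simp) hi.2.ne
  have hm : Measurable fun τ => ‖ψ τ‖ₑ := hψ.measurable.enorm
  rw [integral_tsum (f := fun (γ : SL(2, ℤ)) τ => ψ (γ • τ)) (fun γ => (hψ.comp_measurable
    (measurePreserving_sl_smul γ).measurable).aestronglyMeasurable)
    (by rw [tsum_lintegral_fd (fun τ => ‖ψ τ‖ₑ) hm]; exact hfin)]
  have h1 : ∀ γ : SL(2, ℤ), ∫ τ in ModularGroup.fd, ψ (γ • τ) = ∫ τ, (tile γ).indicator ψ τ := by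
    intro γ
    rw [integral_indicator (measurableSet_tile γ), ← preimage_tile γ]
    exact (measurePreserving_sl_smul γ).setIntegral_preimage_emb (measurableEmbedding_sl_smul γ) ψ _
  simp only [h1]
  rw [← integral_tsum (fun γ => (hψ.indicator (measurableSet_tile γ)).aestronglyMeasurable),
    ← integral_const_mul]
  · refine integral_congr_ae ?_
    filter_upwards [ae_tsum_indicator_tile ψ] with τ hτ
    rw [hτ, nsmul_eq_mul]
    rfl
  · rw [← lintegral_tsum fun γ => (hψ.indicator (measurableSet_tile γ)).measurable.enorm.aemeasurable]
    have : ∫⁻ τ, ∑' γ : SL(2, ℤ), ‖(tile γ).indicator ψ τ‖ₑ = 2 * ∫⁻ τ, ‖ψ τ‖ₑ := by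
      rw [← lintegral_const_mul _ hm]
      refine lintegral_congr_ae ?_
      filter_upwards [ae_tsum_indicator_tile fun τ => ‖ψ τ‖ₑ] with τ hτ
      simp only [enorm_indicator_eq_indicator_enorm]
      rw [hτ, nsmul_eq_mul]
      rfl
    rw [this]
    exact hfin

end Measure

end ThetaLift

namespace ThetaLift

open Matrix MeasureTheory Set Filter Topology UpperHalfPlane

/-! ### Poisson summation for pairs of integral vectors -/

section PairTerm

variable {ι : Type*} [Fintype ι] [DecidableEq ι]

/-- The exponential `exp (-π y⁻¹ (m + n τ) X (m + n τ̄)ᵗ)` for `X = e eᵗ + B` and `τ = x + i y`. -/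
noncomputable def pairTerm (e B : Matrix ι ι ℝ) (m n : ι → ℤ) (p : ℝ × ℝ) : ℂ :=
  Complex.exp (-((Real.pi / p.2 * (qf e (toR m + p.1 • toR n) + p.2 ^ 2 * qf e (toR n)) : ℝ) : ℂ) +
    2 * Real.pi * Complex.I * ((B *ᵥ toR n ⬝ᵥ toR m : ℝ) : ℂ))

/-- `B` enters only through a phase, so all questions of absolute convergence can be settled with B
= 0. -/
lemma norm_pairTerm (e B : Matrix ι ι ℝ) (m n : ι → ℤ) (p : ℝ × ℝ) :
    ‖pairTerm e B m n p‖ =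
      Real.exp (-(Real.pi / p.2 * (qf e (toR m + p.1 • toR n) + p.2 ^ 2 * qf e (toR n)))) := by
  rw [pairTerm, Complex.norm_exp]
  congr 1
  rw [Complex.add_re, show 2 * (Real.pi : ℂ) * Complex.I * ((B *ᵥ toR n ⬝ᵥ toR m : ℝ) : ℂ) =
    ((2 * Real.pi * (B *ᵥ toR n ⬝ᵥ toR m) : ℝ) : ℂ) * Complex.I by push_cast; ring,
    Complex.re_ofReal_mul, Complex.I_re, Complex.neg_re, Complex.ofReal_re]
  ring

lemma measurable_pairTerm (e B : Matrix ι ι ℝ) (m n : ι → ℤ) :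
    Measurable (pairTerm e B m n) := by
  unfold pairTerm
  have h := (continuous_qf e).measurable
  have h1 : Measurable fun p : ℝ × ℝ => qf e (toR m + p.1 • toR n) := by
    have : Continuous fun p : ℝ × ℝ => qf e (toR m + p.1 • toR n) :=
      (continuous_qf e).comp (by fun_prop)
    exact this.measurable
  fun_prop

/-- The quadratic form dual, in the first vector, to the one in `pairTerm`. -/
noncomputable def dualForm (e B : Matrix ι ι ℝ) (n k : ι → ℤ) : ℝ :=
  qf e (toR n) + qf (e⁻¹)ᵀ (toR k - B *ᵥ toR n)

lemma dualForm_nonneg (e B : Matrix ι ι ℝ) (n k : ι → ℤ) : 0 ≤ dualForm e B n k :=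
  add_nonneg (qf_nonneg _ _) (qf_nonneg _ _)

lemma dualForm_pos {e : Matrix ι ι ℝ} (he : e.det ≠ 0) (B : Matrix ι ι ℝ) {n : ι → ℤ}
    (hn : n ≠ 0) (k : ι → ℤ) : 0 < dualForm e B n k :=
  add_pos_of_pos_of_nonneg (qf_toR_pos he hn) (qf_nonneg _ _)

/-- The matrix of `dualForm`. -/
noncomputable def dualMat (e B : Matrix ι ι ℝ) : Matrix (ι ⊕ ι) (ι ⊕ ι) ℝ :=
  Matrix.fromBlocks e (B * (e⁻¹)ᵀ) 0 (e⁻¹)ᵀ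

lemma dualMat_det_ne {e : Matrix ι ι ℝ} (he : e.det ≠ 0) (B : Matrix ι ι ℝ) :
    (dualMat e B).det ≠ 0 := by
  rw [dualMat, Matrix.det_fromBlocks_zero₂₁]
  exact mul_ne_zero he (det_inv_transpose_ne_zero he)

/-- The dual form in (n, k) is positive definite in 2d variables, given by an invertible block
triangular matrix, so the general lattice sums apply. Antisymmetry turns −B n into n B. -/
lemma dualForm_eq (e : Matrix ι ι ℝ) {B : Matrix ι ι ℝ} (hB : Bᵀ = -B) (n k : ι → ℤ) :
    dualForm e B n k = qf (dualMat e B) (toR (Sum.elim n k)) := by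
  have h : toR (Sum.elim n k) = Sum.elim (toR n) (toR k) := by
    ext i; rcases i with i | i <;> rfl
  have h2 : toR k - B *ᵥ toR n = toR k + toR n ᵥ* B := by
    rw [← Matrix.vecMul_transpose, hB, Matrix.vecMul_neg, sub_neg_eq_add]
  rw [h, dualForm, qf, qf, qf, dualMat, Matrix.vecMul_fromBlocks, h2]
  simp only [Matrix.vecMul_zero, add_zero, Matrix.add_vecMul, ← Matrix.vecMul_vecMul]
  simp only [dotProduct, Fintype.sum_sum_type, Sum.elim_inl, Sum.elim_inr]
  simp [add_comm]

lemma summable_dualForm_rpow {e : Matrix ι ι ℝ} (he : e.det ≠ 0) {B : Matrix ι ι ℝ}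
    (hB : Bᵀ = -B) {r : ℝ} (hr : (Fintype.card ι : ℝ) < r) :
    Summable fun q : (ι → ℤ) × (ι → ℤ) => dualForm e B q.1 q.2 ^ (-r) := by
  have h := summable_qf_rpow (dualMat_det_ne he B) (r := r) (by
    rw [Fintype.card_sum]; push_cast; linarith)
  have h2 := h.comp_injective (Equiv.sumArrowEquivProdArrow ι ι ℤ).symm.injective
  refine h2.congr fun q => ?_
  rw [dualForm_eq e hB]
  rfl

lemma dotProduct_mulVec_self {B : Matrix ι ι ℝ} (hB : Bᵀ = -B) (v : ι → ℝ) :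
    B *ᵥ v ⬝ᵥ v = 0 := by
  have h : B *ᵥ v ⬝ᵥ v = -(B *ᵥ v ⬝ᵥ v) := by
    conv_lhs => rw [dotProduct_comm, Matrix.dotProduct_mulVec, ← Matrix.mulVec_transpose, hB,
      Matrix.neg_mulVec, neg_dotProduct]
  linarith

/-- As a function of m the term is a Gaussian for the matrix y^{−1/2} e, shifted by x n and with
linear parameter B n. The shift does not change the phase because B n · n = 0. -/
lemma hasSum_pairTerm_dual {e : Matrix ι ι ℝ} (he : e.det ≠ 0) {B : Matrix ι ι ℝ}
    (hB : Bᵀ = -B) (n : ι → ℤ) (p : ℝ × ℝ) (hp : 0 < p.2) :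
    HasSum (fun k : ι → ℤ => ((|e.det|⁻¹ * p.2 ^ ((Fintype.card ι : ℝ) / 2) : ℝ) : ℂ) *
      Complex.exp (-((Real.pi * p.2 * dualForm e B n k : ℝ) : ℂ)) *
      Complex.exp (2 * Real.pi * Complex.I * ((toR k ⬝ᵥ toR n * p.1 : ℝ) : ℂ)))
      (∑' m, pairTerm e B m n p) ∧ Summable fun m => pairTerm e B m n p := by
  set y := p.2 with hy
  have hsq : Real.sqrt y ≠ 0 := (Real.sqrt_pos.2 hp).ne'
  set c : ℝ := (Real.sqrt y)⁻¹ with hc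
  have hc2 : c ^ 2 = y⁻¹ := by rw [hc, inv_pow, Real.sq_sqrt hp.le]
  have hc0 : c ≠ 0 := inv_ne_zero hsq
  have hdet : (c • e).det = c ^ Fintype.card ι * e.det := Matrix.det_smul _ _
  have hdet0 : (c • e).det ≠ 0 := by rw [hdet]; exact mul_ne_zero (pow_ne_zero _ hc0) he
  have hinv : ((c • e)⁻¹)ᵀ = c⁻¹ • (e⁻¹)ᵀ := by
    have h : (c • e)⁻¹ = c⁻¹ • e⁻¹ := by
      apply Matrix.inv_eq_left_inv
      rw [Matrix.smul_mul, Matrix.mul_smul, smul_smul, inv_mul_cancel₀ hc0, one_smul,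
        Matrix.nonsing_inv_mul _ he.isUnit]
    rw [h, Matrix.transpose_smul]
  have hq : ∀ v, qf ((c • e)⁻¹)ᵀ v = y * qf (e⁻¹)ᵀ v := by
    intro v
    rw [hinv, qf_smul_left, inv_pow, hc2, inv_inv]
  have habs : |(c • e).det|⁻¹ = |e.det|⁻¹ * y ^ ((Fintype.card ι : ℝ) / 2) := by
    rw [hdet, abs_mul, mul_inv, mul_comm, abs_pow, abs_of_pos (inv_pos.2 (Real.sqrt_pos.2 hp)),
      inv_pow, inv_inv, Real.sqrt_eq_rpow, ← Real.rpow_natCast, ← Real.rpow_mul hp.le]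
    congr 2
    ring
  have hterm : ∀ m, pairTerm e B m n p = Complex.exp (-((Real.pi * y * qf e (toR n) : ℝ) : ℂ)) *
      gaussian (c • e) (B *ᵥ toR n) (p.1 • toR n + toR m) := by
    intro m
    rw [pairTerm, gaussian, ← Complex.exp_add, qf_smul_left, hc2, dotProduct_add, dotProduct_smul,
      dotProduct_mulVec_self hB, add_comm (toR m), ← hy]
    congr 1
    rw [smul_zero, zero_add, ← add_assoc]
    congr 1
    have : y ≠ 0 := hp.ne'
    rw [← Complex.ofReal_neg, ← Complex.ofReal_neg, ← Complex.ofReal_neg, ← Complex.ofReal_add]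
    congr 1
    field_simp
    ring
  have hP := (hasSum_poisson hdet0 (B *ᵥ toR n) (p.1 • toR n)).mul_left
    (Complex.exp (-((Real.pi * y * qf e (toR n) : ℝ) : ℂ)))
  constructor
  · rw [tsum_congr hterm, tsum_mul_left]
    refine (congrArg (fun f => HasSum f _) (funext fun k => ?_)).mpr hP
    rw [hq, habs, dualForm, dotProduct_smul, smul_eq_mul, mul_comm p.1]
    rw [show Real.pi * y * (qf e (toR n) + qf (e⁻¹)ᵀ (toR k - B *ᵥ toR n)) =
      Real.pi * y * qf e (toR n) + Real.pi * (y * qf (e⁻¹)ᵀ (toR k - B *ᵥ toR n)) by ring,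
      Complex.ofReal_add, neg_add, Complex.exp_add]
    ring
  · refine Summable.congr ?_ fun m => (hterm m).symm
    exact (summable_gaussian hdet0 _ _).mul_left _

lemma summable_norm_pairTerm {e : Matrix ι ι ℝ} (he : e.det ≠ 0) (B : Matrix ι ι ℝ)
    (n : ι → ℤ) (p : ℝ × ℝ) (hp : 0 < p.2) : Summable fun m => ‖pairTerm e B m n p‖ := by
  refine ((hasSum_pairTerm_dual he (B := 0) (by simp) n p hp).2.norm).congr fun m => ?_
  rw [norm_pairTerm, norm_pairTerm]

lemma summable_exp_dualForm {e : Matrix ι ι ℝ} (he : e.det ≠ 0) {B : Matrix ι ι ℝ}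
    (hB : Bᵀ = -B) {a : ℝ} (ha : 0 < a) :
    Summable fun q : (ι → ℤ) × (ι → ℤ) => Real.exp (-(a * dualForm e B q.1 q.2)) := by
  have h := summable_exp_neg_qf (dualMat_det_ne he B) ha
  have h2 := h.comp_injective (Equiv.sumArrowEquivProdArrow ι ι ℤ).symm.injective
  refine h2.congr fun q => ?_
  rw [dualForm_eq e hB]
  rfl

/-- The norms are themselves the terms for B = 0, so Poisson summation applies to their sum; on the
dual side the characters are bounded by 1. -/
lemma tsum_norm_pairTerm_le {e : Matrix ι ι ℝ} (he : e.det ≠ 0) (B : Matrix ι ι ℝ)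
    (n : ι → ℤ) (p : ℝ × ℝ) (hp : 0 < p.2) :
    ∑' m, ‖pairTerm e B m n p‖ ≤ |e.det|⁻¹ * p.2 ^ ((Fintype.card ι : ℝ) / 2) *
      ∑' k, Real.exp (-(Real.pi * p.2 * dualForm e 0 n k)) := by
  have h := (hasSum_pairTerm_dual he (B := 0) (by simp) n p hp).1
  have h1 : ((∑' m, ‖pairTerm e B m n p‖ : ℝ) : ℂ) = ∑' m, pairTerm e 0 m n p := by
    rw [Complex.ofReal_tsum]
    refine tsum_congr fun m => ?_
    rw [norm_pairTerm, pairTerm]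
    simp
  have hs : Summable fun k => Real.exp (-(Real.pi * p.2 * dualForm e 0 n k)) :=
    (summable_exp_dualForm he (B := 0) (by simp) (mul_pos Real.pi_pos hp)).prod_factor n
  have h0 : 0 ≤ ∑' m, ‖pairTerm e B m n p‖ := tsum_nonneg fun _ => norm_nonneg _
  rw [← abs_of_nonneg h0, ← Real.norm_eq_abs, ← Complex.norm_real, h1, ← h.tsum_eq, ← tsum_mul_left]
  refine tsum_of_norm_bounded (hs.mul_left _).hasSum fun k => ?_
  rw [norm_mul, norm_mul, Complex.norm_real, Complex.norm_exp, Real.norm_of_nonneg (by positivity),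
    show 2 * (Real.pi : ℂ) * Complex.I * ((toR k ⬝ᵥ toR n * p.1 : ℝ) : ℂ) =
      ((2 * Real.pi * (toR k ⬝ᵥ toR n * p.1) : ℝ) : ℂ) * Complex.I by push_cast; ring,
    Complex.norm_exp_ofReal_mul_I, mul_one]
  simp

lemma summable_norm_pairTerm_prod {e : Matrix ι ι ℝ} (he : e.det ≠ 0) (B : Matrix ι ι ℝ)
    (p : ℝ × ℝ) (hp : 0 < p.2) :
    Summable fun q : (ι → ℤ) × (ι → ℤ) => ‖pairTerm e B q.2 q.1 p‖ := by
  rw [summable_prod_of_nonneg fun _ => norm_nonneg _]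
  refine ⟨fun n => summable_norm_pairTerm he B n p hp, ?_⟩
  have hs := (summable_exp_dualForm he (B := 0) (by simp) (mul_pos Real.pi_pos hp))
  exact Summable.of_nonneg_of_le (fun n => tsum_nonneg fun _ => norm_nonneg _)
    (fun n => tsum_norm_pairTerm_le he B n p hp) (hs.prod.mul_left _)

/-! ### Integration over the strip -/

/-- The measure `dx dy` on the half strip `-1/2 < x ≤ 1/2`, `0 < y`. -/
noncomputable def stripMeasure : Measure (ℝ × ℝ) :=
  (volume.restrict (Ioc (-1 / 2) (1 / 2))).prod (volume.restrict (Ioi 0))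

lemma stripMeasure_eq : stripMeasure =
    volume.restrict (Prod.fst ⁻¹' (Ioc (-1 / 2) (1 / 2)) ∩ {p : ℝ × ℝ | 0 < p.2}) := by
  rw [stripMeasure, Measure.prod_restrict, ← Measure.volume_eq_prod]
  rfl

lemma ae_stripMeasure : ∀ᵐ p ∂stripMeasure, 0 < p.2 := by
  rw [stripMeasure_eq]
  have hm : MeasurableSet (Prod.fst ⁻¹' (Ioc (-1 / 2 : ℝ) (1 / 2)) ∩ {p : ℝ × ℝ | 0 < p.2}) :=
    (measurable_fst measurableSet_Ioc).inter (measurableSet_lt measurable_const measurable_snd)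
  filter_upwards [ae_restrict_mem hm] with p hp using hp.2

/-- A function that is not integrable has integral zero by convention, whereas the known value is a
nonzero multiple of Γ(s), which has no zeros. -/
lemma integrable_gamma {s : ℂ} (hs : 0 < s.re) {r : ℝ} (hr : 0 < r) :
    Integrable (fun y : ℝ => (y : ℂ) ^ (s - 1) * Complex.exp (-((r * y : ℝ) : ℂ)))
      (volume.restrict (Ioi 0)) := by
  by_contra h
  have h1 := Complex.integral_cpow_mul_exp_neg_mul_Ioi hs hr
  have h2 := integral_undef h
  push_cast at h2
  rw [h2] at h1
  exact mul_ne_zero (by simp [Complex.cpow_eq_zero_iff, hr.ne']) (Complex.Gamma_ne_zero_of_re_pos hs)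
    h1.symm

lemma integral_gamma {s : ℂ} (hs : 0 < s.re) {r : ℝ} (hr : 0 < r) :
    ∫ y : ℝ in Ioi 0, (y : ℂ) ^ (s - 1) * Complex.exp (-((r * y : ℝ) : ℂ)) =
      (r : ℂ) ^ (-s) * Complex.Gamma s := by
  have h1 := Complex.integral_cpow_mul_exp_neg_mul_Ioi hs hr
  push_cast
  rw [h1, one_div, Complex.inv_cpow _ _ (by rw [Complex.arg_ofReal_of_nonneg hr.le]; exact
    Real.pi_pos.ne), Complex.cpow_neg]

lemma integral_gamma_norm {s : ℂ} (hs : 0 < s.re) {r : ℝ} (hr : 0 < r) :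
    ∫ y : ℝ in Ioi 0, ‖(y : ℂ) ^ (s - 1) * Complex.exp (-((r * y : ℝ) : ℂ))‖ =
      r ^ (-s.re) * Real.Gamma s.re := by
  rw [Real.rpow_neg hr.le, ← Real.inv_rpow hr.le, ← one_div,
    ← Real.integral_rpow_mul_exp_neg_mul_Ioi hs hr]
  refine setIntegral_congr_fun measurableSet_Ioi fun y hy => ?_
  rw [norm_mul, Complex.norm_cpow_eq_rpow_re_of_pos hy, Complex.norm_exp]
  simp

lemma integral_character (N : ℤ) :
    ∫ x in Ioc (-1 / 2 : ℝ) (1 / 2), Complex.exp (2 * Real.pi * Complex.I * ((N * x : ℝ) : ℂ)) =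
      if N = 0 then 1 else 0 := by
  rw [← intervalIntegral.integral_of_le (by norm_num)]
  split_ifs with h
  · subst h
    simp; norm_num
  · have hc : 2 * Real.pi * Complex.I * N ≠ 0 := by
      simp [h, Real.pi_ne_zero]
    have := integral_exp_mul_complex (a := (-1 / 2 : ℝ)) (b := 1 / 2) hc
    have h2 : ∀ x : ℝ, 2 * Real.pi * Complex.I * ((N * x : ℝ) : ℂ) =
      (2 * Real.pi * Complex.I * N) * x := fun x => by push_cast; ring
    simp_rw [h2]
    rw [this, div_eq_zero_iff]
    left
    rw [sub_eq_zero, Complex.exp_eq_exp_iff_exists_int]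
    exact ⟨N, by push_cast; ring⟩

lemma integrable_character (c : ℝ) :
    Integrable (fun x : ℝ => Complex.exp (2 * Real.pi * Complex.I * ((c * x : ℝ) : ℂ)))
      (volume.restrict (Ioc (-1 / 2) (1 / 2))) :=
  (Continuous.integrableOn_Icc (by fun_prop)).mono_set Ioc_subset_Icc_self

/-- `y ^ (s - 2)` times `pairTerm`. -/
noncomputable def weightedTerm (e B : Matrix ι ι ℝ) (s : ℂ) (n m : ι → ℤ) (p : ℝ × ℝ) : ℂ :=
  (p.2 : ℂ) ^ (s - 2) * pairTerm e B m n p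

/-- The exponent that belongs to `s` after Poisson summation. -/
noncomputable def dualExp (ι : Type*) [Fintype ι] (s : ℂ) : ℂ := s + Fintype.card ι / 2 - 1

lemma dualExp_re (s : ℂ) : (dualExp ι s).re = s.re + (Fintype.card ι : ℝ) / 2 - 1 := by
  have h : dualExp ι s = s + (((Fintype.card ι : ℝ) / 2 - 1 : ℝ) : ℂ) := by
    rw [dualExp]; push_cast; ring
  rw [h, Complex.add_re, Complex.ofReal_re]
  ring

/-- The terms which arise from `weightedTerm` by Poisson summation. -/
noncomputable def dualTerm (e B : Matrix ι ι ℝ) (s : ℂ) (n k : ι → ℤ) (p : ℝ × ℝ) : ℂ :=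
  ((|e.det|⁻¹ : ℝ) : ℂ) *
    (Complex.exp (2 * Real.pi * Complex.I * ((toR k ⬝ᵥ toR n * p.1 : ℝ) : ℂ)) *
      ((p.2 : ℂ) ^ (dualExp ι s - 1) *
        Complex.exp (-((Real.pi * dualForm e B n k * p.2 : ℝ) : ℂ))))

lemma measurable_weightedTerm (e B : Matrix ι ι ℝ) (s : ℂ) (n m : ι → ℤ) :
    Measurable (weightedTerm e B s n m) := by
  unfold weightedTerm
  exact (by fun_prop : Measurable fun p : ℝ × ℝ => (p.2 : ℂ) ^ (s - 2)).mul
    (measurable_pairTerm e B m n)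

lemma hasSum_weightedTerm_dual {e : Matrix ι ι ℝ} (he : e.det ≠ 0) {B : Matrix ι ι ℝ}
    (hB : Bᵀ = -B) (s : ℂ) (n : ι → ℤ) (p : ℝ × ℝ) (hp : 0 < p.2) :
    HasSum (fun k => dualTerm e B s n k p) (∑' m, weightedTerm e B s n m p) := by
  have h := ((hasSum_pairTerm_dual he hB n p hp).1).mul_left ((p.2 : ℂ) ^ (s - 2))
  unfold weightedTerm
  rw [tsum_mul_left]
  refine (congrArg (fun f => HasSum f _) (funext fun k => ?_)).mpr h
  have hy : (p.2 : ℂ) ≠ 0 := by exact_mod_cast hp.ne'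
  rw [dualTerm, dualExp, show s + (Fintype.card ι : ℂ) / 2 - 1 - 1 = (s - 2) + Fintype.card ι / 2
    by ring, Complex.cpow_add _ _ hy, Complex.ofReal_mul |e.det|⁻¹, Complex.ofReal_cpow hp.le,
    mul_right_comm Real.pi]
  push_cast
  ring

lemma norm_dualTerm (e B : Matrix ι ι ℝ) (s : ℂ) (n k : ι → ℤ) (p : ℝ × ℝ) (hp : 0 < p.2) :
    ‖dualTerm e B s n k p‖ = |e.det|⁻¹ * (p.2 ^ ((dualExp ι s).re - 1) *
      Real.exp (-(Real.pi * p.2 * dualForm e B n k))) := by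
  rw [dualTerm, norm_mul, norm_mul, norm_mul, Complex.norm_real, Real.norm_of_nonneg (by positivity),
    show 2 * (Real.pi : ℂ) * Complex.I * ((toR k ⬝ᵥ toR n * p.1 : ℝ) : ℂ) =
      ((2 * Real.pi * (toR k ⬝ᵥ toR n * p.1) : ℝ) : ℂ) * Complex.I by push_cast; ring,
    Complex.norm_exp_ofReal_mul_I, one_mul, Complex.norm_cpow_eq_rpow_re_of_pos hp,
    Complex.norm_exp, mul_right_comm Real.pi]
  simp

lemma integrable_dualTerm {e : Matrix ι ι ℝ} (he : e.det ≠ 0) (B : Matrix ι ι ℝ) {s : ℂ}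
    (hs : 0 < (dualExp ι s).re) {n : ι → ℤ} (hn : n ≠ 0) (k : ι → ℤ) :
    Integrable (dualTerm e B s n k) stripMeasure :=
  ((integrable_character _).mul_prod
    (integrable_gamma hs (mul_pos Real.pi_pos (dualForm_pos he B hn k)))).const_mul _

/-- The integral factors. The horizontal part is the orthogonality of characters and selects k·n =
0, the isotropy condition; the vertical part is a Gamma integral. -/
lemma integral_dualTerm {e : Matrix ι ι ℝ} (he : e.det ≠ 0) (B : Matrix ι ι ℝ) {s : ℂ}
    (hs : 0 < (dualExp ι s).re) {n : ι → ℤ} (hn : n ≠ 0) (k : ι → ℤ) :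
    ∫ p, dualTerm e B s n k p ∂stripMeasure =
      ((|e.det|⁻¹ : ℝ) : ℂ) * ((Real.pi : ℂ) ^ (-dualExp ι s) * Complex.Gamma (dualExp ι s)) *
        if k ⬝ᵥ n = 0 then (dualForm e B n k : ℂ) ^ (-dualExp ι s) else 0 := by
  have hQ := dualForm_pos he B hn k
  unfold dualTerm stripMeasure
  rw [integral_const_mul, integral_prod_mul (fun x : ℝ =>
    Complex.exp (2 * Real.pi * Complex.I * ((toR k ⬝ᵥ toR n * x : ℝ) : ℂ)))
    (fun y : ℝ => (y : ℂ) ^ (dualExp ι s - 1) *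
        Complex.exp (-((Real.pi * dualForm e B n k * y : ℝ) : ℂ))),
    integral_gamma hs (mul_pos Real.pi_pos hQ)]
  have hN : toR k ⬝ᵥ toR n = ((k ⬝ᵥ n : ℤ) : ℝ) := by
    simp [dotProduct]
  rw [hN, integral_character, Complex.ofReal_mul, Complex.mul_cpow_ofReal_nonneg Real.pi_pos.le
    hQ.le]
  split_ifs <;> ring

lemma integral_norm_dualTerm {e : Matrix ι ι ℝ} (he : e.det ≠ 0) (B : Matrix ι ι ℝ) {s : ℂ}
    (hs : 0 < (dualExp ι s).re) {n : ι → ℤ} (hn : n ≠ 0) (k : ι → ℤ) :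
    ∫ p, ‖dualTerm e B s n k p‖ ∂stripMeasure =
      |e.det|⁻¹ * (Real.pi ^ (-(dualExp ι s).re) * Real.Gamma (dualExp ι s).re) *
        dualForm e B n k ^ (-(dualExp ι s).re) := by
  have hQ := dualForm_pos he B hn k
  unfold dualTerm stripMeasure
  simp_rw [norm_mul, integral_const_mul]
  have h1 : ∀ x : ℝ,
      ‖Complex.exp (2 * Real.pi * Complex.I * ((toR k ⬝ᵥ toR n * x : ℝ) : ℂ))‖ = 1 := by
    intro x
    rw [show 2 * (Real.pi : ℂ) * Complex.I * ((toR k ⬝ᵥ toR n * x : ℝ) : ℂ) =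
      ((2 * Real.pi * (toR k ⬝ᵥ toR n * x) : ℝ) : ℂ) * Complex.I by push_cast; ring,
    Complex.norm_exp_ofReal_mul_I]
  simp_rw [h1, ← norm_mul]
  rw [integral_prod_mul (fun _ : ℝ => (1 : ℝ))
    (fun y : ℝ => ‖(y : ℂ) ^ (dualExp ι s - 1) *
        Complex.exp (-((Real.pi * dualForm e B n k * y : ℝ) : ℂ))‖),
    integral_gamma_norm hs (mul_pos Real.pi_pos hQ), Real.mul_rpow Real.pi_pos.le hQ.le]
  have h2 : ∫ _ in Ioc (-1 / 2 : ℝ) (1 / 2), (1 : ℝ) = 1 := by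
    simp; norm_num
  rw [h2, Complex.norm_real, Real.norm_of_nonneg (by positivity)]
  ring

lemma summable_integral_norm_dualTerm {e : Matrix ι ι ℝ} (he : e.det ≠ 0) {B : Matrix ι ι ℝ}
    (hB : Bᵀ = -B) {s : ℂ} (hs : (Fintype.card ι : ℝ) < (dualExp ι s).re) :
    Summable fun q : {n : ι → ℤ // n ≠ 0} × (ι → ℤ) =>
      ∫ p, ‖dualTerm e B s q.1 q.2 p‖ ∂stripMeasure := by
  have h := (summable_dualForm_rpow he hB hs).comp_injective
    (Function.Injective.prodMap (Subtype.val_injective (p := fun n : ι → ℤ => n ≠ 0))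
      (Function.injective_id (α := ι → ℤ)))
  refine (h.mul_left (|e.det|⁻¹ * (Real.pi ^ (-(dualExp ι s).re) *
    Real.Gamma (dualExp ι s).re))).congr fun q => ?_
  rw [integral_norm_dualTerm he B (lt_of_le_of_lt (by positivity) hs) q.1.2]
  rfl

lemma tsum_enorm_weightedTerm_le {e : Matrix ι ι ℝ} (he : e.det ≠ 0) (B : Matrix ι ι ℝ) (s : ℂ)
    (n : ι → ℤ) (p : ℝ × ℝ) (hp : 0 < p.2) :
    ∑' m, ‖weightedTerm e B s n m p‖ₑ ≤ ∑' k, ‖dualTerm e 0 s n k p‖ₑ := by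
  have h1 := (summable_norm_pairTerm he B n p hp).mul_left (p.2 ^ (s.re - 2))
  have h2 : Summable fun k => Real.exp (-(Real.pi * p.2 * dualForm e 0 n k)) :=
    (summable_exp_dualForm he (B := 0) (by simp) (mul_pos Real.pi_pos hp)).prod_factor n
  have h3 := (h2.mul_left (p.2 ^ ((dualExp ι s).re - 1))).mul_left |e.det|⁻¹
  have e1 : ∀ m, ‖weightedTerm e B s n m p‖ = p.2 ^ (s.re - 2) * ‖pairTerm e B m n p‖ := by
    intro m
    rw [weightedTerm, norm_mul, Complex.norm_cpow_eq_rpow_re_of_pos hp]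
    simp
  simp_rw [← ofReal_norm, e1, norm_dualTerm e 0 s n _ p hp]
  rw [← ENNReal.ofReal_tsum_of_nonneg (fun _ => by positivity) h1,
    ← ENNReal.ofReal_tsum_of_nonneg (fun _ => by positivity) h3]
  apply ENNReal.ofReal_le_ofReal
  rw [tsum_mul_left, tsum_mul_left, tsum_mul_left]
  refine (mul_le_mul_of_nonneg_left (tsum_norm_pairTerm_le he B n p hp) (by positivity)).trans
    (le_of_eq ?_)
  rw [dualExp_re, show s.re + (Fintype.card ι : ℝ) / 2 - 1 - 1 = (s.re - 2) + Fintype.card ι / 2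
    by ring, Real.rpow_add hp]
  ring

/-- By Tonelli it suffices to compare under the integral with the dual terms at B = 0. Their norms
have exact Gamma integrals, which sum to an Epstein zeta value in 2d variables; the hypothesis on
`dualExp` is its range of convergence. -/
lemma tsum_lintegral_weightedTerm_ne_top {e : Matrix ι ι ℝ} (he : e.det ≠ 0) (B : Matrix ι ι ℝ)
    {s : ℂ} (hs : (Fintype.card ι : ℝ) < (dualExp ι s).re) :
    ∑' q : {n : ι → ℤ // n ≠ 0} × (ι → ℤ),
      ∫⁻ p, ‖weightedTerm e B s q.1 q.2 p‖ₑ ∂stripMeasure ≠ ⊤ := by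
  have hs0 : 0 < (dualExp ι s).re := lt_of_le_of_lt (by positivity) hs
  have hsum := summable_integral_norm_dualTerm he (B := 0) (by simp) hs
  have hle : ∑' q : {n : ι → ℤ // n ≠ 0} × (ι → ℤ),
      ∫⁻ p, ‖weightedTerm e B s q.1 q.2 p‖ₑ ∂stripMeasure ≤
      ∑' q : {n : ι → ℤ // n ≠ 0} × (ι → ℤ), ∫⁻ p, ‖dualTerm e 0 s q.1 q.2 p‖ₑ ∂stripMeasure := by
    have m1 : ∀ q : {n : ι → ℤ // n ≠ 0} × (ι → ℤ),
        AEMeasurable (fun p => ‖weightedTerm e B s q.1 q.2 p‖ₑ) stripMeasure := fun q =>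
      (measurable_weightedTerm e B s q.1 q.2).enorm.aemeasurable
    have m2 : ∀ q : {n : ι → ℤ // n ≠ 0} × (ι → ℤ),
        AEMeasurable (fun p => ‖dualTerm e 0 s q.1 q.2 p‖ₑ) stripMeasure := fun q =>
      (integrable_dualTerm he 0 hs0 q.1.2 q.2).aestronglyMeasurable.enorm
    rw [← lintegral_tsum m1, ← lintegral_tsum m2]
    refine lintegral_mono_ae ?_
    filter_upwards [ae_stripMeasure] with p hp
    rw [ENNReal.tsum_prod', ENNReal.tsum_prod']
    exact ENNReal.tsum_le_tsum fun n => tsum_enorm_weightedTerm_le he B s n p hp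
  refine ne_top_of_le_ne_top ?_ hle
  have h1 : ∀ q : {n : ι → ℤ // n ≠ 0} × (ι → ℤ), ∫⁻ p, ‖dualTerm e 0 s q.1 q.2 p‖ₑ ∂stripMeasure =
      ENNReal.ofReal (∫ p, ‖dualTerm e 0 s q.1 q.2 p‖ ∂stripMeasure) := fun q =>
    (ofReal_integral_norm_eq_lintegral_enorm (integrable_dualTerm he 0 hs0 q.1.2 q.2)).symm
  simp_rw [h1]
  exact hsum.tsum_ofReal_ne_top

lemma integrable_weightedTerm {e : Matrix ι ι ℝ} (he : e.det ≠ 0) (B : Matrix ι ι ℝ)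
    {s : ℂ} (hs : (Fintype.card ι : ℝ) < (dualExp ι s).re) {n : ι → ℤ} (hn : n ≠ 0) (m : ι → ℤ) :
    Integrable (weightedTerm e B s n m) stripMeasure :=
  ⟨(measurable_weightedTerm e B s n m).aestronglyMeasurable,
    lt_top_iff_ne_top.2 (ENNReal.ne_top_of_tsum_ne_top (tsum_lintegral_weightedTerm_ne_top he B hs)
      (⟨n, hn⟩, m))⟩

lemma summable_integral_norm_weightedTerm {e : Matrix ι ι ℝ} (he : e.det ≠ 0) (B : Matrix ι ι ℝ)
    {s : ℂ} (hs : (Fintype.card ι : ℝ) < (dualExp ι s).re) :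
    Summable fun q : {n : ι → ℤ // n ≠ 0} × (ι → ℤ) =>
      ∫ p, ‖weightedTerm e B s q.1 q.2 p‖ ∂stripMeasure := by
  refine (ENNReal.summable_toReal (tsum_lintegral_weightedTerm_ne_top he B hs)).congr fun q => ?_
  rw [integral_norm_eq_lintegral_enorm (measurable_weightedTerm e B s q.1 q.2).aestronglyMeasurable]

lemma summable_integral_weightedTerm {e : Matrix ι ι ℝ} (he : e.det ≠ 0) (B : Matrix ι ι ℝ)
    {s : ℂ} (hs : (Fintype.card ι : ℝ) < (dualExp ι s).re) :
    Summable fun q : {n : ι → ℤ // n ≠ 0} × (ι → ℤ) =>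
      ∫ p, weightedTerm e B s q.1 q.2 p ∂stripMeasure :=
  Summable.of_norm_bounded (summable_integral_norm_weightedTerm he B hs)
    fun _ => norm_integral_le_integral_norm _

/-- For fixed n ≠ 0, sum and integral are exchanged on both sides of the Poisson identity. -/
lemma tsum_integral_weightedTerm {e : Matrix ι ι ℝ} (he : e.det ≠ 0) {B : Matrix ι ι ℝ}
    (hB : Bᵀ = -B) {s : ℂ} (hs : (Fintype.card ι : ℝ) < (dualExp ι s).re) {n : ι → ℤ}
    (hn : n ≠ 0) :
    ∑' m, ∫ p, weightedTerm e B s n m p ∂stripMeasure =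
      ((|e.det|⁻¹ : ℝ) : ℂ) * ((Real.pi : ℂ) ^ (-dualExp ι s) * Complex.Gamma (dualExp ι s)) *
        ∑' k, if k ⬝ᵥ n = 0 then (dualForm e B n k : ℂ) ^ (-dualExp ι s) else 0 := by
  have hs0 : 0 < (dualExp ι s).re := lt_of_le_of_lt (by positivity) hs
  have h1 := hasSum_integral_of_summable_integral_norm
    (fun m => integrable_weightedTerm he B hs hn m)
    ((summable_integral_norm_weightedTerm he B hs).prod_factor ⟨n, hn⟩)
  have h2 := hasSum_integral_of_summable_integral_norm
    (fun k => integrable_dualTerm he B hs0 hn k)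
    ((summable_integral_norm_dualTerm he hB hs).prod_factor ⟨n, hn⟩)
  rw [h1.tsum_eq, ← tsum_mul_left, ← tsum_congr fun k => integral_dualTerm he B hs0 hn k,
    h2.tsum_eq]
  refine integral_congr_ae ?_
  filter_upwards [ae_stripMeasure] with p hp
  exact (hasSum_weightedTerm_dual he hB s n p hp).tsum_eq.symm

end PairTerm

end ThetaLift

namespace ThetaLift

open Matrix MeasureTheory Set Filter Topology UpperHalfPlane
open scoped MatrixGroups

/-! ### The lattice sum as a sum over pairs of vectors -/

section LatticeSum

variable {d : ℕ}

lemma dotProduct_mulVec_conj (X : Matrix (Fin d) (Fin d) ℝ) (u v : Fin d → ℝ) :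
    (fun i => (u i : ℂ) + Complex.I * v i) ⬝ᵥ
      (X.map Complex.ofReal *ᵥ fun i => (u i : ℂ) - Complex.I * v i) =
    ((u ⬝ᵥ X *ᵥ u + v ⬝ᵥ X *ᵥ v : ℝ) : ℂ) + Complex.I * ((v ⬝ᵥ X *ᵥ u - u ⬝ᵥ X *ᵥ v : ℝ) : ℂ) := by
  simp only [dotProduct, mulVec, Matrix.map_apply]
  push_cast
  simp only [Finset.mul_sum, ← Finset.sum_add_distrib, ← Finset.sum_sub_distrib]
  refine Finset.sum_congr rfl fun i _ => Finset.sum_congr rfl fun j _ => ?_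
  ring_nf
  rw [Complex.I_sq]
  ring

lemma dotProduct_mul_transpose (e : Matrix (Fin d) (Fin d) ℝ) (u v : Fin d → ℝ) :
    u ⬝ᵥ (e * eᵀ) *ᵥ v = (u ᵥ* e) ⬝ᵥ (v ᵥ* e) := by
  rw [← Matrix.mulVec_mulVec, Matrix.dotProduct_mulVec, Matrix.mulVec_transpose]

/-- With u = m + τ₁ n and v = τ₂ n the symmetric part of X contributes |u e|² + |v e|² and the
antisymmetric part a multiple of i B n · m. The factor τ₂ in v cancels τ₂⁻¹, so the phase does not
depend on τ. -/
lemma latticeTerm_eq_pairTerm (e : Matrix (Fin d) (Fin d) ℝ) {B : Matrix (Fin d) (Fin d) ℝ}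
    (hB : Bᵀ = -B) (τ : ℍ) (M : RankTwo d) :
    latticeTerm (e * eᵀ + B) τ M = pairTerm e B (M.1 0) (M.1 1) (τ.re, τ.im) := by
  set u : Fin d → ℝ := toR (M.1 0) + τ.re • toR (M.1 1) with hu
  set v : Fin d → ℝ := τ.im • toR (M.1 1) with hv
  have hτ : (τ : ℂ) = τ.re + τ.im * Complex.I := (Complex.re_add_im (τ : ℂ)).symm
  have hτ' : (starRingEnd ℂ) (τ : ℂ) = τ.re - τ.im * Complex.I := by
    rw [hτ]; simp [sub_eq_add_neg]
  have h1 : (fun i => (M.1 0 i : ℂ) + (M.1 1 i : ℂ) * (τ : ℂ)) =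
      fun i => (u i : ℂ) + Complex.I * v i := by
    funext i
    rw [hτ, hu, hv]
    simp only [Pi.add_apply, Pi.smul_apply, toR_apply, smul_eq_mul]
    push_cast
    ring
  have h2 : (fun i => (M.1 0 i : ℂ) + (M.1 1 i : ℂ) * (starRingEnd ℂ) (τ : ℂ)) =
      fun i => (u i : ℂ) - Complex.I * v i := by
    funext i
    rw [hτ', hu, hv]
    simp only [Pi.add_apply, Pi.smul_apply, toR_apply, smul_eq_mul]
    push_cast
    ring
  have hskew : ∀ a b : Fin d → ℝ, a ⬝ᵥ B *ᵥ b = -(b ⬝ᵥ B *ᵥ a) := by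
    intro a b
    conv_lhs => rw [Matrix.dotProduct_mulVec, ← Matrix.mulVec_transpose, hB, Matrix.neg_mulVec,
      neg_dotProduct, dotProduct_comm]
  have hzero : ∀ a : Fin d → ℝ, a ⬝ᵥ B *ᵥ a = 0 := fun a => by linarith [hskew a a]
  have e1 : u ⬝ᵥ (e * eᵀ + B) *ᵥ u + v ⬝ᵥ (e * eᵀ + B) *ᵥ v =
      qf e u + τ.im ^ 2 * qf e (toR (M.1 1)) := by
    rw [Matrix.add_mulVec, Matrix.add_mulVec, dotProduct_add, dotProduct_add, hzero, hzero,
      dotProduct_mul_transpose, dotProduct_mul_transpose, add_zero, add_zero, ← qf_smul, ← hv]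
    rfl
  have e2 : v ⬝ᵥ (e * eᵀ + B) *ᵥ u - u ⬝ᵥ (e * eᵀ + B) *ᵥ v =
      -(2 * τ.im * (B *ᵥ toR (M.1 1) ⬝ᵥ toR (M.1 0))) := by
    rw [Matrix.add_mulVec, Matrix.add_mulVec, dotProduct_add, dotProduct_add, hskew v u,
      dotProduct_mul_transpose, dotProduct_mul_transpose, dotProduct_comm (v ᵥ* e), hv, hu,
      Matrix.mulVec_smul, dotProduct_smul, add_dotProduct, smul_dotProduct, hzero,
      dotProduct_comm (toR (M.1 0)) (B *ᵥ toR (M.1 1))]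
    simp only [smul_eq_mul]
    ring
  have hy : (τ.im : ℂ) ≠ 0 := by exact_mod_cast τ.im_pos.ne'
  rw [latticeTerm, pairTerm, h1, h2, dotProduct_mulVec_conj, e1, e2]
  congr 1
  push_cast
  field_simp
  ring

lemma rank_eq_two_iff (M : Matrix (Fin 2) (Fin d) ℤ) :
    (M.map (Int.cast : ℤ → ℚ)).rank = 2 ↔
      ∀ s t : ℤ, s • M 0 + t • M 1 = 0 → s = 0 ∧ t = 0 := by
  rw [rank_eq_finrank_span_row, eq_comm]
  have h := linearIndependent_iff_card_eq_finrank_span (R := ℚ)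
    (b := (M.map (Int.cast : ℤ → ℚ)).row)
  rw [Fintype.card_fin] at h
  rw [show Module.finrank ℚ (Submodule.span ℚ (range (M.map (Int.cast : ℤ → ℚ)).row)) =
    Set.finrank ℚ (range (M.map (Int.cast : ℤ → ℚ)).row) from rfl, ← h,
    ← LinearIndependent.iff_fractionRing ℤ ℚ]
  have hM : (M.map (Int.cast : ℤ → ℚ)).row =
      ![fun i => (M 0 i : ℚ), fun i => (M 1 i : ℚ)] := by
    funext i
    fin_cases i <;> rfl
  rw [hM, LinearIndependent.pair_iff]
  refine forall₂_congr fun s t => ?_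
  have : (s • (fun i => (M 0 i : ℚ)) + t • fun i => (M 1 i : ℚ)) = 0 ↔ s • M 0 + t • M 1 = 0 := by
    simp only [funext_iff]
    refine forall_congr' fun i => ?_
    change s • (M 0 i : ℚ) + t • (M 1 i : ℚ) = 0 ↔ s • M 0 i + t • M 1 i = 0
    rw [zsmul_eq_mul, zsmul_eq_mul, smul_eq_mul, smul_eq_mul]
    norm_cast
  rw [this]

lemma RankTwo.row_one_ne_zero (M : RankTwo d) : M.1 1 ≠ 0 := by
  intro h
  have := (rank_eq_two_iff M.1).1 M.2 0 1 (by rw [h]; simp)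
  simp at this

/-- A pair of linearly independent vectors, second vector first. -/
def rankTwoPair (M : RankTwo d) : {n : Fin d → ℤ // n ≠ 0} × (Fin d → ℤ) :=
  (⟨M.1 1, M.row_one_ne_zero⟩, M.1 0)

lemma rankTwoPair_injective : Function.Injective (rankTwoPair (d := d)) := by
  intro M N h
  rw [rankTwoPair, rankTwoPair, Prod.mk.injEq, Subtype.mk.injEq] at h
  apply Subtype.ext
  funext i
  fin_cases i
  · exact h.2
  · exact h.1

/-- The pairs of linearly dependent vectors with nonzero second member. -/
def parallelPair (q : (ℕ × {v : Fin d → ℤ // IsPrim v}) × ℤ) :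
    {n : Fin d → ℤ // n ≠ 0} × (Fin d → ℤ) :=
  (⟨((q.1.1 : ℤ) + 1) • q.1.2.1, smul_ne_zero (by positivity) q.1.2.2.ne_zero⟩, q.2 • q.1.2.1)

lemma parallelPair_injective : Function.Injective (parallelPair (d := d)) := by
  rintro ⟨⟨c, v, hv⟩, j⟩ ⟨⟨c', v', hv'⟩, j'⟩ h
  rw [parallelPair, parallelPair, Prod.mk.injEq, Subtype.mk.injEq] at h
  obtain ⟨h1, h2⟩ := h
  obtain ⟨rfl, rfl⟩ := smul_prim_injective hv hv' h1
  have := smul_left_injective ℤ hv.ne_zero h2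
  simp only at this
  rw [this]

lemma range_parallelPair : range (parallelPair (d := d)) = (range rankTwoPair)ᶜ := by
  ext ⟨⟨n, hn⟩, m⟩
  simp only [mem_compl_iff, mem_range, not_exists]
  constructor
  · rintro ⟨⟨⟨c, v, hv⟩, j⟩, h⟩ M hM
    rw [← h, rankTwoPair, parallelPair, Prod.mk.injEq, Subtype.mk.injEq] at hM
    have h3 := (rank_eq_two_iff M.1).1 M.2 ((c : ℤ) + 1) (-j) (by
      rw [hM.1, hM.2, smul_smul, smul_smul, ← add_smul]
      rw [show ((c : ℤ) + 1) * j + -j * ((c : ℤ) + 1) = 0 by ring, zero_smul])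
    have : (c : ℤ) + 1 ≠ 0 := by positivity
    exact this h3.1
  · intro h
    have hdep : ¬ ∀ s t : ℤ, s • m + t • n = 0 → s = 0 ∧ t = 0 := by
      intro hi
      refine h ⟨(![m, n] : Fin 2 → Fin d → ℤ), (rank_eq_two_iff _).2 hi⟩ ?_
      rfl
    push Not at hdep
    obtain ⟨s, t, hst, hne⟩ := hdep
    have hs : s ≠ 0 := by
      intro h0
      rw [h0, zero_smul, zero_add] at hst
      exact hne h0 ((smul_eq_zero.1 hst).resolve_right hn)
    obtain ⟨c, v, hv, hnv⟩ := exists_eq_smul_prim hn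
    have hmul : ∀ i, s ∣ (t * ((c : ℤ) + 1)) * v i := by
      intro i
      have := congrFun hst i
      simp only [hnv, Pi.add_apply, Pi.smul_apply, smul_eq_mul, Pi.zero_apply] at this
      exact ⟨-m i, by linarith⟩
    -- `s` divides every entry of t (c+1) v and v has content one. Hence the ratio m : v is an
    -- integer.
    have hdvd : s ∣ t * ((c : ℤ) + 1) := by
      have h2 : s ∣ Finset.univ.gcd ((t * ((c : ℤ) + 1)) • v) :=
        Finset.dvd_gcd fun i _ => hmul i
      rw [gcd_smul, hv, mul_one] at h2
      exact (dvd_normalize_iff).1 h2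
    obtain ⟨j, hj⟩ := hdvd
    refine ⟨((c, ⟨v, hv⟩), -j), ?_⟩
    rw [parallelPair, Prod.mk.injEq, Subtype.mk.injEq]
    refine ⟨hnv.symm, ?_⟩
    funext i
    have := congrFun hst i
    simp only [hnv, Pi.add_apply, Pi.smul_apply, smul_eq_mul, Pi.zero_apply] at this
    have h4 : s * m i = s * (-j * v i) := by
      rw [show s * (-j * v i) = -((s * j) * v i) by ring, ← hj]; linarith
    simpa using (mul_left_cancel₀ hs h4).symm

lemma tsum_rankTwo_add_tsum_parallel {f : {n : Fin d → ℤ // n ≠ 0} × (Fin d → ℤ) → ℂ}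
    (hf : Summable f) :
    ∑' M, f (rankTwoPair M) + ∑' q, f (parallelPair q) = ∑' q, f q := by
  rw [← tsum_range f rankTwoPair_injective, ← tsum_range f parallelPair_injective,
    range_parallelPair]
  exact hf.tsum_subtype_add_tsum_subtype_compl _

lemma summable_norm_latticeTerm {e : Matrix (Fin d) (Fin d) ℝ} (he : e.det ≠ 0)
    {B : Matrix (Fin d) (Fin d) ℝ} (hB : Bᵀ = -B) (τ : ℍ) :
    Summable fun M => ‖latticeTerm (e * eᵀ + B) τ M‖ := by
  have h := (summable_norm_pairTerm_prod he B (τ.re, τ.im) τ.im_pos).comp_injective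
    ((Function.Injective.prodMap (Subtype.val_injective (p := fun n : Fin d → ℤ => n ≠ 0))
      (Function.injective_id (α := Fin d → ℤ))).comp rankTwoPair_injective)
  refine h.congr fun M => ?_
  rw [latticeTerm_eq_pairTerm e hB]
  rfl

/-! ### Modular invariance of the lattice sum -/

lemma sl_inv_mul_coe (N : SL(2, ℤ)) :
    ((N⁻¹ : SL(2, ℤ)) : Matrix (Fin 2) (Fin 2) ℤ) * (N : Matrix (Fin 2) (Fin 2) ℤ) = 1 :=
  (Matrix.SpecialLinearGroup.coe_mul N⁻¹ N).symm.trans (by rw [inv_mul_cancel]; rfl)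

lemma rank_sl_mul (N : SL(2, ℤ)) (M : RankTwo d) :
    (((N : Matrix (Fin 2) (Fin 2) ℤ) * M.1).map (Int.cast : ℤ → ℚ)).rank = 2 := by
  have h : ((N : Matrix (Fin 2) (Fin 2) ℤ) * M.1).map (Int.cast : ℤ → ℚ) =
      (N : Matrix (Fin 2) (Fin 2) ℤ).map (Int.castRingHom ℚ) * M.1.map (Int.castRingHom ℚ) :=
    Matrix.map_mul (f := Int.castRingHom ℚ)
  have hdet : ((N : Matrix (Fin 2) (Fin 2) ℤ).map (Int.castRingHom ℚ)).det = 1 := by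
    rw [← RingHom.mapMatrix_apply, ← RingHom.map_det, N.det_coe, map_one]
  rw [h, rank_mul_eq_right_of_isUnit_det _ _ (by rw [hdet]; exact isUnit_one)]
  exact M.2

/-- Left multiplication by an element of `SL(2, ℤ)` on integral matrices of rank two. -/
def rankTwoEquiv (N : SL(2, ℤ)) : RankTwo d ≃ RankTwo d where
  toFun M := ⟨(N : Matrix (Fin 2) (Fin 2) ℤ) * M.1, rank_sl_mul N M⟩
  invFun M := ⟨((N⁻¹ : SL(2, ℤ)) : Matrix (Fin 2) (Fin 2) ℤ) * M.1, rank_sl_mul N⁻¹ M⟩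
  left_inv M := Subtype.ext ((Matrix.mul_assoc _ _ _).symm.trans
    ((congrArg (· * M.1) (sl_inv_mul_coe N)).trans (Matrix.one_mul _)))
  right_inv M := Subtype.ext ((Matrix.mul_assoc _ _ _).symm.trans
    ((congrArg (· * M.1) (by simpa using sl_inv_mul_coe N⁻¹)).trans (Matrix.one_mul _)))

lemma latticeSum_smul (X : Matrix (Fin d) (Fin d) ℝ) (γ : SL(2, ℤ)) (τ : ℍ) :
    latticeSum X (γ • τ) = latticeSum X τ := by
  have hdet := γ.2
  rw [Matrix.det_fin_two] at hdet
  -- For γ with rows (a, b), (c, d) and δ = cτ + d one has m + n γτ = δ⁻¹ ((d m + b n) + (c m + a n)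
  -- τ), so γ permutes the pairs through `N`. The factor |δ|⁻² cancels against that in Im γτ.
  set N : SL(2, ℤ) := ⟨!![γ.1 1 1, γ.1 0 1; γ.1 1 0, γ.1 0 0], by
    rw [Matrix.det_fin_two_of]; linarith⟩ with hN
  rw [latticeSum, latticeSum, ← (rankTwoEquiv N).tsum_eq (latticeTerm X τ)]
  refine tsum_congr fun M => ?_
  set δ : ℂ := (γ.1 1 0 : ℂ) * τ + (γ.1 1 1 : ℂ) with hδ
  have hden := ModularGroup.denom_apply γ τ
  have hδ0 : δ ≠ 0 := by
    rw [hδ, ← hden]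
    exact UpperHalfPlane.denom_ne_zero _ τ
  have him : (((γ • τ).im : ℝ) : ℂ) = τ.im / (δ * (starRingEnd ℂ) δ) := by
    rw [ModularGroup.im_smul_eq_div_normSq, hden, Complex.mul_conj]
    push_cast
    rfl
  have hcoe : ((γ • τ : ℍ) : ℂ) = ((γ.1 0 0 : ℂ) * τ + (γ.1 0 1 : ℂ)) / δ := by
    rw [UpperHalfPlane.coe_specialLinearGroup_apply]
    simp [hδ]
  have h1 : ∀ i, (M.1 0 i : ℂ) + (M.1 1 i : ℂ) * ((γ • τ : ℍ) : ℂ) =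
      δ⁻¹ * (((rankTwoEquiv N M).1 0 i : ℂ) + ((rankTwoEquiv N M).1 1 i : ℂ) * τ) := by
    intro i
    have e0 : (rankTwoEquiv N M).1 0 i = γ.1 1 1 * M.1 0 i + γ.1 0 1 * M.1 1 i := by
      exact (Matrix.mul_apply).trans (Fin.sum_univ_two _)
    have e1 : (rankTwoEquiv N M).1 1 i = γ.1 1 0 * M.1 0 i + γ.1 0 0 * M.1 1 i := by
      exact (Matrix.mul_apply).trans (Fin.sum_univ_two _)
    rw [hcoe, e0, e1]
    field_simp
    push_cast
    rw [hδ]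
    ring
  have h2 : ∀ i, (M.1 0 i : ℂ) + (M.1 1 i : ℂ) * (starRingEnd ℂ) ((γ • τ : ℍ) : ℂ) =
      ((starRingEnd ℂ) δ)⁻¹ * (((rankTwoEquiv N M).1 0 i : ℂ) +
        ((rankTwoEquiv N M).1 1 i : ℂ) * (starRingEnd ℂ) (τ : ℂ)) := by
    intro i
    simpa using congrArg (starRingEnd ℂ) (h1 i)
  rw [latticeTerm, latticeTerm, funext h1, funext h2, him]
  congr 1
  have hsm : ∀ (a b : ℂ) (u v : Fin d → ℂ), (fun i => a * u i) ⬝ᵥ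
      (X.map Complex.ofReal *ᵥ fun i => b * v i) = a * b * (u ⬝ᵥ (X.map Complex.ofReal *ᵥ v)) := by
    intro a b u v
    change (a • u) ⬝ᵥ (X.map Complex.ofReal *ᵥ (b • v)) = _
    rw [Matrix.mulVec_smul, smul_dotProduct, dotProduct_smul, smul_eq_mul, smul_eq_mul, mul_assoc]
  rw [hsm]
  have hδ1 : (starRingEnd ℂ) δ ≠ 0 := (map_ne_zero _).2 hδ0
  have hy : (τ.im : ℂ) ≠ 0 := by exact_mod_cast τ.im_pos.ne'
  generalize (fun i => ((rankTwoEquiv N M).1 0 i : ℂ) + ((rankTwoEquiv N M).1 1 i : ℂ) * (τ : ℂ)) ⬝ᵥ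
    (X.map Complex.ofReal *ᵥ fun i => ((rankTwoEquiv N M).1 0 i : ℂ) +
      ((rankTwoEquiv N M).1 1 i : ℂ) * (starRingEnd ℂ) (τ : ℂ)) = Z
  field_simp

end LatticeSum

end ThetaLift

namespace ThetaLift

open Matrix MeasureTheory Set Filter Topology UpperHalfPlane
open scoped MatrixGroups

/-! ### Unfolding -/

/-- The factor ζ(2s) in the normalization accounts for the contents; what is left is half the sum
over primitive vectors. -/
lemma hasSum_prim_qf {ι : Type*} [Fintype ι] [DecidableEq ι] [Nonempty ι] {e : Matrix ι ι ℝ}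
    (he : e.det ≠ 0) {s : ℂ} (hs : (Fintype.card ι : ℝ) < 2 * s.re) (hs1 : 1 < 2 * s.re) :
    HasSum (fun v : {v : ι → ℤ // IsPrim v} => (qf e (toR v.1) : ℂ) ^ (-s))
      (2 * epsteinEis e he s) := by
  have h := hasSum_epsteinEis he hs hs1
  have hre : 1 < (2 * s).re := by simpa using hs1
  have hζ : riemannZeta (2 * s) ≠ 0 := riemannZeta_ne_zero_of_one_lt_re hre
  have h2 : (2 * riemannZeta (2 * s))⁻¹ ≠ 0 := inv_ne_zero (mul_ne_zero two_ne_zero hζ)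
  have hsum : Summable fun v : ι → ℤ => (qf e (toR v) : ℂ) ^ (-s) :=
    (summable_mul_left_iff h2).1 h.summable
  have hs0 : s ≠ 0 := by
    rintro rfl
    simp at hs1
    linarith
  have h3 := tsum_eq_zeta_mul_tsum_prim hre (f := fun v : ι → ℤ => (qf e (toR v) : ℂ) ^ (-s))
    (by simp [hs0]) (fun n v => cpow_neg_qf_smul e s n v) hsum
  have h4 : ∑' v : {v : ι → ℤ // IsPrim v}, (qf e (toR v.1) : ℂ) ^ (-s) = 2 * epsteinEis e he s := by
    have aux : ∀ z S : ℂ, z ≠ 0 → S = 2 * ((2 * z)⁻¹ * (z * S)) := fun z S hz => by field_simp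
    rw [← h.tsum_eq, tsum_mul_left, h3]
    exact aux _ _ hζ
  rw [← h4]
  exact (hsum.comp_injective (Subtype.val_injective (p := fun v : ι → ℤ => IsPrim v))).hasSum

/-- The vertical strip of width one, a fundamental domain for the translations. -/
def strip : Set ℍ := {τ | τ.re ∈ Ioc (-1 / 2 : ℝ) (1 / 2)}

lemma strip_eq : strip = (fun τ : ℍ => (τ.re, τ.im)) ⁻¹' (Prod.fst ⁻¹' Ioc (-1 / 2) (1 / 2)) := rfl

lemma measurableSet_strip : MeasurableSet strip :=
  measurableEmbedding_reIm.measurable (measurable_fst measurableSet_Ioc)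

lemma exists_bottom_row_smul_mem_strip (τ : ℍ) {v : Fin 2 → ℤ} (hv : IsPrim v) :
    ∃ γ : SL(2, ℤ), γ.1 1 = v ∧ γ • τ ∈ strip := by
  obtain ⟨γ, -, hγ⟩ := ModularGroup.bottom_row_surj (R := ℤ) (isPrim_fin_two.1 hv)
  -- The strip is half open, −1/2 < τ₁ ≤ 1/2; translation by −⌈τ₁ − 1/2⌉ is the one that reaches it.
  refine ⟨ModularGroup.T ^ (-⌈(γ • τ).re - 1 / 2⌉) * γ, ?_, ?_⟩
  · rw [← hγ]
    funext j
    rw [Matrix.SpecialLinearGroup.coe_mul, ModularGroup.coe_T_zpow, Matrix.mul_apply,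
      Fin.sum_univ_two]
    simp
  · rw [mul_smul]
    change (ModularGroup.T ^ (-⌈(γ • τ).re - 1 / 2⌉) • γ • τ).re ∈ Ioc (-1 / 2 : ℝ) (1 / 2)
    rw [ModularGroup.re_T_zpow_smul]
    have h1 := Int.le_ceil ((γ • τ).re - 1 / 2)
    have h2 := Int.ceil_lt_add_one ((γ • τ).re - 1 / 2)
    push_cast
    constructor <;> linarith

/-- Matrices with equal bottom rows differ by a power Tⁿ on the left, with n = a b' − a' b read off
from the top rows. Both images lie in a half-open strip of width one, so n = 0. -/
lemma eq_of_bottom_row_eq (τ : ℍ) {γ γ' : SL(2, ℤ)} (h : γ.1 1 = γ'.1 1) (hγ : γ • τ ∈ strip)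
    (hγ' : γ' • τ ∈ strip) : γ = γ' := by
  have h0 := congrFun h 0
  have h1 := congrFun h 1
  have d1 := γ.2
  have d2 := γ'.2
  rw [Matrix.det_fin_two] at d1 d2
  set n : ℤ := γ.1 0 0 * γ'.1 0 1 - γ'.1 0 0 * γ.1 0 1 with hn
  have hT : γ' = ModularGroup.T ^ n * γ := by
    ext i j
    rw [Matrix.SpecialLinearGroup.coe_mul, ModularGroup.coe_T_zpow, Matrix.mul_apply,
      Fin.sum_univ_two]
    fin_cases i <;> fin_cases j <;> simp
    · change γ'.1 0 0 = γ.1 0 0 + n * γ.1 1 0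
      rw [← h0, ← h1] at d2
      rw [hn]
      linear_combination (-γ'.1 0 0) * d1 + γ.1 0 0 * d2
    · change γ'.1 0 1 = γ.1 0 1 + n * γ.1 1 1
      rw [← h0, ← h1] at d2
      rw [hn]
      linear_combination (-γ'.1 0 1) * d1 + γ.1 0 1 * d2
    · exact h0.symm
    · exact h1.symm
  have hre : (γ' • τ).re = (γ • τ).re + n := by
    rw [hT, mul_smul, ModularGroup.re_T_zpow_smul]
  have ha := hγ.1
  have hb := hγ.2
  have hc := hγ'.1
  have hd := hγ'.2
  have hn0 : n = 0 := by
    have e1 : (n : ℝ) < 1 := by linarith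
    have e2 : (-1 : ℝ) < n := by linarith
    have e3 : n < 1 := by exact_mod_cast e1
    have e4 : -1 < n := by exact_mod_cast e2
    omega
  rw [hT, hn0, zpow_zero, one_mul]

lemma im_smul_eq_qf (γ : SL(2, ℤ)) (τ : ℍ) :
    (γ • τ).im = (qf (tauMat τ) (toR ![γ.1 1 1, γ.1 1 0]))⁻¹ := by
  rw [ModularGroup.im_smul_eq_div_normSq, ModularGroup.denom_apply, qf_tauMat, inv_div]
  congr 1
  simp [Complex.normSq_apply]
  ring

/-- Interchange of the two coordinates of a primitive vector. -/
def primSwap : {v : Fin 2 → ℤ // IsPrim v} ≃ {v : Fin 2 → ℤ // IsPrim v} where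
  toFun v := ⟨![v.1 1, v.1 0], isPrim_fin_two.2 (by simpa using (isPrim_fin_two.1 v.2).symm)⟩
  invFun v := ⟨![v.1 1, v.1 0], isPrim_fin_two.2 (by simpa using (isPrim_fin_two.1 v.2).symm)⟩
  left_inv v := Subtype.ext (by ext i; fin_cases i <;> rfl)
  right_inv v := Subtype.ext (by ext i; fin_cases i <;> rfl)

/-- The elements of SL(2,ℤ) that bring τ into the strip correspond bijectively to their bottom rows,
the primitive vectors. A cutoff to the strip thus replaces the quotient by translations, and ±γ are
both counted, whence the 2. The swap appears because the bottom row (c, d) belongs to m = d, n = c.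
-/
lemma tsum_indicator_strip {s : ℂ} (hs : 1 < s.re) (τ : ℍ) :
    ∑' γ : SL(2, ℤ), strip.indicator (fun z => (z.im : ℂ) ^ s) (γ • τ) = 2 * eisSL2Series s τ := by
  choose! g hg using fun v : {v : Fin 2 → ℤ // IsPrim v} =>
    exists_bottom_row_smul_mem_strip τ v.2
  have hinj : Function.Injective g := fun v w h => Subtype.ext (by
    rw [← (hg v).1, ← (hg w).1, h])
  rw [← hinj.tsum_eq]
  · rw [eisSL2Series_eq hs, ← (hasSum_prim_qf (tauMat_det_ne τ) (s := s)
      (by simp only [Fintype.card_fin]; push_cast; linarith) (by linarith)).tsum_eq,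
      ← primSwap.tsum_eq fun v => (qf (tauMat τ) (toR v.1) : ℂ) ^ (-s)]
    refine tsum_congr fun v => ?_
    rw [indicator_of_mem (hg v).2, im_smul_eq_qf, (hg v).1]
    change _ = (qf (tauMat τ) (toR ![v.1 1, v.1 0]) : ℂ) ^ (-s)
    rw [Complex.ofReal_inv, Complex.inv_cpow, Complex.cpow_neg]
    rw [Complex.arg_ofReal_of_nonneg (qf_nonneg _ _)]
    exact Real.pi_pos.ne
  · intro γ hγ
    have hmem : γ • τ ∈ strip := by
      by_contra h
      exact hγ (indicator_of_notMem h _)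
    have hp : IsPrim (γ.1 1) := by
      rw [isPrim_fin_two]
      have := γ.2
      rw [Matrix.det_fin_two] at this
      exact ⟨-γ.1 0 1, γ.1 0 0, by linarith⟩
    exact ⟨⟨γ.1 1, hp⟩, eq_of_bottom_row_eq τ (hg ⟨γ.1 1, hp⟩).1 (hg ⟨γ.1 1, hp⟩).2 hmem⟩

/-! ### Integrability of the lattice sum -/

section Integrability

variable {d : ℕ}

instance : Countable (RankTwo d) := rankTwoPair_injective.countable

lemma measurable_latticeTerm (e : Matrix (Fin d) (Fin d) ℝ) {B : Matrix (Fin d) (Fin d) ℝ}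
    (hB : Bᵀ = -B) (M : RankTwo d) : Measurable fun τ => latticeTerm (e * eᵀ + B) τ M := by
  simp_rw [latticeTerm_eq_pairTerm e hB]
  exact (measurable_pairTerm e B _ _).comp measurableEmbedding_reIm.measurable

lemma measurable_latticeSum (e : Matrix (Fin d) (Fin d) ℝ) {B : Matrix (Fin d) (Fin d) ℝ}
    (hB : Bᵀ = -B) : Measurable (latticeSum (e * eᵀ + B)) :=
  Measurable.tsum fun M => measurable_latticeTerm e hB M

/-- The sum of the absolute values of the terms of the lattice sum. -/
noncomputable def latticeNorm (X : Matrix (Fin d) (Fin d) ℝ) (τ : ℍ) : ℝ :=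
  ∑' M : RankTwo d, ‖latticeTerm X τ M‖

lemma latticeNorm_nonneg (X : Matrix (Fin d) (Fin d) ℝ) (τ : ℍ) : 0 ≤ latticeNorm X τ :=
  tsum_nonneg fun _ => norm_nonneg _

lemma norm_latticeSum_le {e : Matrix (Fin d) (Fin d) ℝ} (he : e.det ≠ 0)
    {B : Matrix (Fin d) (Fin d) ℝ} (hB : Bᵀ = -B) (τ : ℍ) :
    ‖latticeSum (e * eᵀ + B) τ‖ ≤ latticeNorm (e * eᵀ + B) τ :=
  norm_tsum_le_tsum_norm (summable_norm_latticeTerm he hB τ)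

lemma measurable_latticeNorm (e : Matrix (Fin d) (Fin d) ℝ) {B : Matrix (Fin d) (Fin d) ℝ}
    (hB : Bᵀ = -B) : Measurable (latticeNorm (e * eᵀ + B)) :=
  Measurable.tsum fun M => (measurable_latticeTerm e hB M).norm

lemma tsum_lintegral_rankTwo_ne_top {e : Matrix (Fin d) (Fin d) ℝ} (he : e.det ≠ 0)
    (B : Matrix (Fin d) (Fin d) ℝ) {s : ℂ} (hs : (d : ℝ) < (dualExp (Fin d) s).re) :
    ∑' M : RankTwo d, ∫⁻ p, ‖weightedTerm e B s (M.1 1) (M.1 0) p‖ₑ ∂stripMeasure ≠ ⊤ := by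
  set F : {n : Fin d → ℤ // n ≠ 0} × (Fin d → ℤ) → ENNReal :=
    fun q => ∫⁻ p, ‖weightedTerm e B s q.1 q.2 p‖ₑ ∂stripMeasure with hF
  have h1 : ∑' q, F q ≠ ⊤ := tsum_lintegral_weightedTerm_ne_top he B (s := s) (by simpa using hs)
  exact ne_top_of_le_ne_top h1 (ENNReal.tsum_comp_le_tsum_of_injective rankTwoPair_injective F)

/-- The bound on σ says exactly that Re `dualExp` exceeds d, where the sum of the integrals of the
norms is finite. -/
lemma integrableOn_strip_latticeNorm {e : Matrix (Fin d) (Fin d) ℝ} (he : e.det ≠ 0)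
    {B : Matrix (Fin d) (Fin d) ℝ} (hB : Bᵀ = -B) {σ : ℝ} (hσ : (d : ℝ) / 2 + 1 < σ) :
    IntegrableOn (fun τ : ℍ => τ.im ^ σ * latticeNorm (e * eᵀ + B) τ) strip := by
  have hs : (d : ℝ) < (dualExp (Fin d) (σ : ℂ)).re := by
    rw [dualExp_re, Complex.ofReal_re, Fintype.card_fin]; linarith
  have hfin := tsum_lintegral_rankTwo_ne_top he B hs
  set f : ℝ × ℝ → ℝ := fun p => ∑' M : RankTwo d, ‖pairTerm e B (M.1 0) (M.1 1) p‖ with hf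
  have hfm : Measurable f := Measurable.tsum fun M => (measurable_pairTerm e B _ _).norm
  have hInt : Integrable (fun p : ℝ × ℝ => (p.2 ^ 2)⁻¹ • ((p.2 ^ σ * f p : ℝ) : ℂ))
      stripMeasure := by
    refine ⟨(by fun_prop : Measurable _).aestronglyMeasurable, ?_⟩
    refine lt_of_le_of_lt ?_ (lt_top_iff_ne_top.2 hfin)
    rw [← lintegral_tsum fun M => (measurable_weightedTerm e B σ _ _).enorm.aemeasurable]
    refine lintegral_mono_ae ?_
    filter_upwards [ae_stripMeasure] with p hp
    have hsum : Summable fun M : RankTwo d => ‖pairTerm e B (M.1 0) (M.1 1) p‖ := by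
      have := summable_norm_latticeTerm he hB ⟨⟨p.1, p.2⟩, hp⟩
      exact this.congr fun M => by rw [latticeTerm_eq_pairTerm e hB]; rfl
    have e1 : ∀ M : RankTwo d, ‖weightedTerm e B σ (M.1 1) (M.1 0) p‖ₑ =
        ENNReal.ofReal (p.2 ^ (σ - 2) * ‖pairTerm e B (M.1 0) (M.1 1) p‖) := by
      intro M
      rw [← ofReal_norm, weightedTerm, norm_mul, Complex.norm_cpow_eq_rpow_re_of_pos hp]
      simp
    simp_rw [e1]
    rw [← ENNReal.ofReal_tsum_of_nonneg (fun _ => by positivity) (hsum.mul_left _), tsum_mul_left,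
      ← ofReal_norm]
    apply ENNReal.ofReal_le_ofReal
    have hf0 : 0 ≤ f p := tsum_nonneg fun _ => norm_nonneg _
    rw [norm_smul, Complex.norm_real, Real.norm_of_nonneg (by positivity),
      Real.norm_of_nonneg (by positivity), Real.rpow_sub hp, Real.rpow_two]
    apply le_of_eq
    rw [hf]
    ring
  rw [stripMeasure_eq] at hInt
  have h := (integrableOn_comp_reIm (measurable_fst measurableSet_Ioc)
    (f := fun p => ((p.2 ^ σ * f p : ℝ) : ℂ))).2 hInt
  have h2 := h.re
  refine h2.congr (Eventually.of_forall fun τ => ?_)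
  simp only [RCLike.re_to_complex, Complex.ofReal_re, hf, latticeNorm,
    latticeTerm_eq_pairTerm e hB]

/-- Only the left edge τ₁ = −1/2 of the fundamental domain is missing from the strip. -/
lemma fd_subset_strip_ae : ModularGroup.fd ≤ᵐ[volume] strip := by
  have h := volume_re_eq (-1 / 2)
  filter_upwards [measure_eq_zero_iff_ae_notMem.1 h] with τ hτ hfd
  have h2 := abs_le.1 hfd.2
  have h3 : τ.re ≠ -1 / 2 := hτ
  exact ⟨lt_of_le_of_ne (by linarith [h2.1]) (Ne.symm h3), h2.2⟩

/-- This plays the part of rapid decay at the cusp. As τ₂ ≥ 1/2 there, τ₂^R ≤ 2^{σ−R} τ₂^σ for σ ≥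
R, and σ may be taken in the range where the strip integral converges. -/
lemma integrableOn_fd_latticeNorm {e : Matrix (Fin d) (Fin d) ℝ} (he : e.det ≠ 0)
    {B : Matrix (Fin d) (Fin d) ℝ} (hB : Bᵀ = -B) (R : ℝ) :
    IntegrableOn (fun τ : ℍ => τ.im ^ R * latticeNorm (e * eᵀ + B) τ) ModularGroup.fd := by
  set σ : ℝ := max R ((d : ℝ) / 2 + 2) with hσ
  have h1 := (integrableOn_strip_latticeNorm he hB (σ := σ)
    (lt_of_lt_of_le (by linarith) (le_max_right _ _))).mono_set_ae fd_subset_strip_ae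
  have hm : Measurable fun τ : ℍ => τ.im := measurable_snd.comp measurableEmbedding_reIm.measurable
  refine Integrable.mono' (h1.const_mul (2 ^ (σ - R)))
    ((hm.pow_const R).mul (measurable_latticeNorm e hB)).aestronglyMeasurable ?_
  filter_upwards [ae_restrict_mem measurableSet_fd] with τ hτ
  have hy := half_le_im_of_mem_fd hτ
  have hy0 := τ.im_pos
  have h0 := latticeNorm_nonneg (e * eᵀ + B) τ
  rw [Real.norm_of_nonneg (by positivity), ← mul_assoc]
  refine mul_le_mul_of_nonneg_right ?_ h0
  have h2 : (1 : ℝ) ≤ (2 * τ.im) ^ (σ - R) :=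
    Real.one_le_rpow (by linarith) (by linarith [le_max_left R ((d : ℝ) / 2 + 2)])
  rw [Real.mul_rpow two_pos.le hy0.le] at h2
  have h3 : τ.im ^ σ = τ.im ^ (σ - R) * τ.im ^ R := by
    rw [← Real.rpow_add hy0]; congr 1; ring
  rw [h3, ← mul_assoc]
  exact le_mul_of_one_le_left (by positivity) h2

lemma integrableOn_fd_mul_latticeSum {e : Matrix (Fin d) (Fin d) ℝ} (he : e.det ≠ 0)
    {B : Matrix (Fin d) (Fin d) ℝ} (hB : Bᵀ = -B) {φ : ℍ → ℂ}
    (hφ : AEStronglyMeasurable φ (volume.restrict ModularGroup.fd)) {C R : ℝ}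
    (hb : ∀ τ ∈ ModularGroup.fd, ‖φ τ‖ ≤ C * τ.im ^ R) :
    IntegrableOn (fun τ => φ τ * latticeSum (e * eᵀ + B) τ) ModularGroup.fd := by
  refine Integrable.mono' ((integrableOn_fd_latticeNorm he hB R).const_mul C)
    (hφ.mul (measurable_latticeSum e hB).aestronglyMeasurable) ?_
  filter_upwards [ae_restrict_mem measurableSet_fd] with τ hτ
  rw [norm_mul, ← mul_assoc]
  exact mul_le_mul (hb τ hτ) (norm_latticeSum_le he hB τ) (norm_nonneg _)
    ((norm_nonneg _).trans (hb τ hτ))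

end Integrability

end ThetaLift

namespace ThetaLift

open Matrix MeasureTheory Set Filter Topology UpperHalfPlane
open scoped MatrixGroups

/-! ### Evaluation of the modular integral -/

section Evaluation

variable {d : ℕ}

section Reindexing

variable {E : Type*} [NormedAddCommGroup E] [CompleteSpace E]
  {F : (Fin d → ℤ) → (Fin d → ℤ) → E}

lemma summable_ne_zero_pair (h : Summable fun q : (Fin d → ℤ) × (Fin d → ℤ) => F q.1 q.2) :
    Summable fun q : {n : Fin d → ℤ // n ≠ 0} × (Fin d → ℤ) => F q.1 q.2 :=
  h.comp_injective (Function.Injective.prodMap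
    (Subtype.val_injective (p := fun n : Fin d → ℤ => n ≠ 0)) (Function.injective_id (α := Fin d → ℤ)))

lemma summable_rankTwo_pair
    (h : Summable fun q : {n : Fin d → ℤ // n ≠ 0} × (Fin d → ℤ) => F q.1 q.2) :
    Summable fun M : RankTwo d => F (M.1 1) (M.1 0) :=
  h.comp_injective rankTwoPair_injective

lemma summable_parallel_pair
    (h : Summable fun q : {n : Fin d → ℤ // n ≠ 0} × (Fin d → ℤ) => F q.1 q.2) :
    Summable fun q : (ℕ × {v : Fin d → ℤ // IsPrim v}) × ℤ =>
      F (((q.1.1 : ℤ) + 1) • q.1.2.1) (q.2 • q.1.2.1) :=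
  h.comp_injective parallelPair_injective

lemma tsum_pair_eq_add {F : (Fin d → ℤ) → (Fin d → ℤ) → ℂ}
    (h : Summable fun q : {n : Fin d → ℤ // n ≠ 0} × (Fin d → ℤ) => F q.1 q.2) :
    ∑' M : RankTwo d, F (M.1 1) (M.1 0) + ∑' q : (ℕ × {v : Fin d → ℤ // IsPrim v}) × ℤ,
      F (((q.1.1 : ℤ) + 1) • q.1.2.1) (q.2 • q.1.2.1) =
    ∑' q : {n : Fin d → ℤ // n ≠ 0} × (Fin d → ℤ), F q.1 q.2 :=
  tsum_rankTwo_add_tsum_parallel h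

lemma tsum_pair_eq_zero_add (h : Summable fun q : (Fin d → ℤ) × (Fin d → ℤ) => F q.1 q.2) :
    ∑' k, F 0 k + ∑' q : {n : Fin d → ℤ // n ≠ 0} × (Fin d → ℤ), F q.1 q.2 =
      ∑' q : (Fin d → ℤ) × (Fin d → ℤ), F q.1 q.2 := by
  have h1 := h.prod.tsum_subtype_add_tsum_subtype_compl {0}
  rw [tsum_singleton (0 : Fin d → ℤ) (fun n => ∑' k, F n k), ← h.tsum_prod] at h1
  rw [← h1, (summable_ne_zero_pair h).tsum_prod]
  rfl

end Reindexing

lemma measurable_im_cpow (s : ℂ) : Measurable fun τ : ℍ => (τ.im : ℂ) ^ s := by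
  have hm : Measurable fun τ : ℍ => τ.im := measurable_snd.comp measurableEmbedding_reIm.measurable
  fun_prop

/-- The unfolding step: E_s 𝒢 is summed from τ₂^s 𝒢 on the strip. The factor 2 from the double
covering by tiles cancels the one in `tsum_indicator_strip`. -/
lemma integral_eq_tsum_integral {e : Matrix (Fin d) (Fin d) ℝ} (he : e.det ≠ 0)
    {B : Matrix (Fin d) (Fin d) ℝ} (hB : Bᵀ = -B) {s : ℂ} (hs1 : 1 < s.re)
    (hs : (d : ℝ) / 2 + 1 < s.re) :
    modularIntegral (eisSL2Series s) (e * eᵀ + B) =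
      ∑' M : RankTwo d, ∫ p, weightedTerm e B s (M.1 1) (M.1 0) p ∂stripMeasure := by
  have hs' : (d : ℝ) < (dualExp (Fin d) s).re := by
    rw [dualExp_re, Fintype.card_fin]; linarith
  set φ : ℍ → ℂ := fun τ => (τ.im : ℂ) ^ s * latticeSum (e * eᵀ + B) τ with hφ
  have hφm : Measurable φ := (measurable_im_cpow s).mul (measurable_latticeSum e hB)
  set ψ : ℍ → ℂ := strip.indicator φ with hψ
  have hψm : StronglyMeasurable ψ := (hφm.indicator measurableSet_strip).stronglyMeasurable
  have hφi : IntegrableOn φ strip := by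
    refine Integrable.mono' (integrableOn_strip_latticeNorm he hB hs) hφm.aestronglyMeasurable
      (Eventually.of_forall fun τ => ?_)
    rw [hφ, norm_mul, Complex.norm_cpow_eq_rpow_re_of_pos τ.im_pos]
    exact mul_le_mul_of_nonneg_left (norm_latticeSum_le he hB τ)
      (Real.rpow_nonneg τ.im_pos.le _)
  have hψi : Integrable ψ := (integrable_indicator_iff measurableSet_strip).2 hφi
  have h1 := integral_fd_tsum ψ hψm hψi
  have h2 : ∀ τ : ℍ, ∑' γ : SL(2, ℤ), ψ (γ • τ) =
      2 * (eisSL2Series s τ * latticeSum (e * eᵀ + B) τ) := by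
    intro τ
    rw [← mul_assoc, ← tsum_indicator_strip hs1, ← tsum_mul_right]
    refine tsum_congr fun γ => ?_
    by_cases h : γ • τ ∈ strip
    · rw [hψ, indicator_of_mem h, indicator_of_mem h, hφ]
      simp only [latticeSum_smul]
    · rw [hψ, indicator_of_notMem h, indicator_of_notMem h, zero_mul]
  simp_rw [h2] at h1
  rw [integral_const_mul] at h1
  have h3 : modularIntegral (eisSL2Series s) (e * eᵀ + B) = ∫ τ, ψ τ :=
    mul_left_cancel₀ two_ne_zero h1
  rw [h3, hψ, integral_indicator measurableSet_strip]
  have h4 : ∀ τ : ℍ, φ τ = (fun p : ℝ × ℝ => (p.2 : ℂ) ^ s *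
      ∑' M : RankTwo d, pairTerm e B (M.1 0) (M.1 1) p) (τ.re, τ.im) := by
    intro τ
    simp only [hφ, latticeSum, latticeTerm_eq_pairTerm e hB]
  simp_rw [h4]
  rw [strip_eq, integral_comp_reIm _ (measurable_fst measurableSet_Ioc) (fun p : ℝ × ℝ =>
    (p.2 : ℂ) ^ s * ∑' M : RankTwo d, pairTerm e B (M.1 0) (M.1 1) p), ← stripMeasure_eq]
  have hcard : (Fintype.card (Fin d) : ℝ) < (dualExp (Fin d) s).re := by simpa using hs'
  have h5 := hasSum_integral_of_summable_integral_norm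
    (fun M : RankTwo d => integrable_weightedTerm he B hcard M.row_one_ne_zero (M.1 0))
    (summable_rankTwo_pair (F := fun n m => ∫ p, ‖weightedTerm e B s n m p‖ ∂stripMeasure)
      (summable_integral_norm_weightedTerm he B hcard))
  rw [h5.tsum_eq]
  refine integral_congr_ae ?_
  filter_upwards [ae_stripMeasure] with p hp
  have hp' : (p.2 : ℂ) ≠ 0 := by exact_mod_cast hp.ne'
  unfold weightedTerm
  rw [tsum_mul_left, Complex.cpow_sub _ _ hp', Complex.real_smul]
  push_cast
  rw [show (2 : ℂ) = ((2 : ℕ) : ℂ) by norm_num, Complex.cpow_natCast]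
  field_simp

/-- The summand of the Epstein zeta function of the isotropic vectors in `ℤ^d ⊕ ℤ^d`. -/
noncomputable def isoTerm (e B : Matrix (Fin d) (Fin d) ℝ) (s : ℂ) (n k : Fin d → ℤ) : ℂ :=
  if k ⬝ᵥ n = 0 then (dualForm e B n k : ℂ) ^ (-s) else 0

lemma summable_isoTerm {e : Matrix (Fin d) (Fin d) ℝ} (he : e.det ≠ 0)
    {B : Matrix (Fin d) (Fin d) ℝ} (hB : Bᵀ = -B) {s : ℂ} (hs : (d : ℝ) < s.re) :
    Summable fun q : (Fin d → ℤ) × (Fin d → ℤ) => isoTerm e B s q.1 q.2 := by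
  refine Summable.of_norm_bounded (summable_dualForm_rpow he hB (r := s.re) (by simpa using hs))
    fun q => ?_
  have h0 := dualForm_nonneg e B q.1 q.2
  rw [isoTerm]
  split_ifs
  · have hs0 : 0 < s.re := lt_of_le_of_lt (by positivity) hs
    rw [Complex.norm_cpow_eq_rpow_re_of_nonneg h0 (by
      rw [Complex.neg_re]; exact neg_ne_zero.2 hs0.ne'), Complex.neg_re]
  · rw [norm_zero]
    exact Real.rpow_nonneg h0 _

lemma dualForm_zero_left (e B : Matrix (Fin d) (Fin d) ℝ) (k : Fin d → ℤ) :
    dualForm e B 0 k = qf (e⁻¹)ᵀ (toR k) := by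
  simp [dualForm]

lemma completedZeta_eq {z : ℂ} (hz : z ≠ 0) (hΓ : Complex.Gammaℝ z ≠ 0) :
    completedRiemannZeta z = (Real.pi : ℂ) ^ (-z / 2) * Complex.Gamma (z / 2) * riemannZeta z := by
  rw [riemannZeta_def_of_ne_zero hz, ← Complex.Gammaℝ_def]
  field_simp

lemma completedZeta_two_mul {s : ℂ} (hs : 0 < s.re) :
    completedRiemannZeta (2 * s) =
      (Real.pi : ℂ) ^ (-s) * Complex.Gamma s * riemannZeta (2 * s) := by
  have h0 : (2 * s) ≠ 0 := by
    intro h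
    have := congrArg Complex.re h
    simp at this
    linarith
  rw [completedZeta_eq h0 (Complex.Gammaℝ_ne_zero_of_re_pos (by simpa using hs))]
  congr 3 <;> ring

/-- For n = 0 the isotropy condition is empty and the form is that of the dual lattice, so the
omitted terms make up a full Epstein zeta function. -/
lemma tsum_isoTerm_ne_zero {e : Matrix (Fin d) (Fin d) ℝ} (he : e.det ≠ 0)
    {B : Matrix (Fin d) (Fin d) ℝ} (hB : Bᵀ = -B) (hd : 2 ≤ d) {s : ℂ} (hs : (d : ℝ) < s.re) :
    haveI : Nonempty (Fin d) := ⟨⟨0, by omega⟩⟩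
    (Real.pi : ℂ) ^ (-s) * Complex.Gamma s *
      ∑' q : {n : Fin d → ℤ // n ≠ 0} × (Fin d → ℤ), isoTerm e B s q.1 q.2 =
    (Real.pi : ℂ) ^ (-s) * Complex.Gamma s *
      ∑' q : (Fin d → ℤ) × (Fin d → ℤ), isoTerm e B s q.1 q.2 -
    2 * completedRiemannZeta (2 * s) *
      epsteinEis (e⁻¹)ᵀ (det_inv_transpose_ne_zero he) s := by
  have : Nonempty (Fin d) := ⟨⟨0, by omega⟩⟩
  have hd' : (2 : ℝ) ≤ d := by exact_mod_cast hd
  have hsum := summable_isoTerm he hB hs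
  have h1 := tsum_pair_eq_zero_add hsum
  have h3 := (hasSum_epsteinEis (det_inv_transpose_ne_zero he) (s := s)
    (by simp only [Fintype.card_fin]; linarith) (by linarith)).tsum_eq
  have hζ : riemannZeta (2 * s) ≠ 0 := riemannZeta_ne_zero_of_one_lt_re (by simp; linarith)
  have h4 : ∑' k : Fin d → ℤ, isoTerm e B s 0 k = 2 * riemannZeta (2 * s) *
      epsteinEis (e⁻¹)ᵀ (det_inv_transpose_ne_zero he) s := by
    rw [← h3, tsum_mul_left, ← mul_assoc, mul_inv_cancel₀ (mul_ne_zero two_ne_zero hζ), one_mul]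
    refine tsum_congr fun k => ?_
    rw [isoTerm, dualForm_zero_left]
    simp
  rw [← h1, h4, completedZeta_two_mul (by linarith)]
  ring

/-- On multiples of one vector v the form is |v e|² times the standard form in one variable, and the
phase vanishes by antisymmetry. Parallel pairs thus fall under the theory for the index type `Unit`.
-/
lemma pairTerm_parallel (e : Matrix (Fin d) (Fin d) ℝ) {B : Matrix (Fin d) (Fin d) ℝ}
    (hB : Bᵀ = -B) (v : Fin d → ℤ) (c j : ℤ) (p : ℝ × ℝ) :
    pairTerm e B (j • v) (c • v) p =
      pairTerm (fun _ _ : Unit => Real.sqrt (qf e (toR v))) 0 (fun _ => j) (fun _ => c) p := by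
  have h1 : ∀ x : Unit → ℝ, qf (fun _ _ : Unit => Real.sqrt (qf e (toR v))) x =
      x () ^ 2 * qf e (toR v) := by
    intro x
    generalize hq : qf e (toR v) = q
    have hq0 : 0 ≤ q := hq ▸ qf_nonneg _ _
    simp only [qf, vecMul, dotProduct, Finset.univ_unique, Finset.sum_singleton]
    rw [show ∀ a b : ℝ, a * b * (a * b) = a ^ 2 * b ^ 2 by intros; ring, Real.sq_sqrt hq0]
  unfold pairTerm
  rw [h1, h1, toR_smul, toR_smul, smul_smul, ← add_smul, qf_smul, qf_smul,
    Matrix.mulVec_smul, smul_dotProduct, dotProduct_smul, dotProduct_mulVec_self hB]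
  simp

/-- Poisson summation in dimension one, where `dualExp` is s − 1/2 and k·n = 0 leaves only k = 0.
The hypothesis Re s > 3/2 is convergence there. -/
lemma tsum_integral_parallel {e : Matrix (Fin d) (Fin d) ℝ} (he : e.det ≠ 0)
    {B : Matrix (Fin d) (Fin d) ℝ} (hB : Bᵀ = -B) {s : ℂ} (hs : 3 / 2 < s.re)
    (c : ℕ) {v : Fin d → ℤ} (hv : v ≠ 0) :
    ∑' j : ℤ, ∫ p, weightedTerm e B s (((c : ℤ) + 1) • v) (j • v) p ∂stripMeasure =
      (Real.pi : ℂ) ^ (-(s - 1 / 2)) * Complex.Gamma (s - 1 / 2) *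
        (((c : ℂ) + 1) ^ (-(2 * s - 1)) * (qf e (toR v) : ℂ) ^ (-s)) := by
  have hq : 0 < qf e (toR v) := qf_toR_pos he hv
  set q := qf e (toR v) with hqdef
  set e' : Matrix Unit Unit ℝ := fun _ _ => Real.sqrt q with he'
  have hdet : e'.det = Real.sqrt q := by rw [Matrix.det_unique]
  have hsq : 0 < Real.sqrt q := Real.sqrt_pos.2 hq
  have hdet0 : e'.det ≠ 0 := by rw [hdet]; exact hsq.ne'
  have hdE : dualExp Unit s = s - 1 / 2 := by rw [dualExp]; simp; ring
  have hn : (fun _ : Unit => (c : ℤ) + 1) ≠ 0 := by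
    intro h
    have := congrFun h ()
    simp only [Pi.zero_apply] at this
    omega
  have h := tsum_integral_weightedTerm hdet0 (B := 0) (by simp) (s := s) (by
    rw [hdE]; simp; linarith) hn
  have h1 : ∑' j : ℤ, ∫ p, weightedTerm e B s (((c : ℤ) + 1) • v) (j • v) p ∂stripMeasure =
      ∑' m : Unit → ℤ, ∫ p, weightedTerm e' 0 s (fun _ => (c : ℤ) + 1) m p ∂stripMeasure := by
    rw [← (Equiv.funUnique Unit ℤ).symm.tsum_eq]
    refine tsum_congr fun j => ?_
    unfold weightedTerm
    simp_rw [pairTerm_parallel e hB]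
    rfl
  have hc : (0 : ℝ) < (c : ℝ) + 1 := by positivity
  have hD : dualForm e' 0 (fun _ => (c : ℤ) + 1) 0 = ((c : ℝ) + 1) ^ 2 * q := by
    simp only [dualForm, qf, vecMul, dotProduct, Finset.univ_unique, Finset.sum_singleton,
      toR_zero, Matrix.zero_mulVec, sub_zero, Pi.zero_apply, zero_mul, add_zero, toR_apply, he']
    push_cast
    rw [show ∀ a b : ℝ, a * b * (a * b) = a ^ 2 * b ^ 2 by intros; ring, Real.sq_sqrt hq.le]
  have h2 : ∑' k : Unit → ℤ, (if k ⬝ᵥ (fun _ : Unit => (c : ℤ) + 1) = 0 then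
      (dualForm e' 0 (fun _ => (c : ℤ) + 1) k : ℂ) ^ (-dualExp Unit s) else 0) =
      ((((c : ℝ) + 1) ^ 2 * q : ℝ) : ℂ) ^ (-(s - 1 / 2)) := by
    rw [tsum_eq_single 0, hD, hdE]
    · simp
    · intro k hk
      rw [if_neg]
      simp only [dotProduct, Finset.univ_unique, Finset.sum_singleton, mul_eq_zero, not_or]
      refine ⟨fun h0 => hk (funext fun _ => h0), by omega⟩
  rw [h1, h, h2, hdE, hdet, abs_of_pos hsq]
  have hqc : (q : ℂ) ≠ 0 := by exact_mod_cast hq.ne'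
  have e1 : ((((c : ℝ) + 1) ^ 2 * q : ℝ) : ℂ) ^ (-(s - 1 / 2)) =
      ((c : ℂ) + 1) ^ (-(2 * s - 1)) * (q : ℂ) ^ (-(s - 1 / 2)) := by
    rw [Complex.ofReal_mul, Complex.mul_cpow_ofReal_nonneg (by positivity) hq.le]
    congr 1
    rw [show (((c : ℝ) + 1) ^ 2 : ℝ) = ((c : ℝ) + 1) * ((c : ℝ) + 1) by ring, Complex.ofReal_mul,
      Complex.mul_cpow_ofReal_nonneg hc.le hc.le, ← Complex.cpow_add _ _ (by exact_mod_cast hc.ne')]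
    push_cast
    congr 1
    ring
  have e2 : (((Real.sqrt q)⁻¹ : ℝ) : ℂ) = (q : ℂ) ^ (-(1 / 2 : ℂ)) := by
    rw [Real.sqrt_eq_rpow, ← Real.rpow_neg hq.le, Complex.ofReal_cpow hq.le]
    push_cast
    rfl
  have e3 : (q : ℂ) ^ (-s) = (q : ℂ) ^ (-(1 / 2 : ℂ)) * (q : ℂ) ^ (-(s - 1 / 2)) := by
    rw [← Complex.cpow_add _ _ hqc]
    congr 1
    ring
  rw [e1, e2, e3]
  ring

/-- The modular integral for large `Re s` in terms of Epstein zeta functions. -/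
theorem modularIntegral_eq {e : Matrix (Fin d) (Fin d) ℝ} (he : e.det ≠ 0)
    {B : Matrix (Fin d) (Fin d) ℝ} (hB : Bᵀ = -B) (hd : 2 ≤ d) {s : ℂ}
    (hs : (d : ℝ) / 2 + 1 < s.re) :
    haveI : Nonempty (Fin d) := ⟨⟨0, by omega⟩⟩
    modularIntegral (eisSL2Series s) (e * eᵀ + B) =
      ((|e.det|⁻¹ : ℝ) : ℂ) * ((Real.pi : ℂ) ^ (-(s + d / 2 - 1)) * Complex.Gamma (s + d / 2 - 1) *
        ∑' q : (Fin d → ℤ) × (Fin d → ℤ), isoTerm e B (s + d / 2 - 1) q.1 q.2) -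
      2 * ((|e.det|⁻¹ : ℝ) : ℂ) * completedRiemannZeta (2 * (s + d / 2 - 1)) *
        epsteinEis (e⁻¹)ᵀ (det_inv_transpose_ne_zero he) (s + d / 2 - 1) -
      2 * completedRiemannZeta (2 * s - 1) * epsteinEis e he s := by
  have : Nonempty (Fin d) := ⟨⟨0, by omega⟩⟩
  have hd' : (2 : ℝ) ≤ d := by exact_mod_cast hd
  have hdE : dualExp (Fin d) s = s + d / 2 - 1 := by rw [dualExp, Fintype.card_fin]
  have hcard : (Fintype.card (Fin d) : ℝ) < (dualExp (Fin d) s).re := by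
    rw [dualExp_re, Fintype.card_fin]; linarith
  have hs' : (d : ℝ) < (s + d / 2 - 1).re := by
    rw [← hdE]; simpa using hcard
  have hsum := summable_integral_weightedTerm he B hcard
  rw [integral_eq_tsum_integral he hB (by linarith) hs]
  have h1 := tsum_pair_eq_add (F := fun n m => ∫ p, weightedTerm e B s n m p ∂stripMeasure) hsum
  have h2 : ∑' q : {n : Fin d → ℤ // n ≠ 0} × (Fin d → ℤ),
      ∫ p, weightedTerm e B s q.1 q.2 p ∂stripMeasure =
      ((|e.det|⁻¹ : ℝ) : ℂ) * ((Real.pi : ℂ) ^ (-(s + d / 2 - 1)) *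
        Complex.Gamma (s + d / 2 - 1) *
        ∑' q : {n : Fin d → ℤ // n ≠ 0} × (Fin d → ℤ), isoTerm e B (s + d / 2 - 1) q.1 q.2) := by
    rw [hsum.tsum_prod, (summable_ne_zero_pair (summable_isoTerm he hB hs')).tsum_prod, ← mul_assoc, ← tsum_mul_left]
    refine tsum_congr fun n => ?_
    rw [tsum_integral_weightedTerm he hB hcard n.2, hdE]
    rfl
  -- For parallel pairs the contents c + 1 sum to ζ(2s − 1) and the primitive directions to twice
  -- the normalized zeta function of `e`.
  have h3 : ∑' q : (ℕ × {v : Fin d → ℤ // IsPrim v}) × ℤ,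
      ∫ p, weightedTerm e B s (((q.1.1 : ℤ) + 1) • q.1.2.1) (q.2 • q.1.2.1) p ∂stripMeasure =
      2 * completedRiemannZeta (2 * s - 1) * epsteinEis e he s := by
    have hsp := summable_parallel_pair
      (F := fun n m => ∫ p, weightedTerm e B s n m p ∂stripMeasure) hsum
    have hterm : ∀ q : ℕ × {v : Fin d → ℤ // IsPrim v},
        ∑' j : ℤ, ∫ p, weightedTerm e B s (((q.1 : ℤ) + 1) • q.2.1) (j • q.2.1) p
          ∂stripMeasure = (Real.pi : ℂ) ^ (-(s - 1 / 2)) * Complex.Gamma (s - 1 / 2) *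
        (((q.1 : ℂ) + 1) ^ (-(2 * s - 1)) * (qf e (toR q.2.1) : ℂ) ^ (-s)) := fun q =>
      tsum_integral_parallel he hB (by linarith) q.1 q.2.2.ne_zero
    have hsp2 : Summable fun q : ℕ × {v : Fin d → ℤ // IsPrim v} =>
        (Real.pi : ℂ) ^ (-(s - 1 / 2)) * Complex.Gamma (s - 1 / 2) *
        (((q.1 : ℂ) + 1) ^ (-(2 * s - 1)) * (qf e (toR q.2.1) : ℂ) ^ (-s)) :=
      hsp.prod.congr fun q => hterm q
    rw [hsp.tsum_prod, tsum_congr hterm, hsp2.tsum_prod]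
    simp only
    simp_rw [tsum_mul_left, (hasSum_prim_qf he (s := s) (by simp only [Fintype.card_fin]; linarith)
      (by linarith)).tsum_eq]
    rw [tsum_mul_right]
    have hz : 1 < (2 * s - 1).re := by simp; linarith
    have hζ : ∑' c : ℕ, ((c : ℂ) + 1) ^ (-(2 * s - 1)) = riemannZeta (2 * s - 1) := by
      rw [zeta_eq_tsum_one_div_nat_add_one_cpow hz]
      refine tsum_congr fun c => ?_
      rw [Complex.cpow_neg, one_div]
    rw [hζ, show 2 * s - 1 = 2 * (s - 1 / 2) by ring, completedZeta_two_mul (by simp; linarith)]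
    ring
  have h4 := tsum_isoTerm_ne_zero he hB hd hs'
  rw [h3, h2, h4] at h1
  rw [eq_sub_iff_add_eq, h1]
  ring

end Evaluation

end ThetaLift

namespace ThetaLift

open Matrix Set

/-! ### The Iwasawa decomposition -/

section Iwasawa

variable {N : ℕ}

lemma upper_mul_diag {x y : Matrix (Fin N) (Fin N) ℝ} (hx : BlockTriangular x id)
    (hy : BlockTriangular y id) (i : Fin N) : (x * y) i i = x i i * y i i := by
  rw [Matrix.mul_apply]
  refine Finset.sum_eq_single i (fun j _ hj => ?_) (by simp)
  rcases lt_or_gt_of_ne hj with h | h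
  · rw [hx h, zero_mul]
  · rw [hy h, mul_zero]

lemma det_unit_upper {x : Matrix (Fin N) (Fin N) ℝ} (hx : BlockTriangular x id)
    (hx1 : ∀ i, x i i = 1) : x.det = 1 := by
  rw [Matrix.det_of_isUpperTriangular hx]
  simp [hx1]

/-- LDL decomposition with the order of the indices reversed, which turns the lower triangular
factor into an upper triangular one; dividing each row by its diagonal entry makes it unipotent. -/
lemma exists_unit_upper_diagonalize {S : Matrix (Fin N) (Fin N) ℝ} (hS : S.PosDef) :
    ∃ (V : Matrix (Fin N) (Fin N) ℝ) (D : Fin N → ℝ), BlockTriangular V id ∧ (∀ i, V i i = 1) ∧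
      (∀ i, 0 < D i) ∧ V * S * Vᵀ = diagonal D := by
  obtain ⟨U, E, hup, hdiag, hdet⟩ : ∃ (U : Matrix (Fin N) (Fin N) ℝ) (E : Fin N → ℝ),
      BlockTriangular U id ∧ diagonal E = U * S * Uᵀ ∧ U.det ≠ 0 := by
    have hS' : Matrix.PosDef (n := (Fin N)ᵒᵈ) (R := ℝ) S := hS
    refine ⟨LDL.lowerInv (n := (Fin N)ᵒᵈ) hS', LDL.diagEntries (n := (Fin N)ᵒᵈ) hS', ?_, ?_, ?_⟩
    · exact fun i j hij => LDL.lowerInv_triangular (n := (Fin N)ᵒᵈ) hS' (i := OrderDual.toDual i)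
        (j := OrderDual.toDual j) hij
    · have h := LDL.diag_eq_lowerInv_conj (n := (Fin N)ᵒᵈ) hS'
      rw [conjTranspose_eq_transpose_of_trivial] at h
      exact h
    · have h := (LDL.invertibleLowerInv (n := (Fin N)ᵒᵈ) hS').mul_invOf_self
      have h2 := congrArg Matrix.det h
      rw [Matrix.det_mul, Matrix.det_one] at h2
      intro h0
      exact zero_ne_one ((zero_mul _).symm.trans ((congrArg (· * _) h0.symm).trans h2))
  have hu : ∀ i, U i i ≠ 0 := by
    rw [Matrix.det_of_isUpperTriangular hup, Finset.prod_ne_zero_iff] at hdet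
    exact fun i => hdet i (Finset.mem_univ i)
  set V : Matrix (Fin N) (Fin N) ℝ := diagonal (fun i => (U i i)⁻¹) * U with hV
  have hVup : BlockTriangular V id := (blockTriangular_diagonal _).mul hup
  have hV1 : ∀ i, V i i = 1 := by
    intro i
    rw [hV, Matrix.diagonal_mul, inv_mul_cancel₀ (hu i)]
  set D : Fin N → ℝ := fun i => (U i i)⁻¹ * E i * (U i i)⁻¹ with hD
  have hVS : V * S * Vᵀ = diagonal D := by
    rw [hV, Matrix.transpose_mul, Matrix.diagonal_transpose]
    calc _ = diagonal (fun i => (U i i)⁻¹) * (U * S * Uᵀ) * diagonal (fun i => (U i i)⁻¹) := by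
          simp only [Matrix.mul_assoc]
      _ = _ := by rw [← hdiag, diagonal_mul_diagonal, diagonal_mul_diagonal]
  refine ⟨V, D, hVup, hV1, fun i => ?_, hVS⟩
  have hVdet : IsUnit V := by
    rw [Matrix.isUnit_iff_isUnit_det, det_unit_upper hVup hV1]
    exact isUnit_one
  have hpos : (V * S * Vᵀ).PosDef := by
    have := hS.mul_mul_conjTranspose_same (B := V) (Matrix.vecMul_injective_of_isUnit hVdet)
    rwa [conjTranspose_eq_transpose_of_trivial] at this
  have := hpos.diag_pos (i := i)
  rwa [hVS, diagonal_apply_eq] at this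

/-- The upper triangular matrices in `SL(N, ℝ)`. -/
noncomputable def upperSL (N : ℕ) : Subgroup (SLR N) := blockUpper N fun k => k.val

lemma mem_upperSL {x : SLR N} : x ∈ upperSL N ↔ BlockTriangular x.1 id := Iff.rfl

lemma coe_inv_mul (x : SLR N) : (x⁻¹ : SLR N).1 * x.1 = 1 :=
  (Matrix.SpecialLinearGroup.coe_mul x⁻¹ x).symm.trans (by rw [inv_mul_cancel]; rfl)

lemma coe_mul_inv (x : SLR N) : x.1 * (x⁻¹ : SLR N).1 = 1 :=
  (Matrix.SpecialLinearGroup.coe_mul x x⁻¹).symm.trans (by rw [mul_inv_cancel]; rfl)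

lemma coe_inv_eq (x : SLR N) : (x⁻¹ : SLR N).1 = (x.1)⁻¹ :=
  (Matrix.inv_eq_left_inv (coe_inv_mul x)).symm

/-- If V (g gᵗ) Vᵗ = diag(D) with V unit upper triangular, then n = V⁻¹, a = √D and k = t⁻¹ V g. -/
lemma exists_isIwasawa_top (g : SLR N) : ∃ a, IsIwasawa ⊤ g a := by
  have hS : (g.1 * g.1ᵀ).PosDef := by
    have h := Matrix.PosDef.one (n := Fin N) (R := ℝ)
    have hu : IsUnit g.1 := by
      rw [Matrix.isUnit_iff_isUnit_det, g.2]; exact isUnit_one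
    have := h.mul_mul_conjTranspose_same (B := g.1) (Matrix.vecMul_injective_of_isUnit hu)
    rwa [Matrix.mul_one, conjTranspose_eq_transpose_of_trivial] at this
  obtain ⟨V, D, hVu, hV1, hD, hVS⟩ := exists_unit_upper_diagonalize hS
  set V' : SLR N := ⟨V, det_unit_upper hVu hV1⟩ with hV'
  have hinv : (V'⁻¹ : SLR N) ∈ upperSL N := (upperSL N).inv_mem (mem_upperSL.2 hVu)
  have hinv1 : ∀ i, (V'⁻¹ : SLR N).1 i i = 1 := by
    intro i
    have h := congrFun (congrFun (coe_mul_inv V') i) i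
    rw [upper_mul_diag hVu (mem_upperSL.1 hinv), Matrix.one_apply_eq] at h
    rwa [hV1, one_mul] at h
  set a : Fin N → ℝ := fun i => Real.sqrt (D i) with ha
  have ha0 : ∀ i, 0 < a i := fun i => Real.sqrt_pos.2 (hD i)
  have hprod : ∏ i, D i = 1 := by
    have := congrArg Matrix.det hVS
    rw [Matrix.det_mul, Matrix.det_mul, Matrix.det_mul, Matrix.det_transpose, Matrix.det_transpose,
      det_unit_upper hVu hV1, g.2, Matrix.det_diagonal] at this
    simpa using this.symm
  have haprod : ∏ i, a i = 1 := by
    have h1 : (∏ i, a i) ^ 2 = 1 := by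
      rw [← Finset.prod_pow, ← hprod]
      exact Finset.prod_congr rfl fun i _ => Real.sq_sqrt (hD i).le
    have h2 : 0 < ∏ i, a i := Finset.prod_pos fun i _ => ha0 i
    nlinarith
  set t : SLR N := ⟨diagonal a, by rw [Matrix.det_diagonal, haprod]⟩ with ht
  have htinv : (t⁻¹ : SLR N).1 = diagonal fun i => (a i)⁻¹ := by
    rw [coe_inv_eq]
    apply Matrix.inv_eq_left_inv
    rw [ht, diagonal_mul_diagonal, ← diagonal_one]
    congr 1
    funext i
    exact inv_mul_cancel₀ (ha0 i).ne'
  refine ⟨a, V'⁻¹, trivial, t, trivial, t⁻¹ * V' * g, trivial, mem_upperSL.1 hinv, hinv1, ha0, rfl,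
    ?_, by group⟩
  have hk : (t⁻¹ * V' * g).1 = (t⁻¹ : SLR N).1 * V * g.1 := rfl
  change (t⁻¹ * V' * g).1 * (t⁻¹ * V' * g).1ᵀ = 1
  rw [hk, htinv, Matrix.transpose_mul, Matrix.transpose_mul, Matrix.diagonal_transpose]
  calc _ = diagonal (fun i => (a i)⁻¹) * (V * (g.1 * g.1ᵀ) * Vᵀ) * diagonal (fun i => (a i)⁻¹) := by
        simp only [Matrix.mul_assoc]
    _ = 1 := by
        rw [hVS, diagonal_mul_diagonal, diagonal_mul_diagonal, ← diagonal_one]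
        congr 1
        funext i
        have h1 : D i = a i * a i := (Real.mul_self_sqrt (hD i).le).symm
        have h2 := (ha0 i).ne'
        rw [h1]
        field_simp

/-- The inverse is upper triangular, yet equals the lower triangular transpose; so x is diagonal
with positive entries of square 1. -/
lemma upper_orthogonal_eq_one {x : SLR N} (hx : BlockTriangular x.1 id) (hpos : ∀ i, 0 < x.1 i i)
    (ho : x.1 * x.1ᵀ = 1) : x = 1 := by
  have hinv : (x⁻¹ : SLR N).1 = x.1ᵀ := by
    rw [coe_inv_eq]
    exact Matrix.inv_eq_right_inv ho
  have hlow : BlockTriangular (x⁻¹ : SLR N).1 id := (upperSL N).inv_mem (mem_upperSL.2 hx)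
  rw [hinv] at hlow
  have hoff : ∀ i j, i ≠ j → x.1 i j = 0 := by
    intro i j hij
    rcases lt_or_gt_of_ne hij with h | h
    · exact hlow h
    · exact hx h
  apply Subtype.ext
  change x.1 = 1
  ext i j
  by_cases hij : i = j
  · subst hij
    have h := congrFun (congrFun ho i) i
    rw [upper_mul_diag hx hlow, Matrix.transpose_apply, Matrix.one_apply_eq] at h
    rw [Matrix.one_apply_eq]
    nlinarith [hpos i]
  · rw [hoff i j hij, Matrix.one_apply_ne hij]

lemma iwasawa_unique {n t k n' t' k' : SLR N} {a a' : Fin N → ℝ}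
    (hn : BlockTriangular n.1 id) (hn1 : ∀ i, n.1 i i = 1) (hn' : BlockTriangular n'.1 id)
    (hn1' : ∀ i, n'.1 i i = 1) (ha : ∀ i, 0 < a i) (ha' : ∀ i, 0 < a' i)
    (ht : t.1 = diagonal a) (ht' : t'.1 = diagonal a') (hk : k.1 * k.1ᵀ = 1)
    (hk' : k'.1 * k'.1ᵀ = 1) (h : n * t * k = n' * t' * k') : n = n' ∧ t = t' ∧ k = k' := by
  have htu : BlockTriangular t.1 id := by rw [ht]; exact blockTriangular_diagonal _
  have htu' : BlockTriangular t'.1 id := by rw [ht']; exact blockTriangular_diagonal _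
  have hnt : n * t ∈ upperSL N := (upperSL N).mul_mem (mem_upperSL.2 hn) (mem_upperSL.2 htu)
  have hnt' : n' * t' ∈ upperSL N := (upperSL N).mul_mem (mem_upperSL.2 hn') (mem_upperSL.2 htu')
  set x : SLR N := (n' * t')⁻¹ * (n * t) with hx
  have hxu : x ∈ upperSL N := (upperSL N).mul_mem ((upperSL N).inv_mem hnt') hnt
  have hxk : x * k = k' := by
    rw [hx, mul_assoc, h, inv_mul_cancel_left]
  have hxo : x.1 * x.1ᵀ = 1 := by
    have e1 : k'.1 = x.1 * k.1 := by rw [← hxk]; rfl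
    calc x.1 * x.1ᵀ = x.1 * (k.1 * k.1ᵀ) * x.1ᵀ := by rw [hk, Matrix.mul_one]
      _ = (x.1 * k.1) * (x.1 * k.1)ᵀ := by rw [Matrix.transpose_mul]; simp only [Matrix.mul_assoc]
      _ = 1 := by rw [← e1, hk']
  have hd : ∀ i, (n * t).1 i i = a i := by
    intro i
    change (n.1 * t.1) i i = a i
    rw [upper_mul_diag hn htu, hn1, ht, diagonal_apply_eq, one_mul]
  have hd' : ∀ i, (n' * t').1 i i = a' i := by
    intro i
    change (n'.1 * t'.1) i i = a' i
    rw [upper_mul_diag hn' htu', hn1', ht', diagonal_apply_eq, one_mul]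
  have hmul : n' * t' * x = n * t := by rw [hx, mul_inv_cancel_left]
  have hxd : ∀ i, a' i * x.1 i i = a i := by
    intro i
    rw [← hd', ← hd, ← hmul]
    exact (upper_mul_diag hnt' hxu i).symm
  have hx1 : x = 1 := by
    refine upper_orthogonal_eq_one hxu (fun i => ?_) hxo
    have h1 : 0 < a' i * x.1 i i := by rw [hxd]; exact ha i
    exact (mul_pos_iff_of_pos_left (ha' i)).1 h1
  have haa : a = a' := by
    funext i
    rw [← hxd, hx1]
    change a' i * (1 : Matrix (Fin N) (Fin N) ℝ) i i = a' i
    rw [Matrix.one_apply_eq, mul_one]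
  have htt : t = t' := Subtype.ext (by rw [ht, ht', haa])
  refine ⟨?_, htt, ?_⟩
  · rw [hx1, mul_one, htt] at hmul
    exact (mul_right_cancel hmul).symm
  · rw [← hxk, hx1, one_mul]

lemma antidiag_conj_apply (M : Matrix (Fin N) (Fin N) ℝ) (i j : Fin N) :
    (antidiag N * M * antidiag N) i j = M i.rev j.rev := by
  have h1 : ∀ (A : Matrix (Fin N) (Fin N) ℝ) i j, (antidiag N * A) i j = A i.rev j := by
    intro A i j
    simp [antidiag, Matrix.mul_apply]
  have h2 : ∀ (A : Matrix (Fin N) (Fin N) ℝ) i j, (A * antidiag N) i j = A i j.rev := by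
    intro A i j
    rw [Matrix.mul_apply, Finset.sum_eq_single j.rev]
    · simp [antidiag]
    · intro b _ hb
      have : j ≠ b.rev := fun h => hb (by rw [h, Fin.rev_rev])
      simp [antidiag, this]
    · simp
  rw [h2, h1]

/-- The involution `x ↦ w (xᵗ)⁻¹ w` of `SL(N, ℝ)`. -/
noncomputable def antidiagConj (x : SLR N) : SLR N :=
  ⟨antidiag N * (x⁻¹ : SLR N).1ᵀ * antidiag N, by
    have hw : (antidiag N).det * (antidiag N).det = 1 := by
      rw [← Matrix.det_mul, antidiag_mul_self, Matrix.det_one]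
    rw [Matrix.det_mul, Matrix.det_mul, Matrix.det_transpose, (x⁻¹ : SLR N).2, mul_one, hw]⟩

lemma antidiagConj_apply (x : SLR N) (i j : Fin N) :
    (antidiagConj x).1 i j = (x⁻¹ : SLR N).1 j.rev i.rev :=
  antidiag_conj_apply _ i j

lemma antidiagConj_mul (x y : SLR N) : antidiagConj (x * y) = antidiagConj x * antidiagConj y := by
  apply Subtype.ext
  change antidiag N * ((x * y)⁻¹ : SLR N).1ᵀ * antidiag N =
    (antidiag N * (x⁻¹ : SLR N).1ᵀ * antidiag N) * (antidiag N * (y⁻¹ : SLR N).1ᵀ * antidiag N)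
  have h : ((x * y)⁻¹ : SLR N).1 = (y⁻¹ : SLR N).1 * (x⁻¹ : SLR N).1 := by
    rw [_root_.mul_inv_rev]; rfl
  rw [h, Matrix.transpose_mul]
  calc _ = antidiag N * (x⁻¹ : SLR N).1ᵀ * 1 * (y⁻¹ : SLR N).1ᵀ * antidiag N := by
        rw [Matrix.mul_one]; simp only [Matrix.mul_assoc]
    _ = _ := by rw [← antidiag_mul_self]; simp only [Matrix.mul_assoc]

lemma mem_SODD_iff {d : ℕ} {x : SLR (d + d)} :
    x ∈ SODD d ↔ x.1 * antidiag (d + d) * x.1ᵀ = antidiag (d + d) := Iff.rfl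

lemma mem_SODD_iff_antidiagConj {d : ℕ} {x : SLR (d + d)} : x ∈ SODD d ↔ antidiagConj x = x := by
  have hxx : x.1ᵀ * (x⁻¹ : SLR (d + d)).1ᵀ = 1 := by
    rw [← Matrix.transpose_mul, coe_inv_mul, Matrix.transpose_one]
  have hxx' : (x⁻¹ : SLR (d + d)).1ᵀ * x.1ᵀ = 1 := by
    rw [← Matrix.transpose_mul, coe_mul_inv, Matrix.transpose_one]
  have hw := antidiag_mul_self (d + d)
  rw [mem_SODD_iff]
  constructor
  · intro h
    apply Subtype.ext
    change antidiag (d + d) * (x⁻¹ : SLR (d + d)).1ᵀ * antidiag (d + d) = x.1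
    calc _ = (x.1 * antidiag (d + d) * x.1ᵀ) * (x⁻¹ : SLR (d + d)).1ᵀ * antidiag (d + d) := by rw [h]
      _ = x.1 * antidiag (d + d) * (x.1ᵀ * (x⁻¹ : SLR (d + d)).1ᵀ) * antidiag (d + d) := by
        simp only [Matrix.mul_assoc]
      _ = x.1 := by rw [hxx, Matrix.mul_one, Matrix.mul_assoc, hw, Matrix.mul_one]
  · intro h
    have h' : antidiag (d + d) * (x⁻¹ : SLR (d + d)).1ᵀ * antidiag (d + d) = x.1 :=
      congrArg Subtype.val h
    calc x.1 * antidiag (d + d) * x.1ᵀ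
        = (antidiag (d + d) * (x⁻¹ : SLR (d + d)).1ᵀ * antidiag (d + d)) * antidiag (d + d) *
          x.1ᵀ := by rw [h']
      _ = antidiag (d + d) * ((x⁻¹ : SLR (d + d)).1ᵀ * (antidiag (d + d) * antidiag (d + d)) *
          x.1ᵀ) := by simp only [Matrix.mul_assoc]
      _ = _ := by rw [hw, Matrix.mul_one, hxx', Matrix.mul_one]

/-- SO(d,d) is the fixed group of the involution `antidiagConj`, which preserves unit upper
triangular, positive diagonal and orthogonal matrices. By uniqueness it fixes each Iwasawa factor of
a fixed element. -/
lemma exists_isIwasawa_SODD {d : ℕ} {g : SLR (d + d)} (hg : g ∈ SODD d) :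
    ∃ a, IsIwasawa (SODD d) g a := by
  obtain ⟨a, n, -, t, -, k, -, hn, hn1, ha, ht, hk, hgnt⟩ := exists_isIwasawa_top g
  have hninv : BlockTriangular (n⁻¹ : SLR (d + d)).1 id :=
    (upperSL _).inv_mem (mem_upperSL.2 hn)
  have hninv1 : ∀ i, (n⁻¹ : SLR (d + d)).1 i i = 1 := by
    intro i
    have h := congrFun (congrFun (coe_mul_inv n) i) i
    rwa [upper_mul_diag hn hninv, hn1, one_mul, Matrix.one_apply_eq] at h
  have htinv : (t⁻¹ : SLR (d + d)).1 = diagonal fun i => (a i)⁻¹ := by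
    rw [coe_inv_eq]
    apply Matrix.inv_eq_left_inv
    rw [ht, diagonal_mul_diagonal, ← diagonal_one]
    congr 1
    funext i
    exact inv_mul_cancel₀ (ha i).ne'
  have hkinv : (k⁻¹ : SLR (d + d)).1 = k.1ᵀ := by
    rw [coe_inv_eq]
    exact Matrix.inv_eq_right_inv hk
  have hk2 : k.1ᵀ * k.1 = 1 := by rw [← hkinv, coe_inv_mul]
  have hu := iwasawa_unique (n := antidiagConj n) (t := antidiagConj t) (k := antidiagConj k)
    (n' := n) (t' := t) (k' := k) (a := fun i => (a i.rev)⁻¹) (a' := a)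
    (fun i j hij => by
      rw [antidiagConj_apply]
      exact hninv (Fin.rev_lt_rev.2 hij))
    (fun i => by rw [antidiagConj_apply, hninv1]) hn hn1 (fun i => inv_pos.2 (ha _)) ha
    (by
      ext i j
      rw [antidiagConj_apply, htinv]
      by_cases h : i = j
      · subst h; rw [diagonal_apply_eq, diagonal_apply_eq]
      · rw [diagonal_apply_ne _ h, diagonal_apply_ne _ fun h2 => h (Fin.rev_injective h2).symm])
    ht
    (by
      change (antidiag (d + d) * (k⁻¹ : SLR (d + d)).1ᵀ * antidiag (d + d)) *
        (antidiag (d + d) * (k⁻¹ : SLR (d + d)).1ᵀ * antidiag (d + d))ᵀ = 1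
      have hw := antidiag_mul_self (d + d)
      rw [hkinv, Matrix.transpose_transpose, Matrix.transpose_mul, Matrix.transpose_mul,
        antidiag_transpose]
      calc _ = antidiag (d + d) * k.1 * (antidiag (d + d) * antidiag (d + d)) * k.1ᵀ *
            antidiag (d + d) := by simp only [Matrix.mul_assoc]
        _ = antidiag (d + d) * (k.1 * k.1ᵀ) * antidiag (d + d) := by
            rw [hw, Matrix.mul_one]; simp only [Matrix.mul_assoc]
        _ = 1 := by rw [show k.1 * k.1ᵀ = 1 from hk, Matrix.mul_one, hw])
    hk
    (by
      rw [← antidiagConj_mul, ← antidiagConj_mul, ← hgnt]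
      exact mem_SODD_iff_antidiagConj.1 hg)
  exact ⟨a, n, mem_SODD_iff_antidiagConj.2 hu.1, t, mem_SODD_iff_antidiagConj.2 hu.2.1, k,
    mem_SODD_iff_antidiagConj.2 hu.2.2, hn, hn1, ha, ht, hk, hgnt⟩

/-! ### The weights in terms of lengths of vectors -/

lemma qf_mul_orthogonal (x k : Matrix (Fin N) (Fin N) ℝ) (hk : k * kᵀ = 1) (v : Fin N → ℝ) :
    qf (x * k) v = qf x v := by
  have h := dotProduct_mulVec ((v ᵥ* x) ᵥ* k) kᵀ (v ᵥ* x)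
  rw [Matrix.mulVec_transpose, Matrix.vecMul_vecMul _ k, hk, Matrix.vecMul_one] at h
  rw [qf, ← Matrix.vecMul_vecMul, h, qf]

lemma IsIwasawa.prod_eq_one {G : Subgroup (SLR N)} {g : SLR N} {a : Fin N → ℝ}
    (h : IsIwasawa G g a) : ∏ i, a i = 1 := by
  obtain ⟨n, -, t, -, k, -, -, -, -, ht, -, -⟩ := h
  rw [← Matrix.det_diagonal, ← ht]
  exact t.2

lemma IsIwasawa.last_sq {G : Subgroup (SLR N)} {g : SLR N} {a : Fin N → ℝ}
    (h : IsIwasawa G g a) {l : Fin N} (hl : ∀ j, j ≤ l) :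
    a l ^ 2 = qf g.1 (Pi.single l 1) := by
  obtain ⟨n, -, t, -, k, -, hn, hn1, ha, ht, hk, rfl⟩ := h
  change _ = qf (n.1 * t.1 * k.1) _
  rw [qf_mul_orthogonal _ _ hk, ht]
  have hrow : Pi.single l 1 ᵥ* (n.1 * diagonal a) = Pi.single l (a l) := by
    rw [Matrix.single_one_vecMul]
    funext j
    rw [Matrix.row_apply, Matrix.mul_diagonal]
    by_cases hj : j = l
    · subst hj; rw [hn1, one_mul, Pi.single_eq_same]
    · rw [hn (lt_of_le_of_ne (hl j) hj), zero_mul, Pi.single_eq_of_ne hj]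
  rw [qf, hrow]
  simp [sq]

/-- (g⁻¹)ᵗ = (n⁻¹)ᵗ t⁻¹ k, and the first row of the lower triangular factor has a single nonzero
entry. -/
lemma IsIwasawa.first_sq {G : Subgroup (SLR N)} {g : SLR N} {a : Fin N → ℝ}
    (h : IsIwasawa G g a) {f : Fin N} (hf : ∀ j, f ≤ j) :
    (a f)⁻¹ ^ 2 = qf (g⁻¹ : SLR N).1ᵀ (Pi.single f 1) := by
  obtain ⟨n, -, t, -, k, -, hn, hn1, ha, ht, hk, rfl⟩ := h
  have htinv : (t⁻¹ : SLR N).1 = diagonal fun i => (a i)⁻¹ := by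
    rw [coe_inv_eq]
    apply Matrix.inv_eq_left_inv
    rw [ht, diagonal_mul_diagonal, ← diagonal_one]
    congr 1
    funext i
    exact inv_mul_cancel₀ (ha i).ne'
  have hkinv : (k⁻¹ : SLR N).1 = k.1ᵀ := by
    rw [coe_inv_eq]
    exact Matrix.inv_eq_right_inv hk
  have hninv : BlockTriangular (n⁻¹ : SLR N).1 id := (upperSL _).inv_mem (mem_upperSL.2 hn)
  have hninv1 : ∀ i, (n⁻¹ : SLR N).1 i i = 1 := by
    intro i
    have h := congrFun (congrFun (coe_mul_inv n) i) i
    rwa [upper_mul_diag hn hninv, hn1, one_mul, Matrix.one_apply_eq] at h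
  have hinv : ((n * t * k)⁻¹ : SLR N).1ᵀ =
      (n⁻¹ : SLR N).1ᵀ * (diagonal fun i => (a i)⁻¹) * k.1 := by
    have : ((n * t * k)⁻¹ : SLR N).1 = (k⁻¹ : SLR N).1 * ((t⁻¹ : SLR N).1 * (n⁻¹ : SLR N).1) := by
      rw [_root_.mul_inv_rev, _root_.mul_inv_rev]; rfl
    rw [this, hkinv, htinv, Matrix.transpose_mul, Matrix.transpose_mul, Matrix.transpose_transpose,
      Matrix.diagonal_transpose]
  rw [hinv, qf_mul_orthogonal _ _ hk]
  have hrow : Pi.single f 1 ᵥ* ((n⁻¹ : SLR N).1ᵀ * diagonal fun i => (a i)⁻¹) =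
      Pi.single f (a f)⁻¹ := by
    rw [Matrix.single_one_vecMul]
    funext j
    rw [Matrix.row_apply, Matrix.mul_diagonal, Matrix.transpose_apply]
    by_cases hj : j = f
    · subst hj; rw [hninv1, one_mul, Pi.single_eq_same]
    · rw [hninv (lt_of_le_of_ne (hf j) (Ne.symm hj)), zero_mul, Pi.single_eq_of_ne hj]
  rw [qf, hrow]
  simp [sq]

lemma expWeight_one {G : Subgroup (SLR N)} {g : SLR N} (h : ∃ a, IsIwasawa G g a) {f : Fin N}
    (hf : f.val = 0) :
    0 < expWeight G 1 g ∧ (expWeight G 1 g)⁻¹ ^ 2 = qf (g⁻¹ : SLR N).1ᵀ (Pi.single f 1) := by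
  have hs : IsIwasawa G g (iwasawaA G g) := Classical.epsilon_spec h
  have he : expWeight G 1 g = iwasawaA G g f := by
    rw [expWeight]
    have : (Finset.univ.filter fun k : Fin N => k.val < 1) = {f} := by
      ext k
      simp only [Finset.mem_filter, Finset.mem_univ, true_and, Finset.mem_singleton, Fin.ext_iff]
      omega
    rw [this, Finset.prod_singleton]
  rw [he]
  refine ⟨?_, hs.first_sq fun j => by rw [Fin.le_def]; omega⟩
  obtain ⟨n, -, t, -, k, -, -, -, ha, -, -, -⟩ := hs
  exact ha f

/-- The product of all the a_i is 1, so the product of all but the last is the inverse of the last,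
which is the length of the last row of g. -/
lemma expWeight_pred {G : Subgroup (SLR N)} {g : SLR N} (h : ∃ a, IsIwasawa G g a) {l : Fin N}
    (hl : l.val = N - 1) :
    0 < expWeight G (N - 1) g ∧ (expWeight G (N - 1) g)⁻¹ ^ 2 = qf g.1 (Pi.single l 1) := by
  have hs : IsIwasawa G g (iwasawaA G g) := Classical.epsilon_spec h
  have ha : ∀ i, 0 < iwasawaA G g i := by
    obtain ⟨n, -, t, -, k, -, -, -, ha, -, -, -⟩ := hs
    exact ha
  have he : expWeight G (N - 1) g * iwasawaA G g l = 1 := by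
    rw [expWeight, ← hs.prod_eq_one]
    have : (Finset.univ.filter fun k : Fin N => k.val < N - 1) = Finset.univ.erase l := by
      ext k
      simp only [Finset.mem_filter, Finset.mem_univ, true_and, Finset.mem_erase, ne_eq, Fin.ext_iff,
        and_true]
      have := k.2
      omega
    rw [this, Finset.prod_erase_mul _ _ (Finset.mem_univ l)]
  refine ⟨Finset.prod_pos fun i _ => ha i, ?_⟩
  rw [inv_eq_of_mul_eq_one_right he]
  refine hs.last_sq fun j => ?_
  rw [Fin.le_def]
  have := j.2
  omega

end Iwasawa

end ThetaLift

namespace ThetaLift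

open Matrix Set

/-! ### Sums over cosets -/

/-- By `hP` the vector φ(γ) determines the coset up to sign and conversely, and by `hsurj` all of S
is reached up to sign. As v ≠ −v, cosets together with a sign are in bijection with S; the evenness
of F gives the factor 2. -/
lemma hasSum_leftCosets {G ι : Type*} [Group G] {Γ P : Subgroup G} {S : (ι → ℤ) → Prop}
    (hneg : ∀ v, S v → S (-v)) (hne : ∀ v, S v → v ≠ 0) {φ : Γ → ι → ℤ} (hφ : ∀ γ, S (φ γ))
    (hsurj : ∀ v, S v → ∃ γ, φ γ = v ∨ φ γ = -v)
    (hP : ∀ γ γ' : Γ, (γ' : G) * (γ : G)⁻¹ ∈ P ↔ φ γ' = φ γ ∨ φ γ' = -φ γ)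
    {F : (ι → ℤ) → ℂ} (hF : ∀ v, F (-v) = F v) {A : ℂ}
    (h : HasSum (fun v : {v // S v} => F v.1) (2 * A)) :
    HasSum (fun q : LeftCosets Γ P => F (φ q.out)) A := by
  have hrel : ∀ γ γ' : Γ, (Quotient.mk (QuotientGroup.rightRel (P.subgroupOf Γ)) γ =
      Quotient.mk (QuotientGroup.rightRel (P.subgroupOf Γ)) γ') ↔ φ γ' = φ γ ∨ φ γ' = -φ γ := by
    intro γ γ'
    rw [Quotient.eq, QuotientGroup.rightRel_apply, Subgroup.mem_subgroupOf, ← hP γ γ']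
    rfl
  have hself : ∀ γ : Γ, -φ γ ≠ φ γ := fun γ hγ => hne _ (hφ γ) (self_eq_neg.1 hγ.symm)
  set f : LeftCosets Γ P × Bool → {v // S v} := fun q =>
    if q.2 then ⟨φ q.1.out, hφ _⟩ else ⟨-φ q.1.out, hneg _ (hφ _)⟩ with hf
  have hft : ∀ q, (f (q, true)).1 = φ q.out := fun q => rfl
  have hff : ∀ q, (f (q, false)).1 = -φ q.out := fun q => rfl
  have hq : ∀ q q' : LeftCosets Γ P, (φ q'.out = φ q.out ∨ φ q'.out = -φ q.out) → q = q' := by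
    intro q q' hqq
    rw [← Quotient.out_eq q, ← Quotient.out_eq q']
    exact (hrel _ _).2 hqq
  have hbij : Function.Bijective f := by
    constructor
    · rintro ⟨q, b⟩ ⟨q', b'⟩ hqq
      have h1 := congrArg Subtype.val hqq
      rcases b with _ | _ <;> rcases b' with _ | _
      · rw [hff, hff] at h1
        rw [hq q q' (Or.inl (neg_injective h1).symm)]
      · rw [hff, hft] at h1
        have := hq q q' (Or.inr h1.symm)
        subst this
        exact absurd h1 (hself _)
      · rw [hff, hft] at h1
        have := hq q q' (Or.inr (by rw [h1, neg_neg]))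
        subst this
        exact absurd h1.symm (hself _)
      · rw [hft, hft] at h1
        rw [hq q q' (Or.inl h1.symm)]
    · rintro ⟨v, hv⟩
      obtain ⟨γ, hγ⟩ := hsurj v hv
      set q : LeftCosets Γ P := Quotient.mk _ γ with hqdef
      have h1 : φ q.out = φ γ ∨ φ q.out = -φ γ :=
        (hrel γ q.out).1 (by rw [hqdef, Quotient.out_eq])
      have h2 : φ q.out = v ∨ φ q.out = -v := by
        rcases h1 with h1 | h1 <;> rcases hγ with h2 | h2 <;> rw [h1, h2]
        · exact Or.inl rfl
        · exact Or.inr rfl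
        · exact Or.inr rfl
        · exact Or.inl (neg_neg v)
      rcases h2 with h2 | h2
      · exact ⟨(q, true), Subtype.ext (by rw [hft, h2])⟩
      · exact ⟨(q, false), Subtype.ext (by rw [hff, h2, neg_neg])⟩
  have h1 := (Equiv.ofBijective f hbij).hasSum_iff.2 h
  have h2 := h1.prod_fiberwise (g := fun q => 2 * F (φ q.out)) fun q => by
    have h3 := hasSum_fintype fun b : Bool => F (f (q, b)).1
    rw [Fintype.sum_bool, hft, hff, hF, ← two_mul] at h3
    exact h3
  exact (hasSum_mul_left_iff two_ne_zero).1 h2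

/-! ### The Euclidean algorithm for vectors -/

/-- The Euclidean algorithm, by induction on the sum of the |z_k|. It is stated for an abstract
relation and a coordinate map `z`, so that it serves for SL(d,ℤ) and for isotropic blocks of
coordinates under Spin(d,d,ℤ). -/
lemma exists_reachable_single {X : Type*} {d : ℕ} (hd : 0 < d) (R : X → X → Prop)
    (hrefl : ∀ x, R x x) (htrans : ∀ x y z, R x y → R y z → R x z) (z : X → Fin d → ℤ)
    (hstep : ∀ x a b, a ≠ b → ∀ t : ℤ, ∃ y, R x y ∧
      z y = Function.update (z x) a (z x a + t * z x b)) (x : X) :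
    ∃ y l, R x y ∧ ∀ k, k ≠ l → z y k = 0 := by
  induction hN : ∑ k, (z x k).natAbs using Nat.strong_induction_on generalizing x with
  | _ N ih =>
    by_cases h : ∃ a b, a ≠ b ∧ z x b ≠ 0 ∧ (z x b).natAbs ≤ (z x a).natAbs
    · obtain ⟨a, b, hab, hb, hle⟩ := h
      -- Subtract or add the smaller entry according to whether the two signs agree.
      obtain ⟨t, ht⟩ : ∃ t : ℤ, (z x a + t * z x b).natAbs < (z x a).natAbs := by
        by_cases hsign : 0 < z x a * z x b
        · refine ⟨-1, ?_⟩
          rcases lt_trichotomy (z x a) 0 with h1 | h1 | h1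
          · have : z x b < 0 := by by_contra h2; nlinarith
            omega
          · rw [h1] at hsign; simp at hsign
          · have : 0 < z x b := by by_contra h2; nlinarith
            omega
        · refine ⟨1, ?_⟩
          rcases lt_trichotomy (z x a) 0 with h1 | h1 | h1
          · have : 0 < z x b := by
              by_contra h2
              have h3 : z x b < 0 := lt_of_le_of_ne (not_lt.1 h2) hb
              exact hsign (mul_pos_of_neg_of_neg h1 h3)
            omega
          · rw [h1] at hle
            omega
          · have : z x b < 0 := by
              by_contra h2
              have h3 : 0 < z x b := lt_of_le_of_ne (not_lt.1 h2) (Ne.symm hb)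
              exact hsign (mul_pos h1 h3)
            omega
      obtain ⟨y, hy, hzy⟩ := hstep x a b hab t
      have hlt : ∑ k, (z y k).natAbs < N := by
        rw [← hN]
        refine Finset.sum_lt_sum (fun k _ => ?_) ⟨a, Finset.mem_univ a, ?_⟩
        · rw [hzy]
          by_cases hk : k = a
          · subst hk
            rw [Function.update_self]
            exact ht.le
          · rw [Function.update_of_ne hk]
        · rw [hzy, Function.update_self]
          exact ht
      obtain ⟨y', l, h1, h2⟩ := ih _ hlt y rfl
      exact ⟨y', l, htrans _ _ _ hy h1, h2⟩
    · push Not at h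
      by_cases h0 : ∃ l, z x l ≠ 0
      · obtain ⟨l, hl⟩ := h0
        refine ⟨x, l, hrefl x, fun k hk => ?_⟩
        by_contra hk0
        have h1 := h k l hk hl
        have h2 := h l k (Ne.symm hk) hk0
        omega
      · push Not at h0
        exact ⟨x, ⟨0, hd⟩, hrefl x, fun k _ => h0 k⟩

lemma isPrim_of_dotProduct {ι : Type*} [Fintype ι] {v u : ι → ℤ} (h : v ⬝ᵥ u = 1) : IsPrim v := by
  have h1 : Finset.univ.gcd v ∣ 1 := by
    rw [← h]
    exact Finset.dvd_sum fun i hi => Dvd.dvd.mul_right (Finset.gcd_dvd hi) _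
  have h2 := gcd_nonneg v
  exact Int.eq_one_of_dvd_one h2 h1

lemma IsPrim.of_vecMul {ι : Type*} [Fintype ι] [DecidableEq ι] {v : ι → ℤ} {M : Matrix ι ι ℤ}
    (hM : M.det = 1) (hv : IsPrim v) : IsPrim (v ᵥ* M) := by
  have h1 : ∀ (u : ι → ℤ) (A : Matrix ι ι ℤ), Finset.univ.gcd u ∣ Finset.univ.gcd (u ᵥ* A) := by
    intro u A
    refine Finset.dvd_gcd fun i _ => ?_
    exact Finset.dvd_sum fun j hj => Dvd.dvd.mul_right (Finset.gcd_dvd hj) _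
  have h2 := h1 (v ᵥ* M) M.adjugate
  rw [Matrix.vecMul_vecMul, Matrix.mul_adjugate, hM, one_smul, Matrix.vecMul_one] at h2
  have hv' : Finset.univ.gcd v = 1 := hv
  rw [hv'] at h2
  exact Int.eq_one_of_dvd_one (gcd_nonneg _) h2

lemma IsPrim.eq_of_single {ι : Type*} [Fintype ι] [DecidableEq ι] {v : ι → ℤ} {l : ι}
    (hv : IsPrim v) (h : ∀ k, k ≠ l → v k = 0) : v = Pi.single l 1 ∨ v = -Pi.single l 1 := by
  have h1 : v = v l • Pi.single l 1 := by
    funext k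
    by_cases hk : k = l
    · subst hk; simp
    · simp [h k hk, hk]
  have h2 : v l ∣ 1 := by
    have hv' : Finset.univ.gcd v = 1 := hv
    rw [← hv']
    refine Finset.dvd_gcd fun k _ => ?_
    by_cases hk : k = l
    · subst hk; exact dvd_rfl
    · rw [h k hk]; exact dvd_zero _
  rcases Int.isUnit_iff.1 (isUnit_of_dvd_one h2) with h3 | h3
  · left
    rw [h1, h3, one_smul]
  · right
    rw [h1, h3, neg_smul, one_smul]

lemma exists_vecMul_eq_single {d : ℕ} (hd : 2 ≤ d) {v : Fin d → ℤ} (hv : IsPrim v) (i : Fin d) :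
    ∃ M : Matrix.SpecialLinearGroup (Fin d) ℤ, v ᵥ* M.1 = Pi.single i 1 ∨
      v ᵥ* M.1 = -Pi.single i 1 := by
  set R : (Fin d → ℤ) → (Fin d → ℤ) → Prop := fun v w =>
    ∃ M : Matrix.SpecialLinearGroup (Fin d) ℤ, v ᵥ* M.1 = w with hR
  have hrefl : ∀ x, R x x := fun x => ⟨1, by
    change x ᵥ* (1 : Matrix (Fin d) (Fin d) ℤ) = x
    rw [Matrix.vecMul_one]⟩
  have htrans : ∀ x y z, R x y → R y z → R x z := by
    rintro x y z ⟨M, rfl⟩ ⟨M', rfl⟩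
    refine ⟨M * M', ?_⟩
    change x ᵥ* (M.1 * M'.1) = _
    rw [Matrix.vecMul_vecMul]
  have hstep : ∀ (x : Fin d → ℤ) a b, a ≠ b → ∀ t : ℤ, ∃ y, R x y ∧
      y = Function.update x a (x a + t * x b) := by
    intro x a b hab t
    refine ⟨_, ⟨⟨transvection b a t, det_transvection_of_ne b a (Ne.symm hab) t⟩, ?_⟩, rfl⟩
    change x ᵥ* transvection b a t = _
    rw [transvection, Matrix.vecMul_add, Matrix.vecMul_one]
    funext k
    have hs : (x ᵥ* Matrix.single b a t) k = if a = k then t * x b else 0 := by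
      simp only [Matrix.vecMul, dotProduct, Matrix.single_apply, mul_ite, mul_zero]
      rw [Finset.sum_eq_single b (fun i _ hi => if_neg fun h => hi h.1.symm) (by simp)]
      simp [mul_comm]
    rw [Pi.add_apply, hs]
    by_cases hk : k = a
    · subst hk
      simp
    · simp [hk, Ne.symm hk]
  obtain ⟨y, l, ⟨M, hM⟩, hy⟩ := exists_reachable_single (by omega) R hrefl htrans (fun v => v)
    hstep v
  have hyp : IsPrim y := hM ▸ hv.of_vecMul M.2
  -- Two elementary operations lead from e_l through e_l + e_i to e_i.
  obtain ⟨M', hM'⟩ : R (Pi.single l 1) (Pi.single i 1) := by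
    by_cases hl : l = i
    · subst hl; exact hrefl _
    · obtain ⟨y1, h1, e1⟩ := hstep (Pi.single l 1) i l (Ne.symm hl) 1
      obtain ⟨y2, h2, e2⟩ := hstep y1 l i hl (-1)
      have : y2 = Pi.single i 1 := by
        rw [e2, e1]
        funext k
        by_cases hk : k = l
        · subst hk
          simp [hl, Ne.symm hl]
        · by_cases hk' : k = i
          · subst hk'; simp [hk]
          · simp [hk, hk']
      rw [← this]
      exact htrans _ _ _ h1 h2
  refine ⟨M * M', ?_⟩
  change v ᵥ* (M.1 * M'.1) = _ ∨ v ᵥ* (M.1 * M'.1) = _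
  rw [← Matrix.vecMul_vecMul, hM]
  rcases hyp.eq_of_single hy with h | h
  · left; rw [h, hM']
  · right; rw [h, Matrix.neg_vecMul, hM']

/-! ### The Eisenstein series of `SL(d)` -/

section SLSeries

variable {N : ℕ}

lemma exists_int_matrix {x : SLR N} (hx : x ∈ SLZ N) :
    ∃ M : Matrix.SpecialLinearGroup (Fin N) ℤ, x.1 = M.1.map (Int.cast : ℤ → ℝ) := by
  obtain ⟨M, rfl⟩ := hx
  exact ⟨M, rfl⟩

lemma map_mem_SLZ (M : Matrix.SpecialLinearGroup (Fin N) ℤ) :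
    Matrix.SpecialLinearGroup.map (Int.castRingHom ℝ) M ∈ SLZ N := ⟨M, rfl⟩

/-- The integral row with a given index of an element of `SL(N, ℤ)`. -/
noncomputable def intRow (l : Fin N) (x : SLR N) : Fin N → ℤ := fun j => ⌊x.1 l j⌋

lemma toR_intRow {x : SLR N} (hx : x ∈ SLZ N) (l : Fin N) :
    toR (intRow l x) = Pi.single l 1 ᵥ* x.1 := by
  obtain ⟨M, hM⟩ := exists_int_matrix hx
  funext j
  rw [Matrix.single_one_vecMul, Matrix.row_apply, toR_apply, intRow, hM, Matrix.map_apply,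
    Int.floor_intCast]

/-- The integral column with a given index of the inverse of an element of `SL(N, ℤ)`. -/
noncomputable def intInvCol (l : Fin N) (x : SLR N) : Fin N → ℤ :=
  fun j => ⌊(x⁻¹ : SLR N).1 j l⌋

lemma toR_intInvCol {x : SLR N} (hx : x ∈ SLZ N) (l : Fin N) :
    toR (intInvCol l x) = (x⁻¹ : SLR N).1 *ᵥ Pi.single l 1 := by
  obtain ⟨M, hM⟩ := exists_int_matrix ((SLZ N).inv_mem hx)
  funext j
  rw [Matrix.mulVec_single_one, Matrix.col_apply, toR_apply, intInvCol, hM, Matrix.map_apply,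
    Int.floor_intCast]

lemma intRow_dotProduct_intInvCol {x : SLR N} (hx : x ∈ SLZ N) (l : Fin N) :
    intRow l x ⬝ᵥ intInvCol l x = 1 := by
  have h : toR (intRow l x) ⬝ᵥ toR (intInvCol l x) = 1 := by
    rw [toR_intRow hx, toR_intInvCol hx, Matrix.dotProduct_mulVec, Matrix.vecMul_vecMul, coe_mul_inv,
      Matrix.vecMul_one]
    simp
  have h2 : ((intRow l x ⬝ᵥ intInvCol l x : ℤ) : ℝ) = 1 := by
    rw [← h]; simp [dotProduct]
  exact_mod_cast h2

lemma isPrim_intRow {x : SLR N} (hx : x ∈ SLZ N) (l : Fin N) : IsPrim (intRow l x) :=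
  isPrim_of_dotProduct (intRow_dotProduct_intInvCol hx l)

lemma isPrim_intInvCol {x : SLR N} (hx : x ∈ SLZ N) (l : Fin N) : IsPrim (intInvCol l x) :=
  isPrim_of_dotProduct ((dotProduct_comm _ _).trans (intRow_dotProduct_intInvCol hx l))

lemma cpow_two_mul_eq {r q : ℝ} (hr : 0 < r) (h : r⁻¹ ^ 2 = q) (s : ℂ) :
    (r : ℂ) ^ (2 * s) = (q : ℂ) ^ (-s) := by
  have hr' : 0 < r⁻¹ := inv_pos.2 hr
  rw [← h, sq, Complex.ofReal_mul, Complex.mul_cpow_ofReal_nonneg hr'.le hr'.le, Complex.ofReal_inv,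
    Complex.inv_cpow _ _ (by rw [Complex.arg_ofReal_of_nonneg hr.le]; exact Real.pi_pos.ne),
    Complex.cpow_neg, inv_inv, ← Complex.cpow_add _ _ (by exact_mod_cast hr.ne'), two_mul]

lemma eq_or_eq_neg_of_toR {v w : Fin N → ℤ} :
    (v = w ∨ v = -w) ↔ (toR v = toR w ∨ toR v = -toR w) := by
  rw [← toR_neg, toR_injective.eq_iff, toR_injective.eq_iff]

lemma sq_eq_one_of_inv_int {a b : ℝ} (ha : ∃ k : ℤ, a = k) (hb : ∃ k : ℤ, b = k) (h : a * b = 1) :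
    a = 1 ∨ a = -1 := by
  obtain ⟨k, rfl⟩ := ha
  obtain ⟨k', rfl⟩ := hb
  have h' : k * k' = 1 := by exact_mod_cast h
  rcases Int.isUnit_iff.1 (IsUnit.of_mul_eq_one _ h') with h1 | h1 <;> rw [h1] <;> simp

lemma exists_int_entry {x : SLR N} (hx : x ∈ SLZ N) (i j : Fin N) : ∃ k : ℤ, x.1 i j = k := by
  obtain ⟨M, hM⟩ := exists_int_matrix hx
  exact ⟨M.1 i j, by rw [hM, Matrix.map_apply]⟩

/-- The surviving entry is an integer with an integral inverse, hence ±1. -/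
lemma last_row_iff {p : SLR N} (hp : p ∈ SLZ N) (l : Fin N) :
    (∀ j, j ≠ l → p.1 l j = 0) ↔ (Pi.single l 1 ᵥ* p.1 = Pi.single l (1 : ℝ) ∨
      Pi.single l 1 ᵥ* p.1 = -Pi.single l (1 : ℝ)) := by
  rw [Matrix.single_one_vecMul]
  constructor
  · intro h
    have hprod : p.1 l l * (p⁻¹ : SLR N).1 l l = 1 := by
      have h2 := congrFun (congrFun (coe_mul_inv p) l) l
      rw [Matrix.mul_apply, Finset.sum_eq_single l (fun j _ hj => by rw [h j hj, zero_mul])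
        (by simp), Matrix.one_apply_eq] at h2
      exact h2
    rcases sq_eq_one_of_inv_int (exists_int_entry hp l l)
      (exists_int_entry ((SLZ N).inv_mem hp) l l) hprod with h1 | h1
    · left
      funext j
      by_cases hj : j = l
      · subst hj; rw [Matrix.row_apply, h1, Pi.single_eq_same]
      · rw [Matrix.row_apply, h j hj, Pi.single_eq_of_ne hj]
    · right
      funext j
      by_cases hj : j = l
      · subst hj; rw [Matrix.row_apply, h1, Pi.neg_apply, Pi.single_eq_same]
      · rw [Matrix.row_apply, h j hj, Pi.neg_apply, Pi.single_eq_of_ne hj, neg_zero]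
  · rintro (h | h) j hj
    · exact (congrFun h j).trans (Pi.single_eq_of_ne hj _)
    · exact (congrFun h j).trans (by rw [Pi.neg_apply, Pi.single_eq_of_ne hj, neg_zero])

lemma first_col_iff {p : SLR N} (hp : p ∈ SLZ N) (l : Fin N) :
    (∀ j, j ≠ l → p.1 j l = 0) ↔ (p.1 *ᵥ Pi.single l 1 = Pi.single l (1 : ℝ) ∨
      p.1 *ᵥ Pi.single l 1 = -Pi.single l (1 : ℝ)) := by
  obtain ⟨M, hM⟩ := exists_int_matrix hp
  have hpt : (p.transpose : SLR N) ∈ SLZ N := by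
    refine ⟨M.transpose, Subtype.ext ?_⟩
    change M.1ᵀ.map (Int.cast : ℤ → ℝ) = p.1ᵀ
    rw [hM, Matrix.transpose_map]
  have h := last_row_iff hpt l
  have ht : (p.transpose : SLR N).1 = p.1ᵀ := rfl
  rw [ht, Matrix.vecMul_transpose] at h
  exact h

/-- The parabolic is the stabilizer of the line of the last row vector, so cosets are last rows γ_l
up to sign, and the weight of γ g is the inverse of |γ_l g|. -/
theorem hasSum_eisSLTerm_one {d : ℕ} (hd : 2 ≤ d) [Nonempty (Fin d)] (g : SLR d)
    (hg : g.1.det ≠ 0) {s : ℂ} (hs : (d : ℝ) < 2 * s.re) :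
    HasSum (eisSLTerm d 1 s g) (epsteinEis g.1 hg s) := by
  have hd' : (2 : ℝ) ≤ d := by exact_mod_cast hd
  set l : Fin d := ⟨d - 1, by omega⟩ with hl
  have hmain := hasSum_leftCosets (Γ := SLZ d) (P := parabolicSL d 1) (S := IsPrim)
    (fun v hv => hv.neg) (fun v hv => hv.ne_zero) (φ := fun γ => intRow l γ.1)
    (fun γ => isPrim_intRow γ.2 l) (fun v hv => by
      obtain ⟨M, hM⟩ := exists_vecMul_eq_single hd hv l
      refine ⟨(⟨_, map_mem_SLZ M⟩ : SLZ d)⁻¹, ?_⟩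
      set x : SLZ d := ⟨_, map_mem_SLZ M⟩ with hx
      have hxv : toR v ᵥ* (x : SLR d).1 = toR (v ᵥ* M.1) := by
        funext j
        simp [Matrix.vecMul, dotProduct, hx]
      have hinv : toR (intRow l (x⁻¹ : SLZ d).1) = Pi.single l 1 ᵥ* (x.1⁻¹ : SLR d).1 :=
        toR_intRow (x⁻¹).2 l
      have hone : toR (Pi.single l 1 : Fin d → ℤ) = Pi.single l 1 := by
        funext j; by_cases hj : j = l
        · subst hj; simp
        · simp [hj]
      have hback : (toR v ᵥ* (x : SLR d).1) ᵥ* (x.1⁻¹ : SLR d).1 = toR v := by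
        rw [Matrix.vecMul_vecMul, coe_mul_inv, Matrix.vecMul_one]
      rw [eq_or_eq_neg_of_toR, hinv]
      rcases hM with h | h
      · left
        rw [← hback, hxv, h, hone]
      · right
        rw [← hback, hxv, h, toR_neg, hone, Matrix.neg_vecMul, neg_neg])
    (fun γ γ' => by
      rw [eq_or_eq_neg_of_toR, toR_intRow γ.2, toR_intRow γ'.2]
      have hp : (γ' : SLR d) * (γ : SLR d)⁻¹ ∈ SLZ d := (SLZ d).mul_mem γ'.2 ((SLZ d).inv_mem γ.2)
      have h1 := last_row_iff hp l
      have h2 : (γ' : SLR d) * (γ : SLR d)⁻¹ ∈ parabolicSL d 1 ↔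
          ∀ j, j ≠ l → ((γ' : SLR d) * (γ : SLR d)⁻¹).1 l j = 0 := by
        constructor
        · intro h j hj
          refine h ?_
          have hj2 : j.val < d - 1 := by
            have := j.2
            have : j.val ≠ d - 1 := fun h3 => hj (Fin.ext h3)
            omega
          change (if j.val < d - 1 then 0 else 1) < (if l.val < d - 1 then 0 else 1)
          rw [if_pos hj2, if_neg (by rw [hl]; simp)]
          exact one_pos
        · intro h i j hij
          change (if j.val < d - 1 then 0 else 1) < (if i.val < d - 1 then 0 else 1) at hij
          have hi : i = l := by
            apply Fin.ext
            have := i.2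
            rw [hl]
            by_contra h3
            rw [if_pos (show i.val < d - 1 by simp at h3; omega)] at hij
            omega
          have hjl : j ≠ l := by
            rintro rfl
            rw [hi] at hij
            exact lt_irrefl _ hij
          rw [hi]
          exact h j hjl
      rw [h2, h1]
      have e1 : Pi.single l 1 ᵥ* ((γ' : SLR d) * (γ : SLR d)⁻¹).1 =
          (Pi.single l 1 ᵥ* (γ' : SLR d).1) ᵥ* ((γ : SLR d)⁻¹).1 :=
        (Matrix.vecMul_vecMul _ _ _).symm
      have e2 : ∀ u w : Fin d → ℝ, u ᵥ* ((γ : SLR d)⁻¹).1 = w ↔ u = w ᵥ* (γ : SLR d).1 := by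
        intro u w
        constructor
        · rintro rfl
          rw [Matrix.vecMul_vecMul, coe_inv_mul, Matrix.vecMul_one]
        · rintro rfl
          rw [Matrix.vecMul_vecMul, coe_mul_inv, Matrix.vecMul_one]
      rw [e1, e2, e2, Matrix.neg_vecMul])
    (F := fun v => (qf g.1 (toR v) : ℂ) ^ (-s)) (fun v => by rw [toR_neg, qf_neg])
    (hasSum_prim_qf hg (by simpa using hs) (by linarith))
  refine (congrArg (fun f => HasSum f _) (funext fun q => ?_)).mpr hmain
  have hw := expWeight_pred (exists_isIwasawa_top ((q.out : SLZ d).1 * g)) (l := l) rfl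
  rw [eisSLTerm, eisTerm, cpow_two_mul_eq hw.1 hw.2]
  have : qf ((q.out : SLZ d).1 * g).1 (Pi.single l 1) = qf g.1 (toR (intRow l (q.out : SLZ d).1)) := by
    rw [toR_intRow (q.out : SLZ d).2, qf, qf, Matrix.vecMul_vecMul]
    rfl
  rw [this]

/-- Dual to the previous case: the parabolic stabilizes the line of the first column vector, cosets
are first columns of γ⁻¹ up to sign, and lengths are taken with (g⁻¹)ᵗ. -/
theorem hasSum_eisSLTerm_pred {d : ℕ} (hd : 2 ≤ d) [Nonempty (Fin d)] (g : SLR d)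
    (hg : ((g⁻¹ : SLR d).1ᵀ).det ≠ 0) {s : ℂ} (hs : (d : ℝ) < 2 * s.re) :
    HasSum (eisSLTerm d (d - 1) s g) (epsteinEis (g⁻¹ : SLR d).1ᵀ hg s) := by
  have hd' : (2 : ℝ) ≤ d := by exact_mod_cast hd
  set l : Fin d := ⟨0, by omega⟩ with hl
  have hmain := hasSum_leftCosets (Γ := SLZ d) (P := parabolicSL d (d - 1)) (S := IsPrim)
    (fun v hv => hv.neg) (fun v hv => hv.ne_zero) (φ := fun γ => intInvCol l γ.1)
    (fun γ => isPrim_intInvCol γ.2 l) (fun v hv => by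
      obtain ⟨M, hM⟩ := exists_vecMul_eq_single hd hv l
      refine ⟨⟨_, map_mem_SLZ M.transpose⟩, ?_⟩
      set x : SLZ d := ⟨_, map_mem_SLZ M.transpose⟩ with hx
      have hxv : (x : SLR d).1 *ᵥ toR v = toR (v ᵥ* M.1) := by
        rw [← Matrix.vecMul_transpose]
        funext j
        simp [Matrix.vecMul, dotProduct, hx]
      have hinv : toR (intInvCol l x.1) = (x.1⁻¹ : SLR d).1 *ᵥ Pi.single l 1 :=
        toR_intInvCol x.2 l
      have hone : toR (Pi.single l 1 : Fin d → ℤ) = Pi.single l 1 := by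
        funext j; by_cases hj : j = l
        · subst hj; simp
        · simp [hj]
      have hback : (x.1⁻¹ : SLR d).1 *ᵥ ((x : SLR d).1 *ᵥ toR v) = toR v := by
        rw [Matrix.mulVec_mulVec, coe_inv_mul, Matrix.one_mulVec]
      rw [eq_or_eq_neg_of_toR, hinv]
      rcases hM with h | h
      · left
        rw [← hback, hxv, h, hone]
      · right
        rw [← hback, hxv, h, toR_neg, hone, Matrix.mulVec_neg, neg_neg])
    (fun γ γ' => by
      rw [eq_or_eq_neg_of_toR, toR_intInvCol γ.2, toR_intInvCol γ'.2]
      have hp : (γ' : SLR d) * (γ : SLR d)⁻¹ ∈ SLZ d := (SLZ d).mul_mem γ'.2 ((SLZ d).inv_mem γ.2)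
      have h1 := first_col_iff hp l
      have h2 : (γ' : SLR d) * (γ : SLR d)⁻¹ ∈ parabolicSL d (d - 1) ↔
          ∀ j, j ≠ l → ((γ' : SLR d) * (γ : SLR d)⁻¹).1 j l = 0 := by
        constructor
        · intro h j hj
          refine h ?_
          have hj2 : ¬ j.val < d - (d - 1) := by
            have : j.val ≠ 0 := fun h3 => hj (Fin.ext h3)
            omega
          change (if l.val < d - (d - 1) then 0 else 1) < (if j.val < d - (d - 1) then 0 else 1)
          rw [if_neg hj2, if_pos (by rw [hl]; simp; omega)]
          exact one_pos
        · intro h i j hij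
          change (if j.val < d - (d - 1) then 0 else 1) < (if i.val < d - (d - 1) then 0 else 1) at hij
          have hj : j = l := by
            apply Fin.ext
            rw [hl]
            by_contra h3
            rw [if_neg (show ¬ j.val < d - (d - 1) by simp at h3; omega)] at hij
            split_ifs at hij <;> omega
          have hil : i ≠ l := by
            rintro rfl
            rw [hj] at hij
            exact lt_irrefl _ hij
          rw [hj]
          exact h i hil
      rw [h2, h1]
      have e1 : ((γ' : SLR d) * (γ : SLR d)⁻¹).1 *ᵥ Pi.single l 1 =
          (γ' : SLR d).1 *ᵥ (((γ : SLR d)⁻¹).1 *ᵥ Pi.single l 1) :=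
        (Matrix.mulVec_mulVec _ _ _).symm
      have e2 : ∀ u w : Fin d → ℝ, (γ' : SLR d).1 *ᵥ u = w ↔ ((γ' : SLR d)⁻¹).1 *ᵥ w = u := by
        intro u w
        constructor
        · rintro rfl
          rw [Matrix.mulVec_mulVec, coe_inv_mul, Matrix.one_mulVec]
        · rintro rfl
          rw [Matrix.mulVec_mulVec, coe_mul_inv, Matrix.one_mulVec]
      rw [e1, e2, e2, Matrix.mulVec_neg, neg_eq_iff_eq_neg])
    (F := fun v => (qf (g⁻¹ : SLR d).1ᵀ (toR v) : ℂ) ^ (-s)) (fun v => by rw [toR_neg, qf_neg])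
    (hasSum_prim_qf hg (by simpa using hs) (by linarith))
  refine (congrArg (fun f => HasSum f _) (funext fun q => ?_)).mpr hmain
  have hw := expWeight_one (exists_isIwasawa_top ((q.out : SLZ d).1 * g)) (f := l) rfl
  rw [eisSLTerm, eisTerm, show d - (d - 1) = 1 by omega, cpow_two_mul_eq hw.1 hw.2]
  have : qf (((q.out : SLZ d).1 * g)⁻¹ : SLR d).1ᵀ (Pi.single l 1) =
      qf (g⁻¹ : SLR d).1ᵀ (toR (intInvCol l (q.out : SLZ d).1)) := by
    rw [toR_intInvCol (q.out : SLZ d).2, qf, qf, Matrix.vecMul_transpose, Matrix.vecMul_transpose,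
      Matrix.mulVec_mulVec, _root_.mul_inv_rev]
    rfl
  rw [this]

end SLSeries

end ThetaLift

namespace ThetaLift

open Matrix Set CliffordAlgebra

/-! ### Unipotent elements of the spin group -/

section Clifford

variable {M : Type*} [AddCommGroup M] [Module ℝ M] {Q : QuadraticForm ℝ M}

lemma ι_mul_swap_of_polar {u c : M} (h : QuadraticMap.polar Q u c = 0) :
    ι Q c * ι Q u = -(ι Q u * ι Q c) := by
  have h1 := ι_mul_ι_add_swap (Q := Q) u c
  rw [h, map_zero] at h1
  exact eq_neg_of_add_eq_zero_right h1

lemma ι_mul_ι_mul_self {u c : M} (hu : Q u = 0) (h : QuadraticMap.polar Q u c = 0) (c' : M) :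
    ι Q u * ι Q c * (ι Q u * ι Q c') = 0 := by
  have hsq : ι Q u * ι Q u = 0 := by rw [ι_sq_scalar, hu, map_zero]
  calc ι Q u * ι Q c * (ι Q u * ι Q c') = ι Q u * (ι Q c * ι Q u) * ι Q c' := by
        simp only [mul_assoc]
    _ = -(ι Q u * ι Q u * ι Q c * ι Q c') := by
        rw [ι_mul_swap_of_polar h]; simp only [mul_neg, neg_mul, mul_assoc]
    _ = 0 := by rw [hsq]; simp

lemma exists_unit_of_ne_zero {a : M} (ha : Q a ≠ 0) :
    ∃ x : (CliffordAlgebra Q)ˣ, x ∈ lipschitzGroup Q ∧ (x : CliffordAlgebra Q) = ι Q a := by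
  have h1 : ι Q a * ((Q a)⁻¹ • ι Q a) = 1 := by
    rw [mul_smul_comm, ι_sq_scalar, Algebra.smul_def, ← map_mul, inv_mul_cancel₀ ha, map_one]
  have h2 : ((Q a)⁻¹ • ι Q a) * ι Q a = 1 := by
    rw [smul_mul_assoc, ι_sq_scalar, Algebra.smul_def, ← map_mul, inv_mul_cancel₀ ha, map_one]
  exact ⟨⟨ι Q a, (Q a)⁻¹ • ι Q a, h1, h2⟩, Subgroup.subset_closure ⟨a, rfl⟩, rfl⟩

/-- The element is the product of two anisotropic vectors, c/Q(c) + s u and c, hence even and in the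
Lipschitz group. It is unitary because uc anticommutes and (uc)² = 0, so the star is the inverse 1 −
s uc. -/
lemma one_add_ι_mul_ι_mem_spinGroup {u c : M} (hu : Q u = 0) (hc : Q c ≠ 0)
    (h : QuadraticMap.polar Q u c = 0) (s : ℝ) : 1 + s • (ι Q u * ι Q c) ∈ spinGroup Q := by
  set p : M := (Q c)⁻¹ • c + s • u with hp
  have hQp : Q p ≠ 0 := by
    have h1 : QuadraticMap.polar Q ((Q c)⁻¹ • c) (s • u) = 0 := by
      rw [QuadraticMap.polar_smul_left, QuadraticMap.polar_smul_right, QuadraticMap.polar_comm, h]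
      simp
    have h2 : Q p = (Q c)⁻¹ * (Q c)⁻¹ * Q c := by
      rw [hp, QuadraticMap.map_add (⇑Q), h1, QuadraticMap.map_smul, QuadraticMap.map_smul, hu]
      simp
    rw [h2]
    exact mul_ne_zero (mul_ne_zero (inv_ne_zero hc) (inv_ne_zero hc)) hc
  have hprod : ι Q p * ι Q c = 1 + s • (ι Q u * ι Q c) := by
    rw [hp, map_add, map_smul, map_smul, add_mul, smul_mul_assoc, smul_mul_assoc, ι_sq_scalar,
      Algebra.smul_def, ← map_mul, inv_mul_cancel₀ hc, map_one]
  obtain ⟨x, hx, hxp⟩ := exists_unit_of_ne_zero hQp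
  obtain ⟨y, hy, hyc⟩ := exists_unit_of_ne_zero hc
  rw [spinGroup.mem_iff, pinGroup.mem_iff]
  refine ⟨⟨⟨x * y, (lipschitzGroup Q).mul_mem hx hy, ?_⟩, ?_⟩, ?_⟩
  · change ((x * y : (CliffordAlgebra Q)ˣ) : CliffordAlgebra Q) = _
    rw [Units.val_mul, hxp, hyc, hprod]
  · have hW : ι Q u * ι Q c * (ι Q u * ι Q c) = 0 := ι_mul_ι_mul_self hu h c
    have hstar : star (1 + s • (ι Q u * ι Q c)) = 1 - s • (ι Q u * ι Q c) := by
      rw [star_add, star_one, CliffordAlgebra.star_smul, star_mul, star_ι, star_ι, neg_mul_neg,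
        ι_mul_swap_of_polar h, smul_neg, sub_eq_add_neg]
    rw [Unitary.mem_iff, hstar]
    constructor
    · rw [sub_mul, one_mul, mul_add, mul_one, smul_mul_smul_comm, hW, smul_zero, add_zero,
        add_sub_cancel_right]
    · rw [add_mul, one_mul, mul_sub, mul_one, smul_mul_smul_comm, hW, smul_zero, sub_zero,
        sub_add_cancel]
  · rw [← hprod]
    exact ι_mul_ι_mem_evenOdd_zero Q p c

/-- The Siegel–Eichler transformation of a totally isotropic pair; the usual quadratic term is
absent because c is isotropic as well. -/
lemma one_add_mul_ι {u c : M} (hu : Q u = 0) (hc : Q c = 0) (h : QuadraticMap.polar Q u c = 0)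
    (s : ℝ) (v : M) :
    (1 + s • (ι Q u * ι Q c)) * ι Q v =
      ι Q (v + s • (QuadraticMap.polar Q c v • u - QuadraticMap.polar Q u v • c)) *
        (1 + s • (ι Q u * ι Q c)) := by
  set p := QuadraticMap.polar Q u v with hp
  set q := QuadraticMap.polar Q c v with hq
  have hUV : ι Q u * ι Q v = p • 1 - ι Q v * ι Q u := by
    rw [eq_sub_iff_add_eq, ι_mul_ι_add_swap, Algebra.algebraMap_eq_smul_one]
  have hCV : ι Q c * ι Q v = q • 1 - ι Q v * ι Q c := by
    rw [eq_sub_iff_add_eq, ι_mul_ι_add_swap, Algebra.algebraMap_eq_smul_one]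
  have hUU : ι Q u * ι Q u = 0 := by rw [ι_sq_scalar, hu, map_zero]
  have hCC : ι Q c * ι Q c = 0 := by rw [ι_sq_scalar, hc, map_zero]
  have hW : ι Q u * ι Q c * ι Q v = q • ι Q u - p • ι Q c + ι Q v * (ι Q u * ι Q c) := by
    rw [mul_assoc, hCV, mul_sub, mul_smul_comm, mul_one, ← mul_assoc, hUV, sub_mul, smul_mul_assoc,
      one_mul, mul_assoc]
    abel
  have h1 : ι Q u * (ι Q u * ι Q c) = 0 := by rw [← mul_assoc, hUU, zero_mul]
  have h2 : ι Q c * (ι Q u * ι Q c) = 0 := by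
    rw [← mul_assoc, ι_mul_swap_of_polar h, neg_mul, mul_assoc, hCC, mul_zero, neg_zero]
  rw [map_add, map_smul, map_sub, map_smul, map_smul, add_mul, one_mul, smul_mul_assoc, hW, mul_add,
    mul_one, add_mul, mul_smul_comm, smul_mul_assoc, mul_smul_comm, sub_mul, smul_mul_assoc,
    smul_mul_assoc, h1, h2, smul_add]
  simp only [smul_zero, sub_zero, add_zero]
  abel

end Clifford

/-! ### Elementary moves in `Spin(d, d, ℤ)` -/

section Moves

variable {d : ℕ}

lemma antidiag_mulVec (N : ℕ) (u : Fin N → ℝ) (i : Fin N) : (antidiag N *ᵥ u) i = u i.rev := by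
  simp [antidiag, Matrix.mulVec, dotProduct]

lemma polar_single (a : Fin (d + d)) (v : Fin (d + d) → ℝ) :
    QuadraticMap.polar (splitForm d) (Pi.single a 1) v = 2 * v a.rev := by
  rw [polar_splitForm, single_one_dotProduct, antidiag_mulVec]

lemma rev_ne_self (a : Fin (d + d)) : a.rev ≠ a := by
  intro h
  have := congrArg Fin.val h
  rw [Fin.val_rev] at this
  have := a.2
  omega

/-- The elementary isotropic move `v_a += t v_b`, `v_{b*} -= t v_{a*}`. -/
def move {R : Type*} [Ring R] (a b : Fin (d + d)) (t : R) (v : Fin (d + d) → R) : Fin (d + d) → R :=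
  v + (Pi.single a (t * v b) - Pi.single b.rev (t * v a.rev))

lemma toR_move (a b : Fin (d + d)) (t : ℤ) (v : Fin (d + d) → ℤ) :
    toR (move a b t v) = move a b (t : ℝ) (toR v) := by
  have h : ∀ (i : Fin (d + d)) (c : ℤ), toR (Pi.single i c) = Pi.single i (c : ℝ) := by
    intro i c
    funext j
    by_cases hj : j = i
    · subst hj; simp
    · simp [hj]
  rw [move, move, toR_add, sub_eq_add_neg, toR_add, toR_neg, h, h]
  simp [sub_eq_add_neg]

/-- The element is 1 + (t/2) e_a e_{b*}, the half compensating for the factor 2 in the polar form.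
Since e_{b*} is isotropic, it is split as (e_{b*} + e_b)/2 + (e_{b*} − e_b)/2 with both parts
anisotropic and orthogonal to e_a; the two spin elements multiply without a cross term. -/
lemma exists_spin_move {a b : Fin (d + d)} (hab : a ≠ b) (hab' : b ≠ a.rev) (t : ℝ) :
    ∃ x : SpinDD d, ∀ v, (spinCover d x).1.1 *ᵥ v = move a b t v := by
  set Q := splitForm d with hQ
  set u : Fin (d + d) → ℝ := Pi.single a 1 with hu
  set c : Fin (d + d) → ℝ := Pi.single b.rev 1 with hc
  set c' : Fin (d + d) → ℝ := Pi.single b 1 with hc'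
  have hsingle : ∀ i : Fin (d + d), Q (Pi.single i 1) = 0 := by
    intro i
    rw [hQ, splitForm_apply, single_one_dotProduct, antidiag_mulVec, Pi.single_eq_of_ne (rev_ne_self i)]
  have harb : a.rev ≠ b.rev := fun h => hab (Fin.rev_injective h)
  have hpuc : QuadraticMap.polar Q u c = 0 := by
    rw [hQ, hu, polar_single, hc, Pi.single_eq_of_ne harb, mul_zero]
  have hpuc' : QuadraticMap.polar Q u c' = 0 := by
    rw [hQ, hu, polar_single, hc', Pi.single_eq_of_ne (Ne.symm hab'), mul_zero]
  have hpcc' : QuadraticMap.polar Q c c' = 2 := by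
    rw [hQ, hc, polar_single, hc', Fin.rev_rev, Pi.single_eq_same, mul_one]
  have hsmul : ∀ (r : ℝ) (w : Fin (d + d) → ℝ), Q (r • w) = r * r * Q w := fun r w => by
    rw [QuadraticMap.map_smul, smul_eq_mul]
  have hQ1 : Q ((1 / 2 : ℝ) • (c + c')) ≠ 0 := by
    rw [hsmul, QuadraticMap.map_add (⇑Q), hpcc', hsingle, hsingle]
    norm_num
  have hQ2 : Q ((1 / 2 : ℝ) • (c - c')) ≠ 0 := by
    rw [hsmul, sub_eq_add_neg, QuadraticMap.map_add (⇑Q), QuadraticMap.polar_neg_right, hpcc',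
      QuadraticMap.map_neg, hsingle, hsingle]
    norm_num
  have hp1 : QuadraticMap.polar Q u ((1 / 2 : ℝ) • (c + c')) = 0 := by
    rw [QuadraticMap.polar_smul_right, QuadraticMap.polar_add_right, hpuc, hpuc']
    simp
  have hp2 : QuadraticMap.polar Q u ((1 / 2 : ℝ) • (c - c')) = 0 := by
    rw [QuadraticMap.polar_smul_right, QuadraticMap.polar_sub_right, hpuc, hpuc']
    simp
  have h1 := one_add_ι_mul_ι_mem_spinGroup (hsingle a) hQ1 hp1 (t / 2)
  have h2 := one_add_ι_mul_ι_mem_spinGroup (hsingle a) hQ2 hp2 (t / 2)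
  have hmul : (1 + (t / 2) • (ι Q u * ι Q ((1 / 2 : ℝ) • (c + c')))) *
      (1 + (t / 2) • (ι Q u * ι Q ((1 / 2 : ℝ) • (c - c')))) = 1 + (t / 2) • (ι Q u * ι Q c) := by
    have e1 : c = (1 / 2 : ℝ) • (c + c') + (1 / 2 : ℝ) • (c - c') := by module
    rw [add_mul, one_mul, mul_add, mul_one, smul_mul_smul_comm,
      ι_mul_ι_mul_self (hsingle a) hp1, smul_zero, add_zero]
    conv_rhs => rw [e1, map_add, mul_add, smul_add]
    abel
  have hmem := (spinGroup Q).mul_mem h1 h2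
  rw [hmul] at hmem
  set x : SpinDD d := ⟨_, hmem⟩ with hx
  refine ⟨x, fun v => ?_⟩
  have hspec := spinCover_spec d x v
  have hact := one_add_mul_ι (hsingle a) (hsingle b.rev) hpuc (t / 2) v
  have hunit : IsUnit (x : CliffordAlgebra Q) := isUnit_spin d x
  have heq := iota_injective d (hunit.mul_left_injective (hspec.symm.trans hact))
  rw [heq, polar_single, polar_single, Fin.rev_rev, move]
  funext k
  simp only [Pi.add_apply, Pi.smul_apply, Pi.sub_apply, smul_eq_mul, Pi.single_apply]
  split_ifs <;> ring

lemma mem_SLZ_of_int {N : ℕ} {x : SLR N} (h : ∀ i j, ∃ k : ℤ, x.1 i j = k) : x ∈ SLZ N := by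
  choose M hM using h
  have hx : x.1 = (Matrix.of M).map (Int.cast : ℤ → ℝ) := by
    ext i j
    rw [hM]; rfl
  have hdet : (Matrix.of M).det = 1 := by
    have h1 : x.1.det = 1 := x.2
    rw [hx, ← Int.cast_det] at h1
    exact_mod_cast h1
  exact ⟨⟨Matrix.of M, hdet⟩, Subtype.ext hx.symm⟩

/-- Two integral vectors are related if some element of `Spin(d, d, ℤ)` maps one to the other. -/
def SpinRel (d : ℕ) (v w : Fin (d + d) → ℤ) : Prop :=
  ∃ x ∈ SpinDDZ d, (spinCover d x).1.1 *ᵥ toR v = toR w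

lemma SpinRel.refl (v : Fin (d + d) → ℤ) : SpinRel d v v :=
  ⟨1, (SpinDDZ d).one_mem, by
    rw [map_one]
    exact Matrix.one_mulVec _⟩

lemma SpinRel.trans {u v w : Fin (d + d) → ℤ} (h1 : SpinRel d u v) (h2 : SpinRel d v w) :
    SpinRel d u w := by
  obtain ⟨x, hx, h1⟩ := h1
  obtain ⟨y, hy, h2⟩ := h2
  refine ⟨y * x, (SpinDDZ d).mul_mem hy hx, ?_⟩
  rw [map_mul, ← h2, ← h1, Matrix.mulVec_mulVec]
  rfl

lemma SpinRel.neg {v w : Fin (d + d) → ℤ} (h : SpinRel d v w) : SpinRel d (-v) (-w) := by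
  obtain ⟨x, hx, h1⟩ := h
  exact ⟨x, hx, by rw [toR_neg, toR_neg, Matrix.mulVec_neg, h1]⟩

lemma spinRel_move {a b : Fin (d + d)} (hab : a ≠ b) (hab' : b ≠ a.rev) (t : ℤ)
    (v : Fin (d + d) → ℤ) : SpinRel d v (move a b t v) := by
  obtain ⟨x, hx⟩ := exists_spin_move hab hab' (t : ℝ)
  refine ⟨x, ?_, by rw [hx, toR_move]⟩
  change (spinCover d x).1 ∈ SLZ (d + d)
  refine mem_SLZ_of_int fun i j => ?_
  have h := congrFun (hx (Pi.single j 1)) i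
  rw [Matrix.mulVec_single_one] at h
  have h2 : (Pi.single j 1 : Fin (d + d) → ℝ) = toR (Pi.single j 1) := by
    funext k
    by_cases hk : k = j
    · subst hk; simp
    · simp [hk]
  rw [h2, ← toR_move] at h
  exact ⟨_, h⟩

/-- Primitive isotropic integral vectors. -/
def IsPrimIso (v : Fin (d + d) → ℤ) : Prop := IsPrim v ∧ v ⬝ᵥ (v ∘ Fin.rev) = 0

lemma transpose_mul_antidiag_mul {x : SLR (d + d)} (hx : x ∈ SODD d) :
    x.1ᵀ * antidiag (d + d) * x.1 = antidiag (d + d) := by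
  have h2 := congrArg Subtype.val (mem_SODD_iff_antidiagConj.1 hx)
  have h3 : antidiag (d + d) * (x⁻¹ : SLR (d + d)).1ᵀ * antidiag (d + d) = x.1 := h2
  have e2 : x.1ᵀ * (x⁻¹ : SLR (d + d)).1ᵀ = 1 := by
    rw [← Matrix.transpose_mul, coe_inv_mul, Matrix.transpose_one]
  calc x.1ᵀ * antidiag (d + d) * x.1
      = x.1ᵀ * antidiag (d + d) * (antidiag (d + d) * (x⁻¹ : SLR (d + d)).1ᵀ * antidiag (d + d)) := by
        rw [h3]
    _ = x.1ᵀ * (antidiag (d + d) * antidiag (d + d)) * (x⁻¹ : SLR (d + d)).1ᵀ * antidiag (d + d) := by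
        simp only [Matrix.mul_assoc]
    _ = _ := by rw [antidiag_mul_self, Matrix.mul_one, e2, Matrix.one_mul]

lemma dotProduct_antidiag_mulVec {x : SLR (d + d)} (hx : x ∈ SODD d) (u v : Fin (d + d) → ℝ) :
    (x.1 *ᵥ u) ⬝ᵥ (antidiag (d + d) *ᵥ (x.1 *ᵥ v)) = u ⬝ᵥ (antidiag (d + d) *ᵥ v) := by
  conv_rhs => rw [← transpose_mul_antidiag_mul hx]
  rw [← Matrix.mulVec_mulVec, ← Matrix.mulVec_mulVec,
    Matrix.dotProduct_mulVec u x.1ᵀ, Matrix.vecMul_transpose]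

lemma cast_dotProduct_rev (v : Fin (d + d) → ℤ) :
    ((v ⬝ᵥ (v ∘ Fin.rev) : ℤ) : ℝ) = toR v ⬝ᵥ (antidiag (d + d) *ᵥ toR v) := by
  simp only [dotProduct, antidiag_mulVec, toR_apply, Function.comp]
  push_cast
  rfl

lemma isPrimIso_of_mulVec {x : SLR (d + d)} (hx : x ∈ SODD d) (hxZ : x ∈ SLZ (d + d))
    {v w : Fin (d + d) → ℤ} (hv : IsPrimIso v) (h : x.1 *ᵥ toR v = toR w) : IsPrimIso w := by
  constructor
  · obtain ⟨M, hM⟩ := exists_int_matrix hxZ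
    have hw : w = v ᵥ* M.1ᵀ := by
      apply toR_injective
      rw [← h, hM, Matrix.vecMul_transpose]
      funext i
      simp [Matrix.mulVec, dotProduct]
    rw [hw]
    exact hv.1.of_vecMul (by rw [Matrix.det_transpose]; exact M.2)
  · have h1 := dotProduct_antidiag_mulVec hx (toR v) (toR v)
    rw [h, ← cast_dotProduct_rev, ← cast_dotProduct_rev, hv.2] at h1
    exact_mod_cast h1

lemma SpinRel.isPrimIso {v w : Fin (d + d) → ℤ} (h : SpinRel d v w) (hv : IsPrimIso v) :
    IsPrimIso w := by
  obtain ⟨x, hx, h⟩ := h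
  exact isPrimIso_of_mulVec (spinCover d x).2 hx hv h

/-! ### Transitivity on primitive isotropic vectors -/

/-- `σ` picks one index out of each opposite pair. Moves inside this block act on its coordinates as
ordinary row operations and on the opposite block linearly, so an opposite block that vanishes stays
zero. -/
lemma spinRel_reduce (hd : 0 < d) {σ : Fin d → Fin (d + d)} (hinj : Function.Injective σ)
    (hσ : ∀ k l, σ k ≠ (σ l).rev) (v : Fin (d + d) → ℤ) :
    ∃ w l, SpinRel d v w ∧ ((∀ k, v (σ k).rev = 0) → ∀ k, w (σ k).rev = 0) ∧
      ∀ k, k ≠ l → w (σ k) = 0 := by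
  obtain ⟨w, l, h1, h2⟩ := exists_reachable_single hd
    (fun v w => SpinRel d v w ∧ ((∀ k, v (σ k).rev = 0) → ∀ k, w (σ k).rev = 0))
    (fun v => ⟨SpinRel.refl v, id⟩) (fun u v w h1 h2 => ⟨h1.1.trans h2.1, fun h => h2.2 (h1.2 h)⟩)
    (fun v k => v (σ k)) (fun v a b hab t => by
      refine ⟨move (σ a) (σ b) t v, ⟨spinRel_move (fun h => hab (hinj h)) (hσ b a) t v, ?_⟩, ?_⟩
      · intro h k
        have h3 : (σ k).rev ≠ σ a := (hσ a k).symm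
        simp [move, h k, h a, h3]
      · funext k
        have h3 : σ k ≠ (σ b).rev := hσ k b
        by_cases hk : k = a
        · subst hk
          simp [move, h3]
        · have h4 : σ k ≠ σ a := fun h => hk (hinj h)
          simp [move, h3, h4, hk]) v
  exact ⟨w, l, h1.1, h1.2, h2⟩

/-- Two moves, through e_m + e_k. -/
lemma spinRel_single {k m : Fin (d + d)} (h : m ≠ k) (h' : m ≠ k.rev) :
    SpinRel d (Pi.single m 1) (Pi.single k 1) := by
  have h1 := spinRel_move (Ne.symm h) h' 1 (Pi.single m 1)
  have hk : k ≠ m.rev := fun h2 => h' (by rw [h2, Fin.rev_rev])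
  have h2 := spinRel_move h hk (-1) (move k m 1 (Pi.single m 1))
  have h3 : move m k (-1) (move k m 1 (Pi.single m 1)) = (Pi.single k 1 : Fin (d + d) → ℤ) := by
    have e1 : move k m 1 (Pi.single m 1) = (Pi.single m 1 + Pi.single k 1 : Fin (d + d) → ℤ) := by
      rw [move, Pi.single_eq_same, Pi.single_eq_of_ne (Ne.symm h')]
      simp
    have e2 : (Pi.single m 1 : Fin (d + d) → ℤ) k = 0 := Pi.single_eq_of_ne (Ne.symm h) _
    have e3 : (Pi.single m 1 : Fin (d + d) → ℤ) m.rev = 0 := Pi.single_eq_of_ne (rev_ne_self m) _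
    have e4 : (Pi.single k 1 : Fin (d + d) → ℤ) m.rev = 0 := Pi.single_eq_of_ne (Ne.symm hk) _
    rw [e1, move, Pi.add_apply, Pi.add_apply, e2, e3, e4, Pi.single_eq_same]
    simp only [zero_add, mul_one, mul_zero, Pi.single_zero, sub_zero, Pi.single_neg]
    abel
  rw [h3] at h2
  exact h1.trans h2

lemma spinRel_single_zero (hd : 2 ≤ d) {z : Fin (d + d)} (hz : z.val = 0) (m : Fin (d + d)) :
    SpinRel d (Pi.single m 1) (Pi.single z 1) := by
  by_cases h : m = z
  · rw [h]; exact SpinRel.refl _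
  · by_cases h' : m = z.rev
    -- No single move links an index with its opposite; the detour over the second index needs d ≥
    -- 2.
    · set o : Fin (d + d) := ⟨1, by omega⟩ with ho
      have e0 : (z.rev).val = d + d - 1 := by rw [Fin.val_rev]; omega
      have e1 : m ≠ o := fun h2 => by
        have := congrArg Fin.val (h'.symm.trans h2)
        rw [e0] at this
        simp [ho] at this
        omega
      have e2 : m ≠ o.rev := fun h2 => by
        have := congrArg Fin.val (h'.symm.trans h2)
        rw [e0, Fin.val_rev] at this
        simp [ho] at this
        omega
      have e3 : o ≠ z := fun h2 => by
        have := congrArg Fin.val h2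
        simp [ho, hz] at this
      have e4 : o ≠ z.rev := fun h2 => by
        have := congrArg Fin.val h2
        rw [e0] at this
        simp [ho] at this
        omega
      exact (spinRel_single e1 e2).trans (spinRel_single e3 e4)
    · exact spinRel_single h h'

lemma rev_castAdd_val (k : Fin d) : ((Fin.castAdd d k).rev).val = d + d - 1 - k.val := by
  rw [Fin.val_rev, Fin.val_castAdd]
  omega

lemma exists_castAdd_or_rev (m : Fin (d + d)) :
    ∃ k : Fin d, m = Fin.castAdd d k ∨ m = (Fin.castAdd d k).rev := by
  by_cases h : m.val < d
  · exact ⟨⟨m.val, h⟩, Or.inl (Fin.ext rfl)⟩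
  · have := m.2
    refine ⟨⟨d + d - 1 - m.val, by omega⟩, Or.inr (Fin.ext ?_)⟩
    rw [rev_castAdd_val]
    simp only
    omega

/-- Euclid on the first d coordinates leaves one entry, at l. Isotropy then kills this entry or the
opposite one, so the vector is supported on another maximal isotropic block, and a second run of
Euclid leaves a multiple of a basis vector, which is ± it by primitivity. -/
lemma spinRel_transitive (hd : 2 ≤ d) {z : Fin (d + d)} (hz : z.val = 0) {v : Fin (d + d) → ℤ}
    (hv : IsPrimIso v) :
    SpinRel d v (Pi.single z 1) ∨ SpinRel d v (-Pi.single z 1) := by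
  have hrev : ∀ k l : Fin d, Fin.castAdd d k ≠ (Fin.castAdd d l).rev := by
    intro k l h
    have := congrArg Fin.val h
    rw [rev_castAdd_val, Fin.val_castAdd] at this
    have := k.2
    have := l.2
    omega
  obtain ⟨v₁, l, hv₁, -, hl⟩ := spinRel_reduce (by omega) (Fin.castAdd_injective d d) hrev v
  have hp₁ := hv₁.isPrimIso hv
  have hiso : v₁ (Fin.castAdd d l) * v₁ (Fin.castAdd d l).rev = 0 := by
    have h := hp₁.2
    rw [dotProduct, Finset.sum_eq_add (Fin.castAdd d l) (Fin.castAdd d l).rev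
      (hrev l l)] at h
    · simp only [Function.comp, Fin.rev_rev] at h
      linarith
    · intro m _ hm
      obtain ⟨k, hk | hk⟩ := exists_castAdd_or_rev m
      · have : k ≠ l := fun h2 => hm.1 (by rw [hk, h2])
        rw [hk, hl k this, zero_mul]
      · have : k ≠ l := fun h2 => hm.2 (by rw [hk, h2])
        rw [hk, Function.comp, Fin.rev_rev, hl k this, mul_zero]
    · simp
    · simp
  -- The new block takes every index from the second half, except that l is kept when its entry is
  -- nonzero; all entries opposite to the block then vanish.
  set σ : Fin d → Fin (d + d) := fun k =>
    if k = l ∧ v₁ (Fin.castAdd d l) ≠ 0 then Fin.castAdd d k else (Fin.castAdd d k).rev with hσ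
  have hσ' : ∀ k, σ k = Fin.castAdd d k ∨ σ k = (Fin.castAdd d k).rev := by
    intro k
    rw [hσ]
    simp only
    split_ifs
    · exact Or.inl rfl
    · exact Or.inr rfl
  have hcast : ∀ k k' : Fin d, Fin.castAdd d k = Fin.castAdd d k' → k = k' := fun k k' h =>
    Fin.castAdd_injective d d h
  have hinj : Function.Injective σ := by
    intro k k' h
    rcases hσ' k with h1 | h1 <;> rcases hσ' k' with h2 | h2 <;> rw [h1, h2] at h
    · exact hcast _ _ h
    · exact absurd h (hrev _ _)
    · exact absurd h.symm (hrev _ _)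
    · exact hcast _ _ (Fin.rev_injective h)
  have hne : ∀ k k', σ k ≠ (σ k').rev := by
    intro k k' h
    have hkk : k = k' := by
      rcases hσ' k with h1 | h1 <;> rcases hσ' k' with h2 | h2 <;> rw [h1, h2] at h
      · exact absurd h (hrev _ _)
      · rw [Fin.rev_rev] at h
        exact hcast _ _ h
      · exact hcast _ _ (Fin.rev_injective h)
      · rw [Fin.rev_rev] at h
        exact absurd h.symm (hrev _ _)
    subst hkk
    exact rev_ne_self _ h.symm
  have hzero : ∀ k, v₁ (σ k).rev = 0 := by
    intro k
    rw [hσ]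
    simp only
    split_ifs with h
    · rw [h.1]
      exact (mul_eq_zero.1 hiso).resolve_left h.2
    · rw [Fin.rev_rev]
      by_cases hk : k = l
      · rw [hk]
        by_contra h2
        exact h ⟨hk, h2⟩
      · exact hl k hk
  obtain ⟨v₂, l', hv₂, hinv, hl'⟩ := spinRel_reduce (by omega) hinj hne v₁
  have hp₂ := hv₂.isPrimIso hp₁
  have hoff : ∀ m, m ≠ σ l' → v₂ m = 0 := by
    intro m hm
    obtain ⟨k, hk⟩ := exists_castAdd_or_rev m
    have hk2 : m = σ k ∨ m = (σ k).rev := by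
      rcases hk with h1 | h1 <;> rcases hσ' k with h2 | h2
      · exact Or.inl (h1.trans h2.symm)
      · right; rw [h1, h2, Fin.rev_rev]
      · right; rw [h1, h2]
      · exact Or.inl (h1.trans h2.symm)
    rcases hk2 with h | h
    · rw [h]
      exact hl' k fun h2 => hm (by rw [h, h2])
    · rw [h]
      exact hinv hzero k
  rcases hp₂.1.eq_of_single hoff with h | h
  · left
    exact (hv₁.trans hv₂).trans (h ▸ spinRel_single_zero hd hz _)
  · right
    exact (hv₁.trans hv₂).trans (h ▸ (spinRel_single_zero hd hz _).neg)

end Moves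

end ThetaLift

namespace ThetaLift

open Matrix Set

/-! ### The vector Eisenstein series as sums over primitive isotropic vectors -/

section VectorSeries

variable {d : ℕ}

lemma toR_single {N : ℕ} (l : Fin N) : toR (Pi.single l 1 : Fin N → ℤ) = Pi.single l 1 := by
  funext j
  by_cases hj : j = l
  · subst hj; simp
  · simp [hj]

lemma IsPrimIso.neg {v : Fin (d + d) → ℤ} (hv : IsPrimIso v) : IsPrimIso (-v) := by
  refine ⟨hv.1.neg, ?_⟩
  have h : (-v) ∘ Fin.rev = -(v ∘ Fin.rev) := rfl
  rw [h, neg_dotProduct_neg, hv.2]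

lemma isPrimIso_single (z : Fin (d + d)) : IsPrimIso (Pi.single z 1 : Fin (d + d) → ℤ) := by
  constructor
  · exact isPrim_of_dotProduct (u := Pi.single z 1) (by simp)
  · rw [single_one_dotProduct, Function.comp, Pi.single_eq_of_ne (rev_ne_self z)]

lemma isPrimIso_intInvCol {x : SLR (d + d)} (hx : x ∈ SODD d) (hxZ : x ∈ SLZ (d + d))
    (z : Fin (d + d)) : IsPrimIso (intInvCol z x) :=
  isPrimIso_of_mulVec ((SODD d).inv_mem hx) ((SLZ (d + d)).inv_mem hxZ) (isPrimIso_single z)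
    (by rw [toR_single, toR_intInvCol hxZ])

/-- Only the condition on the first column has content: orthogonality of the other columns to p e_1
= ±e_1 makes the last row vanish as required. -/
lemma mem_parabolicSO_iff {p : SODD d} (hp : p.1 ∈ SLZ (d + d)) {z : Fin (d + d)} (hz : z.val = 0) :
    p ∈ parabolicSO d ↔ p.1.1 *ᵥ Pi.single z 1 = Pi.single z (1 : ℝ) ∨
      p.1.1 *ᵥ Pi.single z 1 = -Pi.single z (1 : ℝ) := by
  constructor
  · intro h
    refine (first_col_iff hp z).1 fun j hj => ?_
    have hj0 : j.val ≠ 0 := fun h2 => hj (Fin.ext (h2.trans hz.symm))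
    refine h ?_
    change (if z.val = 0 then 0 else if z.val + 1 = d + d then 2 else 1) <
      (if j.val = 0 then 0 else if j.val + 1 = d + d then 2 else 1)
    rw [if_pos hz, if_neg hj0]
    split_ifs <;> norm_num
  · intro h i j hij
    change (if j.val = 0 then 0 else if j.val + 1 = d + d then 2 else 1) <
      (if i.val = 0 then 0 else if i.val + 1 = d + d then 2 else 1) at hij
    by_cases hj : j.val = 0
    · have hjz : j = z := Fin.ext (hj.trans hz.symm)
      rw [hjz]
      refine (first_col_iff hp z).2 h i fun h2 => ?_
      rw [h2, hjz] at hij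
      exact lt_irrefl _ hij
    · rw [if_neg hj] at hij
      have hi : i.val + 1 = d + d ∧ j.val + 1 ≠ d + d := by
        split_ifs at hij <;> omega
      have hir : i = z.rev := by
        apply Fin.ext
        rw [Fin.val_rev, hz]
        omega
      have hjr : j ≠ z.rev := fun h2 => by
        rw [h2, Fin.val_rev, hz] at hi
        omega
      have h1 := dotProduct_antidiag_mulVec p.2 (Pi.single z 1) (Pi.single j 1)
      rw [single_one_dotProduct, antidiag_mulVec, Pi.single_eq_of_ne hjr.symm] at h1
      rcases h with h | h
      · rw [h, single_one_dotProduct, antidiag_mulVec, Matrix.mulVec_single_one] at h1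
        rw [hir]
        exact h1
      · rw [h, neg_dotProduct, single_one_dotProduct, antidiag_mulVec, Matrix.mulVec_single_one,
          neg_eq_zero] at h1
        rw [hir]
        exact h1

/-- The Eisenstein series for the vector representation, for a group `G` over `SO(d, d)` whose
arithmetic subgroup contains enough elements. -/
lemma hasSum_eisTerm_vector {G : Type*} [Group G] (hd : 2 ≤ d) (π : G →* SODD d)
    {Γ P : Subgroup G} (hΓ : ∀ x, x ∈ Γ → (π x).1 ∈ SLZ (d + d)) (hP : ∀ x, x ∈ P ↔ π x ∈ parabolicSO d)
    (hrel : ∀ v w, SpinRel d v w → ∃ x ∈ Γ, (π x).1.1 *ᵥ toR v = toR w) (g : G) {s A : ℂ}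
    (h : HasSum (fun v : {v : Fin (d + d) → ℤ // IsPrimIso v} =>
      (qf ((π g).1⁻¹ : SLR (d + d)).1ᵀ (toR v.1) : ℂ) ^ (-s)) (2 * A)) :
    HasSum (eisTerm Γ P (fun x => expWeightSO d (π x)) s g) A := by
  set z : Fin (d + d) := ⟨0, by omega⟩ with hz
  have hmain := hasSum_leftCosets (Γ := Γ) (P := P) (S := IsPrimIso)
    (fun v hv => hv.neg) (fun v hv => hv.1.ne_zero) (φ := fun γ => intInvCol z (π γ.1).1)
    (fun γ => isPrimIso_intInvCol (π γ.1).2 (hΓ _ γ.2) z) (fun v hv => by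
      have hx : ∃ x ∈ Γ, (π x).1.1 *ᵥ toR v = Pi.single z 1 ∨
          (π x).1.1 *ᵥ toR v = -Pi.single z 1 := by
        rcases spinRel_transitive hd (z := z) rfl hv with h | h
        · obtain ⟨x, hx, h⟩ := hrel _ _ h
          exact ⟨x, hx, Or.inl (by rw [h, toR_single])⟩
        · obtain ⟨x, hx, h⟩ := hrel _ _ h
          exact ⟨x, hx, Or.inr (by rw [h, toR_neg, toR_single])⟩
      obtain ⟨x, hx, hxv⟩ := hx
      refine ⟨⟨x, hx⟩, ?_⟩
      have hback : ((π x).1⁻¹ : SLR (d + d)).1 *ᵥ ((π x).1.1 *ᵥ toR v) = toR v := by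
        rw [Matrix.mulVec_mulVec, coe_inv_mul, Matrix.one_mulVec]
      rw [eq_or_eq_neg_of_toR, toR_intInvCol (hΓ _ hx)]
      rcases hxv with h | h
      · left
        rw [← hback, h]
      · right
        rw [← hback, h, Matrix.mulVec_neg, neg_neg])
    (fun γ γ' => by
      have hp : (π ((γ' : G) * (γ : G)⁻¹)).1 ∈ SLZ (d + d) :=
        hΓ _ (Γ.mul_mem γ'.2 (Γ.inv_mem γ.2))
      rw [eq_or_eq_neg_of_toR, toR_intInvCol (hΓ _ γ.2), toR_intInvCol (hΓ _ γ'.2), hP,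
        mem_parabolicSO_iff hp (z := z) rfl]
      have e1 : (π ((γ' : G) * (γ : G)⁻¹)).1.1 *ᵥ Pi.single z 1 =
          (π γ'.1).1.1 *ᵥ (((π γ.1).1⁻¹ : SLR (d + d)).1 *ᵥ Pi.single z 1) := by
        rw [map_mul, map_inv, Matrix.mulVec_mulVec]
        rfl
      have e2 : ∀ u w : Fin (d + d) → ℝ, (π γ'.1).1.1 *ᵥ u = w ↔
          ((π γ'.1).1⁻¹ : SLR (d + d)).1 *ᵥ w = u := by
        intro u w
        constructor
        · rintro rfl
          rw [Matrix.mulVec_mulVec, coe_inv_mul, Matrix.one_mulVec]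
        · rintro rfl
          rw [Matrix.mulVec_mulVec, coe_mul_inv, Matrix.one_mulVec]
      rw [e1, e2, e2, Matrix.mulVec_neg, neg_eq_iff_eq_neg])
    (F := fun v => (qf ((π g).1⁻¹ : SLR (d + d)).1ᵀ (toR v) : ℂ) ^ (-s))
    (fun v => by rw [toR_neg, qf_neg]) h
  refine (congrArg (fun f => HasSum f _) (funext fun q => ?_)).mpr hmain
  have hw := expWeight_one (exists_isIwasawa_SODD (π ((q.out : Γ).1 * g)).2) (f := z) rfl
  rw [eisTerm, expWeightSO, cpow_two_mul_eq hw.1 hw.2]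
  have : qf ((π ((q.out : Γ).1 * g)).1⁻¹ : SLR (d + d)).1ᵀ (Pi.single z 1) =
      qf ((π g).1⁻¹ : SLR (d + d)).1ᵀ (toR (intInvCol z (π (q.out : Γ).1).1)) := by
    rw [toR_intInvCol (hΓ _ (q.out : Γ).2), qf, qf, Matrix.vecMul_transpose,
      Matrix.vecMul_transpose, Matrix.mulVec_mulVec, map_mul]
    change _ = (((π g).1⁻¹ : SLR (d + d)) * (π (q.out : Γ).1).1⁻¹ : SLR (d + d)).1 *ᵥ _ ⬝ᵥ
      (((π g).1⁻¹ : SLR (d + d)) * (π (q.out : Γ).1).1⁻¹ : SLR (d + d)).1 *ᵥ _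
    rw [← _root_.mul_inv_rev]
    rfl
  rw [this]

/-- Transitivity is inherited from the image of the spin group. -/
lemma hasSum_eisSOTerm (hd : 2 ≤ d) (g : SODD d) {s A : ℂ}
    (h : HasSum (fun v : {v : Fin (d + d) → ℤ // IsPrimIso v} =>
      (qf (g.1⁻¹ : SLR (d + d)).1ᵀ (toR v.1) : ℂ) ^ (-s)) (2 * A)) :
    HasSum (eisSOTerm d s g) A :=
  hasSum_eisTerm_vector hd (MonoidHom.id _) (fun _ h => h) (fun _ => Iff.rfl)
    (fun _ _ ⟨x, hx, h⟩ => ⟨spinCover d x, hx, h⟩) g h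

lemma hasSum_eisSpinTerm (hd : 2 ≤ d) (g : SpinDD d) {s A : ℂ}
    (h : HasSum (fun v : {v : Fin (d + d) → ℤ // IsPrimIso v} =>
      (qf ((spinCover d g).1⁻¹ : SLR (d + d)).1ᵀ (toR v.1) : ℂ) ^ (-s)) (2 * A)) :
    HasSum (eisSpinTerm d s g) A :=
  hasSum_eisTerm_vector hd (spinCover d) (fun _ h => h) (fun _ => Iff.rfl)
    (fun _ _ h => h) g h

/-- A vector of `ℤ^{2d}` as a pair of vectors of `ℤ^d`: the vector `(k, n w)` corresponds
to `(n, k)`. -/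
def pairVec : (Fin d → ℤ) × (Fin d → ℤ) ≃ (Fin (d + d) → ℤ) where
  toFun q := Sum.elim q.2 (q.1 ∘ Fin.rev) ∘ finSumFinEquiv.symm
  invFun v := (fun i => v (finSumFinEquiv (Sum.inr i.rev)), fun i => v (finSumFinEquiv (Sum.inl i)))
  left_inv q := by
    ext i <;> simp only [Function.comp, Equiv.symm_apply_apply, Sum.elim_inl, Sum.elim_inr, Fin.rev_rev]
  right_inv v := by
    funext i
    obtain ⟨j | j, rfl⟩ := finSumFinEquiv.surjective i <;>
      simp only [Function.comp, Equiv.symm_apply_apply, Sum.elim_inl, Sum.elim_inr, Fin.rev_rev]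

lemma pairVec_apply (n k : Fin d → ℤ) :
    pairVec (n, k) = Sum.elim k (n ∘ Fin.rev) ∘ finSumFinEquiv.symm := rfl

lemma pairVec_dotProduct_rev (n k : Fin d → ℤ) :
    pairVec (n, k) ⬝ᵥ (pairVec (n, k) ∘ Fin.rev) = 2 * (k ⬝ᵥ n) := by
  have h1 : ∀ i : Fin d, (finSumFinEquiv (Sum.inl i : Fin d ⊕ Fin d)).rev =
      finSumFinEquiv (Sum.inr i.rev) := by
    intro i
    apply Fin.ext
    simp [Fin.val_rev]
    omega
  have h2 : ∀ i : Fin d, (finSumFinEquiv (Sum.inr i : Fin d ⊕ Fin d)).rev =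
      finSumFinEquiv (Sum.inl i.rev) := by
    intro i
    apply Fin.ext
    simp [Fin.val_rev]
    omega
  rw [dotProduct, ← finSumFinEquiv.sum_comp, Fintype.sum_sum_type]
  simp only [Function.comp, h1, h2, pairVec_apply, Equiv.symm_apply_apply, Sum.elim_inl,
    Sum.elim_inr, Fin.rev_rev]
  rw [two_mul]
  congr 1
  rw [← Equiv.sum_comp Fin.revPerm]
  simp only [Fin.revPerm_apply, Fin.rev_rev]
  exact Finset.sum_congr rfl fun i _ => mul_comm _ _

lemma hMatrix_mulVec (e B : Matrix (Fin d) (Fin d) ℝ) (x y : Fin d → ℝ) :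
    hMatrix e B *ᵥ (Sum.elim x (antidiag d *ᵥ y) ∘ finSumFinEquiv.symm) =
      Sum.elim (e *ᵥ x + B *ᵥ ((eᵀ)⁻¹ *ᵥ y)) (antidiag d *ᵥ ((eᵀ)⁻¹ *ᵥ y)) ∘
        finSumFinEquiv.symm := by
  have hw : ∀ u : Fin d → ℝ, antidiag d *ᵥ (antidiag d *ᵥ u) = u := fun u => by
    rw [Matrix.mulVec_mulVec, antidiag_mul_self, Matrix.one_mulVec]
  rw [hMatrix, Matrix.reindex_apply, Matrix.submatrix_mulVec_equiv]
  congr 1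
  have h1 : (Sum.elim x (antidiag d *ᵥ y) ∘ finSumFinEquiv.symm) ∘
      (finSumFinEquiv.symm.symm : Fin d ⊕ Fin d ≃ Fin (d + d)) = Sum.elim x (antidiag d *ᵥ y) := by
    funext i
    simp
  rw [h1, ← Matrix.mulVec_mulVec, Matrix.fromBlocks_mulVec, Matrix.fromBlocks_mulVec]
  simp only [Sum.elim_comp_inl, Sum.elim_comp_inr, Matrix.zero_mulVec, Matrix.one_mulVec, add_zero,
    zero_add, ← Matrix.mulVec_mulVec, hw]

/-- Solving h (x, w y) = (k, w n) gives y = eᵗ n and x = e⁻¹ (k − B n), and |x|² + |y|² is the dual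
form. -/
lemma qf_hElt_inv {e : Matrix (Fin d) (Fin d) ℝ} (he : 0 < e.det) {B : Matrix (Fin d) (Fin d) ℝ}
    (hB : Bᵀ = -B) (n k : Fin d → ℤ) :
    qf ((hElt e he B hB).1⁻¹ : SLR (d + d)).1ᵀ (toR (pairVec (n, k))) = dualForm e B n k := by
  have hu : IsUnit e.det := he.ne'.isUnit
  set x : Fin d → ℝ := e⁻¹ *ᵥ (toR k - B *ᵥ toR n) with hx
  set y : Fin d → ℝ := eᵀ *ᵥ toR n with hy
  have hey : (eᵀ)⁻¹ *ᵥ y = toR n := by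
    rw [hy, Matrix.mulVec_mulVec, Matrix.nonsing_inv_mul _ (by rwa [Matrix.det_transpose]),
      Matrix.one_mulVec]
  have hex : e *ᵥ x = toR k - B *ᵥ toR n := by
    rw [hx, Matrix.mulVec_mulVec, Matrix.mul_nonsing_inv _ hu, Matrix.one_mulVec]
  have h1 := hMatrix_mulVec e B x y
  rw [hey, hex, sub_add_cancel] at h1
  have h2 : Sum.elim (toR k) (antidiag d *ᵥ toR n) ∘ finSumFinEquiv.symm =
      toR (pairVec (n, k)) := by
    funext i
    obtain ⟨j | j, rfl⟩ := finSumFinEquiv.surjective i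
    · simp only [toR_apply, pairVec_apply, Function.comp, Equiv.symm_apply_apply, Sum.elim_inl]
    · simp only [toR_apply, pairVec_apply, Function.comp, Equiv.symm_apply_apply, Sum.elim_inr,
        antidiag_mulVec]
  rw [h2] at h1
  have h3 : ((hElt e he B hB).1⁻¹ : SLR (d + d)).1 *ᵥ toR (pairVec (n, k)) =
      Sum.elim x (antidiag d *ᵥ y) ∘ finSumFinEquiv.symm := by
    rw [← h1]
    change ((hElt e he B hB).1⁻¹ : SLR (d + d)).1 *ᵥ ((hElt e he B hB).1.1 *ᵥ _) = _
    rw [Matrix.mulVec_mulVec, coe_inv_mul, Matrix.one_mulVec]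
  rw [qf, Matrix.vecMul_transpose, h3, dualForm, qf, qf, Matrix.vecMul_transpose,
    ← Matrix.mulVec_transpose, ← hx, ← hy, dotProduct, ← finSumFinEquiv.sum_comp,
    Fintype.sum_sum_type, add_comm]
  simp only [Function.comp, Equiv.symm_apply_apply, Sum.elim_inl, Sum.elim_inr]
  congr 1
  rw [← Equiv.sum_comp Fin.revPerm]
  simp only [Fin.revPerm_apply, antidiag_mulVec, Fin.rev_rev]
  rfl

lemma hasSum_subtype_of_indicator_eq {α : Type*} {S T : α → Prop} {F f : α → ℂ} (hF : Summable F)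
    (h : ∀ v, {v | T v}.indicator f v = {v | S v}.indicator F v) :
    HasSum (fun v : {v // T v} => f v.1) (∑' v : {v // S v}, F v.1) := by
  have h4 : HasSum (F ∘ (Subtype.val : {v // S v} → α)) (∑' v : {v // S v}, F v.1) :=
    (hF.comp_injective Subtype.val_injective).hasSum
  have h5 := (hasSum_subtype_iff_indicator (s := {v | S v})).1 h4
  exact (hasSum_subtype_iff_indicator (f := f) (s := {v | T v})).2 (funext h ▸ h5)

/-- The isotropic cone is stable under scaling, so the content argument applies to the power of the
form extended by zero off the cone. -/
lemma hasSum_primIso (hd : 0 < d) {e : Matrix (Fin d) (Fin d) ℝ} (he : e.det ≠ 0)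
    {B : Matrix (Fin d) (Fin d) ℝ} (hB : Bᵀ = -B) {g : Matrix (Fin (d + d)) (Fin (d + d)) ℝ}
    (hg : ∀ n k, qf g (toR (pairVec (n, k))) = dualForm e B n k) {s : ℂ} (hs : (d : ℝ) < s.re) :
    HasSum (fun v : {v : Fin (d + d) → ℤ // IsPrimIso v} => (qf g (toR v.1) : ℂ) ^ (-s))
      (2 * ((2 * riemannZeta (2 * s))⁻¹ *
        ∑' q : (Fin d → ℤ) × (Fin d → ℤ), isoTerm e B s q.1 q.2)) := by
  have hd1 : (1 : ℝ) ≤ d := by exact_mod_cast hd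
  have hs0 : s ≠ 0 := by
    rintro rfl
    simp at hs
    linarith
  have hz1 : 1 < (2 * s).re := by simp; linarith
  obtain ⟨F, hF⟩ : ∃ F : (Fin (d + d) → ℤ) → ℂ, F = fun v =>
    if v ⬝ᵥ (v ∘ Fin.rev) = 0 then (qf g (toR v) : ℂ) ^ (-s) else 0 := ⟨_, rfl⟩
  have hFq : ∀ q : (Fin d → ℤ) × (Fin d → ℤ), F (pairVec q) = isoTerm e B s q.1 q.2 := by
    rintro ⟨n, k⟩
    simp only [hF, isoTerm, pairVec_dotProduct_rev, hg, mul_eq_zero,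
      two_ne_zero, false_or]
  have hsum : Summable F := by
    rw [← pairVec.summable_iff]
    exact (summable_isoTerm he hB hs).congr fun q => (hFq q).symm
  have htsum : ∑' v, F v = ∑' q : (Fin d → ℤ) × (Fin d → ℤ), isoTerm e B s q.1 q.2 := by
    rw [← pairVec.tsum_eq F]
    exact tsum_congr hFq
  have hprim := tsum_eq_zeta_mul_tsum_prim hz1 (f := F) (by simp [hF, hs0]) (fun n v => by
    have h1 : (((n : ℤ) + 1) • v) ⬝ᵥ ((((n : ℤ) + 1) • v) ∘ Fin.rev) =
        ((n : ℤ) + 1) * (((n : ℤ) + 1) * (v ⬝ᵥ (v ∘ Fin.rev))) := by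
      rw [show (((n : ℤ) + 1) • v) ∘ Fin.rev = ((n : ℤ) + 1) • (v ∘ Fin.rev) from rfl,
        smul_dotProduct, dotProduct_smul, smul_eq_mul, smul_eq_mul]
    have hn : (n : ℤ) + 1 ≠ 0 := by positivity
    simp only [hF, h1, mul_eq_zero, hn, false_or]
    split_ifs
    · exact cpow_neg_qf_smul g s n v
    · rw [mul_zero]) hsum
  have hval : 2 * ((2 * riemannZeta (2 * s))⁻¹ *
      ∑' q : (Fin d → ℤ) × (Fin d → ℤ), isoTerm e B s q.1 q.2) =
      ∑' v : {v : Fin (d + d) → ℤ // IsPrim v}, F v := by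
    rw [← htsum, hprim]
    have := riemannZeta_ne_zero_of_one_lt_re hz1
    field_simp
  rw [hval]
  refine hasSum_subtype_of_indicator_eq (f := fun v => (qf g (toR v) : ℂ) ^ (-s)) hsum fun v => ?_
  by_cases h1 : IsPrim v <;> by_cases h2 : v ⬝ᵥ (v ∘ Fin.rev) = 0 <;>
    simp [Set.indicator, hF, IsPrimIso, h1, h2]

theorem hasSum_eisSOTerm_hElt (hd : 2 ≤ d) {e : Matrix (Fin d) (Fin d) ℝ} (he : 0 < e.det)
    {B : Matrix (Fin d) (Fin d) ℝ} (hB : Bᵀ = -B) {s : ℂ} (hs : (d : ℝ) < s.re) :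
    HasSum (eisSOTerm d s (hElt e he B hB)) ((2 * riemannZeta (2 * s))⁻¹ *
      ∑' q : (Fin d → ℤ) × (Fin d → ℤ), isoTerm e B s q.1 q.2) :=
  hasSum_eisSOTerm hd _ (hasSum_primIso (by omega) he.ne' hB (qf_hElt_inv he hB) hs)

theorem hasSum_eisSpinTerm_hElt (hd : 2 ≤ d) {e : Matrix (Fin d) (Fin d) ℝ} (he : 0 < e.det)
    {B : Matrix (Fin d) (Fin d) ℝ} (hB : Bᵀ = -B) {h' : SpinDD d}
    (hh : spinCover d h' = hElt e he B hB) {s : ℂ} (hs : (d : ℝ) < s.re) :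
    HasSum (eisSpinTerm d s h') ((2 * riemannZeta (2 * s))⁻¹ *
      ∑' q : (Fin d → ℤ) × (Fin d → ℤ), isoTerm e B s q.1 q.2) :=
  hasSum_eisSpinTerm hd _ (by
    rw [hh]
    exact hasSum_primIso (by omega) he.ne' hB (qf_hElt_inv he hB) hs)

end VectorSeries

end ThetaLift

namespace ThetaLift

open Matrix MeasureTheory Set Filter Topology UpperHalfPlane

/-! ### The modular integral as a meromorphic function -/

section Integral

variable {d : ℕ} {e B : Matrix (Fin d) (Fin d) ℝ}

lemma analyticAt_modularIntegral (he : e.det ≠ 0) (hB : Bᵀ = -B) {H : ℂ → ℍ → ℂ} {s₀ : ℂ} {r : ℝ}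
    (hr : 0 < r)
    (hm : ∀ s ∈ Metric.ball s₀ r, AEStronglyMeasurable (H s) (volume.restrict ModularGroup.fd))
    (hd : ∀ τ ∈ ModularGroup.fd, DifferentiableOn ℂ (fun s => H s τ) (Metric.ball s₀ r)) {C R : ℝ}
    (hb : ∀ s ∈ Metric.ball s₀ r, ∀ τ ∈ ModularGroup.fd, ‖H s τ‖ ≤ C * τ.im ^ R) :
    AnalyticAt ℂ (fun s => modularIntegral (H s) (e * eᵀ + B)) s₀ := by
  refine analyticAt_integral_of_bound (μ := volume.restrict ModularGroup.fd)
    (g := fun τ : ℍ => C * (τ.im ^ R * latticeNorm (e * eᵀ + B) τ)) hr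
    (fun s hs => (hm s hs).mul (measurable_latticeSum e hB).aestronglyMeasurable)
    ((integrableOn_fd_latticeNorm he hB R).const_mul C) ?_
  filter_upwards [ae_restrict_mem measurableSet_fd] with τ hτ
  refine ⟨(hd τ hτ).mul_const _, fun s hs => ?_⟩
  rw [norm_mul, ← mul_assoc]
  exact mul_le_mul (hb s hs τ hτ) (norm_latticeSum_le he hB τ) (norm_nonneg _)
    ((norm_nonneg _).trans (hb s hs τ hτ))

lemma integrableOn_epsteinLambda₀_mul_latticeSum (he : e.det ≠ 0) (hB : Bᵀ = -B) (s : ℂ) :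
    IntegrableOn (fun τ => epsteinLambda₀ (tauMat τ) (tauMat_det_ne τ) s *
      latticeSum (e * eᵀ + B) τ) ModularGroup.fd := by
  obtain ⟨R, -, -, C, hC⟩ := exists_bound_epsteinLambda₀_tauMat (isCompact_singleton (x := s)) 0
  exact integrableOn_fd_mul_latticeSum he hB
    (measurable_epsteinLambda₀_tauMat s).aestronglyMeasurable (hC s rfl)

lemma integrableOn_latticeSum (he : e.det ≠ 0) (hB : Bᵀ = -B) :
    IntegrableOn (latticeSum (e * eᵀ + B)) ModularGroup.fd := by
  have h := integrableOn_fd_mul_latticeSum he hB (φ := fun _ => 1) (C := 1) (R := 0)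
    aestronglyMeasurable_const (fun τ _ => by simp)
  simpa only [one_mul] using h

/-- The polar part of the binary zeta function does not depend on τ, so it only multiplies the
integral of 𝒢 itself. Meromorphy is thereby reduced to the entire part. -/
lemma modularIntegral_eisSL2_eq (he : e.det ≠ 0) (hB : Bᵀ = -B) {s : ℂ} (hs : s ∈ goodPoints) :
    modularIntegral (eisSL2 s) (e * eᵀ + B) =
      (modularIntegral (fun τ => epsteinLambda₀ (tauMat τ) (tauMat_det_ne τ) s) (e * eᵀ + B) -
        (1 / s + 1 / (1 - s)) * modularIntegral (fun _ => 1) (e * eᵀ + B)) /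
        (2 * completedRiemannZeta (2 * s)) := by
  have h1 : ∀ τ : ℍ, eisSL2 s τ * latticeSum (e * eᵀ + B) τ =
      (epsteinLambda₀ (tauMat τ) (tauMat_det_ne τ) s * latticeSum (e * eᵀ + B) τ -
        (1 / s + 1 / (1 - s)) * (1 * latticeSum (e * eᵀ + B) τ)) /
        (2 * completedRiemannZeta (2 * s)) := by
    intro τ
    rw [eisSL2_eq hs, epsteinEis, epsteinLambda_eq, tauMat_det]
    simp only [abs_one, inv_one, Complex.ofReal_one, Fintype.card_fin, Nat.cast_ofNat]
    rw [div_self (two_ne_zero : (2 : ℂ) ≠ 0)]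
    ring
  simp only [modularIntegral, h1]
  rw [integral_div, integral_sub (integrableOn_epsteinLambda₀_mul_latticeSum he hB s)
    (by simpa only [one_mul] using (integrableOn_latticeSum he hB).const_mul (1 / s + 1 / (1 - s))),
    integral_const_mul]

lemma analyticAt_modularIntegral_epsteinLambda₀ (he : e.det ≠ 0) (hB : Bᵀ = -B) (s₀ : ℂ) :
    AnalyticAt ℂ (fun s => modularIntegral
      (fun τ => epsteinLambda₀ (tauMat τ) (tauMat_det_ne τ) s) (e * eᵀ + B)) s₀ := by
  obtain ⟨R, -, -, C, hC⟩ :=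
    exists_bound_epsteinLambda₀_tauMat (isCompact_closedBall s₀ 1) 0
  exact analyticAt_modularIntegral he hB one_pos
    (fun s _ => (measurable_epsteinLambda₀_tauMat s).aestronglyMeasurable)
    (fun τ _ => (differentiable_epsteinLambda₀ (tauMat_det_ne τ)).differentiableOn)
    (fun s hs => hC s (Metric.ball_subset_closedBall hs))

lemma meromorphicOn_modularIntegral (he : e.det ≠ 0) (hB : Bᵀ = -B) :
    MeromorphicOn (fun s => modularIntegral (eisSL2 s) (e * eᵀ + B)) univ := by
  intro s₀ _
  have h1 := (analyticAt_modularIntegral_epsteinLambda₀ he hB s₀).meromorphicAt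
  have hid : MeromorphicAt (fun s : ℂ => s) s₀ := analyticAt_id.meromorphicAt
  have hc : ∀ c : ℂ, MeromorphicAt (fun _ : ℂ => c) s₀ := fun c => analyticAt_const.meromorphicAt
  refine MeromorphicAt.congr ((h1.sub ((((hc 1).div hid).add ((hc 1).div ((hc 1).sub hid))).mul
    (hc (modularIntegral (fun _ => 1) (e * eᵀ + B))))).div
    ((hc 2).mul (meromorphicAt_completedZeta_two_mul s₀))) ?_
  filter_upwards [eventually_mem_goodPoints s₀] with s hs
  exact (modularIntegral_eisSL2_eq he hB hs).symm

lemma exists_closedBall_goodPoints (s₀ : ℂ) :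
    ∃ r > 0, ∀ z ∈ Metric.closedBall s₀ r, z ≠ s₀ → z ∈ goodPoints := by
  have h := eventually_mem_goodPoints s₀
  rw [eventually_nhdsWithin_iff] at h
  obtain ⟨r, hr, h⟩ := Metric.nhds_basis_closedBall.eventually_iff.1 h
  exact ⟨r, hr, fun z hz hne => h hz hne⟩

/-- Where every `E_s(τ)` is holomorphic, the growth at the cusp is locally uniform in `s`. -/
lemma exists_bound_eisSL2 {s₀ : ℂ} (h : ∀ τ, AnalyticAt ℂ (fun z => eisSL2 z τ) s₀) :
    ∃ r > 0, ∃ R C : ℝ, ∀ s ∈ Metric.ball s₀ r,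
      AEStronglyMeasurable (eisSL2 s) (volume.restrict ModularGroup.fd) ∧
      ∀ τ ∈ ModularGroup.fd, AnalyticAt ℂ (fun z => eisSL2 z τ) s ∧ ‖eisSL2 s τ‖ ≤ C * τ.im ^ R := by
  obtain ⟨r, hr, hgood⟩ := exists_closedBall_goodPoints s₀
  have hana : ∀ τ, ∀ s ∈ Metric.closedBall s₀ r, AnalyticAt ℂ (fun z => eisSL2 z τ) s := by
    intro τ s hs
    rcases eq_or_ne s s₀ with rfl | hne
    · exact h τ
    · exact analyticAt_eisSL2 (hgood s hs hne) τ
  have hsphere : Metric.sphere s₀ r ⊆ goodPoints := fun z hz =>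
    hgood z (Metric.sphere_subset_closedBall hz) fun h2 => by
      rw [h2, Metric.mem_sphere, dist_self] at hz
      exact hr.ne hz
  -- At s₀ itself the explicit quotient may be singular. The bound is therefore taken on a small
  -- circle of good points and carried inside by the maximum principle.
  obtain ⟨R, -, C, hC⟩ := exists_bound_epsteinEis_tauMat (isCompact_sphere s₀ r) hsphere 0
  have hmeas : ∀ s ∈ Metric.closedBall s₀ r, s ≠ s₀ → StronglyMeasurable (eisSL2 s) := by
    intro s hs hne
    have h1 : eisSL2 s = fun τ => epsteinEis (tauMat τ) (tauMat_det_ne τ) s :=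
      funext fun τ => eisSL2_eq (hgood s hs hne) τ
    rw [h1]
    exact measurable_epsteinEis_tauMat s
  refine ⟨r, hr, R, C, fun s hs => ⟨?_, fun τ hτ =>
    ⟨hana τ s (Metric.ball_subset_closedBall hs), ?_⟩⟩⟩
  · rcases eq_or_ne s s₀ with rfl | hne
    -- At the centre, E_s is measurable in τ as the pointwise limit of E_{s'} at nearby good points.
    · have hlim : Tendsto (fun n : ℕ => s + ((r / (n + 2) : ℝ) : ℂ)) atTop (𝓝 s) := by
        have h2 : Tendsto (fun n : ℕ => r / ((n : ℝ) + 2)) atTop (𝓝 0) :=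
          Tendsto.div_atTop tendsto_const_nhds
            (tendsto_atTop_add_const_right _ _ tendsto_natCast_atTop_atTop)
        have h3 := ((Complex.continuous_ofReal.tendsto 0).comp h2).const_add s
        simpa using h3
      refine (stronglyMeasurable_of_tendsto (u := atTop)
        (f := fun n : ℕ => eisSL2 (s + ((r / (n + 2) : ℝ) : ℂ))) (fun n => hmeas _ ?_ ?_)
        (tendsto_pi_nhds.2 fun τ => ((h τ).continuousAt.tendsto.comp hlim))).aestronglyMeasurable
      · rw [Metric.mem_closedBall, dist_eq_norm, add_sub_cancel_left, Complex.norm_real,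
          Real.norm_eq_abs, abs_of_pos (by positivity)]
        exact div_le_self hr.le (by linarith [(Nat.cast_nonneg n : (0 : ℝ) ≤ n)])
      · rw [Ne, add_eq_left, Complex.ofReal_eq_zero]
        positivity
    · exact (hmeas s (Metric.ball_subset_closedBall hs) hne).aestronglyMeasurable
  · refine Complex.norm_le_of_forall_mem_frontier_norm_le (f := fun z => eisSL2 z τ)
      (U := Metric.ball s₀ r) Metric.isBounded_ball ?_ (fun z hz => ?_) (subset_closure hs)
    · refine DifferentiableOn.diffContOnCl fun z hz => ?_
      rw [closure_ball _ hr.ne'] at hz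
      exact (hana τ z hz).differentiableAt.differentiableWithinAt
    · rw [frontier_ball _ hr.ne'] at hz
      rw [eisSL2_eq (hsphere hz)]
      exact hC z hz τ hτ

lemma integrableOn_eisSL2_mul_latticeSum (he : e.det ≠ 0) (hB : Bᵀ = -B) {s₀ : ℂ}
    (h : ∀ τ, AnalyticAt ℂ (fun z => eisSL2 z τ) s₀) :
    IntegrableOn (fun τ => eisSL2 s₀ τ * latticeSum (e * eᵀ + B) τ) ModularGroup.fd := by
  obtain ⟨r, hr, R, C, hC⟩ := exists_bound_eisSL2 h
  obtain ⟨h1, h2⟩ := hC s₀ (Metric.mem_ball_self hr)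
  exact integrableOn_fd_mul_latticeSum he hB h1 fun τ hτ => (h2 τ hτ).2

lemma analyticAt_modularIntegral_eisSL2 (he : e.det ≠ 0) (hB : Bᵀ = -B) {s₀ : ℂ}
    (h : ∀ τ, AnalyticAt ℂ (fun z => eisSL2 z τ) s₀) :
    AnalyticAt ℂ (fun s => modularIntegral (eisSL2 s) (e * eᵀ + B)) s₀ := by
  obtain ⟨r, hr, R, C, hC⟩ := exists_bound_eisSL2 h
  exact analyticAt_modularIntegral he hB hr (fun s hs => (hC s hs).1)
    (fun τ hτ s hs => ((hC s hs).2 τ hτ).1.differentiableAt.differentiableWithinAt)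
    (fun s hs τ hτ => ((hC s hs).2 τ hτ).2)

end Integral

end ThetaLift

namespace ThetaLift

open Matrix MeasureTheory Set Filter Topology UpperHalfPlane

/-! ### The identity and its continuation -/

section Lift

lemma ofReal_rpow_cpow {D : ℝ} (hD : 0 < D) (a : ℝ) (z : ℂ) :
    ((D ^ a : ℝ) : ℂ) ^ z = (D : ℂ) ^ (a * z) := by
  have h1 : ((D ^ a : ℝ) : ℂ) ≠ 0 := by exact_mod_cast (Real.rpow_pos_of_pos hD a).ne'
  have h2 : (D : ℂ) ≠ 0 := by exact_mod_cast hD.ne'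
  rw [Complex.cpow_def_of_ne_zero h1, Complex.cpow_def_of_ne_zero h2, ← Complex.ofReal_log
    (Real.rpow_pos_of_pos hD a).le, ← Complex.ofReal_log hD.le, Real.log_rpow hD]
  push_cast
  ring_nf

lemma epsteinEis_smul {ι : Type*} [Fintype ι] [DecidableEq ι] [Nonempty ι] {e : Matrix ι ι ℝ}
    (he : e.det ≠ 0) {c : ℝ} (hc : 0 < c) (hce : (c • e).det ≠ 0) {s : ℂ}
    (hs : Fintype.card ι < 2 * s.re) (hs1 : 1 < 2 * s.re) :
    epsteinEis (c • e) hce s = (c : ℂ) ^ (-(2 * s)) * epsteinEis e he s := by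
  refine (hasSum_epsteinEis hce hs hs1).unique ?_
  refine (congrArg (fun f => HasSum f _) (funext fun v => ?_)).mpr
    ((hasSum_epsteinEis he hs hs1).mul_left ((c : ℂ) ^ (-(2 * s))))
  have h1 := ofReal_rpow_cpow hc 2 (-s)
  rw [Real.rpow_ofNat] at h1
  rw [qf_smul_left, Complex.ofReal_mul, Complex.mul_cpow_ofReal_nonneg (by positivity)
    (qf_nonneg _ _), h1]
  push_cast
  rw [mul_neg]
  ring

variable {d : ℕ} {e B : Matrix (Fin d) (Fin d) ℝ}

lemma unimodular_inv_transpose (he : 0 < e.det) :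
    ((unimodular e he)⁻¹ : SLR d).1ᵀ = (e.det ^ (1 / (d : ℝ))) • (e⁻¹)ᵀ := by
  have hc : 0 < e.det ^ (1 / (d : ℝ)) := Real.rpow_pos_of_pos he _
  rw [← Matrix.transpose_smul]
  congr 1
  have h1 : ((e.det ^ (1 / (d : ℝ))) • e⁻¹) * (unimodular e he).1 = 1 := by
    change ((e.det ^ (1 / (d : ℝ))) • e⁻¹) * ((e.det ^ (-(1 / (d : ℝ)))) • e) = 1
    rw [Matrix.smul_mul, Matrix.mul_smul, smul_smul, Matrix.nonsing_inv_mul _ he.ne'.isUnit,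
      Real.rpow_neg he.le, mul_inv_cancel₀ hc.ne', one_smul]
  calc ((unimodular e he)⁻¹ : SLR d).1
      = (((e.det ^ (1 / (d : ℝ))) • e⁻¹) * (unimodular e he).1) * ((unimodular e he)⁻¹ : SLR d).1 := by
        rw [h1, Matrix.one_mul]
    _ = _ := by rw [Matrix.mul_assoc, coe_mul_inv, Matrix.mul_one]

lemma unimodular_det_ne (he : 0 < e.det) : (unimodular e he).1.det ≠ 0 := by
  rw [(unimodular e he).2]
  exact one_ne_zero

lemma unimodular_inv_det_ne (he : 0 < e.det) : (((unimodular e he)⁻¹ : SLR d).1ᵀ).det ≠ 0 := by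
  rw [Matrix.det_transpose, ((unimodular e he)⁻¹ : SLR d).2]
  exact one_ne_zero

lemma continues_eisSLSeries_one (hd : 2 ≤ d) [Nonempty (Fin d)] (he : 0 < e.det) :
    Continues (epsteinEis (unimodular e he).1 (unimodular_det_ne he))
      (fun z => eisSLSeries d 1 z (unimodular e he)) (d / 2) where
  mero := meromorphicOn_epsteinEis _
  analyticAt s hs := by
    have hd' : (2 : ℝ) ≤ d := by exact_mod_cast hd
    refine analyticAt_epsteinEis_of_re _ (by linarith) ?_
    rintro rfl
    simp at hs
  eq s hs := ((hasSum_eisSLTerm_one hd _ _ (by linarith)).tsum_eq).symm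

lemma continues_eisSLSeries_pred (hd : 2 ≤ d) [Nonempty (Fin d)] (he : 0 < e.det) :
    Continues (epsteinEis ((unimodular e he)⁻¹ : SLR d).1ᵀ (unimodular_inv_det_ne he))
      (fun z => eisSLSeries d (d - 1) z (unimodular e he)) (d / 2) where
  mero := meromorphicOn_epsteinEis _
  analyticAt s hs := by
    have hd' : (2 : ℝ) ≤ d := by exact_mod_cast hd
    refine analyticAt_epsteinEis_of_re _ (by linarith) ?_
    rintro rfl
    simp at hs
  eq s hs := ((hasSum_eisSLTerm_pred hd _ _ (by linarith)).tsum_eq).symm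

/-- The sum over integral isotropic vectors to which the vector Eisenstein series is
proportional. -/
noncomputable def isoSeries (e B : Matrix (Fin d) (Fin d) ℝ) (s : ℂ) : ℂ :=
  (2 * riemannZeta (2 * s))⁻¹ * ∑' q : (Fin d → ℤ) × (Fin d → ℤ), isoTerm e B s q.1 q.2

/-- `modularIntegral_eq` with `e` rescaled to determinant one. Homogeneity of the zeta functions
produces the powers of det e, and 2ζ(2s') times the normalized isotropic series restores the lattice
sum. -/
lemma modularIntegral_eq_liftRHS (hd : 2 ≤ d) [Nonempty (Fin d)] (he : 0 < e.det) (hB : Bᵀ = -B)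
    {E₀ E₁ E₂ : ℂ → ℂ} {s : ℂ} (hs : (d : ℝ) / 2 + 1 < s.re)
    (h₀ : E₀ (s + d / 2 - 1) = isoSeries e B (s + d / 2 - 1))
    (h₁ : E₁ (s + d / 2 - 1) = epsteinEis ((unimodular e he)⁻¹ : SLR d).1ᵀ
      (unimodular_inv_det_ne he) (s + d / 2 - 1))
    (h₂ : E₂ s = epsteinEis (unimodular e he).1 (unimodular_det_ne he) s) :
    modularIntegral (eisSL2Series s) (e * eᵀ + B) = liftRHS d e.det E₀ E₁ E₂ s := by
  have hd' : (2 : ℝ) ≤ d := by exact_mod_cast hd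
  have hd0 : (d : ℂ) ≠ 0 := by exact_mod_cast (by omega : d ≠ 0)
  have hD : (e.det : ℂ) ≠ 0 := by exact_mod_cast he.ne'
  have hre : (s + d / 2 - 1).re = s.re + d / 2 - 1 := by simp
  have hζ : riemannZeta (2 * (s + d / 2 - 1)) ≠ 0 :=
    riemannZeta_ne_zero_of_one_lt_re (by
      have : (2 * (s + d / 2 - 1)).re = 2 * (s + d / 2 - 1).re := by simp
      rw [this, hre]; linarith)
  have e₁ : epsteinEis ((unimodular e he)⁻¹ : SLR d).1ᵀ (unimodular_inv_det_ne he)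
      (s + d / 2 - 1) = (e.det : ℂ) ^ (-((2 * s + d - 2) / d)) *
        epsteinEis (e⁻¹)ᵀ (det_inv_transpose_ne_zero he.ne') (s + d / 2 - 1) := by
    have h := epsteinEis_smul (s := s + d / 2 - 1) (det_inv_transpose_ne_zero he.ne')
      (Real.rpow_pos_of_pos he (1 / (d : ℝ)))
      (by rw [← unimodular_inv_transpose he]; exact unimodular_inv_det_ne he)
      (by rw [hre, Fintype.card_fin]; linarith) (by rw [hre]; linarith)
    rw [ofReal_rpow_cpow he] at h
    simp only [unimodular_inv_transpose he]
    rw [h]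
    congr 2
    push_cast
    field_simp
  have e₂ : epsteinEis (unimodular e he).1 (unimodular_det_ne he) s =
      (e.det : ℂ) ^ (2 * s / d) * epsteinEis e he.ne' s := by
    have h := epsteinEis_smul (s := s) he.ne' (Real.rpow_pos_of_pos he (-(1 / (d : ℝ))))
      (unimodular_det_ne he) (by rw [Fintype.card_fin]; linarith) (by linarith)
    rw [ofReal_rpow_cpow he] at h
    refine h.trans ?_
    congr 2
    push_cast
    field_simp
  rw [modularIntegral_eq he.ne' hB hd hs, liftRHS, h₀, h₁, h₂, e₁, e₂, isoSeries, abs_of_pos he,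
    show 2 * s + (d : ℂ) - 2 = 2 * (s + d / 2 - 1) by ring,
    completedZeta_two_mul (s := s + d / 2 - 1) (by rw [hre]; linarith)]
  have p₁ : (e.det : ℂ) ^ ((2 * s - 2) / d) * (e.det : ℂ) ^ (-(2 * (s + d / 2 - 1) / d)) =
      (e.det : ℂ)⁻¹ := by
    rw [← Complex.cpow_add _ _ hD, ← Complex.cpow_neg_one]
    congr 1
    field_simp
    ring
  have p₂ : (e.det : ℂ) ^ (-(2 * s / d)) * (e.det : ℂ) ^ (2 * s / d) = 1 := by
    rw [← Complex.cpow_add _ _ hD, neg_add_cancel, Complex.cpow_zero]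
  rw [Complex.ofReal_inv]
  generalize (∑' q : (Fin d → ℤ) × (Fin d → ℤ), isoTerm e B (s + d / 2 - 1) q.1 q.2) = T
  generalize epsteinEis (e⁻¹)ᵀ (det_inv_transpose_ne_zero he.ne') (s + d / 2 - 1) = X₁
  generalize epsteinEis e he.ne' s = X₂
  generalize (Real.pi : ℂ) ^ (-(s + d / 2 - 1)) * Complex.Gamma (s + d / 2 - 1) = P
  generalize riemannZeta (2 * (s + d / 2 - 1)) = Z at hζ ⊢
  have q₀ : (e.det : ℂ)⁻¹ * (P * T) = 2 * (e.det : ℂ)⁻¹ * (P * Z) * ((2 * Z)⁻¹ * T) := by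
    field_simp
  rw [q₀]
  linear_combination (2 * P * Z * X₁) * p₁ +
    (2 * completedRiemannZeta (2 * s - 1) * X₂) * p₂

/-- The solution of the identity for the vector Eisenstein series. -/
noncomputable def vectorCont (d : ℕ) (D : ℝ) (J E₁ E₂ : ℂ → ℂ) (z : ℂ) : ℂ :=
  (J (z - d / 2 + 1)
    + 2 * (D : ℂ) ^ ((2 * (z - d / 2 + 1) - 2) / d) * completedRiemannZeta (2 * z) * E₁ z
    + 2 * (D : ℂ) ^ (-(2 * (z - d / 2 + 1) / d)) *
      completedRiemannZeta (2 * (z - d / 2 + 1) - 1) * E₂ (z - d / 2 + 1)) /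
    (2 * (D : ℂ)⁻¹ * completedRiemannZeta (2 * z))

lemma vectorCont_eq {D : ℝ} (hD : D ≠ 0) {J E₀ E₁ E₂ : ℂ → ℂ} {z : ℂ}
    (hz : completedRiemannZeta (2 * z) ≠ 0)
    (h : J (z - d / 2 + 1) = liftRHS d D E₀ E₁ E₂ (z - d / 2 + 1)) :
    vectorCont d D J E₁ E₂ z = E₀ z := by
  have hD' : (D : ℂ) ≠ 0 := by exact_mod_cast hD
  rw [vectorCont, h, liftRHS, show 2 * (z - d / 2 + 1) + (d : ℂ) - 2 = 2 * z by ring,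
    show z - d / 2 + 1 + (d : ℂ) / 2 - 1 = z by ring, div_eq_iff (by simp [hD', hz])]
  ring

lemma analyticAt_const_cpow {D : ℝ} (hD : 0 < D) {f : ℂ → ℂ} {z : ℂ} (hf : AnalyticAt ℂ f z) :
    AnalyticAt ℂ (fun z => (D : ℂ) ^ f z) z :=
  analyticAt_const.cpow hf (Complex.ofReal_mem_slitPlane.2 hD)

lemma analyticAt_vectorCont {D : ℝ} (hD : 0 < D) {J E₁ E₂ : ℂ → ℂ} {z : ℂ}
    (hJ : AnalyticAt ℂ J (z - d / 2 + 1)) (h₁ : AnalyticAt ℂ E₁ z)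
    (h₂ : AnalyticAt ℂ E₂ (z - d / 2 + 1)) (hz : 1 < (2 * z).re)
    (hz0 : 2 * (z - d / 2 + 1) - 1 ≠ 0) (hz1 : 2 * (z - d / 2 + 1) - 1 ≠ 1) :
    AnalyticAt ℂ (vectorCont d D J E₁ E₂) z := by
  have hD' : (D : ℂ) ≠ 0 := by exact_mod_cast hD.ne'
  have hξ : AnalyticAt ℂ (fun z => completedRiemannZeta (2 * z)) z := by
    refine AnalyticAt.fun_comp (analyticAt_completedZeta ?_ ?_) (by fun_prop)
    · intro h; rw [h] at hz; simp at hz; linarith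
    · intro h; rw [h] at hz; simp at hz
  have hξ' : AnalyticAt ℂ (fun z => completedRiemannZeta (2 * (z - d / 2 + 1) - 1)) z :=
    AnalyticAt.fun_comp (f := fun z : ℂ => 2 * (z - d / 2 + 1) - 1)
      (analyticAt_completedZeta hz0 hz1) (by fun_prop)
  have hJ' : AnalyticAt ℂ (fun z => J (z - d / 2 + 1)) z :=
    AnalyticAt.fun_comp (f := fun z : ℂ => z - d / 2 + 1) hJ (by fun_prop)
  have h₂' : AnalyticAt ℂ (fun z => E₂ (z - d / 2 + 1)) z :=
    AnalyticAt.fun_comp (f := fun z : ℂ => z - d / 2 + 1) h₂ (by fun_prop)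
  have hne := completedZeta_ne_zero hz
  have hc₁ : AnalyticAt ℂ (fun z : ℂ => (D : ℂ) ^ ((2 * (z - d / 2 + 1) - 2) / d)) z :=
    analyticAt_const_cpow hD (by fun_prop)
  have hc₂ : AnalyticAt ℂ (fun z : ℂ => (D : ℂ) ^ (-(2 * (z - d / 2 + 1) / d))) z :=
    analyticAt_const_cpow hD (by fun_prop)
  exact ((hJ'.add (((analyticAt_const.mul hc₁).mul hξ).mul h₁)).add
    (((analyticAt_const.mul hc₂).mul hξ').mul h₂')).div (analyticAt_const.mul hξ)
    (by simp [hD', hne])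

lemma meromorphicOn_vectorCont {D : ℝ} (hD : 0 < D) {J E₁ E₂ : ℂ → ℂ} (hJ : MeromorphicOn J univ)
    (h₁ : MeromorphicOn E₁ univ) (h₂ : MeromorphicOn E₂ univ) :
    MeromorphicOn (vectorCont d D J E₁ E₂) univ := by
  intro z _
  have hξ := meromorphicAt_completedZeta_two_mul z
  have hξ' : MeromorphicAt (fun z => completedRiemannZeta (2 * (z - d / 2 + 1) - 1)) z :=
    (meromorphicAt_completedZeta _).comp_analyticAt (g := fun z : ℂ => 2 * (z - d / 2 + 1) - 1)
      (by fun_prop)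
  have hJ' : MeromorphicAt (fun z => J (z - d / 2 + 1)) z :=
    (hJ _ (mem_univ _)).comp_analyticAt (g := fun z : ℂ => z - d / 2 + 1) (by fun_prop)
  have h₂' : MeromorphicAt (fun z => E₂ (z - d / 2 + 1)) z :=
    (h₂ _ (mem_univ _)).comp_analyticAt (g := fun z : ℂ => z - d / 2 + 1) (by fun_prop)
  have hc₁ : MeromorphicAt (fun z : ℂ => (D : ℂ) ^ ((2 * (z - d / 2 + 1) - 2) / d)) z :=
    (analyticAt_const_cpow hD (by fun_prop)).meromorphicAt
  have hc₂ : MeromorphicAt (fun z : ℂ => (D : ℂ) ^ (-(2 * (z - d / 2 + 1) / d))) z :=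
    (analyticAt_const_cpow hD (by fun_prop)).meromorphicAt
  have hc : ∀ c : ℂ, MeromorphicAt (fun _ : ℂ => c) z := fun c => analyticAt_const.meromorphicAt
  exact ((hJ'.add ((((hc 2).mul hc₁).mul hξ).mul (h₁ z (mem_univ z)))).add
    ((((hc 2).mul hc₂).mul hξ').mul h₂')).div ((hc _).mul hξ)

lemma meromorphicOn_liftRHS {D : ℝ} (hD : 0 < D) {E₀ E₁ E₂ : ℂ → ℂ} (h₀ : MeromorphicOn E₀ univ)
    (h₁ : MeromorphicOn E₁ univ) (h₂ : MeromorphicOn E₂ univ) :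
    MeromorphicOn (liftRHS d D E₀ E₁ E₂) univ := by
  intro s _
  have hξ : MeromorphicAt (fun s : ℂ => completedRiemannZeta (2 * s + d - 2)) s :=
    (meromorphicAt_completedZeta _).comp_analyticAt (g := fun s : ℂ => 2 * s + d - 2)
      (by fun_prop)
  have hξ' : MeromorphicAt (fun s : ℂ => completedRiemannZeta (2 * s - 1)) s :=
    (meromorphicAt_completedZeta _).comp_analyticAt (g := fun s : ℂ => 2 * s - 1) (by fun_prop)
  have h₀' : MeromorphicAt (fun s => E₀ (s + d / 2 - 1)) s :=
    (h₀ _ (mem_univ _)).comp_analyticAt (g := fun s : ℂ => s + d / 2 - 1) (by fun_prop)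
  have h₁' : MeromorphicAt (fun s => E₁ (s + d / 2 - 1)) s :=
    (h₁ _ (mem_univ _)).comp_analyticAt (g := fun s : ℂ => s + d / 2 - 1) (by fun_prop)
  have hc₁ : MeromorphicAt (fun s : ℂ => (D : ℂ) ^ ((2 * s - 2) / d)) s :=
    (analyticAt_const_cpow hD (by fun_prop)).meromorphicAt
  have hc₂ : MeromorphicAt (fun s : ℂ => (D : ℂ) ^ (-(2 * s / d))) s :=
    (analyticAt_const_cpow hD (by fun_prop)).meromorphicAt
  have hc : ∀ c : ℂ, MeromorphicAt (fun _ : ℂ => c) s := fun c => analyticAt_const.meromorphicAt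
  exact ((((hc _).mul hξ).mul h₀').sub ((((hc 2).mul hc₁).mul hξ).mul h₁')).sub
    ((((hc 2).mul hc₂).mul hξ').mul (h₂ s (mem_univ s)))

lemma eisSL2_eq_series {s : ℂ} (hs : 1 < s.re) : eisSL2 s = eisSL2Series s :=
  funext fun τ => (continues_eisSL2 τ).meroCont_eq_self hs

/-- In the range of convergence the identity, divided by ξ(2z) ≠ 0, expresses the vector series
through the modular integral and the two SL(d) series. All of these are already meromorphic on ℂ, so
the same formula continues the vector series. -/
lemma continues_vectorCont (hd : 2 ≤ d) [Nonempty (Fin d)] (he : 0 < e.det) (hB : Bᵀ = -B)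
    {ED : ℂ → ℂ} (hED : ∀ z : ℂ, (d : ℝ) < z.re → ED z = isoSeries e B z) :
    Continues (vectorCont d e.det (fun s => modularIntegral (eisSL2 s) (e * eᵀ + B))
      (epsteinEis ((unimodular e he)⁻¹ : SLR d).1ᵀ (unimodular_inv_det_ne he))
      (epsteinEis (unimodular e he).1 (unimodular_det_ne he))) ED d := by
  have hd' : (2 : ℝ) ≤ d := by exact_mod_cast hd
  have hre : ∀ z : ℂ, (z - d / 2 + 1).re = z.re - d / 2 + 1 := fun z => by simp
  have hre2 : ∀ z : ℂ, (2 * z).re = 2 * z.re := fun z => by simp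
  refine ⟨meromorphicOn_vectorCont he (meromorphicOn_modularIntegral he.ne' hB)
    (meromorphicOn_epsteinEis _) (meromorphicOn_epsteinEis _), fun z hz => ?_, fun z hz => ?_⟩
  · have hpos : 2 < (2 * (z - d / 2 + 1) - 1).re + 1 := by
      rw [Complex.sub_re, hre2, hre, Complex.one_re]; linarith
    refine analyticAt_vectorCont he
      (analyticAt_modularIntegral_eisSL2 he.ne' hB
        fun τ => analyticAt_eisSL2 (mem_goodPoints_of_re (by rw [hre]; linarith)) τ)
      ((continues_eisSLSeries_pred hd he).analyticAt z (by linarith))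
      ((continues_eisSLSeries_one hd he).analyticAt _ (by rw [hre]; linarith))
      (by rw [hre2]; linarith) ?_ ?_
    · intro h; rw [h] at hpos; norm_num at hpos
    · intro h; rw [h] at hpos; norm_num at hpos
  · refine vectorCont_eq he.ne' (completedZeta_ne_zero (by rw [hre2]; linarith)) ?_
    have hs : (d : ℝ) / 2 + 1 < (z - d / 2 + 1).re := by rw [hre]; linarith
    simp only [eisSL2_eq_series (s := z - d / 2 + 1) (by linarith)]
    refine modularIntegral_eq_liftRHS hd he hB hs (hED _ ?_) rfl rfl
    rw [show z - d / 2 + 1 + (d : ℂ) / 2 - 1 = z by ring]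
    exact hz

end Lift

end ThetaLift

/-! ### The proposition -/

theorem propositionG2 (d : ℕ) (hd : 2 ≤ d) :
    ∃ σ : ℝ, ∀ (e : Matrix (Fin d) (Fin d) ℝ) (he : 0 < e.det)
      (B : Matrix (Fin d) (Fin d) ℝ) (hB : B.transpose = -B),
      -- absolute convergence of the lattice sum, and of all series and the integral for large `Re s`
      (∀ τ, Summable (latticeTerm (e * e.transpose + B) τ)) ∧
      (∀ s : ℂ, σ < s.re →
        (∀ τ, Summable (eisSL2Term s τ)) ∧
        Summable (eisSOTerm d (s + d / 2 - 1) (hElt e he B hB)) ∧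
        (∀ h' : SpinDD d, spinCover d h' = hElt e he B hB →
          Summable (eisSpinTerm d (s + d / 2 - 1) h')) ∧
        Summable (eisSLTerm d (d - 1) (s + d / 2 - 1) (unimodular e he)) ∧
        Summable (eisSLTerm d 1 s (unimodular e he)) ∧
        MeasureTheory.IntegrableOn
          (fun τ => eisSL2Series s τ * latticeSum (e * e.transpose + B) τ) ModularGroup.fd) ∧
      -- existence of the meromorphic continuations
      (∀ τ, HasMeroCont fun s => eisSL2Series s τ) ∧
      HasMeroCont (fun s => eisSLSeries d (d - 1) s (unimodular e he)) ∧
      HasMeroCont (fun s => eisSLSeries d 1 s (unimodular e he)) ∧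
      MeromorphicOn (fun s => modularIntegral (eisSL2 s) (e * e.transpose + B)) Set.univ ∧
      -- `E_s` is holomorphic at `s = 0` with value `1`
      (∀ τ, AnalyticAt ℂ (fun z => eisSL2 z τ) 0 ∧ eisSL2 0 τ = 1) ∧
      -- the integral converges wherever `E_s` is holomorphic
      (∀ s : ℂ, (∀ τ, AnalyticAt ℂ (fun z => eisSL2 z τ) s) →
        MeasureTheory.IntegrableOn
          (fun τ => eisSL2 s τ * latticeSum (e * e.transpose + B) τ) ModularGroup.fd) ∧
      -- the identity, for the series of `SO(d,d)` and for that of `Spin(d,d)`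
      ∀ ED : ℂ → ℂ,
        (ED = (fun s => eisSOSeries d s (hElt e he B hB)) ∨
          ∃ h' : SpinDD d, spinCover d h' = hElt e he B hB ∧
            ED = fun s => eisSpinSeries d s h') →
        -- for large `Re s`
        (∀ s : ℂ, σ < s.re →
          modularIntegral (eisSL2Series s) (e * e.transpose + B) =
            liftRHS d e.det ED (fun z => eisSLSeries d (d - 1) z (unimodular e he))
              (fun z => eisSLSeries d 1 z (unimodular e he)) s) ∧
        -- as an identity of meromorphic functions on `ℂ`
        HasMeroCont ED ∧
        (fun s => modularIntegral (eisSL2 s) (e * e.transpose + B)) =ᶠ[codiscrete ℂ]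
          liftRHS d e.det (meroCont ED)
            (meroCont fun z => eisSLSeries d (d - 1) z (unimodular e he))
            (meroCont fun z => eisSLSeries d 1 z (unimodular e he)) ∧
        -- at every point where `E_s` is holomorphic
        (∀ s : ℂ, (∀ τ, AnalyticAt ℂ (fun z => eisSL2 z τ) s) →
          Tendsto
            (liftRHS d e.det (meroCont ED)
              (meroCont fun z => eisSLSeries d (d - 1) z (unimodular e he))
              (meroCont fun z => eisSLSeries d 1 z (unimodular e he)))
            (𝓝[≠] s) (𝓝 (modularIntegral (eisSL2 s) (e * e.transpose + B)))) ∧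
        -- the specialisation to `s = 0`, where `E_s = 1`; for `d ≥ 4` every factor is finite there
        (4 ≤ d →
          MeasureTheory.IntegrableOn (latticeSum (e * e.transpose + B)) ModularGroup.fd ∧
          AnalyticAt ℂ (meroCont ED) (d / 2 - 1) ∧
          AnalyticAt ℂ (meroCont fun z => eisSLSeries d (d - 1) z (unimodular e he)) (d / 2 - 1) ∧
          2 * (e.det : ℂ)⁻¹ * completedRiemannZeta (d - 2) * meroCont ED (d / 2 - 1) =
            modularIntegral (fun _ => 1) (e * e.transpose + B)
              + 2 * (e.det : ℂ) ^ (-(2 / d) : ℂ) * completedRiemannZeta (d - 2) *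
                meroCont (fun z => eisSLSeries d (d - 1) z (unimodular e he)) (d / 2 - 1)
              + 2 * completedRiemannZeta 2) := by
  have : Nonempty (Fin d) := ⟨⟨0, by omega⟩⟩
  have hd' : (2 : ℝ) ≤ d := by exact_mod_cast hd
  have hre : ∀ s : ℂ, (s + d / 2 - 1).re = s.re + d / 2 - 1 := fun s => by simp
  -- Re s > d/2 + 1 is equivalent to Re(s + d/2 − 1) > d, where the Epstein sum in 2d variables
  -- converges.
  refine ⟨d / 2 + 1, fun e he B hB => ?_⟩
  have c₁ := continues_eisSLSeries_pred hd he
  have c₂ := continues_eisSLSeries_one hd he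
  refine ⟨fun τ => (summable_norm_latticeTerm he.ne' hB τ).of_norm, fun s hs =>
    ⟨fun τ => (hasSum_eisSL2Term (by linarith) τ).summable,
      (hasSum_eisSOTerm_hElt hd he hB (by rw [hre]; linarith)).summable,
      fun h' hh => (hasSum_eisSpinTerm_hElt hd he hB hh (by rw [hre]; linarith)).summable,
      (hasSum_eisSLTerm_pred hd _ (unimodular_inv_det_ne he) (by rw [hre]; linarith)).summable,
      (hasSum_eisSLTerm_one hd _ (unimodular_det_ne he) (by linarith)).summable, ?_⟩,
    fun τ => (continues_eisSL2 τ).hasMeroCont, c₁.hasMeroCont, c₂.hasMeroCont,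
    meromorphicOn_modularIntegral he.ne' hB, eisSL2_zero,
    fun s hs => integrableOn_eisSL2_mul_latticeSum he.ne' hB hs, fun ED hED => ?_⟩
  · rw [← eisSL2_eq_series (by linarith)]
    exact integrableOn_eisSL2_mul_latticeSum he.ne' hB fun τ =>
      analyticAt_eisSL2 (mem_goodPoints_of_re (by linarith)) τ
  have hED' : ∀ z : ℂ, (d : ℝ) < z.re → ED z = isoSeries e B z := by
    intro z hz
    rcases hED with rfl | ⟨h', hh, rfl⟩
    · exact (hasSum_eisSOTerm_hElt hd he hB hz).tsum_eq
    · exact (hasSum_eisSpinTerm_hElt hd he hB hh hz).tsum_eq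
  have c₀ := continues_vectorCont hd he hB hED'
  have hseries : ∀ s : ℂ, (d : ℝ) / 2 + 1 < s.re →
      modularIntegral (eisSL2Series s) (e * e.transpose + B) =
        liftRHS d e.det ED (fun z => eisSLSeries d (d - 1) z (unimodular e he))
          (fun z => eisSLSeries d 1 z (unimodular e he)) s := fun s hs =>
    modularIntegral_eq_liftRHS hd he hB hs (hED' _ (by rw [hre]; linarith))
      (c₁.eq _ (by rw [hre]; linarith)).symm (c₂.eq _ (by linarith)).symm
  have hJ := meromorphicOn_modularIntegral he.ne' hB
  have hR : MeromorphicOn (liftRHS d e.det (meroCont ED)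
      (meroCont fun z => eisSLSeries d (d - 1) z (unimodular e he))
      (meroCont fun z => eisSLSeries d 1 z (unimodular e he))) Set.univ :=
    meromorphicOn_liftRHS he c₀.meroCont_nf.meromorphicOn c₁.meroCont_nf.meromorphicOn
      c₂.meroCont_nf.meromorphicOn
  have hhalf : ∀ s : ℂ, (d : ℝ) / 2 + 1 < s.re →
      modularIntegral (eisSL2 s) (e * e.transpose + B) = liftRHS d e.det (meroCont ED)
        (meroCont fun z => eisSLSeries d (d - 1) z (unimodular e he))
        (meroCont fun z => eisSLSeries d 1 z (unimodular e he)) s := by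
    intro s hs
    rw [eisSL2_eq_series (by linarith), hseries s hs, liftRHS, liftRHS,
      c₀.meroCont_eq_self (by rw [hre]; linarith), c₁.meroCont_eq_self (by rw [hre]; linarith),
      c₂.meroCont_eq_self (by linarith)]
  refine ⟨hseries, c₀.hasMeroCont, eventuallyEq_codiscrete_of_eq_halfPlane hJ hR hhalf,
    fun s hs => ?_, fun hd4 => ?_⟩
  · have h1 := (analyticAt_modularIntegral_eisSL2 he.ne' hB hs).continuousAt.tendsto
    exact (h1.mono_left nhdsWithin_le_nhds).congr'
      (eventuallyEq_nhdsNE_of_eq_halfPlane hJ hR hhalf s)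
  -- At s = 0 the formula for the β_1 series is a quotient of two functions with poles. It is
  -- replaced by its analytic extension `G₂`, whose value there is 1.
  obtain ⟨G₂, hG₂, hG₂0, hG₂e⟩ := exists_analytic_epsteinEis_zero (unimodular_det_ne he)
  have hd4' : (4 : ℝ) ≤ d := by exact_mod_cast hd4
  have hs0 : (d : ℂ) / 2 - 1 - d / 2 + 1 = 0 := by ring
  have hz2 : 2 * ((d : ℂ) / 2 - 1) = d - 2 := by ring
  -- For d ≥ 4, d − 2 > 1: ξ(d − 2) is finite and nonzero, so the identity can be divided by it at
  -- this point.
  have hzre : 1 < (2 * ((d : ℂ) / 2 - 1)).re := by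
    rw [hz2]
    simp
    linarith
  have hA₁ : AnalyticAt ℂ (epsteinEis ((unimodular e he)⁻¹ : SLR d).1.transpose
      (unimodular_inv_det_ne he)) ((d : ℂ) / 2 - 1) := by
    refine analyticAt_epsteinEis_of_re _ ?_ ?_
    · simp
      linarith
    · rw [Fintype.card_fin]
      intro h
      exact one_ne_zero (sub_eq_self.1 h)
  have hA₀ : AnalyticAt ℂ (vectorCont d e.det
      (fun s => modularIntegral (eisSL2 s) (e * e.transpose + B))
      (epsteinEis ((unimodular e he)⁻¹ : SLR d).1.transpose (unimodular_inv_det_ne he)) G₂)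
      ((d : ℂ) / 2 - 1) := by
    refine analyticAt_vectorCont he ?_ hA₁ ?_ hzre ?_ ?_
    · rw [hs0]
      exact analyticAt_modularIntegral_eisSL2 he.ne' hB fun τ => (eisSL2_zero τ).1
    · rw [hs0]
      exact hG₂
    · rw [hs0]
      norm_num
    · rw [hs0]
      norm_num
  have hcongr : vectorCont d e.det (fun s => modularIntegral (eisSL2 s) (e * e.transpose + B))
      (epsteinEis ((unimodular e he)⁻¹ : SLR d).1.transpose (unimodular_inv_det_ne he))
      (epsteinEis (unimodular e he).1 (unimodular_det_ne he)) =ᶠ[𝓝[≠] ((d : ℂ) / 2 - 1)]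
      vectorCont d e.det (fun s => modularIntegral (eisSL2 s) (e * e.transpose + B))
      (epsteinEis ((unimodular e he)⁻¹ : SLR d).1.transpose (unimodular_inv_det_ne he)) G₂ := by
    have ht : Tendsto (fun z : ℂ => z - d / 2 + 1) (𝓝[≠] ((d : ℂ) / 2 - 1)) (𝓝[≠] 0) := by
      refine tendsto_nhdsWithin_iff.2 ⟨?_, ?_⟩
      · have h1 : ContinuousAt (fun z : ℂ => z - d / 2 + 1) ((d : ℂ) / 2 - 1) := by fun_prop
        have h2 := h1.tendsto
        rw [hs0] at h2
        exact h2.mono_left nhdsWithin_le_nhds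
      · filter_upwards [self_mem_nhdsWithin] with z hz h
        have h' : z - d / 2 + 1 = 0 := h
        exact hz (show z = d / 2 - 1 by linear_combination h')
    filter_upwards [ht.eventually hG₂e] with z hz
    rw [vectorCont, vectorCont, hz]
  refine ⟨integrableOn_latticeSum he.ne' hB, c₀.analyticAt_meroCont hA₀ hcongr,
    c₁.analyticAt_meroCont hA₁ EventuallyEq.rfl, ?_⟩
  rw [(c₀.eventuallyEq_nhds hA₀ hcongr).eq_of_nhds, c₁.meroCont_eq hA₁, vectorCont, hs0, hz2, hG₂0,
    show eisSL2 0 = fun _ => 1 from funext fun τ => (eisSL2_zero τ).2]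
  have hξ := completedZeta_ne_zero hzre
  rw [hz2] at hξ
  have hD : (e.det : ℂ) ≠ 0 := by exact_mod_cast he.ne'
  -- ξ(−1) = ξ(2) by the functional equation; this is the constant term of the final formula.
  have hξ2 : completedRiemannZeta (2 * 0 - 1) = completedRiemannZeta 2 := by
    rw [← completedRiemannZeta_one_sub]
    norm_num
  have hexp : (2 * 0 - 2 : ℂ) / d = -(2 / d) := by ring
  rw [mul_div_cancel₀ _ (by simp [hD, hξ]), hξ2, hexp]
  simp
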